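/- Fix $\nu\in(1/2,1)$ and let $\phi$ be a rotationally symmetric probability density on $\mathbb{R}^2$ that vanishes outside $|x|<1$. For $\epsilon>0$, the range of a point $z\in\sqrt{\epsilon}\,\mathbb{Z}^2$ is the open disk of radius $\epsilon^{3/2-\nu}+\epsilon$ centered at $z$; for $\epsilon$ small enough the closures of these disks are pairwise disjoint. The Markovian Lorentz process $\widetilde T^t_\epsilon(x,v)=(x(t),v(t))\in\mathbb{R}^2\times S^1$ starts at $(x,v)$ and moves as follows. Outside the ranges the particle moves freely, with unit speed. Each time it enters the range of a lattice point $z$ (and at time $0$, if it starts inside that range), a circular obstacle of radius $\epsilon$ with center $z+\epsilon^{3/2-\nu}\xi$ is placed there, where $\xi$ is a new random variable with density $\phi$, independent of all previous ones; the obstacle stays fixed until the particle leaves the range. The particle is reflected specularly when it hits the obstacle from outside, and a particle that starts inside an obstacle leaves it without change of velocity. Let $\bar t>0$ and let $f_0$ be a probability density on $\mathbb{R}^2\times S^1$ with respect to $dx\,dv$, where $dv$ is arc length. Then: (i) For every $\epsilon>0$ with $2(\epsilon^{3/2-\nu}+\epsilon)<\sqrt{\epsilon}$ and every $t\in[0,\bar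 t]$ there is an integrable function $\tilde f_\epsilon(\cdot,\cdot,t)$, unique up to null sets, such that for all bounded continuous $g:\mathbb{R}^2\times S^1\to\mathbb{R}$ $$\int_{\mathbb{R}^2\times S^1}\tilde f_\epsilon(x,v,t)\,g(x,v)\,dx\,dv=\int_{\mathbb{R}^2\times S^1}f_0(x,v)\,\mathbb{E}\big[g(\widetilde T^t_\epsilon(x,v))\big]\,dx\,dv .$$ (ii) There is a function $f\in C([0,\bar t],L^1(\mathbb{R}^2\times S^1))$, with $f(\cdot,\cdot,t)$ a probability density for every $t$ and $f(\cdot,\cdot,0)=f_0$, which solves in the weak sense (tested with compactly supported $C^1$ functions of $(x,v)$) the linear Boltzmann equation $$\partial_t f(x,v,t)+v\cdot\nabla_x f(x,v,t)=-2f(x,v,t)+\int_{\{\omega\in S^1:\ v\cdot\omega<0\}}f(x,v',t)\,|v\cdot\omega|\,d\omega,\qquad v'=v-2(\omega\cdot v)\,\omega ,$$ and such that for every $t\in[0,\bar t]$ the densities $\tilde f_\epsilon(\cdot,\cdot,t)$ converge weakly to $f(\cdot,\cdot,t)$ as $\epsilon\to0$: for all bounded continuous $g$, $$\lim_{\epsilon\to0}\int_{\mathbb{R}^2\times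 S^1}\tilde f_\epsilon(x,v,t)\,g(x,v)\,dx\,dv=\int_{\mathbb{R}^2\times S^1}f(x,v,t)\,g(x,v)\,dx\,dv .$$ -/

import Mathlib

open MeasureTheory ProbabilityTheory Filter Topology
open scoped RealInnerProductSpace BoundedContinuousFunction

namespace LorentzGas

/-- The plane `ℝ²`, with its Euclidean norm. -/
abbrev Plane : Type := EuclideanSpace ℝ (Fin 2)

/-- The circle `S¹` of unit vectors. -/
abbrev Velocity : Type := Metric.sphere (0 : Plane) 1

/-- Phase space `ℝ² × S¹`. -/
abbrev Phase : Type := Plane × Velocity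

/-! ### Measures -/

/-- The unit vector with polar angle `θ`. -/
noncomputable def unitVector (θ : ℝ) : Velocity :=
  ⟨!₂[Real.cos θ, Real.sin θ], by simp [EuclideanSpace.norm_eq]⟩

/-- Arc length `dv` on `S¹` (total mass `2π`). -/
noncomputable def arcLength : Measure Velocity :=
  ((volume : Measure ℝ).restrict (Set.Ico 0 (2 * Real.pi))).map unitVector

/-- The measure `dx dv` on phase space. -/
noncomputable def phaseMeasure : Measure Phase :=
  (volume : Measure Plane).prod arcLength

/-- A probability density with respect to a given measure. -/
structure IsProbDensity {α : Type*} [MeasurableSpace α] (μ : Measure α) (f : α → ℝ) : Prop where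
  integrable : Integrable f μ
  nonneg : 0 ≤ᵐ[μ] f
  integral_eq_one : ∫ z, f z ∂μ = 1

/-! ### Free flight and specular reflection -/

/-- Specular reflection `v - 2 (ω·v) ω` of the velocity `v`, where `ω = n / |n|`. -/
noncomputable def specular (n : Plane) (v : Velocity) : Velocity :=
  ⟨(v : Plane) - (2 * ⟪n, (v : Plane)⟫ / ‖n‖ ^ 2) • n, by
    have hv : ‖(v : Plane)‖ = 1 := by simp
    rw [mem_sphere_zero_iff_norm]
    rcases eq_or_ne n 0 with rfl | hn
    · simp
    · have hn' : ‖n‖ ≠ 0 := norm_ne_zero_iff.mpr hn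
      have h : ‖(v : Plane) - (2 * ⟪n, (v : Plane)⟫ / ‖n‖ ^ 2) • n‖ ^ 2 = 1 := by
        rw [norm_sub_sq_real, norm_smul, inner_smul_right, hv, real_inner_comm,
          mul_pow, Real.norm_eq_abs, sq_abs]
        field_simp
        ring
      nlinarith [norm_nonneg ((v : Plane) - (2 * ⟪n, (v : Plane)⟫ / ‖n‖ ^ 2) • n)]⟩

/-- Free motion during the time `s`. -/
noncomputable def freeFlight (s : ℝ) (z : Phase) : Phase :=
  (z.1 + s • (z.2 : Plane), z.2)

/-- The times `s ≥ 0` at which the free motion from `z` is in the set `A`. -/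
def timesIn (A : Set Plane) (z : Phase) : Set ℝ :=
  {s | 0 ≤ s ∧ (freeFlight s z).1 ∈ A}

/-! ### The Markovian Lorentz process -/

/-- The point `√ε (j, k)` of the lattice `√ε ℤ²`. -/
noncomputable def latticePoint (ε : ℝ) (j k : ℤ) : Plane :=
  Real.sqrt ε • !₂[(j : ℝ), (k : ℝ)]

/-- The point of the lattice `√ε ℤ²` closest to `x`. -/
noncomputable def nearestSite (ε : ℝ) (x : Plane) : Plane :=
  latticePoint ε (round (x 0 / Real.sqrt ε)) (round (x 1 / Real.sqrt ε))

/-- Radius `√ε ε^(1-ν)` of the patch in which the obstacle centre is chosen. -/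
noncomputable def patchRadius (ε ν : ℝ) : ℝ := Real.sqrt ε * ε ^ (1 - ν)

/-- Radius of the obstacle range, the disk covered by all possible positions of an obstacle of
radius `ε` with centre in the patch. -/
noncomputable def rangeRadius (ε ν : ℝ) : ℝ := patchRadius ε ν + ε

/-- The union of all obstacle ranges. -/
def obstacleRanges (ε ν : ℝ) : Set Plane :=
  ⋃ j : ℤ, ⋃ k : ℤ, Metric.ball (latticePoint ε j k) (rangeRadius ε ν)

/-- The particle at `y` meets from outside the obstacle of radius `ε` with centre `c`. A particle
inside the obstacle leaves it freely. -/
def Collides (ε : ℝ) (c : Plane) (y : Phase) : Prop :=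
  ε ≤ dist y.1 c ∧ (timesIn (Metric.ball c ε) y).Nonempty

/-- The time at which the particle at `y` meets the obstacle with centre `c`, if it does. -/
noncomputable def collisionTime (ε : ℝ) (c : Plane) (y : Phase) : ℝ :=
  sInf (timesIn (Metric.ball c ε) y)

/-- Position and velocity just after the collision with the obstacle with centre `c`. -/
noncomputable def afterCollision (ε : ℝ) (c : Plane) (y : Phase) : Phase :=
  let w := freeFlight (collisionTime ε c y) y
  (w.1, specular (w.1 - c) w.2)

open Classical in
/-- The state at time `t` of a particle started at `z`, which at its visits number `0, …, n-1` to
obstacle ranges finds the obstacle centre at relative position `ξ 0, …, ξ (n-1)` (in units of the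
patch radius) from the lattice point of that range, and which moves freely after these visits.
A visit begins on entry into a range, or at time `0` when the particle starts inside a range;
it ends when the particle leaves that range, and during a visit the obstacle does not move. -/
noncomputable def flow (ε ν : ℝ) : ℕ → (ℕ → Plane) → ℝ → Phase → Phase
  | 0, _, t, z => freeFlight t z
  | n + 1, ξ, t, z =>
    -- time, state, lattice point and obstacle centre at the next entry into a range
    let τ := sInf (timesIn (obstacleRanges ε ν) z)
    let y := freeFlight τ z
    let p := nearestSite ε y.1
    let c := p + patchRadius ε ν • ξ 0
    if (timesIn (obstacleRanges ε ν) z).Nonempty ∧ τ ≤ t then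
      -- state from which the particle leaves the range freely, and the time that remains then
      let hit : Prop := Collides ε c y ∧ collisionTime ε c y ≤ t - τ
      let w := if hit then afterCollision ε c y else y
      let t' := if hit then t - τ - collisionTime ε c y else t - τ
      let e := sSup (timesIn (Metric.ball p (rangeRadius ε ν)) w)
      if t' < e then freeFlight t' w
      else flow ε ν n (fun k => ξ (k + 1)) (t' - e) (freeFlight e w)
    else freeFlight t z

/-- The Markovian Lorentz process at time `t`, started at `z`: the obstacle used at the `k`-th
visit to an obstacle range is placed according to `ξ k`. Different ranges are at a distance of at
least `√ε - 2 * rangeRadius ε ν` from each other, so no more than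
`⌈t / (√ε - 2 * rangeRadius ε ν)⌉ + 1` visits begin before or at time `t`. -/
noncomputable def markovLorentz (ε ν : ℝ) (ξ : ℕ → Plane) (t : ℝ) (z : Phase) : Phase :=
  flow ε ν (⌈t / (Real.sqrt ε - 2 * rangeRadius ε ν)⌉₊ + 1) ξ t z

/-- `F` is the density at time `t` transported by the Markovian Lorentz process:
`∫ F g dx dv = ∫ f₀ E[g(T̃ᵗ(x,v))] dx dv` for all bounded continuous `g`. -/
def IsTransported {Ω : Type*} [MeasurableSpace Ω] (P : Measure Ω) (ξ : ℕ → Ω → Plane)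
    (ε ν : ℝ) (f₀ : Phase → ℝ) (t : ℝ) (F : Phase → ℝ) : Prop :=
  Integrable F phaseMeasure ∧
    ∀ g : Phase →ᵇ ℝ,
      ∫ z, F z * g z ∂phaseMeasure =
        ∫ z, f₀ z * (∫ a, g (markovLorentz ε ν (fun k => ξ k a) t z) ∂P) ∂phaseMeasure

/-! ### The linear Boltzmann equation -/

/-- The collision term `-2 f(x,v) + ∫_{v·ω<0} f(x,v') |v·ω| dω` with `v' = v - 2(ω·v)ω`. -/
noncomputable def collisionOperator (f : Phase → ℝ) (z : Phase) : ℝ :=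
  -2 * f z +
    ∫ ω in {ω : Velocity | ⟪(z.2 : Plane), (ω : Plane)⟫ < 0},
      f (z.1, specular (ω : Plane) z.2) * |⟪(z.2 : Plane), (ω : Plane)⟫| ∂arcLength

/-- `f` is a solution in `C([0,T], L¹)`, with initial value `f₀`, of
`∂ₜ f + v·∇ₓ f = -2 f + ∫_{v·ω<0} f(x,v',t) |v·ω| dω`; each `f t` is a probability density, and the
equation holds weakly, tested with the restrictions to phase space of compactly supported `C¹`
functions. -/
structure IsBoltzmannSolution (f₀ : Phase → ℝ) (T : ℝ) (f : ℝ → Phase → ℝ) : Prop where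
  density : ∀ t ∈ Set.Icc 0 T, IsProbDensity phaseMeasure (f t)
  continuous : ∀ t ∈ Set.Icc 0 T,
    Tendsto (fun s => ∫ z, |f s z - f t z| ∂phaseMeasure) (𝓝[Set.Icc 0 T] t) (𝓝 0)
  initial : f 0 =ᵐ[phaseMeasure] f₀
  equation : ∀ ψ : Plane × Plane → ℝ, ContDiff ℝ 1 ψ → HasCompactSupport ψ →
    ∀ t ∈ Set.Icc 0 T,
      ∫ z, f t z * ψ (z.1, z.2) ∂phaseMeasure =
        ∫ z, f₀ z * ψ (z.1, z.2) ∂phaseMeasure +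
          ∫ s in (0 : ℝ)..t, ∫ z,
            (f s z * fderiv ℝ ψ (z.1, z.2) ((z.2 : Plane), 0) +
              collisionOperator (f s) z * ψ (z.1, z.2)) ∂phaseMeasure

end LorentzGas

/-!
A line is described by its coordinates along and across its direction, relative to the centre of an
obstacle. In these coordinates a collision shears the incoming line along itself and rotates it by
an angle that depends on the impact parameter, so it preserves `dx dv` (`deflect`). Within a time
`δ` below the distance `gap ε ν` of the ranges no more than one range is visited; this gives a
one-step map `step`, and expectations of the process at the times `n δ` are the iterates of a
transfer operator `adv` (`refresh_expectation_eq_iterate`). Its state contains the obstacle in the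
current range, averaged over as soon as the particle is outside the ranges.

*Transported densities.* A step maps only null sets to null sets, so the law of the process started
from a density has a density, by the Radon–Nikodym theorem (`exists_isTransported`).

*Short times.* On a free path of length `h` let `N` be the expected number of strikes of fresh
obstacles. The mean of `N` over a lattice cell is `2 h`, the cross section being `2 ε` per cell area
`ε`. Its mean square is a sum over pairs of obstacles. Pairs in one range are negligible: the ratio
`ε ^ (ν - 1 / 2)` of the radii of obstacle and patch tends to `0`, since `ν > 1 / 2`, and thin
strips carry little mass of `φ dx`. The other pairs form a lattice sum, and by averaging over the
directions (`phaseMeasure_strikeSet_inter_le`) it converges to an integral with value `(2 h) ^ 2`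
per unit of mass. So the variance of `N` tends to `0`, and the same holds for strikes with impact
parameter in a given set: the number of strikes obeys a law of large numbers, for which neither a
regularity nor the symmetry of `φ` is needed. The outcome of two or more collisions is controlled by
the mean square of `N` (`lintegral_moreCollisions_le`), hence is of order `h ^ 2`. By `ν < 1` the
ranges cover a vanishing part of the plane. Hence the process acts on a test function `ψ` during the
time `h` as `shortTime h ψ`, free flight plus `h` times the scattering operator, up to an `L¹` error
of order `h ^ 2` (`eventually_lintegral_adv_sub_shortTime_le`).

*Iteration.* The transfer operator does not increase the `L¹` norm over the states outside the
obstacles (`setLIntegral_adv_le`). For a bounded initial density with bounded support the errors of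
the `t / h` short time intervals therefore add up to order `h`
(`eventually_abs_integral_sub_iterate_le`).

*The Boltzmann equation.* Its solution is `exp (-2 t)` times the series over the number of
collisions, `dysonSum`. Duhamel's formula gives conservation of mass, continuity in `L¹`, the weak
form of the equation, and the comparison with the same iterate of `shortTime h`
(`abs_integral_boltzmann_sub_iterate_le`). Letting `ε → 0` and then `h → 0` proves convergence for
Lipschitz test functions with bounded support. General initial densities are approximated in `L¹`;
bounded continuous test functions are reached since the limit has total mass `1`, so that no mass
escapes to infinity (`tendsto_of_forall_isTest`).
-/

noncomputable section

namespace LorentzGas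

open ENNReal (ofReal ofReal_mul ofReal_add ofReal_ne_top ofReal_le_ofReal
  mul_ne_top tsum_le_tsum toReal_nonneg toReal_ofReal)
open Set (Ioo Ioc univ indicator_of_mem indicator_of_notMem mem_ofPred_eq Icc mem_preimage)
open Real (exp cos sin sqrt_pos norm_eq_abs volume_Ioo)
open Function (iterate_succ_apply')
open scoped Real

/-- The measure `dx dv` on phase space. -/
local notation "𝔪" => phaseMeasure

/-- The measure `dx dv` times a law of the relative position of the obstacle at hand. -/
local notation:max "𝔪×" μ:max => Measure.prod phaseMeasure μ

/-- The law of an independent sequence with the common law `μ`. -/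
local notation:max "𝔭" μ:max => Measure.infinitePi fun _ : ℕ => μ

/-- The integral of a function on phase space. -/
local notation:max "∫𝔪" F:max => ∫⁻ z, F z ∂phaseMeasure

variable {ε ν δ ρ a b r s t h C A L : ℝ} {x y c : Plane} {z : Phase} {p q : ℤ × ℤ}

/-! ### Planar geometry and moving frames -/

/-- The vector `w` turned by a right angle. -/
def perp (w : Plane) : Plane := !₂[-w 1, w 0]

@[simp] lemma perp_zero_coord (w) : perp w 0 = -w 1 := rfl
@[simp] lemma perp_one_coord (w) : perp w 1 = w 0 := rfl

lemma inner_eq (x y : Plane) : ⟪x, y⟫ = x 0 * y 0 + x 1 * y 1 := by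
  simp [PiLp.inner_apply, Fin.sum_univ_two, mul_comm]

lemma norm_sq_eq (x : Plane) : ‖x‖ ^ 2 = x 0 ^ 2 + x 1 ^ 2 := by
  simp [EuclideanSpace.norm_sq_eq, Fin.sum_univ_two]

lemma plane_ext (h0 : x 0 = y 0) (h1 : x 1 = y 1) : x = y := by ext i; fin_cases i <;> assumption

lemma velocity_sq (v : Velocity) : (v : Plane) 0 ^ 2 + (v : Plane) 1 ^ 2 = 1 := by
  have h : ‖(v : Plane)‖ = 1 := by simp
  rw [← norm_sq_eq, h]; norm_num

/-- Rotation of the plane by the angle `α`. -/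
def rot (α : ℝ) (w : Plane) : Plane := cos α • w + sin α • perp w

lemma rot_zero_coord (α w) : rot α w 0 = cos α * w 0 - sin α * w 1 := by simp [rot]; ring
lemma rot_one_coord (α w) : rot α w 1 = cos α * w 1 + sin α * w 0 := by simp [rot]

lemma norm_rot (α : ℝ) (w : Plane) : ‖rot α w‖ = ‖w‖ := by
  have h : ‖rot α w‖ ^ 2 = ‖w‖ ^ 2 := by
    rw [norm_sq_eq, norm_sq_eq, rot_zero_coord, rot_one_coord]
    nlinarith [Real.sin_sq_add_cos_sq α, sq_nonneg (w 0), sq_nonneg (w 1)]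
  exact (sq_eq_sq₀ (norm_nonneg _) (norm_nonneg _)).1 h

/-- Rotation of a velocity by the angle `α`. -/
def rotVel (α : ℝ) (v : Velocity) : Velocity :=
  ⟨rot α v, by rw [mem_sphere_zero_iff_norm, norm_rot]; simp⟩

@[simp] lemma rotVel_coe (α v) : (rotVel α v : Plane) = rot α v := rfl

lemma rot_rot (α β w) : rot α (rot β w) = rot (α + β) w := by
  apply plane_ext <;> (simp only [rot_zero_coord, rot_one_coord, Real.cos_add, Real.sin_add]; ring)

lemma rotVel_rotVel (α β v) : rotVel α (rotVel β v) = rotVel (α + β) v :=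
  Subtype.ext (rot_rot α β v)

lemma rotVel_two_pi (v) : rotVel (2 * π) v = v := by apply Subtype.ext; simp [rot]

lemma unitVector_add (α θ) : rotVel α (unitVector θ) = unitVector (α + θ) := by
  apply Subtype.ext
  apply plane_ext <;>
    simp [rot_zero_coord, rot_one_coord, unitVector, Real.cos_add, Real.sin_add] <;> ring

@[fun_prop] lemma continuous_perp : Continuous perp := by
  unfold perp
  fun_prop

@[fun_prop] lemma continuous_rot : Continuous fun p : ℝ × Plane => rot p.1 p.2 := by
  unfold rot
  have := continuous_perp
  fun_prop

@[fun_prop] lemma continuous_rotVel : Continuous fun p : ℝ × Velocity => rotVel p.1 p.2 := by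
  have h := continuous_rot.comp (f := fun p : ℝ × Velocity => (p.1, (p.2 : Plane))) (by fun_prop)
  exact h.subtype_mk _

@[fun_prop] lemma continuous_unitVector : Continuous unitVector := by
  exact Continuous.subtype_mk (by fun_prop) _

lemma rot_sub (α w w') : rot α w - rot α w' = rot α (w - w') := by
  apply plane_ext <;> simp [rot_zero_coord, rot_one_coord] <;> ring

lemma dist_rotVel (α v w) : dist (rotVel α v) (rotVel α w) = dist v w := by
  rw [Subtype.dist_eq, Subtype.dist_eq, dist_eq_norm, dist_eq_norm, rotVel_coe, rotVel_coe,
    rot_sub, norm_rot]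

lemma dist_rotVel_le (α β : ℝ) (v : Velocity) : dist (rotVel α v) (rotVel β v) ≤ |α - β| := by
  have key : ‖rot α (v : Plane) - rot β v‖ ^ 2 ≤ |α - β| ^ 2 := by
    rw [norm_sq_eq, sq_abs]
    simp only [PiLp.sub_apply, rot_zero_coord, rot_one_coord]
    have h2 := Real.cos_sub α β
    have h3 := Real.one_sub_sq_div_two_le_cos (x := α - β)
    have h4 := Real.sin_sq_add_cos_sq α
    have h5 := Real.sin_sq_add_cos_sq β
    set a := (v : Plane) 0
    set b := (v : Plane) 1
    have : (cos α * a - sin α * b - (cos β * a - sin β * b)) ^ 2 +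
        (cos α * b + sin α * a - (cos β * b + sin β * a)) ^ 2 =
        ((sin α ^ 2 + cos α ^ 2) + (sin β ^ 2 + cos β ^ 2) -
          2 * (cos α * cos β + sin α * sin β)) * (a ^ 2 + b ^ 2) := by ring
    rw [this, (velocity_sq v), h4, h5, ← h2]
    linarith
  have := (sq_le_sq₀ (norm_nonneg _) (abs_nonneg _)).1 key
  rwa [Subtype.dist_eq, dist_eq_norm]

/-! ### Arc length and measure-preserving maps of phase space -/

instance : IsFiniteMeasure arcLength := by
  unfold arcLength
  infer_instance

lemma lintegral_arcLength {F : Velocity → ENNReal} (hF : Measurable F) :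
    ∫⁻ v, F v ∂arcLength = ∫⁻ θ in Set.Ico 0 (2 * π), F (unitVector θ) := by
  rw [arcLength, lintegral_map hF continuous_unitVector.measurable]

lemma unitVector_periodic : Function.Periodic unitVector (2 * π) := by
  intro θ
  apply Subtype.ext; apply plane_ext <;> simp [unitVector]

lemma lintegral_periodic {F : ℝ → ENNReal} (hF : Function.Periodic F (2 * π)) (a b) :
    ∫⁻ θ in Ioc a (a + 2 * π), F θ = ∫⁻ θ in Ioc b (b + 2 * π), F θ := by
  have h := (isAddFundamentalDomain_Ioc Real.two_pi_pos a).setLIntegral_eq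
    (isAddFundamentalDomain_Ioc Real.two_pi_pos b) F ?_
  · exact h
  · rintro ⟨g, hg⟩ x
    obtain ⟨n, rfl⟩ := AddSubgroup.mem_zmultiples_iff.1 hg
    have := hF.int_mul n x
    simpa [AddSubgroup.vadd_def, add_comm, zsmul_eq_mul] using this

lemma lintegral_arcLength_Ioc {F : Velocity → ENNReal} (hF : Measurable F) (a) :
    ∫⁻ v, F v ∂arcLength = ∫⁻ θ in Ioc a (a + 2 * π), F (unitVector θ) := by
  rw [lintegral_arcLength hF, restrict_Ico_eq_restrict_Ioc, ← lintegral_periodic _ 0 a, zero_add]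
  intro θ
  simp only [unitVector_periodic θ]

lemma arcLength_univ : arcLength univ = ofReal (2 * π) := by
  rw [arcLength, Measure.map_apply continuous_unitVector.measurable MeasurableSet.univ]
  simp

lemma measurePreserving_rotVel (α) : MeasurePreserving (rotVel α) arcLength arcLength := by
  have hm : Measurable (rotVel α) := by fun_prop
  refine ⟨hm, ?_⟩
  refine Measure.ext_of_lintegral _ fun F hF => ?_
  rw [lintegral_map hF hm, lintegral_arcLength_Ioc (F := fun v => F (rotVel α v)) (hF.comp hm) 0,
    lintegral_arcLength_Ioc hF α]
  simp only [unitVector_add]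
  rw [← ((measurePreserving_add_left (volume : Measure ℝ) α).setLIntegral_comp_preimage_emb
    (measurableEmbedding_addLeft α) (fun θ => F (unitVector θ)) (Ioc α (α + 2 * π)))]
  congr 2
  ext x; simp

instance : SFinite 𝔪 := by unfold phaseMeasure; infer_instance
instance : SigmaFinite 𝔪 := by unfold phaseMeasure; infer_instance

/-- A measure-preserving map in each fibre over the velocity preserves `dx dv`. -/
lemma measurePreserving_fibre {X : Type*} [MeasurableSpace X] {ρ : Measure X} [SFinite ρ]
    {G : X × Velocity → Plane} (hG : Measurable G)
    (h : ∀ v, MeasurePreserving (fun x => G (x, v)) ρ volume) :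
    MeasurePreserving (fun p : X × Velocity => (G p, p.2)) (ρ.prod arcLength) 𝔪 := by
  have h1 := (MeasurePreserving.id arcLength).skew_product (g := fun v x => G (x, v))
      (by fun_prop) (.of_forall fun v => (h v).map_eq)
  exact Measure.measurePreserving_swap.comp (h1.comp Measure.measurePreserving_swap)

lemma measurable_vel : Measurable fun v : Velocity => (v : Plane) := by fun_prop

lemma measurePreserving_freeFlight (s) : MeasurePreserving (freeFlight s) 𝔪 𝔪 := by
  refine measurePreserving_fibre ?_ ?_
  · fun_prop
  · intro v
    exact measurePreserving_add_right volume (s • (v : Plane))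

@[fun_prop] lemma continuous_freeFlight : Continuous fun p : ℝ × Phase => freeFlight p.1 p.2 := by
  unfold freeFlight
  fun_prop

lemma freeFlight_add (s t z) : freeFlight s (freeFlight t z) = freeFlight (t + s) z := by
  simp [freeFlight, add_smul, add_assoc]

@[simp] lemma freeFlight_zero (z) : freeFlight 0 z = z := by simp [freeFlight]
@[simp] lemma freeFlight_snd (s z) : (freeFlight s z).2 = z.2 := rfl
lemma freeFlight_fst (s z) : (freeFlight s z).1 = z.1 + s • (z.2 : Plane) := rfl

/-- The phase point with velocity `v` whose position has coordinates `a` along `v` and `b` across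
`v`, relative to the centre `c`. -/
def frame (c : Plane) (p : (ℝ × ℝ) × Velocity) : Phase :=
  (c + (p.1.1 • (p.2 : Plane) + p.1.2 • perp p.2), p.2)

/-- The linear isometry that sends the standard frame to the frame of `v`. -/
def frameIsometry (v : Velocity) : Plane →ₗᵢ[ℝ] Plane where
  toFun w := w 0 • (v : Plane) + w 1 • perp v
  map_add' w w' := by apply plane_ext <;> simp <;> ring
  map_smul' c w := by apply plane_ext <;> simp <;> ring
  norm_map' w := by
    have h : ‖w 0 • (v : Plane) + w 1 • perp v‖ ^ 2 = ‖w‖ ^ 2 := by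
      rw [norm_sq_eq, norm_sq_eq]
      have := velocity_sq v
      simp
      linear_combination (w 0 ^ 2 + w 1 ^ 2) * this
    exact (sq_eq_sq₀ (norm_nonneg _) (norm_nonneg _)).1 h

lemma measurePreserving_frameIsometry (v) : MeasurePreserving (frameIsometry v) volume volume :=
  ((frameIsometry v).toLinearIsometryEquiv rfl).measurePreserving

lemma measurePreserving_coords :
    MeasurePreserving (fun p : ℝ × ℝ => (!₂[p.1, p.2] : Plane)) volume volume := by
  have heq : (fun p : ℝ × ℝ => (!₂[p.1, p.2] : Plane)) =
      (MeasurableEquiv.toLp 2 (Fin 2 → ℝ)).symm.symm ∘ MeasurableEquiv.finTwoArrow.symm := by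
    funext p
    apply plane_ext <;> simp [MeasurableEquiv.finTwoArrow]
  rw [heq]
  exact (EuclideanSpace.volume_preserving_symm_measurableEquiv_toLp (Fin 2)).symm.comp
    (volume_preserving_finTwoArrow ℝ).symm

lemma measurePreserving_frame (c) :
    MeasurePreserving (frame c) ((volume : Measure (ℝ × ℝ)).prod arcLength) 𝔪 := by
  refine measurePreserving_fibre
    (G := fun p : (ℝ × ℝ) × Velocity => c + (p.1.1 • (p.2 : Plane) + p.1.2 • perp p.2)) ?_ ?_
  · fun_prop
  · intro v
    exact (measurePreserving_add_left (volume : Measure Plane) c).comp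
      ((measurePreserving_frameIsometry v).comp measurePreserving_coords)

/-- Coordinate of the particle along its velocity, relative to `c`. -/
def lon (c : Plane) (z : Phase) : ℝ := ⟪z.1 - c, (z.2 : Plane)⟫
/-- Coordinate of the particle across its velocity, relative to `c`. -/
def tra (c : Plane) (z : Phase) : ℝ := ⟪z.1 - c, perp z.2⟫

@[fun_prop]
lemma continuous_lon : Continuous fun p : Plane × Phase => lon p.1 p.2 := by unfold lon; fun_prop
@[fun_prop] lemma continuous_tra : Continuous fun p : Plane × Phase => tra p.1 p.2 := by
  unfold tra; have := continuous_perp; fun_prop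

@[simp] lemma lon_frame (c : Plane) (p : (ℝ × ℝ) × Velocity) : lon c (frame c p) = p.1.1 := by
  have := velocity_sq p.2
  simp [lon, frame, inner_eq]
  linear_combination p.1.1 * this
@[simp] lemma tra_frame (c : Plane) (p : (ℝ × ℝ) × Velocity) : tra c (frame c p) = p.1.2 := by
  have := velocity_sq p.2
  simp [tra, frame, inner_eq]
  linear_combination p.1.2 * this

lemma frame_lon_tra (c : Plane) (z : Phase) : frame c ((lon c z, tra c z), z.2) = z := by
  have := velocity_sq z.2
  refine Prod.ext (plane_ext ?_ ?_) rfl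
  · simp [frame, lon, tra, inner_eq]
    linear_combination (z.1 0 - c 0) * this
  · simp [frame, lon, tra, inner_eq]
    linear_combination (z.1 1 - c 1) * this

lemma lon_freeFlight (c : Plane) (s : ℝ) (z : Phase) : lon c (freeFlight s z) = lon c z + s := by
  have := velocity_sq z.2
  simp [lon, freeFlight, inner_eq]
  linear_combination s * this
lemma tra_freeFlight (c : Plane) (s : ℝ) (z : Phase) : tra c (freeFlight s z) = tra c z := by
  simp [tra, freeFlight, inner_eq]
  ring

lemma dist_sq (c : Plane) (z : Phase) : dist z.1 c ^ 2 = lon c z ^ 2 + tra c z ^ 2 := by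
  have := velocity_sq z.2
  rw [dist_eq_norm, norm_sq_eq]
  simp [lon, tra, inner_eq]
  linear_combination (-((z.1 0 - c 0) ^ 2 + (z.1 1 - c 1) ^ 2)) * this

lemma lon_sub (c d : Plane) (z : Phase) : lon (c + d) z = lon c z - ⟪d, (z.2 : Plane)⟫ := by
  simp [lon, inner_eq]; ring
lemma tra_sub (c d : Plane) (z : Phase) : tra (c + d) z = tra c z - ⟪d, perp z.2⟫ := by
  simp [tra, inner_eq]; ring

/-! ### Scattering by one disk as a measure-preserving map of lines -/

/-- Half the chord cut out of the disk with radius `ρ` and centre `c` by the line of `z`. -/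
def halfChord (ρ : ℝ) (c : Plane) (z : Phase) : ℝ := √(ρ ^ 2 - tra c z ^ 2)

/-- The time at which the line of `z` enters the disk (it may be negative). -/
def entryTime (ρ : ℝ) (c : Plane) (z : Phase) : ℝ := -lon c z - halfChord ρ c z
/-- The time at which the line of `z` leaves the disk (it may be negative). -/
def leaveTime (ρ : ℝ) (c : Plane) (z : Phase) : ℝ := -lon c z + halfChord ρ c z

/-- The line of `z` enters the obstacle during the time interval `[0, h]`. -/
def Strikes (ε : ℝ) (c : Plane) (h : ℝ) (z : Phase) : Prop :=
  |tra c z| < ε ∧ 0 ≤ entryTime ε c z ∧ entryTime ε c z ≤ h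

/-- Deflection angle for the impact parameter `σ ∈ (-1, 1)`, in units of the radius. -/
def turn (σ : ℝ) : ℝ := π - 2 * Real.arcsin σ

/-- The outgoing line of a particle with incoming line `z`, parametrized such that the position at
time `s` after the collision is `freeFlight s (deflect ε c z)`. In the frame of the obstacle this is
a shear along the line followed by a rotation by an angle that depends on the impact parameter. -/
def deflect (ε : ℝ) (c : Plane) (z : Phase) : Phase :=
  frame c ((lon c z + 2 * halfChord ε c z, tra c z), rotVel (turn (tra c z / ε)) z.2)

lemma measurable_turn : Measurable turn :=
  (measurable_const.sub (Real.continuous_arcsin.measurable.const_mul 2))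

@[fun_prop] lemma continuous_turn : Continuous turn := continuous_const.sub (by fun_prop)

@[fun_prop]
lemma continuous_halfChord (ρ) : Continuous fun p : Plane × Phase => halfChord ρ p.1 p.2 := by
  have := continuous_tra
  unfold halfChord
  fun_prop

@[fun_prop]
lemma continuous_entryTime (ρ) : Continuous fun p : Plane × Phase => entryTime ρ p.1 p.2 :=
  continuous_lon.neg.sub (by fun_prop)

@[fun_prop]
lemma continuous_leaveTime (ρ) : Continuous fun p : Plane × Phase => leaveTime ρ p.1 p.2 :=
  continuous_lon.neg.add (by fun_prop)

@[fun_prop]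
lemma continuous_deflect (ε) : Continuous fun p : Plane × Phase => deflect ε p.1 p.2 := by
  have h2 := continuous_tra
  have h3 := continuous_halfChord ε
  have h4 := continuous_rotVel
  have h5 := continuous_turn
  have h6 := continuous_perp
  unfold deflect frame
  have h7 := h4.comp (f := fun p : Plane × Phase => (turn (tra p.1 p.2 / ε), p.2.2)) (by fun_prop)
  have h8 := continuous_subtype_val.comp h7
  refine Continuous.prodMk (continuous_fst.add ?_) h7
  fun_prop

lemma measurePreserving_frameTwist (ε) : MeasurePreserving (fun p : (ℝ × ℝ) × Velocity =>
      ((p.1.1 + 2 * √(ε ^ 2 - p.1.2 ^ 2), p.1.2), rotVel (turn (p.1.2 / ε)) p.2))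
      ((volume : Measure (ℝ × ℝ)).prod arcLength) ((volume : Measure (ℝ × ℝ)).prod arcLength) := by
  have hsh : MeasurePreserving (fun w : ℝ × ℝ => (w.1 + 2 * √(ε ^ 2 - w.2 ^ 2), w.2))
      volume volume := by
    have h1 := (MeasurePreserving.id (volume : Measure ℝ)).skew_product
        (g := fun b a => a + 2 * √(ε ^ 2 - b ^ 2)) (by unfold Function.uncurry; fun_prop)
        (.of_forall fun b => (measurePreserving_add_right volume _).map_eq)
    exact Measure.measurePreserving_swap.comp (h1.comp Measure.measurePreserving_swap)
  refine hsh.skew_product (g := fun w v => rotVel (turn (w.2 / ε)) v) ?_ ?_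
  · fun_prop
  · exact Eventually.of_forall fun w => (measurePreserving_rotVel _).map_eq

lemma deflect_frame (ε c) (p : (ℝ × ℝ) × Velocity) : deflect ε c (frame c p) =
      frame c ((p.1.1 + 2 * √(ε ^ 2 - p.1.2 ^ 2), p.1.2), rotVel (turn (p.1.2 / ε)) p.2) := by
  simp only [deflect, halfChord, lon_frame, tra_frame]
  rfl

lemma measurePreserving_deflect (ε c) : MeasurePreserving (deflect ε c) 𝔪 𝔪 := by
  have hm : Measurable (deflect ε c) := by fun_prop
  refine ⟨hm, ?_⟩
  have hf := measurePreserving_frame c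
  conv_lhs => rw [← hf.map_eq]
  rw [Measure.map_map hm hf.measurable, ← (hf.comp (measurePreserving_frameTwist ε)).map_eq]
  congr 1
  funext p
  exact deflect_frame ε c p

lemma lon_deflect (ε c z) :
    lon c (deflect ε c z) = lon c z + 2 * halfChord ε c z := by simp [deflect]
lemma tra_deflect (ε c z) : tra c (deflect ε c z) = tra c z := by simp [deflect]

lemma halfChord_freeFlight (ρ c s z) : halfChord ρ c (freeFlight s z) = halfChord ρ c z := by
  simp [halfChord, tra_freeFlight]

lemma entryTime_freeFlight (ρ c s z) : entryTime ρ c (freeFlight s z) = entryTime ρ c z - s := by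
  simp [entryTime, halfChord_freeFlight, lon_freeFlight]; ring

lemma leaveTime_freeFlight (ρ c s z) : leaveTime ρ c (freeFlight s z) = leaveTime ρ c z - s := by
  simp [leaveTime, halfChord_freeFlight, lon_freeFlight]; ring

lemma freeFlight_frame (c s) (p : (ℝ × ℝ) × Velocity) :
    freeFlight s (frame c p) = frame c ((p.1.1 + s, p.1.2), p.2) := by
  refine Prod.ext (plane_ext ?_ ?_) rfl <;> simp [freeFlight, frame] <;> ring

lemma deflect_freeFlight (ε c s z) :
    deflect ε c (freeFlight s z) = freeFlight s (deflect ε c z) := by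
  simp only [deflect, freeFlight_frame, lon_freeFlight, tra_freeFlight, halfChord_freeFlight,
    freeFlight_snd]
  congr 3
  ring

lemma halfChord_nonneg (ρ c z) : 0 ≤ halfChord ρ c z := Real.sqrt_nonneg _

lemma halfChord_pos (h : |tra c z| < ρ) : 0 < halfChord ρ c z :=
  sqrt_pos.2 (sub_pos.2 (sq_lt_sq' (by linarith [(abs_lt.1 h).1]) (abs_lt.1 h).2))

lemma halfChord_sq (h : |tra c z| ≤ ρ) : halfChord ρ c z ^ 2 = ρ ^ 2 - tra c z ^ 2 :=
  Real.sq_sqrt (sub_nonneg.2 (sq_le_sq' (by linarith [(abs_le.1 h).1]) (abs_le.1 h).2))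

lemma halfChord_le (hρ : 0 ≤ ρ) (c z) : halfChord ρ c z ≤ ρ := by
  rw [halfChord, Real.sqrt_le_left hρ]
  nlinarith [sq_nonneg (tra c z)]

lemma mem_ball_freeFlight (hρ : 0 < ρ) (c s z) : (freeFlight s z).1 ∈ Metric.ball c ρ ↔
      |tra c z| < ρ ∧ entryTime ρ c z < s ∧ s < leaveTime ρ c z := by
  rw [Metric.mem_ball, ← sq_lt_sq₀ dist_nonneg hρ.le, dist_sq, lon_freeFlight, tra_freeFlight]
  constructor
  · intro h
    have h1 : |tra c z| < ρ := by
      apply abs_lt_of_sq_lt_sq _ hρ.le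
      nlinarith [sq_nonneg (lon c z + s)]
    have h2 := halfChord_sq h1.le
    have h3 : |lon c z + s| < halfChord ρ c z :=
      abs_lt_of_sq_lt_sq (by linarith) (halfChord_nonneg _ _ _)
    rw [abs_lt] at h3
    unfold entryTime leaveTime
    exact ⟨h1, by linarith, by linarith⟩
  · rintro ⟨h1, h2, h3⟩
    have h4 := halfChord_sq h1.le
    unfold entryTime at h2
    unfold leaveTime at h3
    nlinarith

lemma timesIn_ball (hρ : 0 < ρ) (c z) : timesIn (Metric.ball c ρ) z =
      {s | |tra c z| < ρ ∧ 0 ≤ s ∧ entryTime ρ c z < s ∧ s < leaveTime ρ c z} := by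
  ext s
  simp only [timesIn, mem_ofPred_eq, mem_ball_freeFlight hρ]
  tauto

lemma timesIn_ball_nonempty (hρ : 0 < ρ) (c z) :
    (timesIn (Metric.ball c ρ) z).Nonempty ↔ |tra c z| < ρ ∧ 0 < leaveTime ρ c z := by
  rw [timesIn_ball hρ]
  constructor
  · rintro ⟨s, h1, h2, h3, h4⟩
    exact ⟨h1, by linarith⟩
  · rintro ⟨h1, h2⟩
    have := halfChord_pos h1
    have h5 : max 0 (entryTime ρ c z) < leaveTime ρ c z :=
      max_lt h2 (by unfold entryTime leaveTime; linarith)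
    obtain ⟨s, hs1, hs2⟩ := exists_between h5
    exact ⟨s, h1, (le_max_left _ _).trans hs1.le, (le_max_right _ _).trans_lt hs1, hs2⟩

lemma sInf_timesIn_ball (hρ : 0 < ρ) (h : |tra c z| < ρ) (h' : 0 < leaveTime ρ c z) :
    sInf (timesIn (Metric.ball c ρ) z) = max 0 (entryTime ρ c z) := by
  have := halfChord_pos h
  have h5 : max 0 (entryTime ρ c z) < leaveTime ρ c z :=
      max_lt h' (by unfold entryTime leaveTime; linarith)
  apply le_antisymm
  · apply le_of_forall_gt_imp_ge_of_dense
    intro b hb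
    obtain ⟨s, hs1, hs2⟩ := exists_between (lt_min hb h5)
    refine (csInf_le ⟨0, fun s hs => hs.1⟩ (?_ : s ∈ _)).trans (hs2.le.trans (min_le_left _ _))
    rw [timesIn_ball hρ]
    exact ⟨h, (le_max_left _ _).trans hs1.le, (le_max_right _ _).trans_lt hs1,
      hs2.trans_le (min_le_right _ _)⟩
  · refine le_csInf ((timesIn_ball_nonempty hρ c z).2 ⟨h, h'⟩) fun s hs => ?_
    rw [timesIn_ball hρ] at hs
    exact max_le hs.2.1 hs.2.2.1.le

lemma sSup_timesIn_ball (hρ : 0 < ρ) (h : |tra c z| < ρ) (h' : 0 < leaveTime ρ c z) :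
    sSup (timesIn (Metric.ball c ρ) z) = leaveTime ρ c z := by
  have := halfChord_pos h
  have h5 : max 0 (entryTime ρ c z) < leaveTime ρ c z :=
      max_lt h' (by unfold entryTime leaveTime; linarith)
  apply le_antisymm
  · refine csSup_le ((timesIn_ball_nonempty hρ c z).2 ⟨h, h'⟩) fun s hs => ?_
    rw [timesIn_ball hρ] at hs
    exact hs.2.2.2.le
  · apply le_of_forall_lt_imp_le_of_dense
    intro b hb
    obtain ⟨s, hs1, hs2⟩ := exists_between (max_lt hb h5)
    refine ((le_max_left _ _).trans hs1.le).trans (le_csSup ⟨leaveTime ρ c z, fun s hs => ?_⟩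
      (?_ : s ∈ _))
    · rw [timesIn_ball hρ] at hs
      exact hs.2.2.2.le
    · rw [timesIn_ball hρ]
      exact ⟨h, (le_max_left _ _).trans ((le_max_right _ _).trans hs1.le),
        (le_max_right _ _).trans_lt ((le_max_right _ _).trans_lt hs1), hs2⟩

/-- Collision from outside, in terms of the line of the particle. -/
lemma collides_iff (hε : 0 < ε) (c z) : Collides ε c z ↔ |tra c z| < ε ∧ 0 ≤ entryTime ε c z := by
  rw [Collides, timesIn_ball_nonempty hε]
  constructor
  · rintro ⟨h1, h2, h3⟩
    refine ⟨h2, ?_⟩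
    by_contra h4
    push Not at h4
    have := (mem_ball_freeFlight hε c 0 z).2 ⟨h2, h4, h3⟩
    rw [freeFlight_zero, Metric.mem_ball] at this
    linarith
  · rintro ⟨h1, h2⟩
    have := halfChord_pos h1
    refine ⟨?_, h1, by unfold entryTime at h2; unfold leaveTime; linarith⟩
    by_contra h4
    push Not at h4
    linarith [((mem_ball_freeFlight hε c 0 z).1 (by simpa using h4)).2.1]

lemma collisionTime_eq (hε : 0 < ε) (h : |tra c z| < ε)
    (h' : 0 ≤ entryTime ε c z) : collisionTime ε c z = entryTime ε c z := by
  have := halfChord_pos h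
  rw [collisionTime, sInf_timesIn_ball hε h (by unfold entryTime at h'; unfold leaveTime; linarith),
    max_eq_right h']

lemma collides_and_le_iff (hε : 0 < ε) (c z t) :
    Collides ε c z ∧ collisionTime ε c z ≤ t ↔ Strikes ε c t z := by
  rw [collides_iff hε]
  constructor
  · rintro ⟨⟨h1, h2⟩, h3⟩
    rw [collisionTime_eq hε h1 h2] at h3
    exact ⟨h1, h2, h3⟩
  · rintro ⟨h1, h2, h3⟩
    refine ⟨⟨h1, h2⟩, ?_⟩
    rwa [collisionTime_eq hε h1 h2]

lemma cos_turn {σ : ℝ} (h1 : -1 ≤ σ) (h2 : σ ≤ 1) : cos (turn σ) = 2 * σ ^ 2 - 1 := by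
  rw [turn, Real.cos_pi_sub, Real.cos_two_mul, Real.cos_arcsin, Real.sq_sqrt (by nlinarith)]
  ring

lemma sin_turn {σ : ℝ} (h1 : -1 ≤ σ) (h2 : σ ≤ 1) : sin (turn σ) = 2 * σ * √(1 - σ ^ 2) := by
  rw [turn, Real.sin_pi_sub, Real.sin_two_mul, Real.cos_arcsin, Real.sin_arcsin h1 h2]

/-- Specular reflection at the boundary of a disk is the rotation by the deflection angle. -/
lemma specular_eq_rotVel (hε : 0 < ε) (hb : |b| ≤ ε) (v : Velocity) :
    specular ((-√(ε ^ 2 - b ^ 2)) • (v : Plane) + b • perp v) v = rotVel (turn (b / ε)) v := by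
  have hv := velocity_sq v
  have hb' := abs_le.1 hb
  have h1 : -1 ≤ b / ε := by rw [le_div_iff₀ hε]; linarith
  have h2 : b / ε ≤ 1 := by rw [div_le_iff₀ hε]; linarith
  have hq : √(1 - (b / ε) ^ 2) = √(ε ^ 2 - b ^ 2) / ε := by
    rw [← Real.sqrt_sq hε.le, ← Real.sqrt_div' _ (sq_nonneg ε), Real.sqrt_sq hε.le]
    congr 1; field_simp
  have hs : √(ε ^ 2 - b ^ 2) ^ 2 = ε ^ 2 - b ^ 2 := Real.sq_sqrt (by nlinarith)
  set s := √(ε ^ 2 - b ^ 2)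
  have hn : ‖(-s) • (v : Plane) + b • perp v‖ ^ 2 = ε ^ 2 := by
    rw [norm_sq_eq]; simp
    linear_combination (s ^ 2 + b ^ 2) * hv + hs
  have hi : ⟪(-s) • (v : Plane) + b • perp v, (v : Plane)⟫ = -s := by
    simp [inner_eq]
    linear_combination (-s) * hv
  apply Subtype.ext
  simp only [specular, rotVel_coe]
  rw [hn, hi]
  have hε' : ε ≠ 0 := hε.ne'
  apply plane_ext
  · rw [rot_zero_coord, cos_turn h1 h2, sin_turn h1 h2, hq]
    simp
    field_simp
    linear_combination (-2 * (v : Plane) 0) * hs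
  · rw [rot_one_coord, cos_turn h1 h2, sin_turn h1 h2, hq]
    simp
    field_simp
    linear_combination (-2 * (v : Plane) 1) * hs

lemma afterCollision_eq (hε : 0 < ε) (h : |tra c z| < ε) (h' : 0 ≤ entryTime ε c z) :
    afterCollision ε c z = freeFlight (entryTime ε c z) (deflect ε c z) := by
  have hq : (freeFlight (entryTime ε c z) z).1 - c =
      (-√(ε ^ 2 - tra c z ^ 2)) • (z.2 : Plane) + tra c z • perp z.2 := by
    have h1 : freeFlight (entryTime ε c z) z =
        frame c ((lon c z + entryTime ε c z, tra c z), z.2) := by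
      conv_lhs => rw [← frame_lon_tra c z, freeFlight_frame]
      simp only [frame_lon_tra]
    rw [h1]
    have h2 : lon c z + (-lon c z - √(ε ^ 2 - tra c z ^ 2)) = -√(ε ^ 2 - tra c z ^ 2) := by ring
    simp only [frame, entryTime, halfChord, h2]
    abel
  have hb : |tra c z / ε| ≤ 1 := by rw [abs_div, abs_of_pos hε, div_le_one hε]; exact h.le
  unfold afterCollision
  simp only [collisionTime_eq hε h h', hq, freeFlight_snd]
  rw [specular_eq_rotVel hε h.le, deflect, freeFlight_frame]
  refine Prod.ext ?_ rfl
  have h3 : (freeFlight (entryTime ε c z) z).1 =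
      c + ((-√(ε ^ 2 - tra c z ^ 2)) • (z.2 : Plane) + tra c z • perp z.2) := by rw [← hq]; abel
  rw [h3]
  simp only [frame, entryTime, halfChord, rotVel_coe]
  have hε' : ε ≠ 0 := hε.ne'
  have h1 := (abs_le.1 hb).1
  have h2 := (abs_le.1 hb).2
  have hq : √(1 - (tra c z / ε) ^ 2) = √(ε ^ 2 - tra c z ^ 2) / ε := by
    rw [← Real.sqrt_sq hε.le, ← Real.sqrt_div' _ (sq_nonneg ε), Real.sqrt_sq hε.le]
    congr 1; field_simp
  have hs : √(ε ^ 2 - tra c z ^ 2) ^ 2 = ε ^ 2 - tra c z ^ 2 := Real.sq_sqrt (by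
    nlinarith [(abs_lt.1 h).1, (abs_lt.1 h).2])
  set s := √(ε ^ 2 - tra c z ^ 2)
  set b := tra c z
  apply plane_ext
  · simp [rot_zero_coord, rot_one_coord, cos_turn h1 h2, sin_turn h1 h2, hq]
    field_simp
    linear_combination (2 * b * (z.2 : Plane) 1) * hs
  · simp [rot_zero_coord, rot_one_coord, cos_turn h1 h2, sin_turn h1 h2, hq]
    field_simp
    linear_combination (-2 * b * (z.2 : Plane) 0) * hs

/-! ### The lattice of obstacle ranges -/

/-- The lattice point with index `p`. -/
def site (ε : ℝ) (p : ℤ × ℤ) : Plane := latticePoint ε p.1 p.2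

/-- The obstacle centre in the range with index `p`, for the relative position `x`. -/
def centre (ε ν : ℝ) (p : ℤ × ℤ) (x : Plane) : Plane := site ε p + patchRadius ε ν • x

/-- The time of entry into the range of the lattice point with index `p`. -/
local notation:max "𝔦" ε:max ν:max p:max => entryTime (rangeRadius ε ν) (site ε p)

/-- The time of exit from the range of the lattice point with index `p`. -/
local notation:max "𝔬" ε:max ν:max p:max => leaveTime (rangeRadius ε ν) (site ε p)

/-- The least distance between two obstacle ranges. -/
def gap (ε ν : ℝ) : ℝ := √ε - 2 * rangeRadius ε ν

lemma mem_obstacleRanges :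
    y ∈ obstacleRanges ε ν ↔ ∃ p, y ∈ Metric.ball (site ε p) (rangeRadius ε ν) := by
  simp [obstacleRanges, site]

lemma isOpen_obstacleRanges (ε ν) : IsOpen (obstacleRanges ε ν) :=
  isOpen_iUnion fun _ => isOpen_iUnion fun _ => Metric.isOpen_ball

lemma patchRadius_pos (hε : 0 < ε) (ν) : 0 < patchRadius ε ν :=
  mul_pos (sqrt_pos.2 hε) (Real.rpow_pos_of_pos hε _)

lemma rangeRadius_pos (hε : 0 < ε) (ν) : 0 < rangeRadius ε ν := add_pos (patchRadius_pos hε ν) hε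

lemma sqrt_le_dist_site (hε : 0 < ε) (h : p ≠ q) : √ε ≤ dist (site ε p) (site ε q) := by
  have hs : 0 < √ε := sqrt_pos.2 hε
  rw [← sq_le_sq₀ hs.le dist_nonneg, dist_eq_norm, norm_sq_eq]
  have h1 : (1 : ℝ) ≤ ((p.1 : ℝ) - q.1) ^ 2 + ((p.2 : ℝ) - q.2) ^ 2 := by
    have : (1 : ℤ) ≤ (p.1 - q.1) ^ 2 + (p.2 - q.2) ^ 2 := by
      by_contra h2
      push Not at h2
      have h3 : (p.1 - q.1) ^ 2 = 0 := by nlinarith [sq_nonneg (p.1 - q.1), sq_nonneg (p.2 - q.2)]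
      have h4 : (p.2 - q.2) ^ 2 = 0 := by nlinarith [sq_nonneg (p.1 - q.1), sq_nonneg (p.2 - q.2)]
      have h5 := pow_eq_zero_iff (two_ne_zero) |>.1 h3
      have h6 := pow_eq_zero_iff (two_ne_zero) |>.1 h4
      exact h (Prod.ext (by omega) (by omega))
    exact_mod_cast this
  simp [site, latticePoint]
  nlinarith [sq_nonneg (√ε)]

lemma nearestSite_eq (hε : 0 < ε) (hg : 0 < gap ε ν)
    (h : dist y (site ε p) ≤ rangeRadius ε ν) : nearestSite ε y = site ε p := by
  have hs : 0 < √ε := sqrt_pos.2 hε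
  unfold gap at hg
  have key : ∀ i : Fin 2, |y i - site ε p i| < √ε / 2 := fun i => by
    have := PiLp.norm_apply_le (y - site ε p) i
    rw [← dist_eq_norm, norm_eq_abs] at this
    simp only [PiLp.sub_apply] at this
    linarith
  have hr : ∀ (a : ℝ) (j : ℤ), |a - √ε * j| < √ε / 2 → round (a / √ε) = j := by
    intro a j h
    have h1 : a / √ε - j = (a - √ε * j) / √ε := by field_simp
    have h2 : |a / √ε - j| < 1 / 2 := by rw [h1, abs_div, abs_of_pos hs, div_lt_iff₀ hs]; linarith
    rw [round_eq, Int.floor_eq_iff]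
    have := abs_lt.1 h2
    constructor <;> linarith
  rw [nearestSite, site, hr _ p.1 (by simpa [site, latticePoint] using key 0),
    hr _ p.2 (by simpa [site, latticePoint] using key 1)]

/-- Points of different ranges are at a distance of at least the gap. -/
lemma gap_lt_dist (hε : 0 < ε)
    (hx : dist x (site ε p) ≤ rangeRadius ε ν) (hy : dist y (site ε q) < rangeRadius ε ν)
    (h : p ≠ q) : gap ε ν < dist x y := by
  have h1 := sqrt_le_dist_site hε h
  have h2 := dist_triangle4 (site ε p) x y (site ε q)
  rw [dist_comm (site ε p) x] at h2
  unfold gap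
  linarith

lemma dist_freeFlight (s t z) : dist (freeFlight s z).1 (freeFlight t z).1 = |s - t| := by
  rw [freeFlight_fst, freeFlight_fst, dist_add_left, dist_eq_norm, ← sub_smul, norm_smul]
  simp

lemma dist_centre_site (hε : 0 < ε) (p) (hx : ‖x‖ < 1) :
    dist (centre ε ν p x) (site ε p) < patchRadius ε ν := by
  have := patchRadius_pos hε ν
  rw [centre, dist_eq_norm, add_sub_cancel_left, norm_smul, norm_eq_abs, abs_of_pos this]
  nlinarith

/-- A point of the closed obstacle lies inside the range. -/
lemma mem_range_of_dist_centre (hε : 0 < ε) (hx : ‖x‖ < 1)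
    (h : dist y (centre ε ν p x) ≤ ε) : y ∈ Metric.ball (site ε p) (rangeRadius ε ν) := by
  rw [Metric.mem_ball]
  have := dist_triangle y (centre ε ν p x) (site ε p)
  have := dist_centre_site (ν := ν) hε p hx
  unfold rangeRadius
  linarith

lemma dist_freeFlight_entryTime (hε : 0 < ε)
    (h : |tra c z| ≤ ε) : dist (freeFlight (entryTime ε c z) z).1 c = ε := by
  rw [← sq_eq_sq₀ dist_nonneg hε.le, dist_sq, lon_freeFlight, tra_freeFlight]
  have := halfChord_sq h
  unfold entryTime
  linear_combination this

lemma entryTime_deflect (ε c z) :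
    entryTime ε c (deflect ε c z) = entryTime ε c z - 2 * halfChord ε c z := by
  have : halfChord ε c (deflect ε c z) = halfChord ε c z := by simp [halfChord, tra_deflect]
  rw [entryTime, entryTime, this, lon_deflect]; ring

lemma dist_deflect (hε : 0 < ε)
    (h : |tra c z| ≤ ε) : dist (freeFlight (entryTime ε c z) (deflect ε c z)).1 c = ε := by
  rw [← sq_eq_sq₀ dist_nonneg hε.le, dist_sq, lon_freeFlight, tra_freeFlight, lon_deflect,
    tra_deflect]
  have := halfChord_sq h
  unfold entryTime
  linear_combination this

/-! ### Unfolding one visit -/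

/-- The range `p` is the first one on the future free path of `z`. -/
def FirstVisit (ε ν : ℝ) (z : Phase) (p : ℤ × ℤ) : Prop :=
  |tra (site ε p) z| < rangeRadius ε ν ∧ 0 < 𝔬 ε ν p z ∧
    ∀ s ∈ timesIn (obstacleRanges ε ν) z, max 0 (𝔦 ε ν p z) ≤ s

lemma mem_timesIn_ranges (hε : 0 < ε) :
    s ∈ timesIn (obstacleRanges ε ν) z ↔ 0 ≤ s ∧ ∃ p, |tra (site ε p) z| < rangeRadius ε ν ∧
      𝔦 ε ν p z < s ∧ s < 𝔬 ε ν p z := by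
  simp only [timesIn, mem_ofPred_eq, mem_obstacleRanges, mem_ball_freeFlight (rangeRadius_pos hε ν)]

lemma entryTime_lt_leaveTime (h : |tra c z| < ρ) : entryTime ρ c z < leaveTime ρ c z := by
  have := halfChord_pos h
  unfold entryTime leaveTime; linarith

lemma exists_firstVisit (hε : 0 < ε) (hg : 0 < gap ε ν)
    (h : (timesIn (obstacleRanges ε ν) z).Nonempty) : ∃ p, FirstVisit ε ν z p := by
  have hR := rangeRadius_pos hε ν
  have hlb : BddBelow (timesIn (obstacleRanges ε ν) z) := ⟨0, fun s hs => hs.1⟩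
  obtain ⟨s₁, hs₁, hlt⟩ := Real.lt_sInf_add_pos h hg
  have hs₁' := hs₁
  rw [mem_timesIn_ranges hε] at hs₁
  obtain ⟨h0, p, hp1, hp2, hp3⟩ := hs₁
  refine ⟨p, hp1, h0.trans_lt hp3, fun s hs => ?_⟩
  by_cases hss : s₁ ≤ s
  · exact (max_le h0 hp2.le).trans hss
  · push Not at hss
    have h1 := csInf_le hlb hs
    have hd : dist (freeFlight s z).1 (freeFlight s₁ z).1 < gap ε ν := by
      rw [dist_freeFlight, abs_lt]; constructor <;> linarith
    rw [mem_timesIn_ranges hε] at hs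
    obtain ⟨h0', q, hq⟩ := hs
    have hqp : q = p := by
      by_contra hne
      have hq' := (mem_ball_freeFlight hR (site ε q) s z).2 hq
      have hp' := (mem_ball_freeFlight hR (site ε p) s₁ z).2 ⟨hp1, hp2, hp3⟩
      exact absurd (gap_lt_dist hε (Metric.mem_ball.1 hq').le (Metric.mem_ball.1 hp') hne)
        (not_lt.2 hd.le)
    subst hqp
    exact max_le h0' hq.2.1.le

namespace FirstVisit

lemma nonempty (hε : 0 < ε) (h : FirstVisit ε ν z p) :
    (timesIn (obstacleRanges ε ν) z).Nonempty := by
  have h5 := max_lt h.2.1 (entryTime_lt_leaveTime h.1)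
  obtain ⟨s, hs1, hs2⟩ := exists_between h5
  exact ⟨s, (mem_timesIn_ranges hε).2 ⟨(le_max_left _ _).trans hs1.le, p, h.1,
    (le_max_right _ _).trans_lt hs1, hs2⟩⟩

lemma sInf_eq (hε : 0 < ε) (h : FirstVisit ε ν z p) : sInf (timesIn (obstacleRanges ε ν) z) =
      max 0 (𝔦 ε ν p z) := by
  apply le_antisymm
  · rw [← sInf_timesIn_ball (rangeRadius_pos hε ν) h.1 h.2.1]
    exact csInf_le_csInf ⟨0, fun s hs => hs.1⟩
      ((timesIn_ball_nonempty (rangeRadius_pos hε ν) _ _).2 ⟨h.1, h.2.1⟩) fun s hs => ⟨hs.1,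
        mem_obstacleRanges.2 ⟨p, hs.2⟩⟩
  · exact le_csInf (h.nonempty hε) h.2.2

lemma max_lt_leaveTime (h : FirstVisit ε ν z p) : max 0 (𝔦 ε ν p z) < 𝔬 ε ν p z :=
  max_lt h.2.1 (entryTime_lt_leaveTime h.1)

lemma dist_le (hε : 0 < ε) (h : FirstVisit ε ν z p) :
    dist (freeFlight (max 0 (𝔦 ε ν p z)) z).1 (site ε p) ≤ rangeRadius ε ν := by
  have h1 : |lon (site ε p) z + max 0 (𝔦 ε ν p z)| ≤ halfChord (rangeRadius ε ν) (site ε p) z := by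
    have h2 := h.max_lt_leaveTime
    have h3 : 𝔦 ε ν p z ≤ max 0 (𝔦 ε ν p z) := le_max_right _ _
    generalize max 0 (𝔦 ε ν p z) = τ at *
    unfold leaveTime at h2
    unfold entryTime at h3
    rw [abs_le]; constructor <;> linarith
  rw [← sq_le_sq₀ dist_nonneg (rangeRadius_pos hε ν).le, dist_sq, lon_freeFlight, tra_freeFlight]
  have h4 := halfChord_sq h.1.le
  have h5 := (sq_le_sq' (abs_le.1 h1).1 (abs_le.1 h1).2)
  linarith

end FirstVisit

lemma sSup_timesIn_range (hε : 0 < ε) (h : |tra (site ε p) z| < rangeRadius ε ν)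
    (hs : s < 𝔬 ε ν p z) : sSup (timesIn (Metric.ball (site ε p) (rangeRadius ε ν))
      (freeFlight s z)) = 𝔬 ε ν p z - s := by
  rw [sSup_timesIn_ball (rangeRadius_pos hε ν) (by rwa [tra_freeFlight])
    (by rw [leaveTime_freeFlight]; linarith), leaveTime_freeFlight]

/-- A collision that does not happen before the time `δ` may be looked for from that time on. -/
lemma strikes_freeFlight_iff (hδ : 0 ≤ δ)
    (h : |tra c z| < ε → 0 ≤ entryTime ε c z → δ ≤ entryTime ε c z) :
    Strikes ε c t (freeFlight δ z) ↔ Strikes ε c (t + δ) z := by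
  rw [Strikes, tra_freeFlight, entryTime_freeFlight]
  exact ⟨fun h' => ⟨h'.1, by linarith [h'.2.1], by linarith [h'.2.2]⟩,
    fun h' => ⟨h'.1, by linarith [h h'.1 h'.2.1], by linarith [h'.2.2]⟩⟩

/-- The obstacle is entered after the range that contains it, and the outgoing line is in that
range at the time of the collision. -/
lemma entryTime_mem_range (hε : 0 < ε) (hx : ‖x‖ < 1) (h : |tra (centre ε ν p x) z| < ε) :
    |tra (site ε p) z| < rangeRadius ε ν ∧
    𝔦 ε ν p z < entryTime ε (centre ε ν p x) z ∧
    entryTime ε (centre ε ν p x) z < 𝔬 ε ν p z :=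
  (mem_ball_freeFlight (rangeRadius_pos hε ν) _ _ _).1
    (mem_range_of_dist_centre hε hx (dist_freeFlight_entryTime hε h.le).le)

lemma entryTime_mem_range_deflect (hε : 0 < ε) (hx : ‖x‖ < 1) (h : |tra (centre ε ν p x) z| < ε) :
    |tra (site ε p) (deflect ε (centre ε ν p x) z)| < rangeRadius ε ν ∧
    𝔦 ε ν p (deflect ε (centre ε ν p x) z) < entryTime ε (centre ε ν p x) z ∧
    entryTime ε (centre ε ν p x) z < 𝔬 ε ν p (deflect ε (centre ε ν p x) z) :=
  (mem_ball_freeFlight (rangeRadius_pos hε ν) _ _ _).1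
    (mem_range_of_dist_centre hε hx (dist_deflect hε h.le).le)

lemma entryTime_mem_timesIn (hε : 0 < ε)
    (hx : ‖x‖ < 1) (h : |tra (centre ε ν p x) z| < ε) (h0 : 0 ≤ entryTime ε (centre ε ν p x) z) :
    entryTime ε (centre ε ν p x) z ∈ timesIn (obstacleRanges ε ν) z :=
  (mem_timesIn_ranges hε).2 ⟨h0, p, entryTime_mem_range hε hx h⟩

open Classical in
/-- The line on which the particle leaves the range `p` if it moves until time `t`. -/
def visitLine (ε ν : ℝ) (p : ℤ × ℤ) (x : Plane) (t : ℝ) (z : Phase) : Phase :=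
  if Strikes ε (centre ε ν p x) t z then deflect ε (centre ε ν p x) z else z

lemma visitLine_freeFlight (hδ : 0 ≤ δ) (h : |tra (centre ε ν p x) z| < ε →
    0 ≤ entryTime ε (centre ε ν p x) z → δ ≤ entryTime ε (centre ε ν p x) z) :
    visitLine ε ν p x t (freeFlight δ z) = freeFlight δ (visitLine ε ν p x (t + δ) z) := by
  simp only [visitLine, deflect_freeFlight, apply_ite (freeFlight δ)]
  congr 1
  exact propext (strikes_freeFlight_iff hδ h)

lemma FirstVisit.visitLine_spec (hε : 0 < ε) (hx : ‖x‖ < 1) (h : FirstVisit ε ν z p) :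
    |tra (site ε p) (visitLine ε ν p x t z)| < rangeRadius ε ν ∧
    max 0 (𝔦 ε ν p z) < 𝔬 ε ν p (visitLine ε ν p x t z) := by
  unfold visitLine
  split_ifs with hs
  · have h1 := entryTime_mem_range_deflect hε hx hs.1
    exact ⟨h1.1, (h.2.2 _ (entryTime_mem_timesIn hε hx hs.1 hs.2.1)).trans_lt h1.2.2⟩
  · exact ⟨h.1, h.max_lt_leaveTime⟩

lemma flow_succ_of_no_visit (hε : 0 < ε) (n : ℕ) (ξ : ℕ → Plane)
    (h : ∀ p, FirstVisit ε ν z p → t < max 0 (𝔦 ε ν p z))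
    (hg : 0 < gap ε ν) : flow ε ν (n + 1) ξ t z = freeFlight t z := by
  rw [flow, if_neg]
  rintro ⟨h1, h2⟩
  obtain ⟨p, hp⟩ := exists_firstVisit hε hg h1
  rw [hp.sInf_eq hε] at h2
  exact absurd (h p hp) (not_lt.2 h2)

lemma flow_succ_of_visit (hε : 0 < ε) (hg : 0 < gap ε ν) (n : ℕ) {ξ : ℕ → Plane} (hξ : ‖ξ 0‖ < 1)
    (h : FirstVisit ε ν z p) (ht : max 0 (𝔦 ε ν p z) ≤ t) : flow ε ν (n + 1) ξ t z =
      if t < 𝔬 ε ν p (visitLine ε ν p (ξ 0) t z) then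
        freeFlight t (visitLine ε ν p (ξ 0) t z)
      else flow ε ν n (fun k => ξ (k + 1)) (t - 𝔬 ε ν p (visitLine ε ν p (ξ 0) t z))
        (freeFlight (𝔬 ε ν p (visitLine ε ν p (ξ 0) t z)) (visitLine ε ν p (ξ 0) t z)) := by
  have hspec := h.visitLine_spec (ν := ν) hε hξ (t := t)
  rw [flow]
  have hτ := h.sInf_eq hε
  set τ := max 0 (𝔦 ε ν p z)
  have hτ0 : 0 ≤ τ := le_max_left _ _
  rw [hτ]
  have hnear : nearestSite ε (freeFlight τ z).1 = site ε p :=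
    nearestSite_eq hε hg (h.dist_le hε)
  rw [if_pos ⟨h.nonempty hε, ht⟩]
  have hc : site ε p + patchRadius ε ν • ξ 0 = centre ε ν p (ξ 0) := rfl
  have hiff : Strikes ε (centre ε ν p (ξ 0)) (t - τ) (freeFlight τ z) ↔
      Strikes ε (centre ε ν p (ξ 0)) t z := by
    rw [strikes_freeFlight_iff hτ0 fun h1 h2 => h.2.2 _ (entryTime_mem_timesIn hε hξ h1 h2),
      sub_add_cancel]
  by_cases hs : Strikes ε (centre ε ν p (ξ 0)) t z
  · have hs' := hiff.2 hs
    have hk : visitLine ε ν p (ξ 0) t z = deflect ε (centre ε ν p (ξ 0)) z := if_pos hs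
    have hcol : Collides ε (nearestSite ε (freeFlight τ z).1 + patchRadius ε ν • ξ 0)
        (freeFlight τ z) ∧ collisionTime ε (nearestSite ε (freeFlight τ z).1 +
          patchRadius ε ν • ξ 0) (freeFlight τ z) ≤ t - τ := by
      rw [hnear]; exact (collides_and_le_iff hε _ _ _).2 hs'
    simp only [if_pos hcol, hnear, hc]
    rw [hk] at hspec ⊢
    rw [afterCollision_eq hε hs'.1 hs'.2.1, collisionTime_eq hε hs'.1 hs'.2.1,
      deflect_freeFlight, freeFlight_add, entryTime_freeFlight, add_sub_cancel]
    set k := deflect ε (centre ε ν p (ξ 0)) z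
    set s := entryTime ε (centre ε ν p (ξ 0)) z
    rw [sSup_timesIn_range (s := s) hε hspec.1 (entryTime_mem_range_deflect hε hξ hs.1).2.2]
    have e1 : t - τ - (s - τ) = t - s := by ring
    simp only [e1, freeFlight_add, sub_lt_sub_iff_right, add_sub_cancel, sub_sub_sub_cancel_right]
  · have hs' := fun h' => hs (hiff.1 h')
    have hk : visitLine ε ν p (ξ 0) t z = z := if_neg hs
    have hcol : ¬ (Collides ε (nearestSite ε (freeFlight τ z).1 + patchRadius ε ν • ξ 0)
        (freeFlight τ z) ∧ collisionTime ε (nearestSite ε (freeFlight τ z).1 +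
          patchRadius ε ν • ξ 0) (freeFlight τ z) ≤ t - τ) := by
      rw [hnear]; exact fun h => hs' ((collides_and_le_iff hε _ _ _).1 h)
    simp only [if_neg hcol, hnear]
    rw [hk] at hspec ⊢
    rw [sSup_timesIn_range (s := τ) hε h.1 h.max_lt_leaveTime]
    simp only [freeFlight_add, sub_lt_sub_iff_right, add_sub_cancel, sub_sub_sub_cancel_right]

/-! ### Independence of the number of visits allowed for -/

/-- After leaving a range, the particle moves freely at least along the gap. -/
lemma gap_le_of_exit (hε : 0 < ε) {k : Phase} (h : |tra (site ε p) k| < rangeRadius ε ν)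
    (hs : s ∈ timesIn (obstacleRanges ε ν) (freeFlight (𝔬 ε ν p k) k)) : gap ε ν < s := by
  have hR := rangeRadius_pos hε ν
  obtain ⟨h0, hq⟩ := hs
  obtain ⟨q, hq⟩ := mem_obstacleRanges.1 hq
  by_cases hpq : p = q
  · subst hpq
    rw [mem_ball_freeFlight hR, leaveTime_freeFlight] at hq
    linarith [hq.2.2]
  · have hd : dist (freeFlight (𝔬 ε ν p k) k).1 (site ε p) ≤ rangeRadius ε ν := by
      rw [← sq_le_sq₀ dist_nonneg hR.le, dist_sq, lon_freeFlight, tra_freeFlight]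
      have := halfChord_sq h.le
      unfold leaveTime
      apply le_of_eq
      linear_combination this
    have := gap_lt_dist hε hd (Metric.mem_ball.1 hq) hpq
    rwa [freeFlight_add, dist_freeFlight, sub_add_cancel_left, abs_neg, abs_of_nonneg h0] at this

lemma flow_eq_flow_succ (hε : 0 < ε) (hg : 0 < gap ε ν) (n : ℕ) :
    ∀ {ξ : ℕ → Plane} (_ : ∀ k, ‖ξ k‖ < 1) {t : ℝ} {z : Phase}
    (_ : (t ≤ n * gap ε ν ∧ ∀ s ∈ timesIn (obstacleRanges ε ν) z, gap ε ν < s) ∨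
      t ≤ (n - 1 : ℝ) * gap ε ν), flow ε ν n ξ t z = flow ε ν (n + 1) ξ t z := by
  induction n with
  | zero =>
    intro ξ hξ t z h
    rw [flow_succ_of_no_visit hε _ _ _ hg, flow]
    intro p hp
    rw [← hp.sInf_eq hε]
    rcases h with ⟨h1, h2⟩ | h1
    · have := le_csInf (hp.nonempty hε) fun s hs => (h2 s hs).le
      simp at h1; linarith
    · have := Real.sInf_nonneg (fun s hs => (show s ∈ timesIn (obstacleRanges ε ν) z from hs).1)
      simp at h1; linarith
  | succ n ih =>
    intro ξ hξ t z h
    by_cases hv : ∃ p, FirstVisit ε ν z p ∧ max 0 (𝔦 ε ν p z) ≤ t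
    · obtain ⟨p, hp, hpt⟩ := hv
      rw [flow_succ_of_visit hε hg n (hξ 0) hp hpt, flow_succ_of_visit hε hg (n + 1) (hξ 0) hp hpt]
      split_ifs with hlt
      · rfl
      · apply ih (fun k => hξ (k + 1))
        left
        have hspec := hp.visitLine_spec (ν := ν) hε (hξ 0) (t := t)
        refine ⟨?_, fun s hs => gap_le_of_exit hε hspec.1 hs⟩
        push_cast at h
        rcases h with ⟨h1, h2⟩ | h1
        · have := le_csInf (hp.nonempty hε) fun s hs => (h2 s hs).le
          rw [hp.sInf_eq hε] at this
          linarith [hspec.2]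
        · have := (le_max_left _ _).trans_lt hspec.2
          linarith
    · push Not at hv
      rw [flow_succ_of_no_visit hε _ _ hv hg, flow_succ_of_no_visit hε _ _ hv hg]

lemma flow_eq_of_le (hε : 0 < ε) (hg : 0 < gap ε ν) {n m : ℕ} (hnm : n ≤ m)
    {ξ : ℕ → Plane} (hξ : ∀ k, ‖ξ k‖ < 1) {t : ℝ} {z : Phase}
    (h : (t ≤ n * gap ε ν ∧ ∀ s ∈ timesIn (obstacleRanges ε ν) z, gap ε ν < s) ∨
      t ≤ (n - 1 : ℝ) * gap ε ν) : flow ε ν n ξ t z = flow ε ν m ξ t z := by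
  induction m, hnm using Nat.le_induction with
  | base => rfl
  | succ m hm ih =>
    rw [ih]
    apply flow_eq_flow_succ hε hg m hξ
    have hm' : (n : ℝ) ≤ m := by exact_mod_cast hm
    rcases h with ⟨h1, h2⟩ | h1
    · exact Or.inl ⟨h1.trans (mul_le_mul_of_nonneg_right hm' hg.le), h2⟩
    · exact Or.inr (h1.trans (mul_le_mul_of_nonneg_right (by linarith) hg.le))

lemma markovLorentz_def (ε ν) (ξ : ℕ → Plane) (t z) :
    markovLorentz ε ν ξ t z = flow ε ν (⌈t / gap ε ν⌉₊ + 1) ξ t z := rfl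

lemma le_ceil_mul_gap (hg : 0 < gap ε ν) (t) : t ≤ (⌈t / gap ε ν⌉₊ : ℝ) * gap ε ν := by
  rw [← div_le_iff₀ hg]; exact Nat.le_ceil _

lemma markovLorentz_of_no_visit (hε : 0 < ε) (hg : 0 < gap ε ν) (ξ : ℕ → Plane)
    (h : ∀ p, FirstVisit ε ν z p → t < max 0 (𝔦 ε ν p z)) :
    markovLorentz ε ν ξ t z = freeFlight t z := flow_succ_of_no_visit hε _ _ h hg

/-- The unfolding of the first visit, free of the bound on the number of visits. -/
lemma markovLorentz_of_visit (hε : 0 < ε) (hg : 0 < gap ε ν) {ξ : ℕ → Plane}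
    (hξ : ∀ k, ‖ξ k‖ < 1) {t : ℝ} {z : Phase}
    (h : FirstVisit ε ν z p) (ht : max 0 (𝔦 ε ν p z) ≤ t) : markovLorentz ε ν ξ t z =
      if t < 𝔬 ε ν p (visitLine ε ν p (ξ 0) t z) then
        freeFlight t (visitLine ε ν p (ξ 0) t z)
      else markovLorentz ε ν (fun k => ξ (k + 1)) (t - 𝔬 ε ν p (visitLine ε ν p (ξ 0) t z))
        (freeFlight (𝔬 ε ν p (visitLine ε ν p (ξ 0) t z)) (visitLine ε ν p (ξ 0) t z)) := by
  rw [markovLorentz_def, flow_succ_of_visit hε hg _ (hξ 0) h ht]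
  split_ifs with hlt
  · rfl
  · have hspec := h.visitLine_spec (ν := ν) hε (hξ 0) (t := t)
    have h0 := (le_max_left _ _).trans_lt hspec.2
    set k := visitLine ε ν p (ξ 0) t z
    set e := 𝔬 ε ν p k
    have hle : ⌈(t - e) / gap ε ν⌉₊ ≤ ⌈t / gap ε ν⌉₊ :=
      Nat.ceil_mono (div_le_div_of_nonneg_right (by linarith) hg.le)
    rw [markovLorentz_def, flow_eq_of_le hε hg (Nat.le_succ _) (fun k => hξ (k + 1))
      (Or.inl ⟨?_, fun s hs => gap_le_of_exit hε hspec.1 hs⟩)]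
    · symm
      apply flow_eq_of_le hε hg (by omega) (fun k => hξ (k + 1))
      right
      have := le_ceil_mul_gap hg (t - e)
      push_cast; linarith
    · linarith [le_ceil_mul_gap hg t]

/-! ### The process in small time steps -/

/-- The sequence that begins with `x` and goes on with `ξ`. -/
def consSeq (x : Plane) (ξ : ℕ → Plane) : ℕ → Plane
  | 0 => x
  | k + 1 => ξ k

/-- Position and velocity after the time `δ`, smaller than the gap: no more than one range is
visited, and the obstacle found there has the relative position `x`. -/
def step (ε ν δ : ℝ) (z : Phase) (x : Plane) : Phase := flow ε ν 1 (fun _ => x) δ z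

lemma FirstVisit.eq_of_near (hε : 0 < ε) (hδ : δ ≤ gap ε ν)
    (h : FirstVisit ε ν z p) (hs0 : 0 ≤ s) (hsδ : s ≤ δ)
    (hs : (freeFlight s z).1 ∈ Metric.ball (site ε q) (rangeRadius ε ν)) : p = q := by
  by_contra hne
  have h1 := h.2.2 s ⟨hs0, mem_obstacleRanges.2 ⟨q, hs⟩⟩
  set τ := max 0 (𝔦 ε ν p z)
  have hτ0 : 0 ≤ τ := le_max_left _ _
  have := gap_lt_dist hε (h.dist_le hε) (Metric.mem_ball.1 hs) hne
  rw [dist_freeFlight, abs_sub_comm, abs_of_nonneg (by linarith)] at this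
  linarith

lemma step_of_visit (hε : 0 < ε) (hg : 0 < gap ε ν) (hx : ‖x‖ < 1) (h : FirstVisit ε ν z p)
    (ht : max 0 (𝔦 ε ν p z) ≤ δ) : step ε ν δ z x = freeFlight δ (visitLine ε ν p x δ z) := by
  rw [step, flow_succ_of_visit hε hg 0 (ξ := fun _ => x) hx h ht]
  split_ifs with h
  · rfl
  · rw [flow, freeFlight_add, add_sub_cancel]

lemma step_of_no_visit (hε : 0 < ε) (hg : 0 < gap ε ν) (x : Plane)
    (h : ∀ p, FirstVisit ε ν z p → δ < max 0 (𝔦 ε ν p z)) :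
    step ε ν δ z x = freeFlight δ z := flow_succ_of_no_visit hε _ _ h hg

lemma step_of_strikes (hε : 0 < ε) (hδ : δ ≤ gap ε ν) (hg : 0 < gap ε ν)
    (hx : ‖x‖ < 1) (h : Strikes ε (centre ε ν p x) δ z) :
    step ε ν δ z x = freeFlight δ (deflect ε (centre ε ν p x) z) := by
  have hm := entryTime_mem_timesIn hε hx h.1 h.2.1
  obtain ⟨q, hq⟩ := exists_firstVisit hε hg ⟨_, hm⟩
  have hqp : q = p := by
    refine hq.eq_of_near hε hδ h.2.1 h.2.2 ?_
    exact (mem_ball_freeFlight (rangeRadius_pos hε ν) _ _ _).2 (entryTime_mem_range hε hx h.1)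
  subst hqp
  rw [step_of_visit hε hg hx hq ((hq.2.2 _ hm).trans h.2.2), visitLine, if_pos h]

lemma step_of_not_strikes (hε : 0 < ε) (hg : 0 < gap ε ν)
    (hx : ‖x‖ < 1) (h : ∀ p, ¬ Strikes ε (centre ε ν p x) δ z) :
    step ε ν δ z x = freeFlight δ z := by
  by_cases hv : ∃ p, FirstVisit ε ν z p ∧ max 0 (𝔦 ε ν p z) ≤ δ
  · obtain ⟨p, hp, hpt⟩ := hv
    rw [step_of_visit hε hg hx hp hpt, visitLine, if_neg (h p)]
  · push Not at hv
    exact step_of_no_visit hε hg x hv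

/-- No more than one obstacle is struck within a time smaller than the gap. -/
lemma strikes_unique (hε : 0 < ε) (hδ : δ ≤ gap ε ν) (hg : 0 < gap ε ν) (hx : ‖x‖ < 1)
    (h : Strikes ε (centre ε ν p x) δ z) (h' : Strikes ε (centre ε ν q x) δ z) : p = q := by
  obtain ⟨o, ho⟩ := exists_firstVisit hε hg ⟨_, (entryTime_mem_timesIn hε hx h.1 h.2.1)⟩
  have hR := rangeRadius_pos hε ν
  rw [← ho.eq_of_near hε hδ h.2.1 h.2.2
      ((mem_ball_freeFlight hR _ _ _).2 (entryTime_mem_range hε hx h.1)),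
    ← ho.eq_of_near hε hδ h'.2.1 h'.2.2
      ((mem_ball_freeFlight hR _ _ _).2 (entryTime_mem_range hε hx h'.1))]

/-- Before the first visit, the process may be restarted from the free motion. -/
lemma markovLorentz_add_of_le (hε : 0 < ε) (hg : 0 < gap ε ν) {ξ : ℕ → Plane}
    (hξ : ∀ k, ‖ξ k‖ < 1) (t) {δ : ℝ} (hδ : 0 ≤ δ)
    (h : ∀ s ∈ timesIn (obstacleRanges ε ν) z, δ ≤ s) :
    markovLorentz ε ν ξ (t + δ) z = markovLorentz ε ν ξ t (freeFlight δ z) := by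
  have hR := rangeRadius_pos hε ν
  by_cases hne : (timesIn (obstacleRanges ε ν) z).Nonempty
  · obtain ⟨p, hp⟩ := exists_firstVisit hε hg hne
    have hτ : δ ≤ max 0 (𝔦 ε ν p z) := by rw [← hp.sInf_eq hε]; exact le_csInf hne h
    have hvt : max 0 (𝔦 ε ν p (freeFlight δ z)) = max 0 (𝔦 ε ν p z) - δ := by
      rw [entryTime_freeFlight]; grind
    have hp' : FirstVisit ε ν (freeFlight δ z) p := by
      refine ⟨by rw [tra_freeFlight]; exact hp.1, ?_, fun s hs => ?_⟩
      · rw [leaveTime_freeFlight]; linarith [hp.max_lt_leaveTime]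
      · rw [hvt]
        have := hp.2.2 (δ + s) ⟨by linarith [hs.1], by rw [← freeFlight_add]; exact hs.2⟩
        linarith
    have hline := visitLine_freeFlight (t := t) (p := p) hδ fun h1 h2 =>
      h _ (entryTime_mem_timesIn hε (hξ 0) h1 h2)
    by_cases hvis : max 0 (𝔦 ε ν p z) ≤ t + δ
    · rw [markovLorentz_of_visit hε hg hξ hp hvis,
        markovLorentz_of_visit hε hg hξ hp' (by rw [hvt]; linarith), hline, leaveTime_freeFlight]
      simp only [freeFlight_add, lt_sub_iff_add_lt, add_sub_cancel]
      rw [add_comm δ t]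
      split_ifs
      · rfl
      · congr 1; ring
    · have hz : ∀ {y : Phase} {q q' : ℤ × ℤ}, FirstVisit ε ν y q → FirstVisit ε ν y q' →
          max 0 (𝔦 ε ν q y) = max 0 (𝔦 ε ν q' y) := by
        intro y q q' hq hq'
        rw [← hq.sInf_eq hε, ← hq'.sInf_eq hε]
      push Not at hvis
      rw [markovLorentz_of_no_visit hε hg, markovLorentz_of_no_visit hε hg, freeFlight_add,
        add_comm]
      · intro q hq
        rw [hz hq hp', hvt]; linarith
      · intro q hq
        rw [hz hq hp]; exact hvis
  · have hne' : ¬ (timesIn (obstacleRanges ε ν) (freeFlight δ z)).Nonempty := by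
      rintro ⟨s, hs⟩
      exact hne ⟨δ + s, by linarith [hs.1], by rw [← freeFlight_add]; exact hs.2⟩
    rw [markovLorentz_of_no_visit hε hg, markovLorentz_of_no_visit hε hg, freeFlight_add, add_comm]
    · intro q hq
      exact absurd (hq.nonempty hε) hne'
    · intro q hq
      exact absurd (hq.nonempty hε) hne

lemma exists_lt_mem_timesIn (hε : 0 < ε) (hδ : 0 < δ)
    (h : δ ∈ timesIn (obstacleRanges ε ν) z) : ∃ s ∈ timesIn (obstacleRanges ε ν) z, s < δ := by
  rw [mem_timesIn_ranges hε] at h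
  obtain ⟨-, p, h1, h2, h3⟩ := h
  obtain ⟨s, hs1, hs2⟩ := exists_between (max_lt hδ h2)
  exact ⟨s, (mem_timesIn_ranges hε).2 ⟨(le_max_left _ _).trans hs1.le, p, h1,
    (le_max_right _ _).trans_lt hs1, hs2.trans h3⟩, hs2⟩

/-- A time step before the first visit is free and ends outside all ranges. -/
lemma step_of_late_visit (hε : 0 < ε) (hg : 0 < gap ε ν) (hδ : 0 < δ)
    (h : ∀ s ∈ timesIn (obstacleRanges ε ν) z, δ ≤ s) : (freeFlight δ z).1 ∉ obstacleRanges ε ν ∧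
      ∀ x : Plane, ‖x‖ < 1 → step ε ν δ z x = freeFlight δ z := by
  refine ⟨fun hm => ?_, fun x hx => step_of_not_strikes hε hg hx fun p hs => ?_⟩
  · obtain ⟨s, hs, hlt⟩ := exists_lt_mem_timesIn hε hδ ⟨hδ.le, hm⟩
    linarith [h s hs]
  · have hm := entryTime_mem_timesIn hε hx hs.1 hs.2.1
    rw [(le_antisymm hs.2.2 (h _ hm))] at hm
    obtain ⟨s, hs, hlt⟩ := exists_lt_mem_timesIn hε hδ hm
    linarith [h s hs]

/-- The Markov property of a time step in which a range is visited: either the step ends in that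
range and the obstacle is kept, or the range has been left and the next visit will find a new
obstacle. -/
lemma markovLorentz_step (hε : 0 < ε) (hδ' : δ < gap ε ν) (hδ : 0 < δ) (hx : ‖x‖ < 1)
    (h : ∃ s ∈ timesIn (obstacleRanges ε ν) z, s < δ) : ((step ε ν δ z x).1 ∈ obstacleRanges ε ν ∧
      ∀ ξ : ℕ → Plane, (∀ k, ‖ξ k‖ < 1) → ∀ t, 0 ≤ t → markovLorentz ε ν (consSeq x ξ) (t + δ) z =
          markovLorentz ε ν (consSeq x ξ) t (step ε ν δ z x)) ∨
    ((step ε ν δ z x).1 ∉ obstacleRanges ε ν ∧ ∀ ξ : ℕ → Plane, (∀ k, ‖ξ k‖ < 1) → ∀ t, 0 ≤ t →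
        markovLorentz ε ν (consSeq x ξ) (t + δ) z = markovLorentz ε ν ξ t (step ε ν δ z x)) := by
  have hg := hδ.trans hδ'
  obtain ⟨s₀, hs₀, hs₀δ⟩ := h
  obtain ⟨p, hp⟩ := exists_firstVisit hε hg ⟨s₀, hs₀⟩
  have hτ : max 0 (𝔦 ε ν p z) < δ := (hp.2.2 _ hs₀).trans_lt hs₀δ
  have hspec := hp.visitLine_spec hε hx (t := δ)
  have hstep := step_of_visit hε hg hx hp hτ.le
  have hcons : ∀ ξ : ℕ → Plane, (∀ k, ‖ξ k‖ < 1) → ∀ k, ‖consSeq x ξ k‖ < 1 := by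
    intro ξ hξ k
    cases k with
    | zero => exact hx
    | succ k => exact hξ k
  -- the entry time of the line on which the particle moves at time `δ`
  have hentry : 𝔦 ε ν p (visitLine ε ν p x δ z) < δ := by
    unfold visitLine
    split_ifs with hs
    · exact (entryTime_mem_range_deflect hε hx hs.1).2.1.trans_le hs.2.2
    · exact (le_max_right _ _).trans_lt hτ
  rw [hstep]
  by_cases hlt : δ < 𝔬 ε ν p (visitLine ε ν p x δ z)
  · left
    refine ⟨mem_obstacleRanges.2 ⟨p, (mem_ball_freeFlight (rangeRadius_pos hε ν) _ _ _).2
      ⟨hspec.1, hentry, hlt⟩⟩, fun ξ hξ t ht => ?_⟩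
    have hp' : FirstVisit ε ν (freeFlight δ (visitLine ε ν p x δ z)) p := by
      refine ⟨by rw [tra_freeFlight]; exact hspec.1, by rw [leaveTime_freeFlight]; linarith,
        fun s hs => ?_⟩
      rw [entryTime_freeFlight, max_eq_left (by linarith)]
      exact hs.1
    have hp'0 : max 0 (𝔦 ε ν p (freeFlight δ (visitLine ε ν p x δ z))) ≤ t := by
      rw [entryTime_freeFlight, max_eq_left (by linarith)]; exact ht
    rw [markovLorentz_of_visit hε hg (hcons ξ hξ) hp (by linarith),
      markovLorentz_of_visit hε hg (hcons ξ hξ) hp' hp'0]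
    have hline : visitLine ε ν p x t (freeFlight δ (visitLine ε ν p x δ z)) =
        freeFlight δ (visitLine ε ν p x (t + δ) z) := by
      by_cases hs : Strikes ε (centre ε ν p x) δ z
      · have hs2 : Strikes ε (centre ε ν p x) (t + δ) z := ⟨hs.1, hs.2.1, by linarith [hs.2.2]⟩
        have e1 : visitLine ε ν p x δ z = deflect ε (centre ε ν p x) z := if_pos hs
        have e2 : visitLine ε ν p x (t + δ) z = deflect ε (centre ε ν p x) z := if_pos hs2
        rw [e1, e2, visitLine, if_neg]
        rintro ⟨-, h2, -⟩
        rw [entryTime_freeFlight, entryTime_deflect] at h2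
        linarith [halfChord_pos hs.1, hs.2.2]
      · have e1 : visitLine ε ν p x δ z = z := if_neg hs
        rw [e1, visitLine_freeFlight hδ.le]
        intro h1 h2
        by_contra h4
        exact hs ⟨h1, h2, by linarith⟩
    change (if t + δ < leaveTime _ _ (visitLine ε ν p x (t + δ) z) then _ else
        markovLorentz ε ν ξ _ _) = if t < leaveTime _ _ (visitLine ε ν p x t _) then _ else
        markovLorentz ε ν ξ _ _
    simp only [consSeq, hline, leaveTime_freeFlight, freeFlight_add, lt_sub_iff_add_lt,
      add_sub_cancel]
    rw [add_comm δ t]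
    split_ifs
    · rfl
    · congr 1; ring
  · right
    push Not at hlt
    have hfresh := fun s (hs : s ∈ timesIn (obstacleRanges ε ν) _) => gap_le_of_exit hε hspec.1 hs
    have hl0 := (le_max_left _ _).trans_lt hspec.2
    refine ⟨fun hm => ?_, fun ξ hξ t ht => ?_⟩
    · have := hfresh (δ - 𝔬 ε ν p (visitLine ε ν p x δ z))
        ⟨by linarith, by rw [freeFlight_add, add_sub_cancel]; exact hm⟩
      linarith
    · have hline : visitLine ε ν p x (t + δ) z = visitLine ε ν p x δ z := by
        unfold visitLine at hlt ⊢
        by_cases hs : Strikes ε (centre ε ν p x) δ z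
        · rw [if_pos hs, if_pos ⟨hs.1, hs.2.1, by linarith [hs.2.2]⟩]
        · rw [if_neg hs] at hlt ⊢
          rw [if_neg]
          rintro ⟨h1, h2, h3⟩
          exact hs ⟨h1, h2, (entryTime_mem_range hε hx h1).2.2.le.trans hlt⟩
      rw [markovLorentz_of_visit hε hg (hcons ξ hξ) hp (by linarith)]
      change (if t + δ < leaveTime _ _ (visitLine ε ν p x (t + δ) z) then _ else
        markovLorentz ε ν ξ (t + δ - leaveTime _ _ (visitLine ε ν p x (t + δ) z))
          (freeFlight (leaveTime _ _ (visitLine ε ν p x (t + δ) z))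
            (visitLine ε ν p x (t + δ) z))) = _
      rw [hline, if_neg (by linarith), add_sub_assoc,
        markovLorentz_add_of_le hε hg hξ t (by linarith) (fun s hs => by linarith [hfresh s hs]),
        freeFlight_add, add_sub_cancel]

/-! ### Measurability of the process -/

section HittingTimes

variable {X : Type*} {O : X → ℝ → Prop}

lemma exists_rat_of_isOpen (ho : ∀ x, IsOpen {s | O x s}) {x : X} (h0 : 0 ≤ s)
    (hs : O x s) (hsa : s < a) : ∃ q : ℚ, 0 ≤ (q : ℝ) ∧ s < (q : ℝ) ∧ (q : ℝ) < a ∧ O x q := by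
  obtain ⟨u, hu, hsub⟩ := exists_Ico_subset_of_mem_nhds
    (((ho x).inter isOpen_Iio).mem_nhds (⟨hs, hsa⟩ : s ∈ {s | O x s} ∩ Set.Iio a)) ⟨s + 1, by simp⟩
  obtain ⟨q, hq1, hq2⟩ := exists_rat_btwn hu
  have := hsub (⟨hq1.le, hq2⟩ : (q : ℝ) ∈ Set.Ico s u)
  exact ⟨q, h0.trans hq1.le, hq1, this.2, this.1⟩

variable [MeasurableSpace X]

lemma measurableSet_exists_time (hm : ∀ s, MeasurableSet {x | O x s})
    (ho : ∀ x, IsOpen {s | O x s}) : MeasurableSet {x | {s | 0 ≤ s ∧ O x s}.Nonempty} := by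
  have : {x | {s | 0 ≤ s ∧ O x s}.Nonempty} = ⋃ q : ℚ, {x | 0 ≤ (q : ℝ) ∧ O x q} := by
    ext x
    simp only [mem_ofPred_eq, Set.mem_iUnion]
    constructor
    · rintro ⟨s, h0, hs⟩
      obtain ⟨q, h1, -, -, h2⟩ := exists_rat_of_isOpen ho h0 hs (lt_add_one s)
      exact ⟨q, h1, h2⟩
    · rintro ⟨q, hq⟩
      exact ⟨q, hq⟩
  rw [this]
  exact MeasurableSet.iUnion fun q => (MeasurableSet.const _).inter (hm q)

lemma measurable_sInf_times (hm : ∀ s, MeasurableSet {x | O x s})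
    (ho : ∀ x, IsOpen {s | O x s}) : Measurable fun x => sInf {s | 0 ≤ s ∧ O x s} := by
  refine measurable_of_Iio fun a => ?_
  have : (fun x => sInf {s | 0 ≤ s ∧ O x s}) ⁻¹' Set.Iio a =
      (⋃ q : ℚ, {x | (0 ≤ (q : ℝ) ∧ (q : ℝ) < a) ∧ O x q}) ∪
        ({x | {s | 0 ≤ s ∧ O x s}.Nonempty}ᶜ ∩ {x | 0 < a}) := by
    ext x
    simp only [mem_preimage, Set.mem_Iio, Set.mem_union, Set.mem_iUnion, mem_ofPred_eq,
      Set.mem_inter_iff, Set.mem_compl_iff]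
    have hlb : BddBelow {s | 0 ≤ s ∧ O x s} := ⟨0, fun s hs => hs.1⟩
    constructor
    · intro h
      by_cases hne : {s | 0 ≤ s ∧ O x s}.Nonempty
      · left
        obtain ⟨s, hs, hsa⟩ := (csInf_lt_iff hlb hne).1 h
        obtain ⟨q, h1, -, h3, h2⟩ := exists_rat_of_isOpen ho hs.1 hs.2 hsa
        exact ⟨q, ⟨h1, h3⟩, h2⟩
      · right
        refine ⟨hne, ?_⟩
        rw [Set.not_nonempty_iff_eq_empty.1 hne, Real.sInf_empty] at h
        exact h
    · rintro (⟨q, ⟨h1, h2⟩, h3⟩ | ⟨h1, h2⟩)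
      · exact (csInf_le hlb ⟨h1, h3⟩).trans_lt h2
      · rw [Set.not_nonempty_iff_eq_empty.1 h1, Real.sInf_empty]; exact h2
  rw [this]
  refine (MeasurableSet.iUnion fun q => ?_).union
    ((measurableSet_exists_time hm ho).compl.inter (MeasurableSet.const _))
  exact (MeasurableSet.const _).inter (hm q)

lemma measurable_sSup_times (hm : ∀ s, MeasurableSet {x | O x s})
    (ho : ∀ x, IsOpen {s | O x s}) (hb : ∀ x, BddAbove {s | 0 ≤ s ∧ O x s}) :
    Measurable fun x => sSup {s | 0 ≤ s ∧ O x s} := by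
  refine measurable_of_Ioi fun a => ?_
  have : (fun x => sSup {s | 0 ≤ s ∧ O x s}) ⁻¹' Set.Ioi a =
      (⋃ q : ℚ, {x | (0 ≤ (q : ℝ) ∧ a < (q : ℝ)) ∧ O x q}) ∪
        ({x | {s | 0 ≤ s ∧ O x s}.Nonempty}ᶜ ∩ {x | a < 0}) := by
    ext x
    simp only [mem_preimage, Set.mem_Ioi, Set.mem_union, Set.mem_iUnion, mem_ofPred_eq,
      Set.mem_inter_iff, Set.mem_compl_iff]
    constructor
    · intro h
      by_cases hne : {s | 0 ≤ s ∧ O x s}.Nonempty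
      · left
        obtain ⟨s, hs, hsa⟩ := (lt_csSup_iff (hb x) hne).1 h
        obtain ⟨q, h1, h4, -, h2⟩ := exists_rat_of_isOpen ho hs.1 hs.2 (lt_add_one s)
        exact ⟨q, ⟨h1, hsa.trans h4⟩, h2⟩
      · right
        refine ⟨hne, ?_⟩
        rw [Set.not_nonempty_iff_eq_empty.1 hne, Real.sSup_empty] at h
        exact h
    · rintro (⟨q, ⟨h1, h2⟩, h3⟩ | ⟨h1, h2⟩)
      · exact h2.trans_le (le_csSup (hb x) ⟨h1, h3⟩)
      · rw [Set.not_nonempty_iff_eq_empty.1 h1, Real.sSup_empty]; exact h2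
  rw [this]
  refine (MeasurableSet.iUnion fun q => ?_).union
    ((measurableSet_exists_time hm ho).compl.inter (MeasurableSet.const _))
  exact (MeasurableSet.const _).inter (hm q)

end HittingTimes

section

variable {X : Type*} [MeasurableSpace X]

@[fun_prop] lemma measurable_freeFlight_comp {f : X → ℝ} {g : X → Phase} (hf : Measurable f)
    (hg : Measurable g) : Measurable fun x => freeFlight (f x) (g x) := by fun_prop

lemma measurableSet_ball_time {c : X → Plane} {y : X → Phase} (hc : Measurable c)
    (hy : Measurable y) (s) : MeasurableSet {x | (freeFlight s (y x)).1 ∈ Metric.ball (c x) ρ} :=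
  measurableSet_lt ((measurable_freeFlight_comp measurable_const hy).fst.dist hc) measurable_const

lemma isOpen_ball_time (c y) : IsOpen {s | (freeFlight s y).1 ∈ Metric.ball c ρ} :=
  Metric.isOpen_ball.preimage (by fun_prop)

lemma bddAbove_timesIn_ball (c y) : BddAbove (timesIn (Metric.ball c ρ) y) := by
  refine ⟨ρ + dist y.1 c, fun s hs => ?_⟩
  have h1 := hs.2
  rw [Metric.mem_ball] at h1
  have h2 := dist_freeFlight s 0 y
  rw [freeFlight_zero, sub_zero, abs_of_nonneg hs.1] at h2
  have := dist_triangle_right (freeFlight s y).1 y.1 c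
  linarith

@[fun_prop] lemma measurable_nearestSite (ε) : Measurable (nearestSite ε) := by
  have hr : Measurable fun a : ℝ => ((round a : ℤ) : ℝ) := by
    simp only [round_eq]
    fun_prop
  have h1 : Measurable fun x : Plane => ((round (x 1 / √ε) : ℤ) : ℝ) := hr.comp (by fun_prop)
  have : Measurable fun p : ℝ × ℝ => (√ε • !₂[p.1, p.2] : Plane) :=
    (measurable_const_smul (√ε)).comp measurePreserving_coords.measurable
  exact this.comp ((hr.comp (by fun_prop)).prodMk h1)

@[fun_prop]
lemma measurable_specular : Measurable fun p : Plane × Velocity => specular p.1 p.2 := by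
  unfold specular
  refine Measurable.subtype_mk ?_
  have h : Measurable fun p : Plane × Velocity => (p.2 : Plane) :=
      measurable_vel.comp measurable_snd
  have h1 : Measurable fun p : Plane × Velocity => ⟪p.1, (p.2 : Plane)⟫ :=
    Measurable.inner measurable_fst h
  fun_prop

@[fun_prop] lemma measurable_collisionTime {c : X → Plane} {y : X → Phase} (hc : Measurable c)
    (hy : Measurable y) : Measurable fun x => collisionTime ε (c x) (y x) :=
  measurable_sInf_times (O := fun x s => (freeFlight s (y x)).1 ∈ Metric.ball (c x) ε)
    (measurableSet_ball_time hc hy) fun _ => isOpen_ball_time _ _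

lemma measurableSet_collides {c : X → Plane} {y : X → Phase} (hc : Measurable c)
    (hy : Measurable y) : MeasurableSet {x | Collides ε (c x) (y x)} :=
  (measurableSet_le measurable_const (hy.fst.dist hc)).inter
    (measurableSet_exists_time (O := fun x s => (freeFlight s (y x)).1 ∈ Metric.ball (c x) ε)
      (measurableSet_ball_time hc hy) fun _ => isOpen_ball_time _ _)

@[fun_prop] lemma measurable_afterCollision {c : X → Plane} {y : X → Phase} (hc : Measurable c)
    (hy : Measurable y) : Measurable fun x => afterCollision ε (c x) (y x) := by
  have h := measurable_freeFlight_comp (measurable_collisionTime (ε := ε) hc hy) hy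
  exact h.fst.prodMk (measurable_specular.comp ((h.fst.sub hc).prodMk h.snd))

end

@[fun_prop] lemma measurable_flow (ε ν n) :
    Measurable fun a : (ℕ → Plane) × ℝ × Phase => flow ε ν n a.1 a.2.1 a.2.2 := by
  induction n with
  | zero => exact measurable_freeFlight_comp measurable_snd.fst measurable_snd.snd
  | succ n ih =>
    classical
    have hz : Measurable fun a : (ℕ → Plane) × ℝ × Phase => a.2.2 := by fun_prop
    have ht : Measurable fun a : (ℕ → Plane) × ℝ × Phase => a.2.1 := by fun_prop
    have hO : ∀ s : ℝ, MeasurableSet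
        {a : (ℕ → Plane) × ℝ × Phase | (freeFlight s a.2.2).1 ∈ obstacleRanges ε ν} := fun s =>
      (measurable_freeFlight_comp measurable_const hz).fst (isOpen_obstacleRanges ε ν).measurableSet
    have hO' : ∀ a : (ℕ → Plane) × ℝ × Phase,
        IsOpen {s | (freeFlight s a.2.2).1 ∈ obstacleRanges ε ν} := fun a =>
      (isOpen_obstacleRanges ε ν).preimage (by fun_prop)
    have hτ : Measurable fun a : (ℕ → Plane) × ℝ × Phase =>
        sInf (timesIn (obstacleRanges ε ν) a.2.2) := measurable_sInf_times hO hO'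
    have hy := measurable_freeFlight_comp hτ hz
    have hp := (measurable_nearestSite ε).comp hy.fst
    have hc := hp.add (((measurable_pi_apply (X := fun _ : ℕ => Plane) 0).comp
      measurable_fst).const_smul (patchRadius ε ν))
    have hct := measurable_collisionTime (ε := ε) hc hy
    have hhit := (measurableSet_collides (ε := ε) hc hy).inter (measurableSet_le hct (ht.sub hτ))
    have hw := fun d => @Measurable.ite _ _ _ _ _ _ _ d hhit
      (measurable_afterCollision (ε := ε) hc hy) hy
    have ht' := fun d => @Measurable.ite _ _ _ _ _ _ _ d hhit ((ht.sub hτ).sub hct) (ht.sub hτ)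
    have he := fun d => measurable_sSup_times (measurableSet_ball_time (ρ := rangeRadius ε ν) hp
      (hw d)) (fun _ => isOpen_ball_time _ _) fun _ => bddAbove_timesIn_ball _ _
    simp only [flow]
    refine Measurable.ite ((measurableSet_exists_time hO hO').inter (measurableSet_le hτ ht))
      (Measurable.ite (measurableSet_lt (ht' _) (he _)) (by fun_prop)
        (ih.comp (((measurable_pi_lambda _ fun k => (measurable_pi_apply (k + 1)).comp
          measurable_fst)).prodMk (((ht' _).sub (he _)).prodMk (by fun_prop))))) (by fun_prop)

@[fun_prop]
lemma measurable_step (ε ν δ) : Measurable fun a : Phase × Plane => step ε ν δ a.1 a.2 :=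
  (measurable_flow ε ν 1).comp (f := fun a : Phase × Plane => ((fun _ : ℕ => a.2), δ, a.1))
    (by fun_prop)

@[fun_prop] lemma measurable_markovLorentz (ε ν t) :
    Measurable fun a : (ℕ → Plane) × Phase => markovLorentz ε ν a.1 t a.2 :=
  (measurable_flow ε ν _).comp (measurable_fst.prodMk (measurable_const.prodMk measurable_snd))

/-! ### Independent obstacles and the transfer operator of one time step -/

@[fun_prop]
lemma measurable_consSeq : Measurable fun p : Plane × (ℕ → Plane) => consSeq p.1 p.2 := by
  refine measurable_pi_lambda _ fun k => ?_
  cases k with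
  | zero => exact measurable_fst
  | succ k => exact (measurable_pi_apply k).comp measurable_snd

lemma map_consSeq (μ : Measure Plane) [IsProbabilityMeasure μ] :
    (μ.prod 𝔭 μ).map (fun p => consSeq p.1 p.2) = 𝔭 μ := by
  refine Measure.eq_infinitePi _ fun s t ht => ?_
  have hS := MeasurableSet.pi s.countable_toSet fun i _ => ht i
  rw [Measure.map_apply measurable_consSeq hS]
  classical
  -- split the index set into `0` and the positive indices
  set s' : Finset ℕ := (s.erase 0).image Nat.pred with hs'
  have hmem : ∀ k, k ∈ s' ↔ k + 1 ∈ s := by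
    intro k
    simp only [hs', Finset.mem_image, Finset.mem_erase]
    constructor
    · rintro ⟨a, ⟨h0, ha⟩, rfl⟩
      rwa [Nat.pred_eq_sub_one, Nat.sub_add_cancel (Nat.pos_of_ne_zero h0)]
    · intro h
      exact ⟨k + 1, ⟨by omega, h⟩, rfl⟩
  have hpre : (fun p : Plane × (ℕ → Plane) => consSeq p.1 p.2) ⁻¹' Set.pi (s : Set ℕ) t =
      (if 0 ∈ s then t 0 else univ) ×ˢ Set.pi (s' : Set ℕ) fun k => t (k + 1) := by
    ext ⟨x, ξ⟩
    simp only [mem_preimage, Set.mem_pi, Finset.mem_coe, Set.mem_prod, hmem]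
    constructor
    · intro h
      refine ⟨?_, fun k hk => h (k + 1) hk⟩
      split_ifs with h0
      · exact h 0 h0
      · trivial
    · rintro ⟨h1, h2⟩ k hk
      cases k with
      | zero => rw [if_pos hk] at h1; exact h1
      | succ k => exact h2 k hk
  rw [hpre, Measure.prod_prod, Measure.infinitePi_pi _ fun i _ => ht (i + 1)]
  have hprod : ∏ i ∈ s.erase 0, μ (t i) = ∏ k ∈ s', μ (t (k + 1)) := by
    rw [hs', Finset.prod_image]
    · refine Finset.prod_congr rfl fun i hi => ?_
      rw [Nat.pred_eq_sub_one, Nat.sub_add_cancel (Nat.pos_of_ne_zero (Finset.ne_of_mem_erase hi))]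
    · intro a ha b hb hab
      have := Finset.ne_of_mem_erase ha
      have := Finset.ne_of_mem_erase hb
      simp only [Nat.pred_eq_sub_one] at hab
      omega
  rw [← hprod]
  split_ifs with h0
  · rw [Finset.mul_prod_erase s (fun i => μ (t i)) h0]
  · rw [measure_univ, one_mul, Finset.erase_eq_of_notMem h0]

open Classical in
/-- Outside the ranges the obstacle is forgotten: `H` is averaged over a fresh obstacle. -/
def refresh (μ : Measure Plane) (ε ν : ℝ) (H : Phase → Plane → ℝ) :
    Phase → Plane → ℝ := fun z x => if z.1 ∈ obstacleRanges ε ν then H z x else ∫ y, H z y ∂μ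

/-- The transfer operator of one time step, on functions of the state of the particle and of the
relative position of the obstacle in the range where the particle is. -/
def adv (μ : Measure Plane) (ε ν δ : ℝ) (H : Phase → Plane → ℝ) : Phase → Plane → ℝ :=
  refresh μ ε ν fun z x => H (step ε ν δ z x) x

/-- Measurability together with a uniform bound. -/
structure IsTame (C : ℝ) (H : Phase → Plane → ℝ) : Prop where
  measurable : Measurable (Function.uncurry H)
  bound : ∀ z x, |H z x| ≤ C

section Operators

variable {μ : Measure Plane} [IsProbabilityMeasure μ] {H : Phase → Plane → ℝ}

lemma IsTame.integrable (h : IsTame C H) (z) : Integrable (H z) μ :=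
  Integrable.of_bound (h.measurable.comp measurable_prodMk_left).aestronglyMeasurable C
    (.of_forall fun x => h.bound z x)

lemma IsTame.refresh (h : IsTame C H) : IsTame C (refresh μ ε ν H) := by
  constructor
  · have h1 : Measurable fun p : Phase × Plane => ∫ y, H p.1 y ∂μ :=
      (h.measurable.stronglyMeasurable.integral_prod_right).measurable.comp measurable_fst
    exact Measurable.ite (measurable_fst.fst (isOpen_obstacleRanges ε ν).measurableSet)
      h.measurable h1
  · intro z x
    unfold LorentzGas.refresh
    split_ifs
    · exact h.bound z x
    · have := norm_integral_le_of_norm_le_const (μ := μ) (f := H z) (C := C)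
        (.of_forall fun y => h.bound z y)
      simpa using this

lemma IsTame.comp_step (h : IsTame C H) : IsTame C fun z x => H (step ε ν δ z x) x :=
  ⟨h.measurable.comp ((measurable_step ε ν δ).prodMk measurable_snd), fun _ _ => h.bound _ _⟩

lemma IsTame.comp_freeFlight (h : IsTame C H) : IsTame C fun z x => H (freeFlight δ z) x :=
  ⟨h.measurable.comp ((measurable_freeFlight_comp measurable_const measurable_fst).prodMk
    measurable_snd), fun _ _ => h.bound _ _⟩

lemma IsTame.adv (h : IsTame C H) : IsTame C (adv μ ε ν δ H) := h.comp_step.refresh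
lemma IsTame.adv_iterate (h : IsTame C H) (n) : IsTame C ((LorentzGas.adv μ ε ν δ)^[n] H) := by
  induction n with
  | zero => exact h
  | succ n ih => rw [iterate_succ_apply']; exact ih.adv

lemma integral_refresh (z) : ∫ x, refresh μ ε ν H z x ∂μ = ∫ x, H z x ∂μ := by
  unfold refresh
  split_ifs
  · rfl
  · simp

end Operators

/-- The expectation of `g` at time `t` for the process started at `z` whose first visit finds the
obstacle at the relative position `x`. -/
def expectation (μ : Measure Plane) (ε ν : ℝ) (g : Phase → ℝ) (t : ℝ) (z : Phase)
    (x : Plane) : ℝ := ∫ ξ, g (markovLorentz ε ν (consSeq x ξ) t z) ∂(𝔭 μ)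

section Expectation

variable {μ : Measure Plane} [IsProbabilityMeasure μ] {g : Phase → ℝ}

lemma integral_expectation (hg : Measurable g) (hC : ∀ z, |g z| ≤ C) (t z) :
    ∫ x, expectation μ ε ν g t z x ∂μ = ∫ ξ, g (markovLorentz ε ν ξ t z) ∂(𝔭 μ) := by
  have hm : Measurable fun ξ => g (markovLorentz ε ν ξ t z) := by fun_prop
  conv_rhs => rw [← map_consSeq μ]
  rw [integral_map measurable_consSeq.aemeasurable hm.aestronglyMeasurable, integral_prod]
  · rfl
  · exact Integrable.of_bound (hm.comp measurable_consSeq).aestronglyMeasurable C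
      (.of_forall fun x => hC _)

lemma ae_forall_norm_lt (hμ : ∀ᵐ x ∂μ, ‖x‖ < 1) : ∀ᵐ ξ ∂(𝔭 μ), ∀ k, ‖ξ k‖ < 1 := by
  rw [ae_all_iff]
  intro k
  have hμ' : ∀ᵐ x ∂(𝔭 μ).map fun ξ => ξ k, ‖x‖ < 1 := by
    rw [(Measure.infinitePi_map_eval (fun _ : ℕ => μ) k)]; exact hμ
  exact ae_of_ae_map (measurable_pi_apply k).aemeasurable hμ'

/-- The Markov property in expectation. -/
lemma refresh_expectation_add (hμ : ∀ᵐ x ∂μ, ‖x‖ < 1) (hε : 0 < ε) (hδ : 0 < δ)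
    (hδ' : δ < gap ε ν) (hg : Measurable g) (hC : ∀ z, |g z| ≤ C) {t : ℝ} (ht : 0 ≤ t)
    (z) (hx : ‖x‖ < 1) : refresh μ ε ν (expectation μ ε ν g (t + δ)) z x =
      adv μ ε ν δ (refresh μ ε ν (expectation μ ε ν g t)) z x := by
  have hgap := hδ.trans hδ'
  by_cases h : ∃ s ∈ timesIn (obstacleRanges ε ν) z, s < δ
  · have key : ∀ x : Plane, ‖x‖ < 1 → expectation μ ε ν g (t + δ) z x =
        refresh μ ε ν (expectation μ ε ν g t) (step ε ν δ z x) x := by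
      intro x hx
      rcases markovLorentz_step hε hδ' hδ hx h with ⟨h1, h2⟩ | ⟨h1, h2⟩
      · rw [refresh, if_pos h1]
        refine integral_congr_ae ?_
        filter_upwards [ae_forall_norm_lt hμ] with ξ hξ
        rw [h2 ξ hξ t ht]
      · rw [refresh, if_neg h1, integral_expectation hg hC]
        refine integral_congr_ae ?_
        filter_upwards [ae_forall_norm_lt hμ] with ξ hξ
        rw [h2 ξ hξ t ht]
    rw [adv, refresh]
    conv_rhs => rw [refresh]
    split_ifs
    · exact key x hx
    · refine integral_congr_ae ?_
      filter_upwards [hμ] with y hy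
      exact key y hy
  · push Not at h
    obtain ⟨h1, h2⟩ := step_of_late_visit hε hgap hδ h
    have hz : z.1 ∉ obstacleRanges ε ν := fun hz => by
      have := h 0 ⟨le_rfl, by rwa [freeFlight_zero]⟩
      linarith
    rw [adv, refresh, if_neg hz]
    conv_rhs => rw [refresh, if_neg hz]
    have e1 : ∫ y, refresh μ ε ν (expectation μ ε ν g t) (step ε ν δ z y) y ∂μ =
        ∫ y, refresh μ ε ν (expectation μ ε ν g t) (freeFlight δ z) y ∂μ := by
      refine integral_congr_ae ?_
      filter_upwards [hμ] with y hy
      rw [h2 y hy]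
    rw [e1, integral_refresh, integral_expectation hg hC, integral_expectation hg hC]
    refine integral_congr_ae ?_
    filter_upwards [ae_forall_norm_lt hμ] with ξ hξ
    rw [markovLorentz_add_of_le hε hgap hξ t hδ.le h]

lemma refresh_expectation_single (hμ : ∀ᵐ x ∂μ, ‖x‖ < 1) (hε : 0 < ε) (hδ : 0 < δ)
    (hδ' : δ < gap ε ν) (g : Phase → ℝ) (z) (hx : ‖x‖ < 1) :
    refresh μ ε ν (expectation μ ε ν g δ) z x = adv μ ε ν δ (fun z _ => g z) z x := by
  have hgap := hδ.trans hδ'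
  have key : ∀ x : Plane, ‖x‖ < 1 → expectation μ ε ν g δ z x = g (step ε ν δ z x) := by
    intro x hx
    have : ∀ᵐ ξ ∂(𝔭 μ), g (markovLorentz ε ν (consSeq x ξ) δ z) = g (step ε ν δ z x) := by
      filter_upwards [ae_forall_norm_lt hμ] with ξ hξ
      have hc : ∀ k, ‖consSeq x ξ k‖ < 1 := fun k => by
        cases k with
        | zero => exact hx
        | succ k => exact hξ k
      congr 1
      by_cases hv : ∃ p, FirstVisit ε ν z p ∧ max 0 (𝔦 ε ν p z) ≤ δ
      · obtain ⟨p, hp, hpt⟩ := hv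
        rw [step_of_visit hε hgap hx hp hpt, markovLorentz_of_visit hε hgap hc hp hpt]
        change (if δ < leaveTime _ _ (visitLine ε ν p x δ z) then
            freeFlight δ (visitLine ε ν p x δ z)
          else markovLorentz ε ν ξ (δ - leaveTime _ _ (visitLine ε ν p x δ z))
            (freeFlight (leaveTime _ _ (visitLine ε ν p x δ z)) (visitLine ε ν p x δ z))) = _
        have hspec := hp.visitLine_spec hε hx (t := δ)
        have h0 := (le_max_left _ _).trans_lt hspec.2
        split_ifs with hlt
        · rfl
        · rw [markovLorentz_of_no_visit hε hgap, freeFlight_add, add_sub_cancel]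
          intro q hq
          rw [← hq.sInf_eq hε]
          have := le_csInf (hq.nonempty hε) fun s hs => (gap_le_of_exit hε hspec.1 hs).le
          linarith
      · push Not at hv
        rw [step_of_no_visit hε hgap x hv, markovLorentz_of_no_visit hε hgap _ hv]
    rw [expectation, integral_congr_ae this]
    simp
  rw [adv, refresh]
  conv_rhs => rw [refresh]
  split_ifs
  · exact key x hx
  · refine integral_congr_ae ?_
    filter_upwards [hμ] with y hy
    exact key y hy

lemma adv_congr (hμ : ∀ᵐ x ∂μ, ‖x‖ < 1) {H H' : Phase → Plane → ℝ}
    (h : ∀ z x, ‖x‖ < 1 → H z x = H' z x) (z) (hx : ‖x‖ < 1) :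
    adv μ ε ν δ H z x = adv μ ε ν δ H' z x := by
  unfold adv
  rw [refresh]
  conv_rhs => rw [refresh]
  split_ifs
  · exact h _ _ hx
  · refine integral_congr_ae ?_
    filter_upwards [hμ] with y hy
    exact h _ _ hy

/-- Expectations of the process are iterates of the transfer operator of a small time step. -/
theorem refresh_expectation_eq_iterate (hμ : ∀ᵐ x ∂μ, ‖x‖ < 1) (hε : 0 < ε) (hδ : 0 < δ)
    (hδ' : δ < gap ε ν) (hg : Measurable g) (hC : ∀ z, |g z| ≤ C) (n z) (hx : ‖x‖ < 1) :
    refresh μ ε ν (expectation μ ε ν g ((n + 1 : ℕ) * δ)) z x =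
      (adv μ ε ν δ)^[n + 1] (fun z _ => g z) z x := by
  induction n generalizing z x with
  | zero => simpa using refresh_expectation_single hμ hε hδ hδ' g z hx
  | succ n ih =>
    rw [iterate_succ_apply']
    have e : ((n + 1 + 1 : ℕ) : ℝ) * δ = (n + 1 : ℕ) * δ + δ := by push_cast; ring
    rw [e, refresh_expectation_add hμ hε hδ hδ' hg hC (by positivity) z hx]
    exact adv_congr hμ (fun z x hx => ih z hx) z hx

/-- The same for the process started with a random obstacle. -/
theorem integral_markovLorentz_eq (hμ : ∀ᵐ x ∂μ, ‖x‖ < 1) (hε : 0 < ε) (hδ : 0 < δ)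
    (hδ' : δ < gap ε ν) (hg : Measurable g) (hC : ∀ z, |g z| ≤ C) (n z) :
    ∫ ξ, g (markovLorentz ε ν ξ ((n + 1 : ℕ) * δ) z) ∂(𝔭 μ) =
      ∫ x, (adv μ ε ν δ)^[n + 1] (fun z _ => g z) z x ∂μ := by
  rw [← integral_expectation hg hC, ← integral_refresh]
  refine integral_congr_ae ?_
  filter_upwards [hμ] with y hy
  exact refresh_expectation_eq_iterate hμ hε hδ hδ' hg hC n z hy

end Expectation

/-! ### Absolute continuity of the law of the process -/

/-- Almost every phase point avoids a given graph in the coordinates along and across the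
motion. -/
lemma ae_lon_ne (c) {F : ℝ → ℝ} (hF : Measurable F) : ∀ᵐ z ∂𝔪, lon c z ≠ F (tra c z) := by
  have hm := (continuous_lon.comp (Continuous.prodMk_right c)).measurable.sub
      (hF.comp (continuous_tra.comp (Continuous.prodMk_right c)).measurable)
  have hme : MeasurableSet {z : Phase | lon c z ≠ F (tra c z)} := by
    have : {z : Phase | lon c z ≠ F (tra c z)} = (fun z => lon c z - F (tra c z)) ⁻¹' {0}ᶜ := by
      ext; simp [sub_eq_zero]
    rw [this]
    exact hm (measurableSet_singleton 0).compl
  rw [← (measurePreserving_frame c).map_eq,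
    ae_map_iff (measurePreserving_frame c).measurable.aemeasurable hme]
  have h0 : (volume : Measure (ℝ × ℝ)) {p | p.1 = F p.2} = 0 := by
    rw [Measure.volume_eq_prod, Measure.prod_apply_symm
      (show MeasurableSet {p : ℝ × ℝ | p.1 = F p.2} from
        measurableSet_eq_fun measurable_fst (hF.comp measurable_snd))]
    have : ∀ y : ℝ, volume ((fun x => (x, y)) ⁻¹' {p : ℝ × ℝ | p.1 = F p.2}) = 0 := by
      intro y
      refine Set.Subsingleton.measure_zero (fun a ha b hb => ?_) _
      simp only [mem_preimage, mem_ofPred_eq] at ha hb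
      linarith
    exact (lintegral_congr this).trans lintegral_zero
  have h1 : ∀ᵐ p ∂(volume : Measure (ℝ × ℝ)), p.1 ≠ F p.2 := by rw [ae_iff]; simpa using h0
  have h2 := Measure.quasiMeasurePreserving_fst (μ := (volume : Measure (ℝ × ℝ)))
    (ν := arcLength) |>.ae h1
  filter_upwards [h2] with p hp
  rwa [lon_frame, tra_frame]

lemma ae_entryTime_ne (ρ c s) : ∀ᵐ z ∂𝔪, entryTime ρ c z ≠ s := by
  filter_upwards [ae_lon_ne c (F := fun b => -s - √(ρ ^ 2 - b ^ 2)) (by fun_prop)] with z hz h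
  refine hz ?_
  rw [← h, entryTime, halfChord]; ring

lemma ae_leaveTime_ne (ρ c s) : ∀ᵐ z ∂𝔪, leaveTime ρ c z ≠ s := by
  filter_upwards [ae_lon_ne c (F := fun b => -s + √(ρ ^ 2 - b ^ 2)) (by fun_prop)] with z hz h
  refine hz ?_
  rw [← h, leaveTime, halfChord]; ring

section Step

lemma continuous_freeFlight_right (s) : Continuous (freeFlight s) := by fun_prop

/-- One step maps only null sets into null sets. -/
lemma quasiMeasurePreserving_step (hε : 0 < ε) (hδ : δ ≤ gap ε ν) (hg : 0 < gap ε ν)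
    (hx : ‖x‖ < 1) : Measure.QuasiMeasurePreserving (fun z => step ε ν δ z x) 𝔪 𝔪 := by
  have hm : Measurable fun z => step ε ν δ z x := by fun_prop
  refine ⟨hm, Measure.AbsolutelyContinuous.mk fun A hA h0 => ?_⟩
  rw [Measure.map_apply hm hA]
  have hsub : (fun z => step ε ν δ z x) ⁻¹' A ⊆ freeFlight δ ⁻¹' A ∪
      ⋃ p : ℤ × ℤ, (fun z => freeFlight δ (deflect ε (centre ε ν p x) z)) ⁻¹' A := by
    intro z hz
    by_cases h : ∃ p, Strikes ε (centre ε ν p x) δ z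
    · obtain ⟨p, hp⟩ := h
      refine Or.inr (Set.mem_iUnion.2 ⟨p, ?_⟩)
      rw [mem_preimage, ← step_of_strikes hε hδ hg hx hp]
      exact hz
    · push Not at h
      refine Or.inl ?_
      rw [mem_preimage, ← step_of_not_strikes hε hg hx h]
      exact hz
  refine measure_mono_null hsub (measure_union_null ?_ (measure_iUnion_null fun p => ?_))
  · rw [(measurePreserving_freeFlight δ).measure_preimage hA.nullMeasurableSet, h0]
  · have := ((measurePreserving_freeFlight δ).comp
      (measurePreserving_deflect ε (centre ε ν p x))).measure_preimage hA.nullMeasurableSet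
    exact this.trans h0

lemma step_zero_ae (hε : 0 < ε) (hg : 0 < gap ε ν) (hx : ‖x‖ < 1) :
    ∀ᵐ z ∂𝔪, step ε ν 0 z x = z := by
  have h : ∀ᵐ z ∂𝔪, ∀ p : ℤ × ℤ, entryTime ε (centre ε ν p x) z ≠ 0 :=
    ae_all_iff.2 fun p => ae_entryTime_ne _ _ _
  filter_upwards [h] with z hz
  rw [step_of_not_strikes hε hg hx, freeFlight_zero]
  exact fun p hp => hz p (le_antisymm hp.2.2 hp.2.1)

lemma markovLorentz_zero (ε ν) (ξ : ℕ → Plane) (z) :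
    markovLorentz ε ν ξ 0 z = step ε ν 0 z (ξ 0) := by
  rw [markovLorentz_def, step, zero_div, Nat.ceil_zero, zero_add]
  simp only [flow]

end Step

section Law

variable {μ : Measure Plane} [IsProbabilityMeasure μ] {H : Phase → Plane → ℝ}

lemma adv_eq_zero_ae (hμ : ∀ᵐ x ∂μ, ‖x‖ < 1) (hε : 0 < ε) (hδ : δ ≤ gap ε ν) (hg : 0 < gap ε ν)
    (hH : IsTame C H) (h : ∀ᵐ p ∂𝔪× μ, H p.1 p.2 = 0) : ∀ᵐ p ∂𝔪× μ, adv μ ε ν δ H p.1 p.2 = 0 := by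
  have hme : MeasurableSet {p : Phase × Plane | H p.1 p.2 = 0} :=
    hH.measurable (measurableSet_singleton 0)
  have hme' : MeasurableSet {p : Phase × Plane | H (step ε ν δ p.1 p.2) p.2 = 0} :=
    hH.comp_step.measurable (measurableSet_singleton 0)
  have h2 : ∀ᵐ x ∂μ, ∀ᵐ z ∂𝔪, H (step ε ν δ z x) x = 0 := by
    filter_upwards [((Measure.ae_ae_comm hme).1 (Measure.ae_ae_of_ae_prod h)), hμ] with x hx hx1
    exact (quasiMeasurePreserving_step hε hδ hg hx1).ae hx
  refine (Measure.ae_prod_iff_ae_ae (hH.adv.measurable (measurableSet_singleton 0))).2 ?_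
  filter_upwards [((Measure.ae_ae_comm hme').2 h2)] with z hz
  unfold adv refresh
  by_cases hr : z.1 ∈ obstacleRanges ε ν
  · filter_upwards [hz] with x hx
    simp [hr, hx]
  · exact Eventually.of_forall fun x => (by simp [hr, integral_congr_ae hz])

lemma markovLorentz_zero_ae (hμ : ∀ᵐ x ∂μ, ‖x‖ < 1) (hε : 0 < ε) (hg : 0 < gap ε ν) :
    ∀ᵐ z ∂𝔪, ∀ᵐ ξ ∂(𝔭 μ), markovLorentz ε ν ξ 0 z = z := by
  have hme := measurableSet_eq_fun (measurable_step ε ν 0) measurable_fst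
  have h1 : ∀ᵐ z ∂𝔪, ∀ᵐ x ∂μ, step ε ν 0 z x = z := by
    refine (Measure.ae_ae_comm hme).2 ?_
    filter_upwards [hμ] with x hx using step_zero_ae hε hg hx
  filter_upwards [h1] with z hz
  have h2 : ∀ᵐ ξ ∂(𝔭 μ), step ε ν 0 z (ξ 0) = z := by
    have := Measure.infinitePi_map_eval (fun _ : ℕ => μ) 0
    refine ae_of_ae_map (f := fun ξ : ℕ → Plane => ξ 0)
      (p := fun x => step ε ν 0 z x = z) (measurable_pi_apply 0).aemeasurable ?_
    rw [this]; exact hz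
  filter_upwards [h2] with ξ hξ
  rw [markovLorentz_zero, hξ]

/-- The law of the process started from a random point with a density has a density. -/
lemma map_markovLorentz_absolutelyContinuous (hμ : ∀ᵐ x ∂μ, ‖x‖ < 1) (hε : 0 < ε)
    (hg : 0 < gap ε ν) (ht : 0 ≤ t) {ρ : Measure Phase} [IsFiniteMeasure ρ] (hρ : ρ ≪ 𝔪) :
    (ρ.prod 𝔭 μ).map (fun p => markovLorentz ε ν p.2 t p.1) ≪ 𝔪 := by
  have hm : Measurable fun p : Phase × (ℕ → Plane) => markovLorentz ε ν p.2 t p.1 := by fun_prop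
  refine Measure.AbsolutelyContinuous.mk fun A hA h0 => ?_
  rw [Measure.map_apply hm hA]
  refine Measure.measure_prod_null (hm hA) |>.2 ?_
  refine hρ.ae_le ?_
  -- the indicator function of `A` vanishes almost everywhere, hence so does its expectation
  have hgA : Measurable (A.indicator fun _ => (1 : ℝ)) := by fun_prop
  have hC : ∀ z, |A.indicator (fun _ => (1 : ℝ)) z| ≤ 1 := fun z => by
    by_cases hz : z ∈ A <;> simp [hz]
  have hA0 : ∀ᵐ z ∂𝔪, A.indicator (fun _ => (1 : ℝ)) z = 0 := by
    filter_upwards [measure_eq_zero_iff_ae_notMem.1 h0] with z hz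
    simp [hz]
  have key : ∀ᵐ z ∂𝔪, ∫ ξ, A.indicator (fun _ => (1 : ℝ)) (markovLorentz ε ν ξ t z) ∂(𝔭 μ) = 0 := by
    rcases ht.eq_or_lt with rfl | ht
    · filter_upwards [markovLorentz_zero_ae hμ hε hg, hA0] with z hz hz0
      rw [integral_eq_zero_of_ae]
      filter_upwards [hz] with ξ hξ
      rw [hξ, hz0]; rfl
    · obtain ⟨n, hn⟩ := exists_nat_gt (t / gap ε ν)
      have hδ : 0 < t / (n + 1 : ℕ) := by positivity
      have hδ' : t / (n + 1 : ℕ) < gap ε ν := by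
        rw [div_lt_iff₀ hg] at hn
        rw [div_lt_iff₀ (by positivity)]
        push_cast
        nlinarith
      have e : t = (n + 1 : ℕ) * (t / (n + 1 : ℕ)) := by field_simp
      have h1 : ∀ m : ℕ, ∀ᵐ p ∂𝔪× μ, (adv μ ε ν (t / (n + 1 : ℕ)))^[m]
          (fun z _ => A.indicator (fun _ => (1 : ℝ)) z) p.1 p.2 = 0 := by
        have hT : IsTame 1 fun (z : Phase) (_ : Plane) => A.indicator (fun _ => (1 : ℝ)) z :=
          ⟨hgA.comp measurable_fst, fun z _ => hC z⟩
        intro m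
        induction m with
        | zero => exact Measure.quasiMeasurePreserving_fst.ae hA0
        | succ m ih =>
          simp only [iterate_succ_apply']
          exact adv_eq_zero_ae hμ hε hδ'.le hg (hT.adv_iterate m) ih
      filter_upwards [Measure.ae_ae_of_ae_prod (h1 (n + 1))] with z hz
      conv_lhs => rw [e]
      rw [integral_markovLorentz_eq hμ hε hδ hδ' hgA hC n z, integral_congr_ae hz]
      simp
  filter_upwards [key] with z hz
  have hAz : MeasurableSet {ξ : ℕ → Plane | markovLorentz ε ν ξ t z ∈ A} :=
    ((measurable_markovLorentz ε ν t).comp (f := fun ξ : ℕ → Plane => (ξ, z)) (by fun_prop)) hA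
  have : (fun ξ : ℕ → Plane => A.indicator (fun _ => (1 : ℝ)) (markovLorentz ε ν ξ t z)) =
      {ξ : ℕ → Plane | markovLorentz ε ν ξ t z ∈ A}.indicator fun _ => (1 : ℝ) := rfl
  rw [this, integral_indicator_const _ hAz, smul_eq_mul, mul_one, measureReal_def,
    ENNReal.toReal_eq_zero_iff] at hz
  exact hz.resolve_right (measure_ne_top _ _)

end Law

/-- Integrable functions are determined by their integrals against bounded continuous functions. -/
lemma ae_eq_of_forall_integral_mul_eq {X : Type*} [TopologicalSpace X] [MeasurableSpace X]
    [HasOuterApproxClosed X] [BorelSpace X] {m : Measure X} {F G : X → ℝ}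
    (hF : Integrable F m) (hG : Integrable G m)
    (h : ∀ g : X →ᵇ ℝ, ∫ z, F z * g z ∂m = ∫ z, G z * g z ∂m) : G =ᵐ[m] F := by
  set K := fun z => G z - F z with hK
  have hKi : Integrable K m := hG.sub hF
  have hfin : ∀ {f : X → ℝ}, Integrable f m →
      IsFiniteMeasure (m.withDensity fun z => ofReal (f z)) := fun hf =>
    isFiniteMeasure_withDensity_ofReal hf.2
  have := hfin hKi
  have := hfin hKi.neg
  have hint : ∀ {f : X → ℝ}, Integrable f m → ∀ g : X →ᵇ ℝ,
      ∫ z, g z ∂(m.withDensity fun z => ofReal (f z)) = ∫ z, max (f z) 0 * g z ∂m := by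
    intro f hf g
    rw [integral_withDensity_eq_integral_toReal_smul₀ hf.aemeasurable.ennreal_ofReal
      (.of_forall fun z => ENNReal.ofReal_lt_top)]
    exact integral_congr_ae (.of_forall fun z => (by simp [ENNReal.toReal_ofReal']))
  have hbdd : ∀ {f : X → ℝ}, Integrable f m → ∀ g : X →ᵇ ℝ, Integrable (fun z => f z * g z) m :=
    fun hf g => hf.mul_bdd g.continuous.measurable.aestronglyMeasurable
      (.of_forall fun z => g.norm_coe_le_norm z)
  have e : (m.withDensity fun z => ofReal (K z)) = m.withDensity fun z => ofReal ((-K) z) := by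
    refine ext_of_forall_integral_eq_of_IsFiniteMeasure fun g => ?_
    rw [hint hKi, hint hKi.neg, ← sub_eq_zero, ← integral_sub (hbdd hKi.pos_part g)
      (hbdd hKi.neg.pos_part g)]
    have : ∀ z, max (K z) 0 * g z - max ((-K) z) 0 * g z = G z * g z - F z * g z := fun z => by
      rw [← sub_mul, Pi.neg_apply, max_zero_sub_max_neg_zero_eq_self, hK]
      ring
    rw [integral_congr_ae (Eventually.of_forall this), integral_sub (hbdd hG g) (hbdd hF g),
      h, sub_self]
  filter_upwards [((withDensity_eq_iff hKi.aemeasurable.ennreal_ofReal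
    hKi.neg.aemeasurable.ennreal_ofReal (hKi.lintegral_lt_top).ne).1 e)] with z hz
  have h1 := congrArg ENNReal.toReal hz
  rw [ENNReal.toReal_ofReal', ENNReal.toReal_ofReal', Pi.neg_apply] at h1
  have h2 := max_zero_sub_max_neg_zero_eq_self (K z)
  exact sub_eq_zero.1 (by linarith)

section Transport

variable {φ : Plane → ℝ} {Ω : Type*} [MeasurableSpace Ω] {P : Measure Ω} [IsProbabilityMeasure P]
  {ξ : ℕ → Ω → Plane} {f₀ : Phase → ℝ}

/-- The law of the relative position of an obstacle. -/
def obstacleLaw (φ : Plane → ℝ) : Measure Plane :=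
  volume.withDensity fun x => ofReal (φ x)

lemma isProbabilityMeasure_obstacleLaw (hφ : IsProbDensity volume φ) :
    IsProbabilityMeasure (obstacleLaw φ) := by
  constructor
  rw [obstacleLaw, withDensity_apply _ MeasurableSet.univ, Measure.restrict_univ,
    ← ofReal_integral_eq_lintegral_ofReal hφ.integrable hφ.nonneg, hφ.integral_eq_one,
    ENNReal.ofReal_one]

lemma obstacleLaw_norm_lt (hφ : IsProbDensity volume φ)
    (hφ_supp : ∀ x : Plane, 1 ≤ ‖x‖ → φ x = 0) : ∀ᵐ x ∂obstacleLaw φ, ‖x‖ < 1 := by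
  rw [obstacleLaw, ae_withDensity_iff' hφ.integrable.aemeasurable.ennreal_ofReal]
  refine Eventually.of_forall fun x hx => ?_
  by_contra h
  exact hx (by rw [hφ_supp x (not_lt.1 h), ENNReal.ofReal_zero])

/-- The expectation in the definition of the transported density only involves the common law of
the obstacle positions. -/
lemma integral_comp_obstacles (hφ : IsProbDensity volume φ) (hξ_meas : ∀ k, Measurable (ξ k))
    (hξ_law : ∀ k, P.map (ξ k) = obstacleLaw φ) (hξ_indep : iIndepFun ξ P)
    {g : (ℕ → Plane) → ℝ} (hg : Measurable g) :
    ∫ a, g (fun k => ξ k a) ∂P = ∫ y, g y ∂𝔭 (obstacleLaw φ) := by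
  have := isProbabilityMeasure_obstacleLaw hφ
  have h := (iIndepFun_iff_map_fun_eq_infinitePi_map hξ_meas).1 hξ_indep
  simp only [hξ_law] at h
  rw [← h, integral_map (measurable_pi_lambda _ hξ_meas).aemeasurable hg.aestronglyMeasurable]

lemma measurable_comp_markovLorentz (ε ν t z) {g : Phase → ℝ} (hg : Measurable g) :
    Measurable fun y : ℕ → Plane => g (markovLorentz ε ν y t z) :=
  hg.comp ((measurable_markovLorentz ε ν t).comp (f := fun ξ => (ξ, z)) (by fun_prop))

/-- The expectation of `ψ` at the position of the Markovian Lorentz process at time `t`. -/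
def meanAt (φ : Plane → ℝ) (ε ν t : ℝ) (ψ : Phase → ℝ) (z : Phase) : ℝ :=
  ∫ ξ, ψ (markovLorentz ε ν ξ t z) ∂𝔭 (obstacleLaw φ)

section

variable {F : Phase → ENNReal}

lemma integral_withDensity_mul (hF : Measurable F) (hm : ∫𝔪 F ≠ ⊤) (g : Phase → ℝ) :
    ∫ z, g z ∂(phaseMeasure.withDensity F) = ∫ z, (F z).toReal * g z ∂𝔪 :=
  integral_withDensity_eq_integral_toReal_smul hF (ae_lt_top hF hm) g

/-- A probability density has a measurable version with values in `[0, ∞)`. -/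
lemma exists_measurable_density {f₀ : Phase → ℝ} (hf₀ : IsProbDensity 𝔪 f₀) :
    ∃ F : Phase → ENNReal, Measurable F ∧ (fun z => (F z).toReal) =ᵐ[𝔪] f₀ ∧ ∫𝔪 F = 1 := by
  have hmk := hf₀.integrable.aestronglyMeasurable
  refine ⟨fun z => ofReal (hmk.mk f₀ z),
    hmk.stronglyMeasurable_mk.measurable.ennreal_ofReal, ?_, ?_⟩
  · filter_upwards [hmk.ae_eq_mk, hf₀.nonneg] with z hz h0
    rw [toReal_ofReal (hz ▸ h0), ← hz]
  · have e : (fun z => ofReal (hmk.mk f₀ z)) =ᵐ[𝔪] fun z => ofReal (f₀ z) := by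
      filter_upwards [hmk.ae_eq_mk] with z hz
      rw [← hz]
    rw [lintegral_congr_ae e, ← ofReal_integral_eq_lintegral_ofReal hf₀.integrable hf₀.nonneg,
      hf₀.integral_eq_one, ENNReal.ofReal_one]

/-- The law at time `t` of the Markovian Lorentz process started from a random point with
density `F`. -/
def processLaw (φ : Plane → ℝ) (F : Phase → ENNReal) (ε ν t : ℝ) : Measure Phase :=
  ((phaseMeasure.withDensity F).prod 𝔭 (obstacleLaw φ)).map fun p => markovLorentz ε ν p.2 t p.1

lemma isProbabilityMeasure_withDensity (hm : ∫𝔪 F = 1) :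
    IsProbabilityMeasure (phaseMeasure.withDensity F) :=
  ⟨by rw [withDensity_apply _ MeasurableSet.univ, Measure.restrict_univ, hm]⟩

lemma isProbabilityMeasure_processLaw (hφ : IsProbDensity volume φ)
    (hm : ∫𝔪 F = 1) (ε ν t) : IsProbabilityMeasure (processLaw φ F ε ν t) := by
  have := isProbabilityMeasure_obstacleLaw hφ
  have := isProbabilityMeasure_withDensity hm
  exact Measure.isProbabilityMeasure_map (by fun_prop)

lemma integral_processLaw (hφ : IsProbDensity volume φ) (hF : Measurable F)
    (hm : ∫𝔪 F = 1) (ε ν t) {g : Phase → ℝ} (hg : Measurable g) (hC : ∀ z, |g z| ≤ C) :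
    ∫ z, g z ∂(processLaw φ F ε ν t) = ∫ z, (F z).toReal * meanAt φ ε ν t g z ∂𝔪 := by
  have := isProbabilityMeasure_obstacleLaw hφ
  have := isProbabilityMeasure_withDensity hm
  have hmeas : Measurable fun p : Phase × (ℕ → Plane) => markovLorentz ε ν p.2 t p.1 := by fun_prop
  rw [processLaw, integral_map hmeas.aemeasurable hg.aestronglyMeasurable, integral_prod,
    integral_withDensity_mul hF (by rw [hm]; exact ENNReal.one_ne_top)]
  · rfl
  · exact Integrable.of_bound (hg.comp hmeas).aestronglyMeasurable C (ae_of_all _ fun p => hC _)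

end

theorem exists_isTransported (hφ : IsProbDensity volume φ)
    (hφ_supp : ∀ x : Plane, 1 ≤ ‖x‖ → φ x = 0) (hξ_meas : ∀ k, Measurable (ξ k))
    (hξ_law : ∀ k, P.map (ξ k) = obstacleLaw φ) (hξ_indep : iIndepFun ξ P)
    (hf₀ : IsProbDensity 𝔪 f₀) (hε : 0 < ε) (hg : 0 < gap ε ν) (ht : 0 ≤ t) :
    ∃ F, IsTransported P ξ ε ν f₀ t F := by
  have := isProbabilityMeasure_obstacleLaw hφ
  obtain ⟨F, hF, hFf, hm⟩ := exists_measurable_density hf₀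
  have := isProbabilityMeasure_withDensity hm
  set κ := processLaw φ F ε ν t
  have : IsProbabilityMeasure κ := isProbabilityMeasure_processLaw hφ hm ε ν t
  have hκ : κ ≪ 𝔪 := map_markovLorentz_absolutelyContinuous
    (obstacleLaw_norm_lt hφ hφ_supp) hε hg ht (withDensity_absolutelyContinuous _ _)
  refine ⟨fun z => (κ.rnDeriv 𝔪 z).toReal, Measure.integrable_toReal_rnDeriv, fun g => ?_⟩
  have hgm : Measurable g := by fun_prop
  rw [show ∫ z, (κ.rnDeriv 𝔪 z).toReal * g z ∂𝔪 = ∫ z, g z ∂κ from integral_rnDeriv_smul hκ,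
    integral_processLaw hφ hF hm ε ν t hgm g.norm_coe_le_norm]
  refine integral_congr_ae ?_
  filter_upwards [hFf] with z hz
  rw [← hz, meanAt, integral_comp_obstacles hφ hξ_meas hξ_law hξ_indep
    (measurable_comp_markovLorentz ε ν t z hgm)]

theorem isTransported_unique {F G : Phase → ℝ} (hF : IsTransported P ξ ε ν f₀ t F)
    (hG : IsTransported P ξ ε ν f₀ t G) : G =ᵐ[𝔪] F :=
  ae_eq_of_forall_integral_mul_eq hF.1 hG.1 fun g => (hF.2 g).trans (hG.2 g).symm

end Transport

/-! ### The free phase space outside the obstacles is left invariant -/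

/-- The obstacle with centre `c` is left during the last `δ` time units of the free motion. -/
def HasLeft (ε : ℝ) (c : Plane) (δ : ℝ) (z : Phase) : Prop :=
  |tra c z| < ε ∧ -δ ≤ leaveTime ε c z ∧ leaveTime ε c z ≤ 0

/-- The phase points outside all obstacles, when these have the relative position `x`. -/
def outside (ε ν : ℝ) (x : Plane) : Set Phase := {z | ∀ p, ε ≤ dist z.1 (centre ε ν p x)}

lemma leaveTime_eq (ρ c z) : leaveTime ρ c z = entryTime ρ c z + 2 * halfChord ρ c z := by
  unfold leaveTime entryTime; ring

lemma leaveTime_deflect (ε c z) : leaveTime ε c (deflect ε c z) = entryTime ε c z := by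
  rw [leaveTime_eq, entryTime_deflect]
  unfold halfChord
  rw [tra_deflect]
  ring

lemma strikes_iff_hasLeft (ε c δ z) :
    Strikes ε c δ z ↔ HasLeft ε c δ (freeFlight δ (deflect ε c z)) := by
  rw [Strikes, HasLeft, tra_freeFlight, tra_deflect, leaveTime_freeFlight, leaveTime_deflect]
  constructor <;> rintro ⟨h1, h2, h3⟩ <;> exact ⟨h1, by linarith, by linarith⟩

lemma dist_freeFlight_leaveTime (hε : 0 < ε)
    (h : |tra c z| ≤ ε) : dist (freeFlight (leaveTime ε c z) z).1 c = ε := by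
  have h1 : dist (freeFlight (leaveTime ε c z) z).1 c ^ 2 = ε ^ 2 := by
    rw [dist_sq, lon_freeFlight, tra_freeFlight]
    have : lon c z + leaveTime ε c z = halfChord ε c z := by unfold leaveTime; ring
    rw [this, halfChord_sq h]; ring
  exact (sq_eq_sq₀ dist_nonneg hε.le).1 h1

lemma mem_ball_iff (hρ : 0 < ρ) (c z) :
    dist z.1 c < ρ ↔ |tra c z| < ρ ∧ entryTime ρ c z < 0 ∧ 0 < leaveTime ρ c z := by
  have := mem_ball_freeFlight hρ c 0 z
  rwa [freeFlight_zero, Metric.mem_ball] at this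

section Outside

/-- A particle that was at the obstacle of one range less than the gap ago is in no other range. -/
lemma eq_of_near_obstacle (hε : 0 < ε) (hx : ‖x‖ < 1)
    (hst : |s - t| ≤ gap ε ν) (hs : dist (freeFlight s z).1 (centre ε ν p x) ≤ ε)
    (ht : (freeFlight t z).1 ∈ Metric.ball (site ε q) (rangeRadius ε ν)) : p = q := by
  by_contra hpq
  have h1 := gap_lt_dist hε (Metric.mem_ball.1 (mem_range_of_dist_centre hε hx hs)).le
    (Metric.mem_ball.1 ht) hpq
  rw [dist_freeFlight] at h1
  linarith

lemma HasLeft.mem_outside (hε : 0 < ε) (hδ : δ ≤ gap ε ν) (hx : ‖x‖ < 1)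
    (h : HasLeft ε (centre ε ν p x) δ z) : z ∈ outside ε ν x := by
  intro q
  by_contra hq
  push Not at hq
  have hqz : (freeFlight 0 z).1 ∈ Metric.ball (site ε q) (rangeRadius ε ν) := by
    rw [freeFlight_zero]; exact mem_range_of_dist_centre hε hx hq.le
  have := eq_of_near_obstacle hε hx
    (by rw [sub_zero, abs_le]; constructor <;> linarith [h.2.1, h.2.2])
    (dist_freeFlight_leaveTime hε h.1.le).le hqz
  subst this
  exact absurd ((mem_ball_iff hε _ _).1 hq).2.2 (not_lt.2 h.2.2)

lemma HasLeft.unique (hε : 0 < ε) (hδ : δ ≤ gap ε ν) (hx : ‖x‖ < 1)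
    (h : HasLeft ε (centre ε ν p x) δ z) (h' : HasLeft ε (centre ε ν q x) δ z) : p = q := by
  refine eq_of_near_obstacle hε hx ?_ (dist_freeFlight_leaveTime hε h.1.le).le
    (mem_range_of_dist_centre hε hx (dist_freeFlight_leaveTime hε h'.1.le).le)
  rw [abs_le]; constructor <;> linarith [h.2.1, h.2.2, h'.2.1, h'.2.2]

lemma freeFlight_mem_outside (hε : 0 < ε) (hδ : 0 ≤ δ)
    (hz : z ∈ outside ε ν x) (h : ∀ p, ¬ Strikes ε (centre ε ν p x) δ z) :
    freeFlight δ z ∈ outside ε ν x := by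
  intro p
  by_contra hp
  push Not at hp
  obtain ⟨h1, h2, h3⟩ := (mem_ball_iff hε _ _).1 hp
  rw [tra_freeFlight] at h1
  rw [entryTime_freeFlight] at h2
  rw [leaveTime_freeFlight] at h3
  refine h p ⟨h1, ?_, by linarith⟩
  by_contra h4
  push Not at h4
  exact absurd ((mem_ball_iff hε _ _).2 ⟨h1, h4, by linarith⟩) (not_lt.2 (hz p))

lemma measurableSet_outside (ε ν) : MeasurableSet {p : Phase × Plane | p.1 ∈ outside ε ν p.2} := by
  have : {p : Phase × Plane | p.1 ∈ outside ε ν p.2} =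
      ⋂ q : ℤ × ℤ, {p : Phase × Plane | ε ≤ dist p.1.1 (centre ε ν q p.2)} := by ext; simp [outside]
  rw [this]
  refine MeasurableSet.iInter fun q => measurableSet_le measurable_const ?_
  unfold centre
  fun_prop

lemma measurable_tra (c) : Measurable (tra c) := by fun_prop

lemma measurable_entryTime (ρ c) : Measurable (entryTime ρ c) := by fun_prop

lemma measurable_leaveTime (ρ c) : Measurable (leaveTime ρ c) := by fun_prop

lemma measurableSet_hasLeft (ε c δ) : MeasurableSet {z | HasLeft ε c δ z} :=
  (measurableSet_lt (measurable_tra c).abs measurable_const).inter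
    ((measurableSet_le measurable_const (measurable_leaveTime ε c)).inter
      (measurableSet_le (measurable_leaveTime ε c) measurable_const))

lemma measurableSet_strikes (ε c δ) : MeasurableSet {z | Strikes ε c δ z} :=
  (measurableSet_lt (measurable_tra c).abs measurable_const).inter
    ((measurableSet_le measurable_const (measurable_entryTime ε c)).inter
      (measurableSet_le (measurable_entryTime ε c) measurable_const))

/-- The phase volume outside the obstacles does not increase under one step of the process: the
points reached after a reflection have just left an obstacle, and no unreflected particle arrives
there. -/
lemma setLIntegral_outside_step_le (hε : 0 < ε) (hδ0 : 0 ≤ δ) (hδ : δ ≤ gap ε ν)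
    (hg : 0 < gap ε ν) (hx : ‖x‖ < 1) {K : Phase → ENNReal} (hK : Measurable K) :
    ∫⁻ z in outside ε ν x, K (step ε ν δ z x) ∂𝔪 ≤ ∫⁻ z in outside ε ν x, K z ∂𝔪 := by
  have hO := (measurableSet_outside ε ν).preimage (f := fun z => (z, x))
      (measurable_id.prodMk measurable_const)
  set S : ℤ × ℤ → Set Phase := fun p => {z | Strikes ε (centre ε ν p x) δ z}
  set L : ℤ × ℤ → Set Phase := fun p => {z | HasLeft ε (centre ε ν p x) δ z}
  set U : Set Phase := outside ε ν x ∩ ⋂ p, (S p)ᶜ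
  have hSm : ∀ p, MeasurableSet (S p) := fun p => measurableSet_strikes _ _ _
  have hLm : ∀ p, MeasurableSet (L p) := fun p => measurableSet_hasLeft _ _ _
  have hUm : MeasurableSet U := hO.inter (MeasurableSet.iInter fun p => (hSm p).compl)
  have hmp : ∀ p, MeasurePreserving
      (fun z => freeFlight δ (deflect ε (centre ε ν p x) z)) 𝔪 𝔪 := fun p =>
    (measurePreserving_freeFlight δ).comp (measurePreserving_deflect ε (centre ε ν p x))
  calc ∫⁻ z in outside ε ν x, K (step ε ν δ z x) ∂𝔪
      = ∫⁻ z, (outside ε ν x).indicator (fun z => K (step ε ν δ z x)) z ∂𝔪 :=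
        (lintegral_indicator hO _).symm
    _ ≤ ∫⁻ z, ((∑' p, (L p).indicator K (freeFlight δ (deflect ε (centre ε ν p x) z))) +
          U.indicator (fun z => K (freeFlight δ z)) z) ∂𝔪 := by
        refine lintegral_mono fun z => ?_
        by_cases hz : z ∈ outside ε ν x
        · rw [indicator_of_mem hz]
          by_cases h : ∃ p, Strikes ε (centre ε ν p x) δ z
          · obtain ⟨p, hp⟩ := h
            rw [step_of_strikes hε hδ hg hx hp]
            refine le_add_right (le_trans ?_ (ENNReal.le_tsum p))
            rw [indicator_of_mem]
            exact (strikes_iff_hasLeft _ _ _ _).1 hp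
          · push Not at h
            rw [step_of_not_strikes hε hg hx h]
            refine le_add_left ?_
            rw [indicator_of_mem]
            exact ⟨hz, Set.mem_iInter.2 h⟩
        · rw [indicator_of_notMem hz]; exact zero_le
    _ = ∫⁻ z, ((∑' p, (L p).indicator K z) +
          U.indicator (fun z => K (freeFlight δ z)) (freeFlight (-δ) z)) ∂𝔪 := by
        have hm1 : ∀ p, Measurable fun z => (L p).indicator K
            (freeFlight δ (deflect ε (centre ε ν p x) z)) := fun p =>
          (hK.indicator (hLm p)).comp (hmp p).measurable
        have hm2 := (hK.comp (measurePreserving_freeFlight δ).measurable).indicator hUm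
        rw [lintegral_add_left (Measurable.tsum hm1),
          lintegral_add_left (Measurable.tsum fun p => hK.indicator (hLm p)),
          lintegral_tsum fun p => (hm1 p).aemeasurable,
          lintegral_tsum fun p => (hK.indicator (hLm p)).aemeasurable]
        congr 1
        · exact tsum_congr fun p => (hmp p).lintegral_comp (hK.indicator (hLm p))
        · exact ((measurePreserving_freeFlight (-δ)).lintegral_comp hm2).symm
    _ ≤ ∫⁻ z, (outside ε ν x).indicator K z ∂𝔪 := by
        have hae : ∀ᵐ z ∂𝔪, ∀ p : ℤ × ℤ, leaveTime ε (centre ε ν p x) z ≠ -δ :=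
          ae_all_iff.2 fun p => ae_leaveTime_ne _ _ _
        refine lintegral_mono_ae ?_
        filter_upwards [hae] with z hz
        by_cases h : ∃ p, z ∈ L p
        · obtain ⟨p, hp⟩ := h
          rw [tsum_eq_single p, indicator_of_mem hp, indicator_of_mem
            (HasLeft.mem_outside hε hδ hx hp), indicator_of_notMem, add_zero]
          · rintro ⟨h1, h2⟩
            obtain ⟨e1, e2, e3⟩ := hp
            have e4 := halfChord_nonneg ε (centre ε ν p x) z
            have e5 := leaveTime_eq ε (centre ε ν p x) z
            have e6 := lt_of_le_of_ne e2 (hz p).symm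
            by_cases h4 : 0 ≤ entryTime ε (centre ε ν p x) z + δ
            · refine (Set.mem_iInter.1 h2 p) ⟨?_, ?_, ?_⟩
              · rwa [tra_freeFlight]
              · rw [entryTime_freeFlight]; linarith
              · rw [entryTime_freeFlight]; linarith
            · refine absurd ((mem_ball_iff hε _ _).2 ⟨?_, ?_, ?_⟩) (not_lt.2 (h1 p))
              · rwa [tra_freeFlight]
              · rw [entryTime_freeFlight]; linarith
              · rw [leaveTime_freeFlight]; linarith
          · intro q hq
            exact indicator_of_notMem (s := L q) (fun h => hq (HasLeft.unique hε hδ hx h hp)) _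
        · push Not at h
          rw [ENNReal.tsum_eq_zero.2 fun p => indicator_of_notMem (h p) _, zero_add]
          by_cases hu : freeFlight (-δ) z ∈ U
          · have h1 := freeFlight_mem_outside hε hδ0 hu.1 fun p => Set.mem_iInter.1 hu.2 p
            rw [freeFlight_add, neg_add_cancel, freeFlight_zero] at h1
            rw [indicator_of_mem hu, indicator_of_mem h1, freeFlight_add, neg_add_cancel,
              freeFlight_zero]
          · rw [indicator_of_notMem hu]; exact zero_le
    _ = ∫⁻ z in outside ε ν x, K z ∂𝔪 := lintegral_indicator hO _

end Outside

section Contraction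

variable {μ : Measure Plane} [IsProbabilityMeasure μ] {H : Phase → Plane → ℝ}

lemma IsTame.measurable_prod (h : IsTame C H) : Measurable fun p : Phase × Plane => H p.1 p.2 :=
  h.measurable

lemma setLIntegral_refresh_le (hH : IsTame C H) {V : Set (Phase × Plane)} (hV : MeasurableSet V)
    (hVr : ∀ z : Phase, z.1 ∉ obstacleRanges ε ν → ∀ᵐ x ∂μ, (z, x) ∈ V) :
    ∫⁻ p in V, ‖refresh μ ε ν H p.1 p.2‖ₑ ∂𝔪× μ ≤ ∫⁻ p in V, ‖H p.1 p.2‖ₑ ∂𝔪× μ := by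
  have hm' := (hH.refresh (μ := μ) (ε := ε) (ν := ν)).measurable_prod.enorm
  rw [← lintegral_indicator hV, ← lintegral_indicator hV,
    lintegral_prod _ (hH.measurable_prod.enorm.indicator hV).aemeasurable,
    lintegral_prod _ (hm'.indicator hV).aemeasurable]
  refine lintegral_mono fun z => ?_
  by_cases hz : z.1 ∈ obstacleRanges ε ν
  · exact le_of_eq (lintegral_congr fun x => (by simp only [Set.indicator, refresh, if_pos hz]))
  · calc ∫⁻ x, V.indicator (fun p => ‖refresh μ ε ν H p.1 p.2‖ₑ) (z, x) ∂μ
        ≤ ∫⁻ _, ‖∫ y, H z y ∂μ‖ₑ ∂μ := by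
          refine lintegral_mono fun x => ?_
          exact (Set.indicator_le_self _ _ _).trans (by simp only [refresh, if_neg hz, le_refl])
      _ = ‖∫ y, H z y ∂μ‖ₑ := by simp
      _ ≤ ∫⁻ y, ‖H z y‖ₑ ∂μ := enorm_integral_le_lintegral_enorm _
      _ = ∫⁻ x, V.indicator (fun p => ‖H p.1 p.2‖ₑ) (z, x) ∂μ := by
          refine lintegral_congr_ae ?_
          filter_upwards [hVr z hz] with x hx
          rw [indicator_of_mem hx]

/-- The transfer operator contracts the integral over the free phase space. -/
lemma setLIntegral_adv_le (hμ : ∀ᵐ x ∂μ, ‖x‖ < 1) (hε : 0 < ε) (hδ0 : 0 ≤ δ) (hδ : δ ≤ gap ε ν)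
    (hg : 0 < gap ε ν) (hH : IsTame C H) : ∫⁻ p in {p : Phase × Plane | p.1 ∈ outside ε ν p.2},
        ‖adv μ ε ν δ H p.1 p.2‖ₑ ∂𝔪× μ ≤
      ∫⁻ p in {p : Phase × Plane | p.1 ∈ outside ε ν p.2}, ‖H p.1 p.2‖ₑ ∂𝔪× μ := by
  have hV := measurableSet_outside ε ν
  refine (setLIntegral_refresh_le hH.comp_step hV fun z hz => ?_).trans ?_
  · filter_upwards [hμ] with x hx q
    by_contra hq
    push Not at hq
    exact hz (mem_obstacleRanges.2 ⟨q, mem_range_of_dist_centre hε hx hq.le⟩)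
  · have hm := hH.measurable_prod.enorm
    rw [← lintegral_indicator hV, ← lintegral_indicator hV,
      lintegral_prod_symm _ (hm.indicator hV).aemeasurable,
      lintegral_prod_symm _ (((hH.comp_step (ε := ε) (ν := ν) (δ :=
        δ)).measurable_prod.enorm).indicator hV).aemeasurable]
    refine lintegral_mono_ae ?_
    filter_upwards [hμ] with x hx
    have hO : MeasurableSet (outside ε ν x) := hV.preimage (f := fun z => (z, x)) (by fun_prop)
    have := setLIntegral_outside_step_le hε hδ0 hδ hg hx
      (K := fun z => ‖H z x‖ₑ) (hm.comp (measurable_id.prodMk measurable_const))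
    rw [← lintegral_indicator hO, ← lintegral_indicator hO] at this
    exact this

end Contraction

/-! ### Expected numbers of strikes along a free path -/

/-- The phase points whose free path strikes the obstacle with centre `c` from outside at a time in
`[a, b]`, with an impact parameter, in units of `ε`, in the set `I`. -/
def strikeSet (ε : ℝ) (c : Plane) (I : Set ℝ) (a b : ℝ) : Set Phase :=
  {z | |tra c z| < ε ∧ tra c z / ε ∈ I ∧ a ≤ entryTime ε c z ∧ entryTime ε c z ≤ b}

/-- The phases that strike the obstacle of the index `p` displaced by `x`. -/
local notation:max "𝔰" ε:max ν:max p:max x:max => strikeSet ε (centre ε ν p x)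

/-- The expected number of strikes, with impact parameter in `I` and at times in `[a, b]`, of the
free path from `z` when the relative position of all obstacles has the law `μ`. -/
def strikeCount (μ : Measure Plane) (ε ν : ℝ) (I : Set ℝ) (a b : ℝ) (z : Phase) :
    ENNReal := ∫⁻ y, ∑' p, (𝔰 ε ν p y I a b).indicator 1 z ∂μ

open Classical in
/-- The indicator function of a strike with impact parameter in `I` during the time `δ`. -/
def hitI (ε ν : ℝ) (I : Set ℝ) (δ : ℝ) (z : Phase) (x : Plane) : ℝ :=
  if ∃ p, z ∈ 𝔰 ε ν p x I 0 δ then 1 else 0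

/-- The sum, over the first `n` time steps, of the probabilities of a strike with impact parameter
in `I` on the free path. -/
def hitSum (μ : Measure Plane) (ε ν : ℝ) (I : Set ℝ) (δ : ℝ)
    (n : ℕ) (z : Phase) : ℝ :=
  ∑ i ∈ Finset.range n, ∫ y, hitI ε ν I δ (freeFlight (i * δ) z) y ∂μ

section Strikes

variable {I : Set ℝ}

lemma strikes_iff (ε c δ z) : Strikes ε c δ z ↔ z ∈ strikeSet ε c univ 0 δ := by
  simp [Strikes, strikeSet]

lemma strikeSet_subset_univ (ε c) (I : Set ℝ) (a b) :
    strikeSet ε c I a b ⊆ strikeSet ε c univ a b := fun _ h => ⟨h.1, trivial, h.2.2⟩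

lemma freeFlight_mem_strikeSet (ε c) (I : Set ℝ) (a b s z) :
    freeFlight s z ∈ strikeSet ε c I a b ↔ z ∈ strikeSet ε c I (a + s) (b + s) := by
  simp only [strikeSet, mem_ofPred_eq, tra_freeFlight, entryTime_freeFlight, le_sub_iff_add_le,
    sub_le_iff_le_add]

@[fun_prop]
lemma continuous_centre (ε ν p) : Continuous (centre ε ν p) := by unfold centre; fun_prop

lemma measurableSet_strikeSet_prod (ε ν) (hI : MeasurableSet I) (a b p) :
    MeasurableSet {q : Phase × Plane | q.1 ∈ 𝔰 ε ν p q.2 I a b} := by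
  have hc : Continuous fun q : Phase × Plane => (centre ε ν p q.2, q.1) := by fun_prop
  have h1 := (continuous_tra.comp hc).measurable
  have h2 := ((continuous_entryTime ε).comp hc).measurable
  exact (measurableSet_lt h1.abs measurable_const).inter
    (((h1.div_const ε) hI).inter ((measurableSet_le measurable_const h2).inter
      (measurableSet_le h2 measurable_const)))

lemma measurableSet_strikeSet (ε c) (hI : MeasurableSet I) (a b) :
    MeasurableSet (strikeSet ε c I a b) :=
  (measurableSet_lt (measurable_tra c).abs measurable_const).inter
    ((((measurable_tra c).div_const ε) hI).inter
      ((measurableSet_le measurable_const (measurable_entryTime ε c)).inter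
        (measurableSet_le (measurable_entryTime ε c) measurable_const)))

lemma measurable_tsum_strikeSet (ε ν) (hI : MeasurableSet I) (a b) :
    Measurable fun q : Phase × Plane =>
      ∑' p, (𝔰 ε ν p q.2 I a b).indicator (1 : Phase → ENNReal) q.1 := by
  exact Measurable.tsum fun p => (measurable_one).indicator (measurableSet_strikeSet_prod ε ν hI a b
    p)

@[fun_prop]
lemma measurable_strikeCount (μ : Measure Plane) [SFinite μ] (ε ν) (hI : MeasurableSet I)
    (a b) : Measurable (strikeCount μ ε ν I a b) :=
  (measurable_tsum_strikeSet ε ν hI a b).lintegral_prod_right'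

lemma strikeCount_freeFlight (μ : Measure Plane) (ε ν) (I : Set ℝ) (a b s z) :
    strikeCount μ ε ν I a b (freeFlight s z) = strikeCount μ ε ν I (a + s) (b + s) z := by
  refine lintegral_congr fun y => tsum_congr fun p => ?_
  by_cases h : freeFlight s z ∈ 𝔰 ε ν p y I a b
  · rw [indicator_of_mem h, indicator_of_mem ((freeFlight_mem_strikeSet _ _ _ _ _ _ _).1 h)]; rfl
  · rw [indicator_of_notMem h, indicator_of_notMem
      (fun h' => h ((freeFlight_mem_strikeSet _ _ _ _ _ _ _).2 h'))]

lemma strikeCount_mono (μ : Measure Plane) (ε ν) (I : Set ℝ) {a' b' : ℝ} (ha : a' ≤ a)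
    (hb : b ≤ b') (z) : strikeCount μ ε ν I a b z ≤ strikeCount μ ε ν I a' b' z :=
  lintegral_mono fun y => tsum_le_tsum fun p => Set.indicator_le_indicator_of_subset
      (show 𝔰 ε ν p y I a b ⊆ 𝔰 ε ν p y I a' b' from
        fun _ h => ⟨h.1, h.2.1, ha.trans h.2.2.1, h.2.2.2.trans hb⟩) (fun _ => zero_le) _

open Classical in
/-- A time lies in no more than two of the consecutive intervals `[a + iδ, a + (i + 1)δ]`. -/
lemma sum_window_le (hδ : 0 < δ) (a e n) :
    ∑ i ∈ Finset.range n, (if a + i * δ ≤ e ∧ e ≤ a + (i + 1) * δ then (1 : ENNReal) else 0) ≤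
      if a ≤ e ∧ e ≤ a + n * δ then (if e = a + n * δ then 1 else 2) else 0 := by
  induction n with
  | zero => simp
  | succ n ih =>
    rw [Finset.sum_range_succ]
    have hn : (0 : ℝ) ≤ n * δ := by positivity
    have e1 : a + ((n + 1 : ℕ) : ℝ) * δ = a + n * δ + δ := by push_cast; ring
    have e2 : a + ((n : ℝ) + 1) * δ = a + n * δ + δ := by ring
    rw [e1, e2]
    set w := a + n * δ
    rcases lt_trichotomy e w with h | h | h
    · rw [if_neg (fun h' => absurd h'.1 (not_le.2 h)), add_zero]
      refine ih.trans ?_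
      by_cases h0 : a ≤ e
      · rw [if_pos ⟨h0, h.le⟩, if_neg h.ne, if_pos ⟨h0, by linarith⟩, if_neg (by linarith)]
      · rw [if_neg (fun h' => h0 h'.1), if_neg (fun h' => h0 h'.1)]
    · have h0 : a ≤ e := by linarith
      rw [if_pos ⟨h0, h.le⟩, if_pos h] at ih
      rw [if_pos ⟨h.ge, by linarith⟩, if_pos ⟨h0, by linarith⟩, if_neg (by linarith)]
      exact (add_le_add_left ih 1).trans (by norm_num)
    · rw [if_neg (fun h' => absurd h'.2 (not_le.2 h))] at ih
      rw [le_zero_iff.1 ih, zero_add]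
      by_cases h1 : e ≤ w + δ
      · rw [if_pos ⟨h.le, h1⟩, if_pos ⟨by linarith, h1⟩]
        split_ifs <;> norm_num
      · rw [if_neg (fun h' => h1 h'.2), if_neg (fun h' => h1 h'.2)]

lemma sum_strikeCount_le (μ : Measure Plane) [SFinite μ] (ε ν) (hI : MeasurableSet I)
    (hδ : 0 < δ) (a n z) :
    ∑ i ∈ Finset.range n, strikeCount μ ε ν I (a + i * δ) (a + (i + 1) * δ) z ≤
      2 * strikeCount μ ε ν I a (a + n * δ) z := by
  classical
  have hm : ∀ a b, Measurable fun y =>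
      ∑' p, (𝔰 ε ν p y I a b).indicator (1 : Phase → ENNReal) z := fun a b =>
    (measurable_tsum_strikeSet ε ν hI a b).comp (f := fun y => (z, y)) measurable_prodMk_left
  unfold strikeCount
  rw [← lintegral_finsetSum _ fun i _ => hm _ _, ← lintegral_const_mul _ (hm _ _)]
  refine lintegral_mono fun y => ?_
  simp only
  rw [← ENNReal.tsum_mul_left, ← Summable.tsum_finsetSum fun i _ => ENNReal.summable]
  refine tsum_le_tsum fun p => ?_
  by_cases h : |tra (centre ε ν p y) z| < ε ∧ tra (centre ε ν p y) z / ε ∈ I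
  · have e : ∀ a b, (𝔰 ε ν p y I a b).indicator (1 : Phase → ENNReal) z =
        if a ≤ entryTime ε (centre ε ν p y) z ∧ entryTime ε (centre ε ν p y) z ≤ b
          then 1 else 0 := by
      intro a b
      simp only [Set.indicator, strikeSet, mem_ofPred_eq, h.1, h.2, true_and, Pi.one_apply]
    simp only [e]
    refine (sum_window_le hδ a _ n).trans ?_
    split_ifs <;> norm_num
  · have e : ∀ a b, (𝔰 ε ν p y I a b).indicator (1 : Phase → ENNReal) z = 0 :=
      fun a b => indicator_of_notMem (fun h' => h ⟨h'.1, h'.2.1⟩) _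
    simp [e]

lemma isTame_hitI (ε ν) (hI : MeasurableSet I) (δ) : IsTame 1 (hitI ε ν I δ) := by
  constructor
  · have hs : MeasurableSet {q : Phase × Plane | ∃ p, q.1 ∈ 𝔰 ε ν p q.2 I 0 δ} := by
      have : {q : Phase × Plane | ∃ p, q.1 ∈ 𝔰 ε ν p q.2 I 0 δ} =
          ⋃ p, {q : Phase × Plane | q.1 ∈ 𝔰 ε ν p q.2 I 0 δ} := by ext; simp
      rw [this]
      exact MeasurableSet.iUnion fun p => measurableSet_strikeSet_prod ε ν hI 0 δ p
    exact Measurable.ite hs measurable_const measurable_const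
  · intro z x
    unfold hitI
    split_ifs <;> simp

lemma hitI_nonneg (ε ν) (I : Set ℝ) (δ z x) : 0 ≤ hitI ε ν I δ z x := by
  unfold hitI; split_ifs <;> simp

lemma hitSum_succ (μ : Measure Plane) (ε ν) (I : Set ℝ) (δ n z) : hitSum μ ε ν I δ (n + 1) z =
      hitSum μ ε ν I δ n (freeFlight δ z) + ∫ y, hitI ε ν I δ z y ∂μ := by
  rw [hitSum, Finset.sum_range_succ']
  congr 1
  · refine Finset.sum_congr rfl fun i _ => ?_
    rw [freeFlight_add]
    congr 3
    push_cast; ring_nf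
  · simp [freeFlight_zero]

lemma hitSum_nonneg (μ : Measure Plane) (ε ν) (I : Set ℝ) (δ n z) : 0 ≤ hitSum μ ε ν I δ n z :=
  Finset.sum_nonneg fun _ _ => integral_nonneg fun _ => hitI_nonneg _ _ _ _ _ _

@[fun_prop] lemma measurable_integral_hitI (μ : Measure Plane) [IsProbabilityMeasure μ] (ε ν)
    (hI : MeasurableSet I) (δ) : Measurable fun z => ∫ y, hitI ε ν I δ z y ∂μ :=
  ((isTame_hitI ε ν hI δ).measurable.stronglyMeasurable.integral_prod_right).measurable

@[fun_prop] lemma measurable_hitSum (μ : Measure Plane) [IsProbabilityMeasure μ] (ε ν)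
    (hI : MeasurableSet I) (δ n) : Measurable (hitSum μ ε ν I δ n) :=
  Finset.measurable_sum _ fun _ _ =>
    (measurable_integral_hitI μ ε ν hI δ).comp (continuous_freeFlight_right _).measurable

lemma ofReal_integral_hitI_le (μ : Measure Plane) [IsProbabilityMeasure μ] (ε ν)
    (hI : MeasurableSet I) (δ z) :
    ofReal (∫ y, hitI ε ν I δ z y ∂μ) ≤ strikeCount μ ε ν I 0 δ z := by
  rw [ofReal_integral_eq_lintegral_ofReal ((isTame_hitI ε ν hI δ).integrable z)
    (.of_forall fun y => hitI_nonneg _ _ _ _ _ _)]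
  refine lintegral_mono fun y => ?_
  unfold hitI
  split_ifs with h
  · obtain ⟨p, hp⟩ := h
    refine le_trans ?_ (ENNReal.le_tsum p)
    rw [indicator_of_mem hp]
    simp
  · simp

lemma ofReal_hitSum_le (μ : Measure Plane) [IsProbabilityMeasure μ] (ε ν)
    (hI : MeasurableSet I) (hδ : 0 < δ) (n z) :
    ofReal (hitSum μ ε ν I δ n z) ≤ 2 * strikeCount μ ε ν I 0 (n * δ) z := by
  have h := sum_strikeCount_le μ ε ν hI hδ 0 n z
  rw [zero_add] at h
  refine le_trans ?_ h
  rw [hitSum, ENNReal.ofReal_sum_of_nonneg fun _ _ => integral_nonneg fun _ => hitI_nonneg _ _ _ _ _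
    _]
  refine Finset.sum_le_sum fun i _ => (ofReal_integral_hitI_le μ ε ν hI δ _).trans ?_
  rw [strikeCount_freeFlight]
  refine le_of_eq ?_
  congr 1
  ring

end Strikes

/-! ### Comparison with the free motion -/

section Duhamel

variable {μ : Measure Plane} [IsProbabilityMeasure μ]

lemma IsTame.add {C' : ℝ} {H K : Phase → Plane → ℝ} (hH : IsTame C H) (hK : IsTame C' K) :
    IsTame (C + C') fun z x => H z x + K z x := ⟨hH.measurable.add hK.measurable, fun z x =>
    (abs_add_le _ _).trans (add_le_add (hH.bound z x) (hK.bound z x))⟩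

lemma IsTame.sub {C' : ℝ} {H K : Phase → Plane → ℝ} (hH : IsTame C H) (hK : IsTame C' K) :
    IsTame (C + C') fun z x => H z x - K z x := ⟨hH.measurable.sub hK.measurable, fun z x =>
    (abs_sub _ _).trans (add_le_add (hH.bound z x) (hK.bound z x))⟩

lemma IsTame.of_left {g : Phase → ℝ} (hg : Measurable g) (hC : ∀ z, |g z| ≤ C) :
    IsTame C fun z (_ : Plane) => g z := ⟨hg.comp measurable_fst, fun z _ => hC z⟩

lemma refresh_of_mem {H : Phase → Plane → ℝ} (h : z.1 ∈ obstacleRanges ε ν)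
    (x) : refresh μ ε ν H z x = H z x := if_pos h

lemma refresh_of_notMem {H : Phase → Plane → ℝ} (h : z.1 ∉ obstacleRanges ε ν)
    (x) : refresh μ ε ν H z x = ∫ y, H z y ∂μ := if_neg h

lemma refresh_sub {C' : ℝ} {H K : Phase → Plane → ℝ} (hH : IsTame C H) (hK : IsTame C' K) (z x) :
    refresh μ ε ν (fun z x => H z x - K z x) z x = refresh μ ε ν H z x - refresh μ ε ν K z x := by
  unfold refresh
  split_ifs
  · rfl
  · exact integral_sub (hH.integrable z) (hK.integrable z)

lemma abs_refresh_le (hμ : ∀ᵐ x ∂μ, ‖x‖ < 1) {H K : Phase → Plane → ℝ}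
    (hK : IsTame C K) (h : ∀ x, ‖x‖ < 1 → |H z x| ≤ K z x)
    (hx : ‖x‖ < 1) : |refresh μ ε ν H z x| ≤ refresh μ ε ν K z x := by
  unfold refresh
  split_ifs
  · exact h x hx
  · refine abs_integral_le_integral_abs.trans (integral_mono_of_nonneg
      (.of_forall fun x => abs_nonneg _) (hK.integrable z) ?_)
    filter_upwards [hμ] with y hy using h y hy

lemma refresh_const (g : Phase → ℝ) (z x) : refresh μ ε ν (fun z _ => g z) z x = g z := by
  unfold refresh
  split_ifs <;> simp

/-- The expected number of strikes of a free particle in `n` steps, given the obstacle in the range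
in which it starts. -/
def freeHits (μ : Measure Plane) (ε ν δ : ℝ) : ℕ → Phase → Plane → ℝ
  | 0 => fun _ _ => 0
  | n + 1 => refresh μ ε ν fun z x =>
      freeHits μ ε ν δ n (freeFlight δ z) x + hitI ε ν univ δ z x

lemma isTame_freeHits (ε ν δ : ℝ) (n : ℕ) : IsTame n (freeHits μ ε ν δ n) := by
  induction n with
  | zero => exact ⟨measurable_const, fun _ _ => by simp [freeHits]⟩
  | succ n ih =>
    have := (ih.comp_freeFlight (δ := δ)).add (isTame_hitI ε ν MeasurableSet.univ δ)
    have := this.refresh (μ := μ) (ε := ε) (ν := ν)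
    push_cast
    exact this

lemma freeHits_nonneg (ε ν δ n z x) : 0 ≤ freeHits μ ε ν δ n z x := by
  induction n generalizing z x with
  | zero => exact le_rfl
  | succ n ih =>
    simp only [freeHits, refresh]
    split_ifs
    · exact add_nonneg (ih _ _) (hitI_nonneg _ _ _ _ _ _)
    · exact integral_nonneg fun y => add_nonneg (ih _ _) (hitI_nonneg _ _ _ _ _ _)

lemma integral_freeHits (ε ν δ : ℝ) (n : ℕ) (z : Phase) :
    ∫ x, freeHits μ ε ν δ n z x ∂μ = hitSum μ ε ν univ δ n z := by
  induction n generalizing z with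
  | zero => simp [freeHits, hitSum]
  | succ n ih =>
    rw [hitSum_succ, ← ih]
    simp only [freeHits]
    rw [integral_refresh, integral_add ((isTame_freeHits ε ν δ n).integrable _)
      ((isTame_hitI ε ν MeasurableSet.univ δ).integrable _)]

lemma mem_range_of_strikes (hε : 0 < ε) (hx : ‖x‖ < 1)
    (hδ : δ ≤ gap ε ν) (h : z ∈ 𝔰 ε ν p x univ 0 δ)
    (hq : z.1 ∈ Metric.ball (site ε q) (rangeRadius ε ν)) : p = q := by
  refine eq_of_near_obstacle hε hx ?_
    (dist_freeFlight_entryTime hε h.1.le).le (by rwa [freeFlight_zero])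
  rw [sub_zero, abs_le]
  constructor <;> linarith [h.2.2.1, h.2.2.2]

/-- If the free path does not strike the obstacle of the range in which it starts, then only fresh
obstacles count. -/
lemma freeHits_le (hε : 0 < ε) (hδ0 : 0 ≤ δ) (hδ : δ ≤ gap ε ν) (n : ℕ) (hx : ‖x‖ < 1)
    (h : ∀ p, z.1 ∈ Metric.ball (site ε p) (rangeRadius ε ν) → |tra (centre ε ν p x) z| < ε →
      entryTime ε (centre ε ν p x) z < 0) : freeHits μ ε ν δ n z x ≤ hitSum μ ε ν univ δ n z := by
  induction n generalizing z with
  | zero => simp [freeHits, hitSum]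
  | succ n ih =>
    by_cases hz : z.1 ∈ obstacleRanges ε ν
    · rw [freeHits, refresh_of_mem hz, hitSum_succ]
      obtain ⟨q, hq⟩ := mem_obstacleRanges.1 hz
      refine add_le_add (ih fun p hp htra => ?_) ?_
      · have hpq : p = q := by
          by_contra hpq
          have := gap_lt_dist hε (Metric.mem_ball.1 hp).le (Metric.mem_ball.1 hq) hpq
          have e := dist_freeFlight δ 0 z
          rw [freeFlight_zero, sub_zero, abs_of_nonneg hδ0] at e
          linarith
        subst hpq
        rw [tra_freeFlight] at htra
        rw [entryTime_freeFlight]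
        linarith [h p hq htra]
      · have : hitI ε ν univ δ z x = 0 := by
          rw [hitI, if_neg]
          rintro ⟨p, hp⟩
          have := mem_range_of_strikes hε hx hδ hp hq
          subst this
          exact absurd (h p hq hp.1) (not_lt.2 hp.2.2.1)
        rw [this]
        exact integral_nonneg fun y => hitI_nonneg _ _ _ _ _ _
    · rw [← integral_freeHits, freeHits, refresh_of_notMem hz, integral_refresh]

section Expansion

variable {ψ : Phase → ℝ}

/-- The difference between the process and the free motion is controlled by the number of strikes
on the free path. -/
lemma abs_iterate_adv_sub_le (hμ : ∀ᵐ x ∂μ, ‖x‖ < 1) (hε : 0 < ε) (hg : 0 < gap ε ν)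
    (hψ : Measurable ψ) (hC : ∀ z, |ψ z| ≤ C) (n z) (hx : ‖x‖ < 1) :
    |(adv μ ε ν δ)^[n] (fun z _ => ψ z) z x - ψ (freeFlight (n * δ) z)| ≤
      2 * C * freeHits μ ε ν δ n z x := by
  have hC0 : 0 ≤ C := (abs_nonneg _).trans (hC (0, unitVector 0))
  have hT : IsTame C fun (z : Phase) (_ : Plane) => ψ z := IsTame.of_left hψ hC
  induction n generalizing z x with
  | zero => simp [freeFlight_zero, freeHits]
  | succ n ih =>
    rw [iterate_succ_apply']
    have hT' := (hT.adv_iterate (μ := μ) (ε := ε) (ν := ν) (δ := δ) n).comp_step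
      (ε := ε) (ν := ν) (δ := δ)
    have hF : IsTame C fun (z : Phase) (_ : Plane) => ψ (freeFlight ((n + 1 : ℕ) * δ) z) :=
      IsTame.of_left (by fun_prop) fun z => hC _
    have hK := (((isTame_freeHits (μ := μ) ε ν δ n).comp_freeFlight (δ := δ)).add
      (isTame_hitI ε ν MeasurableSet.univ δ))
    have hK2 : IsTame (2 * C * (n + 1)) fun z x => 2 * C *
        (freeHits μ ε ν δ n (freeFlight δ z) x + hitI ε ν univ δ z x) := by
      refine ⟨hK.measurable.const_mul _, fun z x => ?_⟩
      rw [abs_mul, abs_of_nonneg (by positivity)]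
      exact mul_le_mul_of_nonneg_left (hK.bound z x) (by positivity)
    have e1 : 2 * C * freeHits μ ε ν δ (n + 1) z x = refresh μ ε ν (fun z x => 2 * C *
        (freeHits μ ε ν δ n (freeFlight δ z) x + hitI ε ν univ δ z x)) z x := by
      rw [freeHits]
      unfold refresh
      split_ifs
      · rfl
      · exact (integral_const_mul _ _).symm
    rw [e1, ← refresh_const (μ := μ) (ε := ε) (ν := ν)
      (fun z => ψ (freeFlight ((n + 1 : ℕ) * δ) z)) z x]
    rw [adv, ← refresh_sub hT' hF]
    refine abs_refresh_le hμ hK2 (fun y hy => ?_) hx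
    have e2 : freeFlight ((n + 1 : ℕ) * δ) z = freeFlight (n * δ) (freeFlight δ z) := by
      rw [freeFlight_add]; congr 1; push_cast; ring
    by_cases h : ∃ p, z ∈ 𝔰 ε ν p y univ 0 δ
    · have e3 : hitI ε ν univ δ z y = 1 := if_pos h
      rw [e3]
      have h1 := (hT.adv_iterate (μ := μ) (ε := ε) (ν := ν) (δ := δ) n).bound (step ε ν δ z y) y
      have h2 := hC (freeFlight ((n + 1 : ℕ) * δ) z)
      have h3 := freeHits_nonneg (μ := μ) ε ν δ n (freeFlight δ z) y
      have h4 := mul_nonneg (mul_nonneg zero_le_two hC0) h3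
      have h5 := abs_sub ((adv μ ε ν δ)^[n] (fun z _ => ψ z) (step ε ν δ z y) y)
        (ψ (freeFlight ((n + 1 : ℕ) * δ) z))
      linarith
    · have e3 : hitI ε ν univ δ z y = 0 := if_neg h
      push Not at h
      rw [e3, add_zero, e2, step_of_not_strikes hε hg hy
          fun p hp => h p ((strikes_iff _ _ _ _).1 hp)]
      exact ih _ hy

/-- The contribution of a single collision to the transfer operator of `n` steps. -/
def oneCollision (μ : Measure Plane) (ε ν δ : ℝ) (ψ : Phase → ℝ) :
    ℕ → Phase → Plane → ℝ
  | 0 => fun _ _ => 0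
  | n + 1 => refresh μ ε ν fun z x => oneCollision μ ε ν δ ψ n (freeFlight δ z) x +
      (ψ (freeFlight (n * δ) (step ε ν δ z x)) - ψ (freeFlight (n * δ) (freeFlight δ z)))

lemma isTame_collisionIncrement (hψ : Measurable ψ) (hC : ∀ z, |ψ z| ≤ C) (s) :
    IsTame (C + C) fun z x =>
      ψ (freeFlight s (step ε ν δ z x)) - ψ (freeFlight s (freeFlight δ z)) := by
  have hF : IsTame C fun (z : Phase) (_ : Plane) => ψ (freeFlight s z) :=
    IsTame.of_left (by fun_prop) fun z => hC _
  exact (hF.comp_step).sub (hF.comp_freeFlight)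

lemma isTame_oneCollision (ε ν δ : ℝ) (hψ : Measurable ψ) (hC : ∀ z, |ψ z| ≤ C) (n : ℕ) :
    IsTame (n * (C + C)) (oneCollision μ ε ν δ ψ n) := by
  induction n with
  | zero => exact ⟨measurable_const, fun _ _ => by simp [oneCollision]⟩
  | succ n ih =>
    have := ((ih.comp_freeFlight (δ := δ)).add (isTame_collisionIncrement (ε := ε) (ν := ν)
      (δ := δ) hψ hC (n * δ))).refresh (μ := μ) (ε := ε) (ν := ν)
    have e : ((n + 1 : ℕ) : ℝ) * (C + C) = n * (C + C) + (C + C) := by push_cast; ring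
    rw [e]
    exact this

/-- The contribution of two or more collisions to the transfer operator of `n` steps. -/
def moreCollisions (μ : Measure Plane) (ε ν δ : ℝ) (ψ : Phase → ℝ) (n : ℕ)
    (z : Phase) (x : Plane) : ℝ :=
  (adv μ ε ν δ)^[n] (fun z _ => ψ z) z x - ψ (freeFlight (n * δ) z) - oneCollision μ ε ν δ ψ n z x

/-- The effect of the collisions up to step `n` on the outcome. -/
def collisionEffect (μ : Measure Plane) (ε ν δ : ℝ) (ψ : Phase → ℝ) (n : ℕ)
    (z : Phase) (x : Plane) : ℝ := (adv μ ε ν δ)^[n] (fun z _ => ψ z) z x - ψ (freeFlight (n * δ) z)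

lemma isTame_collisionEffect (ε ν δ) (hψ : Measurable ψ) (hC : ∀ z, |ψ z| ≤ C) (n) :
    IsTame (C + C) (collisionEffect μ ε ν δ ψ n) := (((IsTame.of_left hψ hC).adv_iterate n)).sub
    (IsTame.of_left (by fun_prop) fun z => hC _)

lemma isTame_moreCollisions (ε ν δ : ℝ) (hψ : Measurable ψ) (hC : ∀ z, |ψ z| ≤ C) (n : ℕ) :
    IsTame (C + C + n * (C + C)) (moreCollisions μ ε ν δ ψ n) :=
  (isTame_collisionEffect ε ν δ hψ hC n).sub (isTame_oneCollision ε ν δ hψ hC n)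

lemma moreCollisions_succ (hψ : Measurable ψ) (hC : ∀ z, |ψ z| ≤ C) (n : ℕ) :
    moreCollisions μ ε ν δ ψ (n + 1) = refresh μ ε ν fun z x =>
      moreCollisions μ ε ν δ ψ n (freeFlight δ z) x +
        (collisionEffect μ ε ν δ ψ n (step ε ν δ z x) x -
          collisionEffect μ ε ν δ ψ n (freeFlight δ z) x) := by
  have hA := ((IsTame.of_left hψ hC).adv_iterate (μ := μ) (ε := ε) (ν := ν) (δ := δ) n).comp_step
    (ε := ε) (ν := ν) (δ := δ)
  have hF : IsTame C fun (z : Phase) (_ : Plane) => ψ (freeFlight ((n + 1 : ℕ) * δ) z) :=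
    IsTame.of_left (by fun_prop) fun z => hC _
  funext z x
  unfold moreCollisions
  rw [iterate_succ_apply', oneCollision, adv, ← refresh_const (μ := μ) (ε := ε) (ν := ν)
      (fun z => ψ (freeFlight ((n + 1 : ℕ) * δ) z)) z x, ← refresh_sub hA hF,
    ← refresh_sub (hA.sub hF) (((isTame_oneCollision (μ := μ) ε ν δ hψ hC n).comp_freeFlight (δ :=
      δ)).add (isTame_collisionIncrement (ε := ε) (ν := ν) (δ := δ) hψ hC (n * δ)))]
  congr 1
  funext z x
  have e2 : freeFlight ((n + 1 : ℕ) * δ) z = freeFlight (n * δ) (freeFlight δ z) := by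
    rw [freeFlight_add]; congr 1; push_cast; ring
  unfold collisionEffect
  rw [e2]
  ring

lemma lintegral_moreCollisions_succ_le (hψ : Measurable ψ) (hC : ∀ z, |ψ z| ≤ C) (n) :
    ∫⁻ p, ‖moreCollisions μ ε ν δ ψ (n + 1) p.1 p.2‖ₑ ∂𝔪× μ ≤
      ∫⁻ p, ‖moreCollisions μ ε ν δ ψ n p.1 p.2‖ₑ ∂𝔪× μ +
      ∫⁻ p, ‖collisionEffect μ ε ν δ ψ n (step ε ν δ p.1 p.2) p.2 -
          collisionEffect μ ε ν δ ψ n (freeFlight δ p.1) p.2‖ₑ ∂𝔪× μ := by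
  have hE := isTame_moreCollisions (μ := μ) ε ν δ hψ hC n
  have hD := isTame_collisionEffect (μ := μ) ε ν δ hψ hC n
  have hD' := (hD.comp_step (ε := ε) (ν := ν) (δ := δ)).sub (hD.comp_freeFlight (δ := δ))
  have h1 := setLIntegral_refresh_le (μ := μ) (ε := ε) (ν := ν)
    ((hE.comp_freeFlight (δ := δ)).add hD')
    MeasurableSet.univ (fun z _ => Eventually.of_forall fun x => Set.mem_univ _)
  simp only [Measure.restrict_univ] at h1
  rw [moreCollisions_succ hψ hC]
  refine h1.trans ((lintegral_mono fun p => enorm_add_le _ _).trans ?_)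
  rw [lintegral_add_right _ hD'.measurable_prod.enorm]
  refine add_le_add_left (le_of_eq ?_) _
  have hm := hE.measurable_prod.enorm
  rw [lintegral_prod_symm _ hm.aemeasurable, lintegral_prod_symm _ ((hE.comp_freeFlight (δ :=
    δ)).measurable_prod.enorm).aemeasurable]
  exact lintegral_congr fun x => ((measurePreserving_freeFlight δ).lintegral_comp
    (f := fun z => ‖moreCollisions μ ε ν δ ψ n z x‖ₑ) (hm.comp (measurable_id.prodMk
      measurable_const)))

end Expansion

end Duhamel

/-! ### Two or more collisions -/

section MoreCollisions

variable {μ : Measure Plane} [IsProbabilityMeasure μ]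

lemma HasLeft.mem_strikeSet (hε : 0 < ε) (h : HasLeft ε c δ z) :
    z ∈ strikeSet ε c univ (-δ - 2 * ε) 0 := by
  have h1 := leaveTime_eq ε c z
  have h2 := halfChord_nonneg ε c z
  have h3 := halfChord_le hε.le c z
  exact ⟨h.1, trivial, by linarith [h.2.1], by linarith [h.2.2]⟩

lemma strikeCount_add_le (μ : Measure Plane) [SFinite μ] (ε ν) {I : Set ℝ}
    (hI : MeasurableSet I) (a m b z) :
    strikeCount μ ε ν I a b z ≤ strikeCount μ ε ν I a m z + strikeCount μ ε ν I m b z := by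
  have hm : ∀ a b, Measurable fun y =>
      ∑' p, (𝔰 ε ν p y I a b).indicator (1 : Phase → ENNReal) z := fun a b =>
    (measurable_tsum_strikeSet ε ν hI a b).comp (f := fun y => (z, y)) measurable_prodMk_left
  unfold strikeCount
  rw [← lintegral_add_left (hm _ _)]
  refine lintegral_mono fun y => ?_
  simp only
  rw [← ENNReal.tsum_add]
  refine tsum_le_tsum fun p => ?_
  by_cases h : z ∈ 𝔰 ε ν p y I a b
  · rw [indicator_of_mem h]
    rcases le_total (entryTime ε (centre ε ν p y) z) m with h' | h'
    · refine le_add_right ?_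
      rw [indicator_of_mem (s := 𝔰 ε ν p y I a m) ⟨h.1, h.2.1, h.2.2.1, h'⟩]
    · refine le_add_left ?_
      rw [indicator_of_mem (s := 𝔰 ε ν p y I m b) ⟨h.1, h.2.1, h', h.2.2.2⟩]
  · rw [indicator_of_notMem h]; exact zero_le

/-- The effect of a change of the obstacle-free step into a true step is carried by the phase points
that have just met an obstacle. -/
lemma lintegral_step_sub_le (hμ : ∀ᵐ x ∂μ, ‖x‖ < 1) (hε : 0 < ε) (hδ : δ ≤ gap ε ν)
    (hg : 0 < gap ε ν) {D : Phase → Plane → ℝ} (hD : IsTame C D) :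
    ∫⁻ p, ‖D (step ε ν δ p.1 p.2) p.2 - D (freeFlight δ p.1) p.2‖ₑ ∂𝔪× μ ≤
      2 * ∫⁻ x, ∫⁻ z, (∑' p, (𝔰 ε ν p x univ (-δ - 2 * ε) 0).indicator
        (1 : Phase → ENNReal) z) * ‖D z x‖ₑ ∂𝔪 ∂μ := by
  rw [lintegral_prod_symm _ ((hD.comp_step (ε := ε) (ν := ν) (δ := δ)).sub (hD.comp_freeFlight (δ :=
    δ))).measurable_prod.enorm.aemeasurable, ← lintegral_const_mul' _ _ (by norm_num)]
  refine lintegral_mono_ae ?_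
  filter_upwards [hμ] with x hx
  have hDx := hD.measurable_prod.enorm.comp (f := fun z => (z, x)) (by fun_prop)
  set G : ℤ × ℤ → Phase → ENNReal := fun p z =>
    (𝔰 ε ν p x univ (-δ - 2 * ε) 0).indicator (1 : Phase → ENNReal) z * ‖D z x‖ₑ with hG
  have hGm : ∀ p, Measurable (G p) := fun p =>
    (measurable_one.indicator (measurableSet_strikeSet _ _ MeasurableSet.univ _ _)).mul hDx
  have hmp : ∀ p, MeasurePreserving
      (fun z => freeFlight δ (deflect ε (centre ε ν p x) z)) 𝔪 𝔪 := fun p =>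
    (measurePreserving_freeFlight δ).comp (measurePreserving_deflect ε (centre ε ν p x))
  have hS := measurePreserving_freeFlight δ
  calc ∫⁻ z, ‖D (step ε ν δ z x) x - D (freeFlight δ z) x‖ₑ ∂𝔪
      ≤ ∫⁻ z, ∑' p, (G p (freeFlight δ (deflect ε (centre ε ν p x) z)) + G p (freeFlight δ z))
          ∂𝔪 := by
        refine lintegral_mono fun z => ?_
        by_cases h : ∃ p, Strikes ε (centre ε ν p x) δ z
        · obtain ⟨p, hp⟩ := h
          refine le_trans ?_ (ENNReal.le_tsum p)
          simp only [hG]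
          rw [step_of_strikes hε hδ hg hx hp, indicator_of_mem
            (((strikes_iff_hasLeft _ _ _ _).1 hp).mem_strikeSet hε), indicator_of_mem]
          · simp only [Pi.one_apply, one_mul]
            exact enorm_sub_le
          · rw [freeFlight_mem_strikeSet]
            obtain ⟨h1, h2, h3⟩ := hp
            exact ⟨h1, trivial, by linarith, by linarith⟩
        · push Not at h
          rw [step_of_not_strikes hε hg hx h, sub_self, enorm_zero]
          exact zero_le
    _ = ∑' p, (∫⁻ z, G p z ∂𝔪 + ∫⁻ z, G p z ∂𝔪) := by
        have hm2 : ∀ p, Measurable fun z =>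
            G p (freeFlight δ (deflect ε (centre ε ν p x) z)) + G p (freeFlight δ z) := by fun_prop
        rw [lintegral_tsum fun p => (hm2 p).aemeasurable]
        refine tsum_congr fun p => ?_
        refine (lintegral_add_left (by fun_prop) _).trans ?_
        congr 1
        · exact (hmp p).lintegral_comp (hGm p)
        · exact hS.lintegral_comp (hGm p)
    _ = 2 * ∫⁻ z, (∑' p, (𝔰 ε ν p x univ (-δ - 2 * ε) 0).indicator
        (1 : Phase → ENNReal) z) * ‖D z x‖ₑ ∂𝔪 := by
        simp only [← two_mul]
        rw [ENNReal.tsum_mul_left, ← lintegral_tsum fun p => (hGm p).aemeasurable]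
        congr 1
        exact lintegral_congr fun z => ENNReal.tsum_mul_right

lemma dist_step_le (hε : 0 < ε) (hδ0 : 0 ≤ δ) (hδ : δ ≤ gap ε ν) (hg : 0 < gap ε ν)
    (hx : ‖x‖ < 1) (z) : dist (step ε ν δ z x).1 z.1 ≤ δ + 2 * ε := by
  by_cases h : ∃ p, Strikes ε (centre ε ν p x) δ z
  · obtain ⟨p, hp⟩ := h
    rw [step_of_strikes hε hδ hg hx hp]
    obtain ⟨h1, h2, h3⟩ := hp
    set c := centre ε ν p x
    set e := entryTime ε c z
    have d1 := dist_freeFlight_entryTime hε h1.le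
    have d2 := dist_deflect hε h1.le
    have d3 := dist_freeFlight δ e (deflect ε c z)
    have d4 := dist_freeFlight e 0 z
    rw [freeFlight_zero, sub_zero, abs_of_nonneg h2] at d4
    rw [abs_of_nonneg (by linarith)] at d3
    have t1 := dist_triangle (freeFlight δ (deflect ε c z)).1 (freeFlight e (deflect ε c z)).1 z.1
    have t2 := dist_triangle (freeFlight e (deflect ε c z)).1 c z.1
    have t3 := dist_triangle c (freeFlight e z).1 z.1
    rw [dist_comm] at d1
    linarith
  · push Not at h
    rw [step_of_not_strikes hε hg hx h]
    have d4 := dist_freeFlight δ 0 z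
    rw [freeFlight_zero, sub_zero, abs_of_nonneg hδ0] at d4
    linarith

variable {ψ : Phase → ℝ}

lemma norm_fst_le_of_dist {y : Phase} {d : ℝ} (h : dist y.1 z.1 ≤ d) : ‖z.1‖ ≤ ‖y.1‖ + d := by
  have := norm_le_norm_add_norm_sub' z.1 y.1
  rw [dist_comm, dist_eq_norm] at h
  linarith

lemma norm_freeFlight_fst_le (s z) : ‖z.1‖ ≤ ‖(freeFlight s z).1‖ + |s| := by
  refine norm_fst_le_of_dist (le_of_eq ?_)
  have d4 := dist_freeFlight s 0 z
  rwa [freeFlight_zero, sub_zero] at d4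

lemma collisionEffect_eq_zero (hμ : ∀ᵐ x ∂μ, ‖x‖ < 1) (hε : 0 < ε) (hδ0 : 0 ≤ δ)
    (hδ : δ ≤ gap ε ν) (hg : 0 < gap ε ν) (hεδ : 2 * ε ≤ δ) (hA : ∀ z : Phase, A < ‖z.1‖ → ψ z = 0)
    (n : ℕ) (hz : A + 2 * (n * δ) < ‖z.1‖) (hx : ‖x‖ < 1) :
    collisionEffect μ ε ν δ ψ n z x = 0 := by
  have key : (adv μ ε ν δ)^[n] (fun z _ => ψ z) z x = 0 := by
    induction n generalizing z x with
    | zero => simpa using hA z (by simpa using hz)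
    | succ n ih =>
      rw [iterate_succ_apply']
      have h : ∀ y : Plane, ‖y‖ < 1 →
          (adv μ ε ν δ)^[n] (fun z _ => ψ z) (step ε ν δ z y) y = 0 := fun y hy => by
        refine ih ?_ hy
        have := norm_fst_le_of_dist (dist_step_le hε hδ0 hδ hg hy z)
        push_cast at hz
        linarith
      rw [adv, refresh]
      split_ifs
      · exact h x hx
      · refine integral_eq_zero_of_ae ?_
        filter_upwards [hμ] with y hy using h y hy
  rw [collisionEffect, key, hA, sub_zero]
  have h1 := norm_freeFlight_fst_le (n * δ) z
  have h2 : 0 ≤ n * δ := by positivity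
  rw [abs_of_nonneg h2] at h1
  linarith

/-- The phase points with position at distance no more than `ρ` from the origin. -/
def slab (ρ : ℝ) : Set Phase := {z | ‖z.1‖ ≤ ρ}

lemma measurableSet_slab (ρ) : MeasurableSet (slab ρ) :=
  measurableSet_le measurable_fst.norm measurable_const

lemma lintegral_collisionEffect_step_le (hμ : ∀ᵐ x ∂μ, ‖x‖ < 1) (hε : 0 < ε)
    (hδ : δ + 2 * ε ≤ gap ε ν) (hεδ : 2 * ε ≤ δ) (hψ : Measurable ψ) (hC : ∀ z, |ψ z| ≤ C)
    (hA : ∀ z : Phase, A < ‖z.1‖ → ψ z = 0) (n : ℕ) (hn : n * δ ≤ h) :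
    ∫⁻ p, ‖collisionEffect μ ε ν δ ψ n (step ε ν δ p.1 p.2) p.2 -
          collisionEffect μ ε ν δ ψ n (freeFlight δ p.1) p.2‖ₑ ∂𝔪× μ ≤
      ofReal (8 * C) * ∫⁻ z in slab (A + 2 * h),
        strikeCount μ ε ν univ (-(2 * δ)) 0 z * strikeCount μ ε ν univ 0 h z ∂𝔪 := by
  have hC0 : 0 ≤ C := (abs_nonneg _).trans (hC (0, unitVector 0))
  have hδ0 : 0 < δ := by linarith
  have hδg : δ ≤ gap ε ν := by linarith
  have hg : 0 < gap ε ν := by linarith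
  refine (lintegral_step_sub_le hμ hε hδg hg (isTame_collisionEffect ε ν δ hψ hC n)).trans ?_
  set w : Phase × Plane → ENNReal := fun q => ∑' p, (𝔰 ε ν p q.2 univ (-δ - 2 * ε) 0).indicator
        (1 : Phase → ENNReal) q.1 with hw
  have hwm : Measurable w := measurable_tsum_strikeSet ε ν MeasurableSet.univ _ _
  set k : Phase → ENNReal := (slab (A + 2 * h)).indicator
    fun z => ofReal (4 * C) * strikeCount μ ε ν univ 0 h z with hk
  have hkm : Measurable k := ((measurable_strikeCount μ ε ν MeasurableSet.univ 0 h).const_mul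
    _).indicator (measurableSet_slab _)
  have h1 : ∫⁻ x, ∫⁻ z, w (z, x) * ‖collisionEffect μ ε ν δ ψ n z x‖ₑ ∂𝔪 ∂μ ≤
      ∫⁻ x, ∫⁻ z, w (z, x) * k z ∂𝔪 ∂μ := by
    refine lintegral_mono_ae ?_
    filter_upwards [hμ] with x hx
    have hae : ∀ᵐ z ∂𝔪, ∀ p : ℤ × ℤ, entryTime ε (centre ε ν p x) z ≠ 0 :=
      ae_all_iff.2 fun p => ae_entryTime_ne _ _ _
    refine lintegral_mono_ae ?_
    filter_upwards [hae] with z hz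
    by_cases hp : ∃ p, z ∈ 𝔰 ε ν p x univ (-δ - 2 * ε) 0
    · refine mul_le_mul_right ?_ _
      obtain ⟨p, hp⟩ := hp
      by_cases hzs : z ∈ slab (A + 2 * h)
      · rw [hk, indicator_of_mem hzs]
        have e2 : freeHits μ ε ν δ n z x ≤ hitSum μ ε ν univ δ n z := by
          refine freeHits_le hε hδ0.le hδg n hx fun q hq htra => ?_
          have : p = q := eq_of_near_obstacle hε hx (s := entryTime ε (centre ε ν p x) z) (t := 0)
            (by rw [sub_zero, abs_le]; constructor <;> linarith [hp.2.2.1, hp.2.2.2])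
            (dist_freeFlight_entryTime hε hp.1.le).le (by rwa [freeFlight_zero])
          subst this
          exact lt_of_le_of_ne hp.2.2.2 (hz p)
        have e3 : ‖collisionEffect μ ε ν δ ψ n z x‖ₑ ≤
            ofReal (2 * C * hitSum μ ε ν univ δ n z) := by
          rw [Real.enorm_eq_ofReal_abs]
          exact ofReal_le_ofReal ((abs_iterate_adv_sub_le (δ := δ) hμ hε hg hψ hC n z hx).trans
            (mul_le_mul_of_nonneg_left e2 (by positivity)))
        refine e3.trans ?_
        rw [ofReal_mul (by positivity)]
        refine (mul_le_mul_right (ofReal_hitSum_le μ ε ν MeasurableSet.univ hδ0 n z) _).trans ?_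
        rw [← mul_assoc, show (4 : ℝ) * C = 2 * C * 2 by ring, ofReal_mul (p := 2 * C)
          (by positivity), ENNReal.ofReal_ofNat]
        exact mul_le_mul_right (strikeCount_mono μ ε ν _ le_rfl hn z) _
      · rw [collisionEffect_eq_zero hμ hε hδ0.le hδg hg hεδ hA n _ hx]
        · simp
        · simp only [slab, mem_ofPred_eq, not_le] at hzs
          linarith
    · push Not at hp
      have : w (z, x) = 0 := ENNReal.tsum_eq_zero.2 fun p => indicator_of_notMem (hp p) _
      rw [this, zero_mul, zero_mul]
  have h2 : ∫⁻ x, ∫⁻ z, w (z, x) * k z ∂𝔪 ∂μ =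
      ∫⁻ z, strikeCount μ ε ν univ (-δ - 2 * ε) 0 z * k z ∂𝔪 := by
    rw [lintegral_lintegral_swap
      ((hwm.comp measurable_swap).mul (hkm.comp measurable_snd)).aemeasurable]
    exact lintegral_congr fun z => (lintegral_mul_const _ (hwm.comp (f := fun x => (z, x))
      measurable_prodMk_left))
  refine (mul_le_mul_right (h1.trans h2.le) _).trans ?_
  rw [← lintegral_indicator (measurableSet_slab _), ← lintegral_const_mul' _ _ (by norm_num),
    ← lintegral_const_mul' _ _ ofReal_ne_top]
  refine lintegral_mono fun z => ?_
  simp only [hk]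
  by_cases hzs : z ∈ slab (A + 2 * h)
  · rw [indicator_of_mem hzs, indicator_of_mem hzs, show (8 : ℝ) * C = 2 * (4 * C) by ring,
      ofReal_mul (p := 2) (by positivity),
      ENNReal.ofReal_ofNat, mul_assoc, ← mul_assoc (strikeCount _ _ _ _ _ _ _),
      mul_comm (strikeCount _ _ _ _ _ _ _) (ofReal _), mul_assoc]
    exact mul_le_mul_right (mul_le_mul_right (mul_le_mul_left
      (strikeCount_mono μ ε ν _ (by linarith) le_rfl z) _) _) _
  · rw [indicator_of_notMem hzs, indicator_of_notMem hzs]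
    simp

lemma lintegral_moreCollisions_le_sum (hψ : Measurable ψ) (hC : ∀ z, |ψ z| ≤ C) (n) :
    ∫⁻ p, ‖moreCollisions μ ε ν δ ψ n p.1 p.2‖ₑ ∂𝔪× μ ≤
      ∑ l ∈ Finset.range n, ∫⁻ p, ‖collisionEffect μ ε ν δ ψ l (step ε ν δ p.1 p.2) p.2 -
          collisionEffect μ ε ν δ ψ l (freeFlight δ p.1) p.2‖ₑ ∂𝔪× μ := by
  induction n with
  | zero => simp [moreCollisions, oneCollision, freeFlight_zero]
  | succ n ih =>
    rw [Finset.sum_range_succ]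
    exact (lintegral_moreCollisions_succ_le hψ hC n).trans (add_le_add_left ih _)

/-- The contribution of two or more collisions is controlled by the second moment of the number of
strikes on the free path. -/
theorem lintegral_moreCollisions_le (hμ : ∀ᵐ x ∂μ, ‖x‖ < 1) (hε : 0 < ε)
    (hδ : δ + 2 * ε ≤ gap ε ν) (hεδ : 2 * ε ≤ δ) (hψ : Measurable ψ) (hC : ∀ z, |ψ z| ≤ C)
    (hA : ∀ z : Phase, A < ‖z.1‖ → ψ z = 0) (n : ℕ) (hn : n * δ = h) (hδh : δ ≤ h) :
    ∫⁻ p, ‖moreCollisions μ ε ν δ ψ n p.1 p.2‖ₑ ∂𝔪× μ ≤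
      ofReal (32 * C) * ∫⁻ z in slab (A + 5 * h), strikeCount μ ε ν univ 0 (4 * h) z ^ 2 ∂𝔪 := by
  have hC0 : 0 ≤ C := (abs_nonneg _).trans (hC (0, unitVector 0))
  have hδ0 : 0 < δ := by linarith
  have hsc : ∀ a b, Measurable (strikeCount μ ε ν univ a b) := fun a b =>
    measurable_strikeCount μ ε ν MeasurableSet.univ a b
  -- the terms with different numbers of steps are shifted to disjoint time windows
  have hshift : ∀ l : ℕ, l < n → ∫⁻ z in slab (A + 2 * h),
      strikeCount μ ε ν univ (-(2 * δ)) 0 z * strikeCount μ ε ν univ 0 h z ∂𝔪 ≤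
      ∫⁻ z in slab (A + 3 * h),
        (strikeCount μ ε ν univ (-(2 * δ) + l * δ) (-(2 * δ) + (l + 1) * δ) z +
          strikeCount μ ε ν univ (-δ + l * δ) (-δ + (l + 1) * δ) z) *
          strikeCount μ ε ν univ (-(2 * h)) (2 * h) z ∂𝔪 := by
    intro l hl
    have hlh : l * δ ≤ h := by
      rw [← hn]
      exact mul_le_mul_of_nonneg_right (by exact_mod_cast hl.le) hδ0.le
    have hl0 : 0 ≤ l * δ := by positivity
    have hm2 : Measurable ((slab (A + 2 * h)).indicator fun z =>
        strikeCount μ ε ν univ (-(2 * δ)) 0 z * strikeCount μ ε ν univ 0 h z) :=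
      ((hsc _ _).mul (hsc _ _)).indicator (measurableSet_slab _)
    rw [← lintegral_indicator (measurableSet_slab _), ← lintegral_indicator (measurableSet_slab _),
      ← (measurePreserving_freeFlight (l * δ)).lintegral_comp hm2]
    refine lintegral_mono fun z => ?_
    by_cases hz : freeFlight (l * δ) z ∈ slab (A + 2 * h)
    · have hz' : z ∈ slab (A + 3 * h) := by
        have := norm_freeFlight_fst_le (l * δ) z
        rw [abs_of_nonneg hl0] at this
        simp only [slab, mem_ofPred_eq] at hz ⊢
        linarith
      rw [indicator_of_mem hz, indicator_of_mem hz', strikeCount_freeFlight, strikeCount_freeFlight]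
      refine mul_le_mul' ?_ (strikeCount_mono μ ε ν _ (by linarith) (by linarith) z)
      refine (strikeCount_add_le μ ε ν MeasurableSet.univ _ (-δ + l * δ) _ z).trans (le_of_eq ?_)
      congr 2 <;> ring
    · rw [indicator_of_notMem hz]; exact zero_le
  have hsum : ∫⁻ p, ‖moreCollisions μ ε ν δ ψ n p.1 p.2‖ₑ ∂𝔪× μ ≤
      ofReal (8 * C) * ∫⁻ z in slab (A + 3 * h),
        4 * strikeCount μ ε ν univ (-(2 * h)) (2 * h) z ^ 2 ∂𝔪 := by
    refine (lintegral_moreCollisions_le_sum hψ hC n).trans ?_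
    refine (Finset.sum_le_sum (g := fun l : ℕ => ofReal (8 * C) * ∫⁻ z in slab (A + 3 * h),
        (strikeCount μ ε ν univ (-(2 * δ) + l * δ) (-(2 * δ) + (l + 1) * δ) z +
          strikeCount μ ε ν univ (-δ + l * δ) (-δ + (l + 1) * δ) z) *
          strikeCount μ ε ν univ (-(2 * h)) (2 * h) z ∂𝔪) fun l hl => ?_).trans ?_
    · rw [Finset.mem_range] at hl
      have hlh : l * δ ≤ h := by
        rw [← hn]
        exact mul_le_mul_of_nonneg_right (by exact_mod_cast hl.le) hδ0.le
      exact (lintegral_collisionEffect_step_le hμ hε hδ hεδ hψ hC hA l hlh).trans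
        (mul_le_mul_right (hshift l hl) _)
    · have hm2 : ∀ l : ℕ, Measurable fun z =>
          (strikeCount μ ε ν univ (-(2 * δ) + l * δ) (-(2 * δ) + (l + 1) * δ) z +
            strikeCount μ ε ν univ (-δ + l * δ) (-δ + (l + 1) * δ) z) *
            strikeCount μ ε ν univ (-(2 * h)) (2 * h) z := by fun_prop
      rw [← Finset.mul_sum, ← lintegral_finsetSum _ fun l _ => hm2 l]
      refine mul_le_mul_right (lintegral_mono fun z => ?_) _
      simp only
      rw [← Finset.sum_mul, Finset.sum_add_distrib, sq, ← mul_assoc]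
      refine mul_le_mul_left ?_ _
      have b1 := (sum_strikeCount_le μ ε ν MeasurableSet.univ hδ0 (-(2 * δ)) n z).trans
        (mul_le_mul_right (strikeCount_mono μ ε ν univ (a' := -(2 * h)) (b' := 2 * h)
          (by linarith) (by linarith) z) 2)
      have b2 := (sum_strikeCount_le μ ε ν MeasurableSet.univ hδ0 (-δ) n z).trans
        (mul_le_mul_right (strikeCount_mono μ ε ν univ (a' := -(2 * h)) (b' := 2 * h)
          (by linarith) (by linarith) z) 2)
      refine (add_le_add b1 b2).trans (le_of_eq ?_)
      rw [← add_mul]; norm_num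
  refine hsum.trans ?_
  rw [lintegral_const_mul' _ _ (by norm_num), ← mul_assoc,
    show (32 : ℝ) * C = 8 * C * 4 by ring, ofReal_mul (p := 8 * C) (by positivity),
    ENNReal.ofReal_ofNat]
  refine mul_le_mul_right ?_ _
  rw [← lintegral_indicator (measurableSet_slab _), ← lintegral_indicator (measurableSet_slab _),
      ← (measurePreserving_freeFlight (2 * h)).lintegral_comp
        (((hsc _ _).pow_const 2).indicator (measurableSet_slab _))]
  refine lintegral_mono fun z => ?_
  by_cases hz : freeFlight (2 * h) z ∈ slab (A + 3 * h)
  · have hz' : z ∈ slab (A + 5 * h) := by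
      have := norm_freeFlight_fst_le (2 * h) z
      rw [abs_of_nonneg (by linarith)] at this
      simp only [slab, mem_ofPred_eq] at hz ⊢
      linarith
    rw [indicator_of_mem hz, indicator_of_mem hz', strikeCount_freeFlight]
    refine le_of_eq ?_
    congr 2 <;> ring
  · rw [indicator_of_notMem hz]; exact zero_le

end MoreCollisions

/-! ### Exactly one collision -/

section OneCollision

variable {μ : Measure Plane} [IsProbabilityMeasure μ] {ψ : Phase → ℝ}

/-- If a collision with impact parameter in `I k` changes the outcome by `a k`, up to an error `η`,
then the effect of a single collision is determined by the probabilities of the strikes. -/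
lemma abs_integral_oneCollision_sub_le {κ : Type*} [Fintype κ] {I : κ → Set ℝ}
    (hI : ∀ k, MeasurableSet (I k))
    (hpart : ∀ σ : ℝ, |σ| < 1 → ∃ k, σ ∈ I k ∧ ∀ k', σ ∈ I k' → k' = k)
    (hμ : ∀ᵐ x ∂μ, ‖x‖ < 1) (hε : 0 < ε) (hδ : δ ≤ gap ε ν) (hg : 0 < gap ε ν)
    (hψ : Measurable ψ) (hC : ∀ z, |ψ z| ≤ C) {a : κ → ℝ} {η : ℝ} (n : ℕ)
    (h : ∀ i : ℕ, i < n → ∀ p k, ∀ y : Plane, ‖y‖ < 1 → freeFlight (i * δ) z ∈ 𝔰 ε ν p y (I k) 0 δ →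
      |ψ (freeFlight (n * δ) (deflect ε (centre ε ν p y) z)) -
          ψ (freeFlight (n * δ) z) - a k| ≤ η) :
    |∫ y, oneCollision μ ε ν δ ψ n z y ∂μ - ∑ k, a k * hitSum μ ε ν (I k) δ n z| ≤
      η * hitSum μ ε ν univ δ n z := by
  classical
  induction n generalizing z with
  | zero => simp [oneCollision, hitSum]
  | succ n ih =>
    have e2 : freeFlight ((n + 1 : ℕ) * δ) z = freeFlight (n * δ) (freeFlight δ z) := by
      rw [freeFlight_add]; congr 1; push_cast; ring
    have e3 : ∀ c, freeFlight ((n + 1 : ℕ) * δ) (deflect ε c z) =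
        freeFlight (n * δ) (freeFlight δ (deflect ε c z)) := fun c => by
      rw [freeFlight_add]; congr 1; push_cast; ring
    have hJ := isTame_oneCollision (μ := μ) ε ν δ hψ hC n
    have hT := isTame_collisionIncrement (ε := ε) (ν := ν) (δ := δ) hψ hC (n * δ)
    simp only [hitSum_succ, oneCollision]
    rw [integral_refresh, integral_add (hJ.integrable _) (hT.integrable z)]
    have h1 := ih (z := freeFlight δ z) fun i hi p k y hy hm => by
      rw [freeFlight_add] at hm
      have h' := h (i + 1) (by omega) p k y hy (by convert hm using 2; push_cast; ring)
      rwa [e2, e3, ← deflect_freeFlight] at h'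
    have hHi : ∀ J, MeasurableSet J → Integrable (hitI ε ν J δ z) μ := fun J hJ =>
      (isTame_hitI ε ν hJ δ).integrable z
    have h2 : |∫ y, (ψ (freeFlight (n * δ) (step ε ν δ z y)) -
          ψ (freeFlight (n * δ) (freeFlight δ z))) ∂μ -
        ∑ k, a k * ∫ y, hitI ε ν (I k) δ z y ∂μ| ≤ η * ∫ y, hitI ε ν univ δ z y ∂μ := by
      have hsum : ∑ k, a k * ∫ y, hitI ε ν (I k) δ z y ∂μ =
          ∫ y, ∑ k, a k * hitI ε ν (I k) δ z y ∂μ := by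
        rw [integral_finsetSum _ fun k _ => (hHi _ (hI k)).const_mul _]
        exact Finset.sum_congr rfl fun k _ => (integral_const_mul _ _).symm
      rw [hsum, ← integral_sub (hT.integrable z)
        (integrable_finsetSum _ fun k _ => (hHi _ (hI k)).const_mul _), ← integral_const_mul]
      refine abs_integral_le_integral_abs.trans (integral_mono_of_nonneg
        (Eventually.of_forall fun x => abs_nonneg _) ((hHi _ MeasurableSet.univ).const_mul _) ?_)
      filter_upwards [hμ] with y hy
      by_cases hs : ∃ p, Strikes ε (centre ε ν p y) δ z
      · obtain ⟨p, hp⟩ := hs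
        have hu : hitI ε ν univ δ z y = 1 := if_pos ⟨p, (strikes_iff _ _ _ _).1 hp⟩
        have hσ : |tra (centre ε ν p y) z / ε| < 1 := by
          rw [abs_div, abs_of_pos hε, div_lt_one hε]; exact hp.1
        obtain ⟨k, hk, hk'⟩ := hpart _ hσ
        have hpk : z ∈ 𝔰 ε ν p y (I k) 0 δ := ⟨hp.1, hk, hp.2⟩
        have hhk : ∀ k', hitI ε ν (I k') δ z y = if k' = k then 1 else 0 := by
          intro k'
          by_cases hkk : k' = k
          · subst hkk; rw [if_pos rfl]; exact if_pos ⟨p, hpk⟩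
          · rw [if_neg hkk]
            refine if_neg ?_
            rintro ⟨q, hq⟩
            have := strikes_unique hε hδ hg hy hp
              ((strikes_iff _ _ _ _).2 (strikeSet_subset_univ _ _ _ _ _ hq))
            subst this
            exact hkk (hk' _ hq.2.1)
        have hs : ∑ k', a k' * hitI ε ν (I k') δ z y = a k := by simp only [hhk]; simp
        rw [hs, hu, mul_one, step_of_strikes hε hδ hg hy hp]
        have := h 0 (by omega) p k y hy (by simpa [freeFlight_zero] using hpk)
        rwa [e2, e3] at this
      · have hz : ∀ J, hitI ε ν J δ z y = 0 := fun J => if_neg fun ⟨p, hp⟩ =>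
          hs ⟨p, (strikes_iff _ _ _ _).2 (strikeSet_subset_univ _ _ _ _ _ hp)⟩
        push Not at hs
        rw [step_of_not_strikes hε hg hy hs]
        simp [hz]
    have h3 : ∀ k, a k * (hitSum μ ε ν (I k) δ n (freeFlight δ z) + ∫ y, hitI ε ν (I k) δ z y ∂μ) =
        a k * hitSum μ ε ν (I k) δ n (freeFlight δ z) + a k * ∫ y, hitI ε ν (I k) δ z y ∂μ :=
      fun k => mul_add _ _ _
    simp only [h3, Finset.sum_add_distrib]
    rw [mul_add]
    refine (le_of_eq ?_).trans ((abs_add_le _ _).trans (add_le_add h1 h2))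
    congr 1
    ring

lemma oneCollision_eq_integral {n : ℕ} (hn : n ≠ 0) (hz : z.1 ∉ obstacleRanges ε ν)
    (x) : oneCollision μ ε ν δ ψ n z x = ∫ y, oneCollision μ ε ν δ ψ n z y ∂μ := by
  obtain ⟨m, rfl⟩ := Nat.exists_eq_succ_of_ne_zero hn
  simp only [oneCollision]
  rw [integral_refresh, refresh_of_notMem hz]

end OneCollision

/-! ### Volumes of sets of striking particles -/

/-- The admissible impact parameters `b` such that `b / ε` lies in `I`. -/
def impactSet (ε : ℝ) (I : Set ℝ) : Set ℝ := {b | |b| < ε ∧ b / ε ∈ I}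

lemma measurableSet_impactSet (ε) {I : Set ℝ} (hI : MeasurableSet I) :
    MeasurableSet (impactSet ε I) :=
  (measurableSet_lt measurable_id.abs measurable_const).inter ((measurable_id.div_const ε) hI)

lemma volume_impactSet (hε : 0 < ε) (I : Set ℝ) :
    volume (impactSet ε I) = ofReal ε * volume (I ∩ Ioo (-1) 1) := by
  have : impactSet ε I = (fun b => b * ε⁻¹) ⁻¹' (I ∩ Ioo (-1) 1) := by
    ext b
    simp only [impactSet, mem_ofPred_eq, mem_preimage, Set.mem_inter_iff, Set.mem_Ioo,
      ← div_eq_mul_inv, abs_lt, lt_div_iff₀ hε, div_lt_iff₀ hε]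
    constructor
    · rintro ⟨⟨h1, h2⟩, h3⟩; exact ⟨h3, by linarith, by linarith⟩
    · rintro ⟨h3, h1, h2⟩; exact ⟨⟨by linarith, by linarith⟩, h3⟩
  rw [this, Real.volume_preimage_mul_right (inv_ne_zero hε.ne'), inv_inv, abs_of_pos hε]

lemma entryTime_frame (ρ c) (p : (ℝ × ℝ) × Velocity) :
    entryTime ρ c (frame c p) = -p.1.1 - √(ρ ^ 2 - p.1.2 ^ 2) := by
  simp [entryTime, halfChord, lon_frame, tra_frame]

lemma mem_strikeSet_frame (c) (I : Set ℝ) (s t) (p : (ℝ × ℝ) × Velocity) :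
    frame c p ∈ strikeSet ε c I s t ↔ p.1.2 ∈ impactSet ε I ∧
      p.1.1 ∈ Icc (-t - √(ε ^ 2 - p.1.2 ^ 2)) (-s - √(ε ^ 2 - p.1.2 ^ 2)) := by
  simp only [strikeSet, impactSet, mem_ofPred_eq, tra_frame, entryTime_frame, Set.mem_Icc]
  constructor
  · rintro ⟨h1, h2, h3, h4⟩; exact ⟨⟨h1, h2⟩, by linarith, by linarith⟩
  · rintro ⟨⟨h1, h2⟩, h3, h4⟩; exact ⟨h1, h2, by linarith, by linarith⟩

lemma phaseMeasure_strikeSet (hε : 0 < ε) (c) {I : Set ℝ} (hI : MeasurableSet I)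
    (s t) : 𝔪 (strikeSet ε c I s t) = ofReal (2 * π) * (ofReal ε * volume (I ∩ Ioo (-1) 1)) *
        ofReal (t - s) := by
  have hmp := measurePreserving_frame c
  rw [← hmp.measure_preimage (measurableSet_strikeSet ε c hI s t).nullMeasurableSet, ←
    volume_impactSet hε]
  set T : Set (ℝ × ℝ) := {q | q.2 ∈ impactSet ε I ∧
      q.1 ∈ Icc (-t - √(ε ^ 2 - q.2 ^ 2)) (-s - √(ε ^ 2 - q.2 ^ 2))} with hT
  have hTm : MeasurableSet T := by
    exact ((measurableSet_impactSet ε hI).preimage measurable_snd).inter ((measurableSet_le (by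
      fun_prop)
      measurable_fst).inter (measurableSet_le
      measurable_fst (by fun_prop)))
  have hpre : frame c ⁻¹' strikeSet ε c I s t = T ×ˢ univ := by
    ext p
    rw [mem_preimage, mem_strikeSet_frame]
    simp [hT]
  rw [hpre, Measure.prod_prod, arcLength_univ, Measure.volume_eq_prod, Measure.prod_apply_symm hTm]
  have : ∀ b : ℝ, volume ((fun a => (a, b)) ⁻¹' T) =
      (impactSet ε I).indicator (fun _ => ofReal (t - s)) b := by
    intro b
    by_cases hb : b ∈ impactSet ε I
    · rw [indicator_of_mem hb]
      have : (fun a => (a, b)) ⁻¹' T =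
          Icc (-t - √(ε ^ 2 - b ^ 2)) (-s - √(ε ^ 2 - b ^ 2)) := by ext a; simp [hT, hb]
      rw [this, Real.volume_Icc]
      congr 1; ring
    · rw [indicator_of_notMem hb]
      have : (fun a => (a, b)) ⁻¹' T = ∅ := by ext a; simp [hT, hb]
      rw [this, measure_empty]
  rw [lintegral_congr this, lintegral_indicator_const (measurableSet_impactSet ε hI)]
  ring

/-- A function with derivative bounded from below contracts no set by more than that bound. -/
lemma mul_volume_le_of_injOn {f f' : ℝ → ℝ} {S E : Set ℝ} (hS : MeasurableSet S)
    (hf : ∀ x ∈ S, HasDerivWithinAt f (f' x) S x) (hinj : Set.InjOn f S) (hE : Set.MapsTo f S E)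
    {k : ℝ} (hk : ∀ x ∈ S, k ≤ |f' x|) : ofReal k * volume S ≤ volume E := by
  have h := lintegral_image_eq_lintegral_abs_deriv_mul hS hf hinj fun _ => 1
  simp only [mul_one, lintegral_one, Measure.restrict_apply MeasurableSet.univ, Set.univ_inter] at h
  calc ofReal k * volume S = ∫⁻ _ in S, ofReal k := by rw [setLIntegral_const]
    _ ≤ ∫⁻ x in S, ofReal |f' x| := setLIntegral_mono' hS fun x hx => ofReal_le_ofReal (hk x hx)
    _ = volume (f '' S) := h.symm
    _ ≤ volume E := measure_mono hE.image_subset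

/-- Directions for which the component of `D` across the direction lies in `E`. -/
lemma arcLength_inner_perp_le {D : Plane} {w : ℝ} (hw : 0 < w) (hD : w < ‖D‖) {E : Set ℝ}
    (hE : MeasurableSet E) (hEw : E ⊆ Ioo (-w) w) : arcLength {v : Velocity | ⟪D, perp v⟫ ∈ E} ≤
      ofReal (2 / √(‖D‖ ^ 2 - w ^ 2)) * volume E := by
  set ρ := ‖D‖ with hρ
  have hρ0 : 0 < ρ := hw.trans hD
  set k := √(ρ ^ 2 - w ^ 2) with hk
  have hk0 : 0 < k := sqrt_pos.2 (by nlinarith)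
  obtain ⟨α, h0, h1⟩ : ∃ α, D 0 = ρ * cos α ∧ D 1 = ρ * sin α := by
    have hn : ‖(⟨D 0, D 1⟩ : ℂ)‖ = ρ := by
      have : ‖(⟨D 0, D 1⟩ : ℂ)‖ ^ 2 = ρ ^ 2 := by
        rw [hρ, norm_sq_eq, Complex.sq_norm, Complex.normSq_mk]; ring
      exact (sq_eq_sq₀ (norm_nonneg _) hρ0.le).1 this
    refine ⟨Complex.arg ⟨D 0, D 1⟩, ?_, ?_⟩
    · rw [← hn, Complex.norm_mul_cos_arg]
    · rw [← hn, Complex.norm_mul_sin_arg]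
  have hinner : ∀ θ, ⟪D, perp (unitVector θ : Plane)⟫ = ρ * sin (α - θ) := by
    intro θ
    rw [inner_eq, Real.sin_sub, h0, h1]
    simp [unitVector]; ring
  have hmv : MeasurableSet {v : Velocity | ⟪D, perp v⟫ ∈ E} := by
    have : Measurable fun v : Velocity => ⟪D, perp v⟫ := by fun_prop
    exact this hE
  set f : ℝ → ℝ := fun θ => ρ * sin (α - θ) with hf
  have hfm : Measurable f := by fun_prop
  have hderiv : ∀ S θ, HasDerivWithinAt f (-(ρ * cos (α - θ))) S θ := by
    intro S θ
    have h1 : HasDerivAt (fun θ => α - θ) (-1) θ := by simpa using (hasDerivAt_id θ).const_sub α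
    have h3 := ((Real.hasDerivAt_sin (α - θ)).comp θ h1).const_mul ρ
    have e : -(ρ * cos (α - θ)) = ρ * (cos (α - θ) * -1) := by ring
    rw [e]
    exact h3.hasDerivWithinAt
  have hlow : ∀ θ, f θ ∈ E → k ≤ |-(ρ * cos (α - θ))| := by
    intro θ hθ
    rw [hk, abs_neg, ← Real.sqrt_sq_eq_abs]
    refine Real.sqrt_le_sqrt ?_
    have h3 : f θ ^ 2 ≤ w ^ 2 := by
      rw [← sq_abs (f θ)]
      exact pow_le_pow_left₀ (abs_nonneg _) (abs_lt.2 (hEw hθ)).le 2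
    have h4 := Real.sin_sq_add_cos_sq (α - θ)
    simp only [hf] at h3
    nlinarith
  set a := α - 3 * π / 2 with ha
  have hpi := Real.pi_pos
  set S1 := Ioo a (a + π) ∩ f ⁻¹' E with hS1
  set S2 := Ioo (a + π) (a + 2 * π) ∩ f ⁻¹' E with hS2
  have hb : ∀ I, MeasurableSet I → Set.InjOn (fun θ => sin (α - θ)) I →
      volume (I ∩ f ⁻¹' E) ≤ ofReal (1 / k) * volume E := by
    intro I hI hinj
    have h := mul_volume_le_of_injOn (hI.inter (hfm hE)) (fun x _ => hderiv _ x)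
      (fun x hx y hy hxy => hinj hx.1 hy.1 (mul_left_cancel₀ hρ0.ne' hxy)) (fun x hx => hx.2)
      (fun x hx => hlow x hx.2)
    rwa [one_div, ENNReal.ofReal_inv_of_pos hk0, ← ENNReal.div_eq_inv_mul,
      ENNReal.le_div_iff_mul_le (by simp [hk0]) (by simp), mul_comm]
  have hb2 : volume S2 ≤ ofReal (1 / k) * volume E := by
    refine hb _ measurableSet_Ioo fun x hx y hy hxy => ?_
    have h : α - x = α - y := Real.injOn_sin
      ⟨by linarith [hx.2], by linarith [hx.1]⟩ ⟨by linarith [hy.2], by linarith [hy.1]⟩ hxy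
    linarith
  have hb1 : volume S1 ≤ ofReal (1 / k) * volume E := by
    refine hb _ measurableSet_Ioo fun x hx y hy hxy => ?_
    have h : α - x - π = α - y - π := Real.injOn_sin
      ⟨by linarith [hx.2], by linarith [hx.1]⟩ ⟨by linarith [hy.2], by linarith [hy.1]⟩
      (by rw [Real.sin_sub_pi, Real.sin_sub_pi]; exact congrArg Neg.neg hxy)
    linarith
  have hle : arcLength {v : Velocity | ⟪D, perp v⟫ ∈ E} ≤ volume S1 + volume S2 := by
    rw [← lintegral_indicator_one hmv, lintegral_arcLength_Ioc (by fun_prop) a]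
    have e : ∀ θ, {v : Velocity | ⟪D, perp v⟫ ∈ E}.indicator (1 : Velocity → ENNReal)
        (unitVector θ) = (f ⁻¹' E).indicator 1 θ := by
      intro θ
      have hiff : unitVector θ ∈ {v : Velocity | ⟪D, perp v⟫ ∈ E} ↔ θ ∈ f ⁻¹' E := by
        change ⟪D, perp (unitVector θ : Plane)⟫ ∈ E ↔ ρ * sin (α - θ) ∈ E
        rw [hinner]
      by_cases h : θ ∈ f ⁻¹' E
      · rw [indicator_of_mem h, indicator_of_mem (hiff.2 h)]; rfl
      · rw [indicator_of_notMem h, indicator_of_notMem fun h' => h (hiff.1 h')]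
    simp only [e]
    rw [lintegral_indicator_one (hfm hE), Measure.restrict_apply (hfm hE)]
    have hsub : f ⁻¹' E ∩ Ioc a (a + 2 * π) ⊆ (S1 ∪ S2) ∪ {a + π, a + 2 * π} := by
      rintro θ ⟨h1, h2, h3⟩
      rcases lt_trichotomy θ (a + π) with h | h | h
      · exact Or.inl (Or.inl ⟨⟨h2, h⟩, h1⟩)
      · exact Or.inr (Or.inl h)
      · rcases h3.lt_or_eq with h' | h'
        · exact Or.inl (Or.inr ⟨⟨h, h'⟩, h1⟩)
        · exact Or.inr (Or.inr h')
    refine (measure_mono hsub).trans ((measure_union_le _ _).trans ?_)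
    rw [(Set.toFinite {a + π, a + 2 * π}).measure_zero, add_zero]
    exact measure_union_le _ _
  refine hle.trans ((add_le_add hb1 hb2).trans (le_of_eq ?_))
  rw [← two_mul, ← mul_assoc, ← ENNReal.ofReal_ofNat, ← ofReal_mul (by norm_num), mul_one_div]

lemma inner_sq_add_inner_perp_sq (D : Plane) (v : Velocity) :
    ⟪D, (v : Plane)⟫ ^ 2 + ⟪D, perp v⟫ ^ 2 = ‖D‖ ^ 2 := by
  have := velocity_sq v
  rw [inner_eq, inner_eq, norm_sq_eq]
  simp only [perp_zero_coord, perp_one_coord]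
  linear_combination (D 0 ^ 2 + D 1 ^ 2) * this

/-- The phase volume of the particles that strike both of two obstacles. -/
lemma phaseMeasure_strikeSet_inter_le (hε : 0 < ε) (c D) (hD : 2 * ε < ‖D‖)
    {I : Set ℝ} (hI : MeasurableSet I) : 𝔪 (strikeSet ε c I 0 h ∩ strikeSet ε (c + D) I 0 h) ≤
      ofReal (h - ‖D‖ + 3 * ε) * ofReal (2 / √(‖D‖ ^ 2 - (2 * ε) ^ 2)) *
        (ofReal ε * volume (I ∩ Ioo (-1) 1)) ^ 2 := by
  have hmp := measurePreserving_frame c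
  have hm1 := measurableSet_strikeSet ε c hI 0 h
  have hm2 := measurableSet_strikeSet ε (c + D) hI 0 h
  rw [← hmp.measure_preimage (hm1.inter hm2).nullMeasurableSet, ← volume_impactSet hε]
  set B := impactSet ε I with hB
  have hBm : MeasurableSet B := measurableSet_impactSet ε hI
  set U := frame c ⁻¹' (strikeSet ε c I 0 h ∩ strikeSet ε (c + D) I 0 h) with hU
  have hUm : MeasurableSet U := (hm1.inter hm2).preimage hmp.measurable
  set L := ofReal (h - ‖D‖ + 3 * ε)
  have hslice : ∀ (v : Velocity) (b : ℝ), ∫⁻ a, U.indicator 1 ((a, b), v) ≤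
        L * (B.indicator 1 b * B.indicator 1 (b - ⟪D, perp v⟫)) := by
    intro v b
    have hmem : ∀ a, ((a, b), v) ∈ U ↔ (b ∈ B ∧
        a ∈ Icc (-h - √(ε ^ 2 - b ^ 2)) (-0 - √(ε ^ 2 - b ^ 2))) ∧
        b - ⟪D, perp v⟫ ∈ B ∧ 0 ≤ entryTime ε (c + D) (frame c ((a, b), v)) ∧
          entryTime ε (c + D) (frame c ((a, b), v)) ≤ h := by
      intro a
      rw [hU, mem_preimage, Set.mem_inter_iff, mem_strikeSet_frame]
      simp only [strikeSet, mem_ofPred_eq, tra_sub, tra_frame, hB, impactSet]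
      simp only [frame, and_assoc]
    by_cases hb : b ∈ B ∧ b - ⟪D, perp v⟫ ∈ B
    · rw [indicator_of_mem hb.1, indicator_of_mem hb.2]
      simp only [Pi.one_apply, mul_one]
      set q := √(ε ^ 2 - b ^ 2) with hq
      set q' := √(ε ^ 2 - (b - ⟪D, perp v⟫) ^ 2) with hq'
      set s := ⟪D, (v : Plane)⟫ + q - q' with hs
      have hentry : ∀ a, entryTime ε (c + D) (frame c ((a, b), v)) = -a - q + s := by
        intro a
        rw [entryTime, halfChord, lon_sub, tra_sub, lon_frame, tra_frame]
        simp only [frame, hs, hq, hq']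
        ring
      have hqε : q ≤ ε := by rw [hq, Real.sqrt_le_left hε.le]; nlinarith [sq_nonneg b]
      have hqε' : q' ≤ ε := by
        rw [hq', Real.sqrt_le_left hε.le]; nlinarith [sq_nonneg (b - ⟪D, perp v⟫)]
      have hq0 : 0 ≤ q := Real.sqrt_nonneg _
      have hq0' : 0 ≤ q' := Real.sqrt_nonneg _
      have hsD : ‖D‖ - 3 * ε ≤ |s| := by
        have h1 := inner_sq_add_inner_perp_sq D v
        have h2 : |⟪D, perp v⟫| ≤ 2 * ε := by
          have h3 := abs_lt.1 hb.1.1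
          have h4 := abs_lt.1 hb.2.1
          rw [abs_le]; constructor <;> linarith
        have h3 : ‖D‖ ≤ |⟪D, (v : Plane)⟫| + |⟪D, perp v⟫| := by
          refine le_of_sq_le_sq ?_ (by positivity)
          rw [← h1, ← sq_abs ⟪D, (v : Plane)⟫, ← sq_abs ⟪D, perp v⟫]
          nlinarith [mul_nonneg (abs_nonneg ⟪D, (v : Plane)⟫) (abs_nonneg ⟪D, perp v⟫)]
        have h4 : |⟪D, (v : Plane)⟫| ≤ |s| + ε := by
          have : ⟪D, (v : Plane)⟫ = s + (q' - q) := by rw [hs]; ring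
          rw [this]
          refine (abs_add_le _ _).trans (add_le_add le_rfl ?_)
          rw [abs_le]; constructor <;> linarith
        linarith
      have hsub : {a | ((a, b), v) ∈ U} ⊆ Icc (-h - q + max s 0) (-q + min s 0) := by
        intro a ha
        obtain ⟨⟨_, h1, h2⟩, _, h3, h4⟩ := (hmem a).1 ha
        rw [hentry] at h3 h4
        constructor
        · rcases max_cases s 0 with h | h <;> rw [h.1] <;> linarith
        · rcases min_cases s 0 with h | h <;> rw [h.1] <;> linarith
      have hind : ∀ a, U.indicator (1 : (ℝ × ℝ) × Velocity → ENNReal) ((a, b), v) =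
          {a | ((a, b), v) ∈ U}.indicator 1 a := fun a => rfl
      have hUs : MeasurableSet {a | ((a, b), v) ∈ U} := hUm.preimage (by fun_prop)
      simp only [hind]
      rw [lintegral_indicator_one hUs]
      refine (measure_mono hsub).trans ?_
      rw [Real.volume_Icc]
      refine ofReal_le_ofReal ?_
      rcases le_total s 0 with h | h
      · rw [max_eq_right h, min_eq_left h]; rw [abs_of_nonpos h] at hsD; linarith
      · rw [max_eq_left h, min_eq_right h]; rw [abs_of_nonneg h] at hsD; linarith
    · have : ∀ a, U.indicator (1 : (ℝ × ℝ) × Velocity → ENNReal) ((a, b), v) = 0 := fun a =>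
        indicator_of_notMem (fun ha => hb ⟨((hmem a).1 ha).1.1, ((hmem a).1 ha).2.1⟩) _
      simp only [this, lintegral_zero, zero_le]
  have hcp := continuous_perp
  have hmB : Measurable fun p : ℝ × Velocity => B.indicator (1 : ℝ → ENNReal) p.1 *
      B.indicator (1 : ℝ → ENNReal) (p.1 - ⟪D, perp p.2⟫) := by fun_prop
  calc ((volume : Measure (ℝ × ℝ)).prod arcLength) U
      = ∫⁻ v, (∫⁻ b, ∫⁻ a, U.indicator 1 ((a, b), v)) ∂arcLength := by
        rw [← lintegral_indicator_one hUm,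
          lintegral_prod_symm _ (measurable_one.indicator hUm).aemeasurable]
        refine lintegral_congr fun v => ?_
        rw [Measure.volume_eq_prod, lintegral_prod_symm]
        fun_prop
    _ ≤ ∫⁻ v, (∫⁻ b, L * (B.indicator 1 b * B.indicator 1 (b - ⟪D, perp v⟫))) ∂arcLength :=
        lintegral_mono fun v => lintegral_mono fun b => hslice v b
    _ = L * ∫⁻ b, ∫⁻ v, B.indicator 1 b * B.indicator 1 (b - ⟪D, perp v⟫) ∂arcLength := by
        rw [lintegral_congr fun v => lintegral_const_mul' L _ ofReal_ne_top,
          lintegral_const_mul' L _ ofReal_ne_top]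
        congr 1
        exact lintegral_lintegral_swap (hmB.comp measurable_swap).aemeasurable
    _ ≤ L * ∫⁻ b, B.indicator 1 b * (ofReal (2 / √(‖D‖ ^ 2 - (2 * ε) ^ 2)) * volume B) := by
        refine mul_le_mul_right (lintegral_mono fun b => ?_) _
        by_cases hb : b ∈ B
        · rw [indicator_of_mem hb]
          simp only [Pi.one_apply, one_mul]
          set E := (fun t => b - t) ⁻¹' B with hE
          have hEm : MeasurableSet E := hBm.preimage (by fun_prop)
          have hEw : E ⊆ Ioo (-(2 * ε)) (2 * ε) := by
            intro t ht
            have h3 := abs_lt.1 hb.1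
            have h4 := abs_lt.1 (show |b - t| < ε from ht.1)
            constructor <;> linarith
          have hvE : volume E = volume B := by
            rw [hE, (Measure.measurePreserving_sub_left volume b).measure_preimage
              hBm.nullMeasurableSet]
          have := arcLength_inner_perp_le (by positivity) hD hEm hEw
          rw [hvE] at this
          refine le_trans (le_of_eq ?_) this
          have hmv : MeasurableSet {v : Velocity | ⟪D, perp v⟫ ∈ E} := by
            have : Measurable fun v : Velocity => ⟪D, perp v⟫ := by fun_prop
            exact this hEm
          rw [← lintegral_indicator_one hmv]
          rfl
        · rw [indicator_of_notMem hb]; simp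
    _ = _ := by
        rw [lintegral_mul_const _ (by fun_prop), lintegral_indicator_one hBm]
        ring

/-- Thin strips carry little mass of the obstacle law. -/
lemma exists_strip_le {φ : Plane → ℝ} (hφ : IsProbDensity volume φ)
    (hμ : ∀ᵐ x ∂obstacleLaw φ, ‖x‖ < 1) {η : ENNReal} (hη : η ≠ 0) :
    ∃ w > 0, ∀ (v : Velocity) (t : ℝ), obstacleLaw φ {y : Plane | |⟪y, perp v⟫ - t| < w} ≤ η := by
  obtain ⟨κ, hκ, hκ'⟩ := exists_pos_setLIntegral_lt_of_measure_lt hφ.integrable.lintegral_lt_top.ne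
    hη
  obtain ⟨w, hw0, hw⟩ : ∃ w : ℝ, 0 < w ∧ ofReal (4 * w) < κ := by
    obtain ⟨r, hr0, hr⟩ := ENNReal.lt_iff_exists_real_btwn.1 hκ
    refine ⟨r / 8, ?_, ?_⟩
    · have := ENNReal.ofReal_pos.1 hr.1; positivity
    · exact lt_of_le_of_lt (ofReal_le_ofReal (by linarith)) hr.2
  refine ⟨w, hw0, fun v t => ?_⟩
  have hcp := continuous_perp
  set S := {y : Plane | |⟪y, perp v⟫ - t| < w} ∩ {y | ‖y‖ < 1}
  have hSm : MeasurableSet S := by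
    exact MeasurableSet.inter (measurableSet_lt (by fun_prop) measurable_const)
      (measurableSet_lt measurable_norm measurable_const)
  have h1 : obstacleLaw φ {y : Plane | |⟪y, perp v⟫ - t| < w} ≤ obstacleLaw φ S := by
    refine measure_mono_ae ?_
    filter_upwards [hμ] with y hy h using ⟨h, hy⟩
  refine h1.trans ?_
  rw [obstacleLaw, withDensity_apply _ hSm]
  refine (hκ' S (lt_of_le_of_lt ?_ hw)).le
  rw [← ((measurePreserving_frameIsometry v).comp measurePreserving_coords).measure_preimage
    hSm.nullMeasurableSet]
  have hsub : ((frameIsometry v) ∘ fun p : ℝ × ℝ => (!₂[p.1, p.2] : Plane)) ⁻¹' S ⊆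
      Ioo (-1) 1 ×ˢ Ioo (t - w) (t + w) := by
    rintro ⟨a, b⟩ ⟨h2, h3⟩
    have e : frameIsometry v (!₂[a, b] : Plane) = a • (v : Plane) + b • perp v := rfl
    have hv := velocity_sq v
    have e1 : ⟪frameIsometry v (!₂[a, b] : Plane), perp v⟫ = b := by
      rw [e, inner_eq]; simp; linear_combination b * hv
    simp only [mem_ofPred_eq, Function.comp_apply, e1] at h2 h3
    rw [(frameIsometry v).norm_map] at h3
    have h4 := norm_sq_eq (!₂[a, b] : Plane)
    have h5 : a ^ 2 < 1 := by
      simp only [Matrix.cons_val_zero, Matrix.cons_val_one] at h4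
      nlinarith [norm_nonneg (!₂[a, b] : Plane), sq_nonneg b]
    have h6 := abs_lt.1 h2
    have h7 := abs_lt.1 ((sq_lt_one_iff_abs_lt_one a).1 h5)
    exact ⟨⟨h7.1, h7.2⟩, by constructor <;> linarith⟩
  refine (measure_mono hsub).trans ?_
  rw [Measure.volume_eq_prod, Measure.prod_prod, volume_Ioo, volume_Ioo,
    ← ofReal_mul (by norm_num)]
  exact ofReal_le_ofReal (by linarith)

/-! ### Periodicity -/

/-- Translation of the position by `d`. -/
def shift (d : Plane) (z : Phase) : Phase := (z.1 + d, z.2)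

/-- The index of the lattice point closest to `x`. -/
def cellIndex (ε : ℝ) (x : Plane) : ℤ × ℤ := (round (x 0 / √ε), round (x 1 / √ε))

/-- The phase points whose position is closest to the lattice point `0`. -/
def cell (ε : ℝ) : Set Phase := {z | cellIndex ε z.1 = 0}

lemma measurePreserving_shift (d) : MeasurePreserving (shift d) 𝔪 𝔪 :=
  (measurePreserving_add_right volume d).prod (MeasurePreserving.id arcLength)

section Cells

lemma site_zero_coord (ε p) : site ε p 0 = √ε * p.1 := by simp [site, latticePoint]

lemma site_one_coord (ε p) : site ε p 1 = √ε * p.2 := by simp [site, latticePoint]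

lemma site_add (ε p q) : site ε (p + q) = site ε p + site ε q := by
  apply plane_ext
  · rw [PiLp.add_apply, site_zero_coord, site_zero_coord, site_zero_coord, Prod.fst_add];
    push_cast; ring
  · rw [PiLp.add_apply, site_one_coord, site_one_coord, site_one_coord, Prod.snd_add];
    push_cast; ring

lemma site_neg (ε p) : site ε (-p) = -site ε p := by
  apply plane_ext
  · rw [PiLp.neg_apply, site_zero_coord, site_zero_coord, Prod.fst_neg]; push_cast; ring
  · rw [PiLp.neg_apply, site_one_coord, site_one_coord, Prod.snd_neg]; push_cast; ring

lemma site_zero (ε) : site ε 0 = 0 := by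
  apply plane_ext
  · rw [site_zero_coord]; simp
  · rw [site_one_coord]; simp

lemma cellIndex_add_site (hε : 0 < ε) (x p) : cellIndex ε (x + site ε p) = cellIndex ε x + p := by
  have h : √ε ≠ 0 := (sqrt_pos.2 hε).ne'
  unfold cellIndex
  refine Prod.ext ?_ ?_
  · simp only [PiLp.add_apply, site_zero_coord, Prod.fst_add]
    rw [add_div, mul_div_cancel_left₀ _ h, round_add_intCast]
  · simp only [PiLp.add_apply, site_one_coord, Prod.snd_add]
    rw [add_div, mul_div_cancel_left₀ _ h, round_add_intCast]

lemma measurable_cellIndex (ε) : Measurable (cellIndex ε) := by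
  have h : ∀ i : Fin 2, Measurable fun x : Plane => round (x i / √ε) := by
    intro i
    simp only [round_eq]
    exact Int.measurable_floor.comp (by fun_prop)
  exact (h 0).prodMk (h 1)

lemma measurableSet_cell (ε) : MeasurableSet (cell ε) :=
  (measurable_cellIndex ε).comp measurable_fst (measurableSet_singleton 0)

lemma phaseMeasure_cell (hε : 0 < ε) : 𝔪 (cell ε) = ofReal (2 * π * ε) := by
  have hs := sqrt_pos.2 hε
  have e : cell ε = {x : Plane | cellIndex ε x = 0} ×ˢ univ := by ext z; simp [cell]
  have hm : MeasurableSet {x : Plane | cellIndex ε x = 0} :=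
    (measurable_cellIndex ε) (measurableSet_singleton 0)
  rw [e, phaseMeasure, Measure.prod_prod, arcLength_univ,
    ← measurePreserving_coords.measure_preimage hm.nullMeasurableSet]
  have e2 : (fun p : ℝ × ℝ => (!₂[p.1, p.2] : Plane)) ⁻¹' {x : Plane | cellIndex ε x = 0} =
      Set.Ico (-(√ε / 2)) (√ε / 2) ×ˢ Set.Ico (-(√ε / 2)) (√ε / 2) := by
    ext ⟨a, b⟩
    simp only [mem_preimage, mem_ofPred_eq, cellIndex, Prod.mk_eq_zero, round_eq_zero_iff,
      Set.mem_prod, Matrix.cons_val_zero, Matrix.cons_val_one, Set.mem_Ico, le_div_iff₀ hs,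
      div_lt_iff₀ hs]
    constructor
    · rintro ⟨⟨h1, h2⟩, h3, h4⟩
      exact ⟨⟨by linarith, by linarith⟩, by linarith, by linarith⟩
    · rintro ⟨⟨h1, h2⟩, h3, h4⟩
      exact ⟨⟨by linarith, by linarith⟩, by linarith, by linarith⟩
  rw [e2, Measure.volume_eq_prod, Measure.prod_prod, Real.volume_Ico,
    ← ofReal_mul (by linarith), ← ofReal_mul (by nlinarith)]
  congr 1
  have := Real.mul_self_sqrt hε.le
  ring_nf
  rw [Real.sq_sqrt hε.le]
  ring

lemma lintegral_eq_tsum_cell (hε : 0 < ε) {F : Phase → ENNReal} (hF : Measurable F) :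
    ∫𝔪 F = ∑' p, ∫⁻ z in cell ε, F (shift (site ε p) z) ∂𝔪 := by
  have hm : ∀ p, MeasurableSet {z : Phase | cellIndex ε z.1 = p} := fun p =>
    (measurable_cellIndex ε).comp measurable_fst (measurableSet_singleton p)
  have hU : (⋃ p, {z : Phase | cellIndex ε z.1 = p}) = univ := by ext z; simp
  rw [← setLIntegral_univ, ← hU, lintegral_iUnion hm]
  · refine tsum_congr fun p => ?_
    rw [← (measurePreserving_shift (site ε p)).setLIntegral_comp_preimage (hm p) hF]
    congr 2
    ext z
    simp [cell, shift, cellIndex_add_site hε]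
  · intro p q hpq
    exact Set.disjoint_left.2 fun z hz hz' => hpq (hz.symm.trans hz')

/-- Summation over all lattice translates unfolds the integral over a cell. -/
lemma setLIntegral_cell_tsum (hε : 0 < ε) {F : Phase → ENNReal} (hF : Measurable F) :
    ∫⁻ z in cell ε, ∑' p, F (shift (-site ε p) z) ∂𝔪 = ∫𝔪 F := by
  have hm : ∀ p, Measurable fun z => F (shift (-site ε p) z) := fun p =>
    hF.comp (measurePreserving_shift _).measurable
  rw [lintegral_tsum fun p => (hm p).aemeasurable, lintegral_eq_tsum_cell hε hF,
    ← (Equiv.neg (ℤ × ℤ)).tsum_eq]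
  exact tsum_congr fun p => (by simp only [Equiv.neg_apply, site_neg, neg_neg])

lemma norm_le_of_mem_cell (hε : 0 < ε) (hz : z ∈ cell ε) : ‖z.1‖ ≤ √ε := by
  have hs := sqrt_pos.2 hε
  obtain ⟨h0, h1⟩ := Prod.mk_eq_zero.1 hz
  have key : ∀ a : ℝ, round (a / √ε) = 0 → a ^ 2 ≤ (√ε) ^ 2 / 4 := by
    intro a ha
    rw [round_eq_zero_iff] at ha
    have h2 := ha.1
    have h3 := ha.2
    rw [le_div_iff₀ hs] at h2
    rw [div_lt_iff₀ hs] at h3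
    nlinarith
  refine le_of_sq_le_sq ?_ hs.le
  rw [norm_sq_eq]
  nlinarith [key _ h0, key _ h1]

/-- The integral of a periodic function over a bounded region is controlled by the mean over a
cell. -/
lemma setLIntegral_slab_le (hε : 0 < ε) (hε1 : ε ≤ 1) {F : Phase → ENNReal} (hF : Measurable F)
    (hper : ∀ p z, F (shift (site ε p) z) = F z) (ρ) : 𝔪 (cell ε) * ∫⁻ z in slab ρ, F z ∂𝔪 ≤
      𝔪 (slab (ρ + 2)) * ∫⁻ z in cell ε, F z ∂𝔪 := by
  classical
  have hs1 : √ε ≤ 1 := Real.sqrt_le_one.2 hε1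
  set χ : ℤ × ℤ → ENNReal := fun p => if ‖site ε p‖ ≤ ρ + 1 then 1 else 0 with hχ
  have h1 : ∫⁻ z in slab ρ, F z ∂𝔪 ≤ ∑' p, χ p * ∫⁻ z in cell ε, F z ∂𝔪 := by
    rw [← lintegral_indicator (measurableSet_slab ρ),
      lintegral_eq_tsum_cell hε (hF.indicator (measurableSet_slab ρ))]
    refine tsum_le_tsum fun p => ?_
    by_cases hp : ‖site ε p‖ ≤ ρ + 1
    · rw [hχ]
      simp only [if_pos hp, one_mul]
      refine lintegral_mono fun z => ?_
      rw [← hper p z]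
      exact Set.indicator_le_self _ _ _
    · refine le_trans (le_of_eq ?_) (zero_le)
      rw [setLIntegral_congr_fun (measurableSet_cell ε), lintegral_zero]
      intro z hz
      refine indicator_of_notMem (fun h => hp ?_) _
      have h2 := norm_le_of_mem_cell hε hz
      have h3 : ‖z.1 + site ε p‖ ≤ ρ := h
      have h4 := norm_sub_le (z.1 + site ε p) z.1
      rw [add_sub_cancel_left] at h4
      linarith
  have h2 : ∑' p, χ p * 𝔪 (cell ε) ≤ 𝔪 (slab (ρ + 2)) := by
    rw [← lintegral_indicator_one (measurableSet_slab (ρ + 2)),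
      lintegral_eq_tsum_cell hε (measurable_one.indicator (measurableSet_slab _))]
    refine tsum_le_tsum fun p => ?_
    by_cases hp : ‖site ε p‖ ≤ ρ + 1
    · simp only [hχ, if_pos hp, one_mul]
      rw [← setLIntegral_one]
      refine setLIntegral_mono' (measurableSet_cell ε) fun z hz => ?_
      rw [indicator_of_mem]
      · rfl
      · have h2 := norm_le_of_mem_cell hε hz
        have h4 := norm_add_le z.1 (site ε p)
        change ‖z.1 + site ε p‖ ≤ ρ + 2
        linarith
    · simp only [hχ, if_neg hp, zero_mul, zero_le]
  calc 𝔪 (cell ε) * ∫⁻ z in slab ρ, F z ∂𝔪 ≤ 𝔪 (cell ε) * ∑' p, χ p * ∫⁻ z in cell ε, F z ∂𝔪 :=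
        mul_le_mul_right h1 _
    _ = (∑' p, χ p * 𝔪 (cell ε)) * ∫⁻ z in cell ε, F z ∂𝔪 := by
        rw [ENNReal.tsum_mul_right, ENNReal.tsum_mul_right]; ring
    _ ≤ _ := mul_le_mul_left h2 _

lemma shift_mem_strikeSet (ε c d) (I : Set ℝ) (s t z) :
    shift d z ∈ strikeSet ε (c + d) I s t ↔ z ∈ strikeSet ε c I s t := by
  have h1 : tra (c + d) (shift d z) = tra c z := by simp only [tra, shift, add_sub_add_right_eq_sub]
  have h2 : entryTime ε (c + d) (shift d z) = entryTime ε c z := by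
    unfold entryTime halfChord
    rw [h1]
    simp only [lon, shift, add_sub_add_right_eq_sub]
  simp only [strikeSet, mem_ofPred_eq, h1, h2]

lemma indicator_strikeSet_centre (ε ν p d y) (I : Set ℝ) (s t z) :
    (𝔰 ε ν (p + d) y I s t).indicator (1 : Phase → ENNReal) z =
      (𝔰 ε ν d y I s t).indicator 1 (shift (-site ε p) z) := by
  have e : centre ε ν d y = centre ε ν (p + d) y + -site ε p := by
    unfold centre; rw [site_add]; abel
  have h := shift_mem_strikeSet ε (centre ε ν (p + d) y) (-site ε p) I s t z
  rw [← e] at h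
  by_cases hz : z ∈ 𝔰 ε ν (p + d) y I s t
  · rw [indicator_of_mem hz, indicator_of_mem (h.2 hz)]; rfl
  · rw [indicator_of_notMem hz, indicator_of_notMem fun h' => hz (h.1 h')]

variable {I : Set ℝ} {μ : Measure Plane} [IsProbabilityMeasure μ]

lemma strikeCount_shift (μ : Measure Plane) (ε ν) (I : Set ℝ) (s t p z) :
    strikeCount μ ε ν I s t (shift (site ε p) z) = strikeCount μ ε ν I s t z := by
  refine lintegral_congr fun y => ?_
  rw [← (Equiv.addLeft p).tsum_eq]
  refine tsum_congr fun q => ?_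
  rw [Equiv.coe_addLeft, indicator_strikeSet_centre]
  congr 1
  simp [shift]

/-- The mean number of strikes. -/
lemma setLIntegral_cell_strikeCount (hε : 0 < ε) (hI : MeasurableSet I) (s t) :
    ∫⁻ z in cell ε, strikeCount μ ε ν I s t z ∂𝔪 =
      𝔪 (cell ε) * (volume (I ∩ Ioo (-1) 1) * ofReal (t - s)) := by
  unfold strikeCount
  rw [lintegral_lintegral_swap (measurable_tsum_strikeSet ε ν hI s t).aemeasurable]
  have : ∀ y, ∫⁻ z in cell ε, ∑' p, (𝔰 ε ν p y I s t).indicator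
      (1 : Phase → ENNReal) z ∂𝔪 = 𝔪 (cell ε) * (volume (I ∩ Ioo (-1) 1) * ofReal (t - s)) := by
    intro y
    have e : ∀ z p, (𝔰 ε ν p y I s t).indicator (1 : Phase → ENNReal) z =
        (𝔰 ε ν 0 y I s t).indicator 1 (shift (-site ε p) z) := fun z p => by
      have := indicator_strikeSet_centre ε ν p 0 y I s t z
      rwa [add_zero] at this
    rw [lintegral_congr fun z => tsum_congr fun p => e z p]
    have hm := measurableSet_strikeSet ε (centre ε ν 0 y) hI s t
    rw [setLIntegral_cell_tsum hε (by fun_prop), lintegral_indicator_one hm,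
      phaseMeasure_strikeSet hε _ hI, phaseMeasure_cell hε, ofReal_mul (p := 2 * π) (by positivity)]
    ring
  simp only [this, lintegral_const, measure_univ, mul_one]

/-- The mean square of the number of strikes, as a sum over pairs of obstacles. -/
lemma setLIntegral_cell_strikeCount_sq (hε : 0 < ε) (hI : MeasurableSet I) (s t) :
    ∫⁻ z in cell ε, strikeCount μ ε ν I s t z ^ 2 ∂𝔪 = ∫⁻ y, ∫⁻ y', ∑' d, 𝔪 (𝔰 ε ν 0 y I s t ∩
        𝔰 ε ν d y' I s t) ∂μ ∂μ := by
  set w : Phase × Plane → ENNReal := fun q =>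
    ∑' p, (𝔰 ε ν p q.2 I s t).indicator (1 : Phase → ENNReal) q.1 with hw
  have hwm : Measurable w := measurable_tsum_strikeSet ε ν hI s t
  have h1 : ∀ z, strikeCount μ ε ν I s t z ^ 2 = ∫⁻ y, ∫⁻ y', w (z, y) * w (z, y') ∂μ ∂μ := by
    intro z
    have hz : Measurable fun y => w (z, y) := by fun_prop
    have : ∀ y, ∫⁻ y', w (z, y) * w (z, y') ∂μ = w (z, y) * strikeCount μ ε ν I s t z := fun y =>
      lintegral_const_mul _ hz
    rw [lintegral_congr this, lintegral_mul_const _ hz, sq]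
    rfl
  have hm3 : Measurable fun q : (Phase × Plane) × Plane => w q.1 * w (q.1.1, q.2) := by fun_prop
  have hm2 : Measurable fun q : Phase × Plane => ∫⁻ y', w q * w (q.1, y') ∂μ := by fun_prop
  rw [lintegral_congr h1, lintegral_lintegral_swap (by exact hm2.aemeasurable)]
  refine lintegral_congr fun y => ?_
  rw [lintegral_lintegral_swap]
  swap
  · fun_prop
  refine lintegral_congr fun y' => ?_
  have hm : ∀ d, MeasurableSet (𝔰 ε ν 0 y I s t ∩ 𝔰 ε ν d y' I s t) := fun d =>
    (measurableSet_strikeSet ε _ hI s t).inter (measurableSet_strikeSet ε _ hI s t)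
  have e : ∀ z, w (z, y) * w (z, y') = ∑' d, ∑' p, (𝔰 ε ν 0 y I s t ∩ 𝔰 ε ν d y' I s t).indicator
        (1 : Phase → ENNReal) (shift (-site ε p) z) := by
    intro z
    rw [ENNReal.tsum_comm]
    simp only [hw]
    rw [← ENNReal.tsum_mul_right]
    refine tsum_congr fun p => ?_
    rw [← (Equiv.addLeft p).tsum_eq fun q => (𝔰 ε ν q y' I s t).indicator
      (1 : Phase → ENNReal) z, ← ENNReal.tsum_mul_left]
    refine tsum_congr fun d => ?_
    have h0 := indicator_strikeSet_centre ε ν p 0 y I s t z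
    rw [add_zero] at h0
    rw [Equiv.coe_addLeft, indicator_strikeSet_centre, h0, Set.inter_indicator_one]
    rfl
  rw [lintegral_congr e, lintegral_tsum]
  · refine tsum_congr fun d => ?_
    rw [setLIntegral_cell_tsum hε (measurable_one.indicator (hm d)), lintegral_indicator_one (hm d)]
  · intro d
    exact (Measurable.tsum fun p => (measurable_one.indicator (hm d)).comp
      (measurePreserving_shift _).measurable).aemeasurable

/-- A bound, decreasing in the distance `ρ` of two obstacles, for the relative phase volume of the
particles that strike both of them. -/
def pairWeight (ε h ρ : ℝ) : ENNReal :=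
  ofReal (h - ρ + 3 * ε) * ofReal (2 / √(ρ ^ 2 - (2 * ε) ^ 2))

lemma pairWeight_anti {ρ' : ℝ} (hε : 0 < ε) (hρ : 2 * ε < ρ) (hρρ : ρ ≤ ρ') :
    pairWeight ε h ρ' ≤ pairWeight ε h ρ := by
  unfold pairWeight
  refine mul_le_mul' (ofReal_le_ofReal (by linarith)) (ofReal_le_ofReal ?_)
  exact div_le_div_of_nonneg_left zero_le_two (sqrt_pos.2 (by nlinarith)) (Real.sqrt_le_sqrt
    (by nlinarith))

open Classical in
/-- Bound for the mean square of the number of strikes: pairs of strikes in the same range are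
controlled by the mass of thin strips, the others by a sum over the lattice. -/
lemma setLIntegral_cell_strikeCount_sq_le (hμ : ∀ᵐ x ∂μ, ‖x‖ < 1) (hε : 0 < ε)
    (hg : 0 < gap ε ν) (hI : MeasurableSet I) {w : ℝ} {η : ENNReal}
    (hη : ∀ (v : Velocity) (t : ℝ), μ {y : Plane | |⟪y, perp v⟫ - t| < w} ≤ η)
    (hw : ε ≤ w * patchRadius ε ν) : ∫⁻ z in cell ε, strikeCount μ ε ν I 0 h z ^ 2 ∂𝔪 ≤
      𝔪 (cell ε) * (volume (I ∩ Ioo (-1) 1) * ofReal h) * η +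
      (ofReal ε * volume (I ∩ Ioo (-1) 1)) ^ 2 *
        ∑' d : ℤ × ℤ, if d = 0 then 0 else pairWeight ε h (‖site ε d‖ - 2 * patchRadius ε ν) := by
  rw [setLIntegral_cell_strikeCount_sq hε hI]
  set ℓ := volume (I ∩ Ioo (-1) 1)
  set r := patchRadius ε ν with hr
  have hr0 : 0 < r := patchRadius_pos hε ν
  have hm0 : ∀ y, MeasurableSet (𝔰 ε ν 0 y I 0 h) := fun y => measurableSet_strikeSet ε _ hI 0 h
  -- pairs in the same range
  have h1 : ∀ y, ∫⁻ y', 𝔪 (𝔰 ε ν 0 y I 0 h ∩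
      𝔰 ε ν 0 y' I 0 h) ∂μ ≤ 𝔪 (cell ε) * (ℓ * ofReal h) * η := by
    intro y
    have hmj := measurableSet_strikeSet_prod ε ν hI 0 h 0
    have hmj' := (measurable_one (α := ENNReal)).indicator hmj
    calc ∫⁻ y', 𝔪 (𝔰 ε ν 0 y I 0 h ∩ 𝔰 ε ν 0 y' I 0 h) ∂μ = ∫⁻ y', ∫⁻ z in 𝔰 ε ν 0 y I 0 h,
            (𝔰 ε ν 0 y' I 0 h).indicator 1 z ∂𝔪 ∂μ := by
          refine lintegral_congr fun y' => ?_
          rw [lintegral_indicator_one (hm0 y'), Measure.restrict_apply (hm0 y'), Set.inter_comm]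
      _ = ∫⁻ z in 𝔰 ε ν 0 y I 0 h, ∫⁻ y', (𝔰 ε ν 0 y' I 0 h).indicator 1 z ∂μ ∂𝔪 :=
          lintegral_lintegral_swap (hmj'.comp measurable_swap).aemeasurable
      _ ≤ ∫⁻ z in 𝔰 ε ν 0 y I 0 h, η ∂𝔪 := by
          refine lintegral_mono fun z => ?_
          have hms : MeasurableSet {y' : Plane | z ∈ 𝔰 ε ν 0 y' I 0 h} :=
            hmj.preimage (f := fun y' => (z, y')) measurable_prodMk_left
          have e : ∀ y', (𝔰 ε ν 0 y' I 0 h).indicator (1 : Phase → ENNReal) z =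
              {y' : Plane | z ∈ 𝔰 ε ν 0 y' I 0 h}.indicator 1 y' := fun y' => rfl
          simp only [e]
          rw [lintegral_indicator_one hms]
          refine (measure_mono fun y' hy' => ?_).trans (hη z.2 (tra 0 z / r))
          have h2 := hy'.1
          have h3 : tra (centre ε ν 0 y') z = tra 0 z - r * ⟪y', perp z.2⟫ := by
            have := tra_sub 0 (r • y') z
            rw [zero_add, real_inner_smul_left] at this
            rw [← this, centre, site_zero, zero_add]
          change |⟪y', perp z.2⟫ - tra 0 z / r| < w
          have h4 : ⟪y', perp z.2⟫ - tra 0 z / r = -(tra (centre ε ν 0 y') z / r) := by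
            rw [h3]; field_simp; ring
          rw [h4, abs_neg, abs_div, abs_of_pos hr0, div_lt_iff₀ hr0]
          exact h2.trans_le hw
      _ = _ := by
          rw [setLIntegral_const, phaseMeasure_strikeSet hε _ hI, phaseMeasure_cell hε, sub_zero,
            ofReal_mul (p := 2 * π) (by positivity)]
          ring
  -- pairs in different ranges
  have h2 : ∀ y y' : Plane, ‖y‖ < 1 → ‖y'‖ < 1 → ∀ d : ℤ × ℤ, d ≠ 0 →
      𝔪 (𝔰 ε ν 0 y I 0 h ∩ 𝔰 ε ν d y' I 0 h) ≤
      (ofReal ε * ℓ) ^ 2 * pairWeight ε h (‖site ε d‖ - 2 * r) := by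
    intro y y' hy hy' d hd
    have e : centre ε ν d y' = centre ε ν 0 y + (site ε d + r • (y' - y)) := by
      simp only [centre, site_zero, ← hr, smul_sub]; abel
    have hd1 : √ε ≤ ‖site ε d‖ := by
      have := sqrt_le_dist_site hε hd
      rwa [site_zero, dist_zero_right] at this
    have hg' : 2 * r + 2 * ε < √ε := by
      unfold gap rangeRadius at hg
      rw [← hr] at hg
      linarith
    have hn : ‖r • (y' - y)‖ ≤ 2 * r := by
      rw [norm_smul, Real.norm_of_nonneg hr0.le]
      have := norm_sub_le y' y
      nlinarith
    have hD : ‖site ε d‖ - 2 * r ≤ ‖site ε d + r • (y' - y)‖ := by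
      have := norm_sub_le (site ε d + r • (y' - y)) (r • (y' - y))
      rw [add_sub_cancel_right] at this
      linarith
    rw [e]
    refine (phaseMeasure_strikeSet_inter_le hε _ _ (by linarith) hI).trans ?_
    rw [mul_comm]
    exact mul_le_mul_right (pairWeight_anti hε (by linarith) hD) _
  calc ∫⁻ y, ∫⁻ y', ∑' d, 𝔪 (𝔰 ε ν 0 y I 0 h ∩
        𝔰 ε ν d y' I 0 h) ∂μ ∂μ ≤ ∫⁻ _, (𝔪 (cell ε) * (ℓ * ofReal h) * η +
        (ofReal ε * ℓ) ^ 2 * ∑' d : ℤ × ℤ, if d = 0 then 0 else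
          pairWeight ε h (‖site ε d‖ - 2 * r)) ∂μ := by
        refine lintegral_mono_ae ?_
        filter_upwards [hμ] with y hy
        have h3 : ∫⁻ y', ∑' d, 𝔪 (𝔰 ε ν 0 y I 0 h ∩ 𝔰 ε ν d y' I 0 h) ∂μ ≤
            ∫⁻ y', (𝔪 (𝔰 ε ν 0 y I 0 h ∩ 𝔰 ε ν 0 y' I 0 h) +
              (ofReal ε * ℓ) ^ 2 * ∑' d : ℤ × ℤ, if d = 0 then 0 else
                pairWeight ε h (‖site ε d‖ - 2 * r)) ∂μ := by
          refine lintegral_mono_ae ?_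
          filter_upwards [hμ] with y' hy'
          rw [ENNReal.tsum_eq_add_tsum_ite 0, ← ENNReal.tsum_mul_left]
          refine add_le_add_right (tsum_le_tsum fun d => ?_) _
          by_cases hd : d = 0
          · rw [if_pos hd, if_pos hd, mul_zero]
          · rw [if_neg hd, if_neg hd]
            exact h2 y y' hy hy' d hd
        refine h3.trans ?_
        rw [lintegral_add_right _ measurable_const, lintegral_const, measure_univ, mul_one]
        exact add_le_add_left (h1 y) _
    _ = _ := by simp

end Cells

/-! ### The second moment of the number of strikes -/

lemma lintegral_norm_plane {F : ℝ → ENNReal} (hF : Measurable F) : ∫⁻ x : Plane, F ‖x‖ =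
      ofReal (2 * π) * ∫⁻ r in Set.Ioi (0 : ℝ), ofReal r * F r := by
  have hm : Measurable fun x : Plane => F ‖x‖ := by fun_prop
  rw [← measurePreserving_coords.lintegral_comp hm, ← lintegral_comp_polarCoord_symm]
  have e : ∀ p ∈ polarCoord.target,
      ofReal p.1 • F ‖(!₂[(polarCoord.symm p).1, (polarCoord.symm p).2] : Plane)‖ =
        ofReal p.1 * F p.1 := by
    intro p hp
    have : ‖(!₂[(polarCoord.symm p).1, (polarCoord.symm p).2] : Plane)‖ = p.1 := by
      rw [← sq_eq_sq₀ (norm_nonneg _) hp.1.le, norm_sq_eq]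
      simp only [polarCoord_symm_apply, Matrix.cons_val_zero, Matrix.cons_val_one]
      nlinarith [Real.sin_sq_add_cos_sq p.2]
    rw [this, smul_eq_mul]
  rw [setLIntegral_congr_fun polarCoord.open_target.measurableSet e]
  have hm2 : Measurable fun r => ofReal r * F r := by fun_prop
  change ∫⁻ p in Set.Ioi (0 : ℝ) ×ˢ Ioo (-π) π, ofReal p.1 * F p.1 = _
  rw [Measure.volume_eq_prod, ← Measure.prod_restrict]
  have hm3 : Measurable fun p : ℝ × ℝ => ofReal p.1 * F p.1 := by fun_prop
  rw [lintegral_prod _ hm3.aemeasurable]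
  simp only [lintegral_const, Measure.restrict_apply MeasurableSet.univ, Set.univ_inter,
    volume_Ioo]
  rw [lintegral_mul_const _ hm2, mul_comm]
  congr 2
  ring

lemma lintegral_phase_fst {F : Plane → ENNReal} (hF : Measurable F) :
    ∫⁻ z, F z.1 ∂𝔪 = ofReal (2 * π) * ∫⁻ x, F x := by
  have hm : Measurable fun z : Phase => F z.1 := by fun_prop
  rw [phaseMeasure, lintegral_prod _ hm.aemeasurable]
  simp only [lintegral_const, arcLength_univ]
  rw [lintegral_mul_const _ hF, mul_comm]

lemma lintegral_Ioi_ofReal_sub (hh : 0 ≤ h) :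
    ∫⁻ r in Set.Ioi (0 : ℝ), ofReal (2 * (h - r)) = ofReal (h ^ 2) := by
  rw [← Set.Ioc_union_Ioi_eq_Ioi hh, lintegral_union measurableSet_Ioi
    (Set.Ioc_disjoint_Ioi le_rfl), setLIntegral_congr_fun measurableSet_Ioi
      (fun r hr => ENNReal.ofReal_of_nonpos (by linarith [Set.mem_Ioi.1 hr])), lintegral_zero,
    add_zero, ← ofReal_integral_eq_lintegral_ofReal]
  · rw [← intervalIntegral.integral_of_le hh]
    congr 1
    rw [intervalIntegral.integral_const_mul, intervalIntegral.integral_sub (by simp) (by simp),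
      intervalIntegral.integral_const, integral_id, smul_eq_mul]
    ring
  · exact (Continuous.integrableOn_Icc (by fun_prop)).mono_set Set.Ioc_subset_Icc_self
  · refine (ae_restrict_iff' measurableSet_Ioc).2 (ae_of_all _ fun r hr => ?_)
    have := hr.2
    change 0 ≤ 2 * (h - r)
    linarith

/-- The limit of the sum over the pairs of obstacles. -/
lemma lintegral_pair_limit (hh : 0 ≤ h) : ∫⁻ z : Phase, ofReal (h - ‖z.1‖) * ofReal (2 / ‖z.1‖) ∂𝔪 =
      ofReal (2 * π) ^ 2 * ofReal h ^ 2 := by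
  rw [lintegral_phase_fst (F := fun x => ofReal (h - ‖x‖) * ofReal (2 / ‖x‖)) (by fun_prop),
    lintegral_norm_plane (F := fun r => ofReal (h - r) * ofReal (2 / r)) (by fun_prop),
    setLIntegral_congr_fun (g := fun r => ofReal (2 * (h - r))) measurableSet_Ioi,
    lintegral_Ioi_ofReal_sub hh, ← mul_assoc, ENNReal.ofReal_pow hh, sq (ofReal (2 * _))]
  intro r hr
  have hr0 : 0 < r := hr
  change ofReal r * (ofReal (h - r) * ofReal (2 / r)) = _
  rw [mul_left_comm, ← ofReal_mul hr0.le, mul_div_cancel₀ _ hr0.ne', mul_comm,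
    ← ofReal_mul zero_le_two]

lemma lintegral_inv_norm_ne_top (ρ C) : ∫⁻ z : Phase in slab ρ, ofReal (C / ‖z.1‖) ∂𝔪 ≠ ⊤ := by
  have e : ∫⁻ z : Phase in slab ρ, ofReal (C / ‖z.1‖) ∂𝔪 =
      ∫⁻ z : Phase, (fun x => (Set.Iic ρ).indicator (fun r => ofReal (C / r)) ‖x‖) z.1 ∂𝔪 := by
    rw [← lintegral_indicator (measurableSet_slab ρ)]
    rfl
  have hm : Measurable ((Set.Iic ρ).indicator fun r => ofReal (C / r)) :=
    Measurable.indicator (by fun_prop) measurableSet_Iic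
  have hm' : Measurable fun x : Plane => (Set.Iic ρ).indicator
      (fun r => ofReal (C / r)) ‖x‖ := by fun_prop
  rw [e, lintegral_phase_fst hm', lintegral_norm_plane hm]
  refine mul_ne_top ofReal_ne_top (mul_ne_top ofReal_ne_top ?_)
  refine ne_top_of_le_ne_top (b := ∫⁻ r in Icc 0 ρ, ofReal C) ?_ ?_
  · rw [setLIntegral_const, Real.volume_Icc]
    exact mul_ne_top ofReal_ne_top ofReal_ne_top
  · rw [← lintegral_indicator measurableSet_Ioi, ← lintegral_indicator measurableSet_Icc]
    refine lintegral_mono fun r => ?_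
    by_cases hr : 0 < r
    · rw [indicator_of_mem (Set.mem_Ioi.2 hr)]
      by_cases hρ : r ≤ ρ
      · rw [indicator_of_mem (Set.mem_Iic.2 hρ),
            indicator_of_mem (show r ∈ Icc 0 ρ from ⟨hr.le, hρ⟩),
          ← ofReal_mul hr.le, mul_div_cancel₀ _ hr.ne']
      · rw [indicator_of_notMem (by simpa using hρ)]; simp
    · rw [indicator_of_notMem (by simpa using hr)]; simp

/-! ### The scales -/

section Scales

lemma patchRadius_eq (ε ν) : patchRadius ε ν = √ε * ε ^ (1 - ν) := rfl

lemma tendsto_patchRadius_div (hν : ν < 1) :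
    Tendsto (fun ε => patchRadius ε ν / √ε) (𝓝[>] 0) (𝓝 0) := by
  have h : Tendsto (fun ε : ℝ => ε ^ (1 - ν)) (𝓝[>] 0) (𝓝 0) := by
    have := (Real.continuousAt_rpow_const 0 (1 - ν) (Or.inr (by linarith))).tendsto
    rw [Real.zero_rpow (by linarith)] at this
    exact this.mono_left nhdsWithin_le_nhds
  refine h.congr' ?_
  filter_upwards [self_mem_nhdsWithin] with ε hε
  rw [patchRadius_eq, mul_div_cancel_left₀ _ (sqrt_pos.2 hε).ne']

lemma tendsto_div_patchRadius (hν : 1 / 2 < ν) :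
    Tendsto (fun ε => ε / patchRadius ε ν) (𝓝[>] 0) (𝓝 0) := by
  have h : Tendsto (fun ε : ℝ => ε ^ (ν - 1 / 2)) (𝓝[>] 0) (𝓝 0) := by
    have := (Real.continuousAt_rpow_const 0 (ν - 1 / 2) (Or.inr (by linarith))).tendsto
    rw [Real.zero_rpow (by linarith)] at this
    exact this.mono_left nhdsWithin_le_nhds
  refine h.congr' ?_
  filter_upwards [self_mem_nhdsWithin] with ε hε
  have hε0 : (0 : ℝ) < ε := hε
  rw [patchRadius_eq, Real.sqrt_eq_rpow, ← Real.rpow_add hε0]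
  nth_rw 2 [← Real.rpow_one ε]
  rw [← Real.rpow_sub hε0]
  congr 1
  ring

lemma tendsto_sqrt_zero : Tendsto (fun ε : ℝ => √ε) (𝓝[>] 0) (𝓝 0) := by
  have := Real.continuous_sqrt.tendsto 0
  rw [Real.sqrt_zero] at this
  exact this.mono_left nhdsWithin_le_nhds

lemma eventually_sqrt_lt (hb : 0 < b) : ∀ᶠ ε : ℝ in 𝓝[>] 0, √ε < b :=
  tendsto_sqrt_zero.eventually (gt_mem_nhds hb)

lemma eventually_patchRadius_le (hν : ν < 1) (hb : 0 < b) :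
    ∀ᶠ ε : ℝ in 𝓝[>] 0, patchRadius ε ν ≤ b * √ε := by
  filter_upwards [(tendsto_patchRadius_div hν).eventually (gt_mem_nhds hb), self_mem_nhdsWithin]
    with ε h hε
  rw [div_lt_iff₀ (sqrt_pos.2 hε)] at h
  exact h.le

lemma eventually_le_mul_patchRadius (hν : 1 / 2 < ν) {w : ℝ} (hw : 0 < w) :
    ∀ᶠ ε : ℝ in 𝓝[>] 0, ε ≤ w * patchRadius ε ν := by
  filter_upwards [(tendsto_div_patchRadius hν).eventually (gt_mem_nhds hw), self_mem_nhdsWithin]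
    with ε h hε
  rw [div_lt_iff₀ (patchRadius_pos hε ν)] at h
  exact h.le

/-- The ranges are much smaller than the lattice spacing. -/
lemma eventually_rangeRadius_le (hν : ν < 1) (hb : 0 < b) :
    ∀ᶠ ε : ℝ in 𝓝[>] 0, rangeRadius ε ν ≤ b * √ε := by
  filter_upwards [eventually_patchRadius_le hν (half_pos hb), eventually_sqrt_lt (half_pos hb),
    self_mem_nhdsWithin] with ε h1 h2 hε
  have hs := sqrt_pos.2 hε
  have := Real.mul_self_sqrt (le_of_lt hε)
  unfold rangeRadius
  nlinarith

lemma tendsto_patchRadius (hν : ν < 1) : Tendsto (fun ε => patchRadius ε ν) (𝓝[>] 0) (𝓝 0) := by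
  have := tendsto_sqrt_zero.mul (tendsto_patchRadius_div hν)
  rw [zero_mul] at this
  refine this.congr' ?_
  filter_upwards [self_mem_nhdsWithin] with ε hε
  rw [mul_div_cancel₀ _ (sqrt_pos.2 hε).ne']

end Scales

section SecondMoment

open Classical in
/-- The lattice sum of `pairWeight` as an integral over the phase space. -/
lemma cell_mul_tsum_pairWeight (hε : 0 < ε) (h) : 𝔪 (cell ε) *
        ∑' d : ℤ × ℤ, (if d = 0 then 0 else pairWeight ε h (‖site ε d‖ - 2 * patchRadius ε ν)) =
      ∫⁻ z : Phase, (if cellIndex ε z.1 = 0 then 0 else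
        pairWeight ε h (‖site ε (cellIndex ε z.1)‖ - 2 * patchRadius ε ν)) ∂𝔪 := by
  set G : ℤ × ℤ → ENNReal := fun d =>
    if d = 0 then 0 else pairWeight ε h (‖site ε d‖ - 2 * patchRadius ε ν) with hG
  have hm : Measurable fun z : Phase => G (cellIndex ε z.1) :=
    (measurable_of_countable G).comp ((measurable_cellIndex ε).comp measurable_fst)
  change _ = ∫⁻ z : Phase, G (cellIndex ε z.1) ∂𝔪
  rw [lintegral_eq_tsum_cell hε hm, ← ENNReal.tsum_mul_left]
  refine tsum_congr fun p => ?_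
  rw [setLIntegral_congr_fun (g := fun _ => G p) (measurableSet_cell ε), setLIntegral_const,
    mul_comm]
  intro z hz
  have : cellIndex ε z.1 = 0 := hz
  simp [shift, cellIndex_add_site hε, this]

lemma norm_sub_site_le (hε : 0 < ε) (z : Phase) : ‖z.1 - site ε (cellIndex ε z.1)‖ ≤ √ε := by
  have : shift (-site ε (cellIndex ε z.1)) z ∈ cell ε := by
    change cellIndex ε (z.1 + -site ε (cellIndex ε z.1)) = 0
    rw [← site_neg, cellIndex_add_site hε, add_neg_cancel]
  have := norm_le_of_mem_cell hε this
  rwa [shift, ← sub_eq_add_neg] at this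

open Classical in
lemma tendsto_cell_mul_tsum (hν : ν < 1) (hh : 0 ≤ h) :
    Tendsto (fun ε => 𝔪 (cell ε) *
        ∑' d : ℤ × ℤ, (if d = 0 then 0 else pairWeight ε h (‖site ε d‖ - 2 * patchRadius ε ν)))
      (𝓝[>] 0) (𝓝 (ofReal (2 * π) ^ 2 * ofReal h ^ 2)) := by
  rw [← lintegral_pair_limit hh]
  have hε : ∀ᶠ ε : ℝ in 𝓝[>] 0, 0 < ε := self_mem_nhdsWithin
  refine Tendsto.congr' (f₁ := fun ε => ∫⁻ z : Phase, (if cellIndex ε z.1 = 0 then 0 else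
        pairWeight ε h (‖site ε (cellIndex ε z.1)‖ - 2 * patchRadius ε ν)) ∂𝔪) ?_ ?_
  · filter_upwards [hε] with ε hε
    exact (cell_mul_tsum_pairWeight hε h).symm
  refine tendsto_lintegral_filter_of_dominated_convergence
    (fun z : Phase => ofReal (h + 1) *
      (slab (4 * (h + 1))).indicator (fun z : Phase => ofReal (16 / ‖z.1‖)) z) ?_ ?_ ?_ ?_
  · exact Eventually.of_forall fun ε => ((measurable_of_countable fun d : ℤ × ℤ => if d = 0 then (0
      : ENNReal) else
      pairWeight ε h (‖site ε d‖ - 2 * patchRadius ε ν)).comp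
        ((measurable_cellIndex ε).comp measurable_fst))
  · filter_upwards [hε, eventually_patchRadius_le hν (show (0 : ℝ) < 1 / 4 by norm_num),
      eventually_sqrt_lt (show (0 : ℝ) < 1 / 8 by norm_num)] with ε hε hr hs
    refine ae_of_all _ fun z => ?_
    by_cases hi : cellIndex ε z.1 = 0
    · rw [if_pos hi]; exact zero_le
    rw [if_neg hi]
    have hs0 := sqrt_pos.2 hε
    have hss := Real.mul_self_sqrt hε.le
    have hd := sqrt_le_dist_site hε hi
    rw [site_zero, dist_zero_right] at hd
    set S := ‖site ε (cellIndex ε z.1)‖ with hS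
    set ρ := S - 2 * patchRadius ε ν with hρ
    have hx : ‖z.1‖ ≤ S + √ε := by
      have h1 := norm_sub_site_le hε z
      have h2 := norm_add_le (z.1 - site ε (cellIndex ε z.1)) (site ε (cellIndex ε z.1))
      rw [sub_add_cancel] at h2
      linarith
    have h4 : ‖z.1‖ ≤ 4 * ρ := by linarith
    have hρ0 : √ε / 2 ≤ ρ := by linarith
    have hε2 : 4 * ε ≤ ρ := by nlinarith
    have hε1 : 3 * ε ≤ 1 := by nlinarith
    unfold pairWeight
    have hx0 : 0 < ‖z.1‖ := by
      -- the point is not in the cell of the origin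
      rw [norm_pos_iff]
      intro h0
      apply hi
      rw [h0]
      simp [cellIndex]
    by_cases hz : z ∈ slab (4 * (h + 1))
    · rw [indicator_of_mem hz]
      refine mul_le_mul' (ofReal_le_ofReal (by linarith)) (ofReal_le_ofReal ?_)
      have h5 : ρ / 2 ≤ √(ρ ^ 2 - (2 * ε) ^ 2) := by
        apply Real.le_sqrt_of_sq_le
        nlinarith
      rw [div_le_div_iff₀ (by linarith) hx0]
      linarith
    · have : 4 * (h + 1) < ‖z.1‖ := not_le.1 hz
      rw [ENNReal.ofReal_of_nonpos (by linarith), zero_mul]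
      exact zero_le
  · rw [lintegral_const_mul' _ _ ofReal_ne_top, lintegral_indicator (measurableSet_slab _)]
    exact mul_ne_top ofReal_ne_top (lintegral_inv_norm_ne_top _ _)
  · have h0 : ∀ᵐ z : Phase ∂𝔪, z.1 ≠ 0 := by
      have : ∀ᵐ x : Plane, x ≠ 0 := by simp [ae_iff]
      exact Measure.quasiMeasurePreserving_fst.ae this
    filter_upwards [h0] with z hz
    have hz0 := norm_pos_iff.2 hz
    have h1 : Tendsto (fun ε => ‖site ε (cellIndex ε z.1)‖) (𝓝[>] 0) (𝓝 ‖z.1‖) := by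
      rw [tendsto_iff_dist_tendsto_zero]
      refine squeeze_zero' (Eventually.of_forall fun _ => dist_nonneg) ?_ tendsto_sqrt_zero
      filter_upwards [hε] with ε hε
      rw [dist_comm, Real.dist_eq]
      exact (abs_norm_sub_norm_le _ _).trans (norm_sub_site_le hε z)
    have h2 : Tendsto (fun ε => ‖site ε (cellIndex ε z.1)‖ - 2 * patchRadius ε ν) (𝓝[>] 0)
        (𝓝 ‖z.1‖) := by
      have := h1.sub ((tendsto_patchRadius hν).const_mul 2)
      rwa [mul_zero, sub_zero] at this
    have h3 : Tendsto (fun ε : ℝ => ε) (𝓝[>] 0) (𝓝 0) := tendsto_id.mono_left nhdsWithin_le_nhds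
    have h4 : Tendsto (fun ε => pairWeight ε h (‖site ε (cellIndex ε z.1)‖ - 2 * patchRadius ε ν))
        (𝓝[>] 0) (𝓝 (ofReal (h - ‖z.1‖) * ofReal (2 / ‖z.1‖))) := by
      unfold pairWeight
      refine ENNReal.Tendsto.mul ?_ (Or.inr ofReal_ne_top) ?_ (Or.inr ofReal_ne_top)
      · refine ENNReal.tendsto_ofReal ?_
        have := (tendsto_const_nhds (x := h)).sub h2 |>.add (h3.const_mul 3)
        rwa [mul_zero, add_zero] at this
      · refine ENNReal.tendsto_ofReal ?_
        have := ((h2.pow 2).sub ((h3.const_mul 2).pow 2)).sqrt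
        rw [mul_zero, zero_pow two_ne_zero, sub_zero, Real.sqrt_sq hz0.le] at this
        exact tendsto_const_nhds.div this hz0.ne'
    refine h4.congr' ?_
    filter_upwards [hε, eventually_sqrt_lt hz0] with ε hε hs
    rw [if_neg]
    intro hc
    have := norm_le_of_mem_cell hε (z := z) hc
    linarith

end SecondMoment

/-! ### Law of large numbers for the number of strikes -/

lemma phaseMeasure_slab_ne_top (ρ) : 𝔪 (slab ρ) ≠ ⊤ := by
  have e : slab ρ = Metric.closedBall (0 : Plane) ρ ×ˢ (univ : Set Velocity) := by
    ext z; simp [slab]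
  rw [e, phaseMeasure, Measure.prod_prod, arcLength_univ]
  exact mul_ne_top measure_closedBall_lt_top.ne ofReal_ne_top

lemma phaseMeasure_cell_ne_zero (hε : 0 < ε) : 𝔪 (cell ε) ≠ 0 := by
  rw [phaseMeasure_cell hε]
  simpa using by positivity

lemma phaseMeasure_cell_ne_top (hε : 0 < ε) : 𝔪 (cell ε) ≠ ⊤ := by
  rw [phaseMeasure_cell hε]; exact ofReal_ne_top

/-- A bound for the mean of a periodic function gives a bound for its integral over a bounded
region. -/
lemma setLIntegral_slab_le_of_cell (hε : 0 < ε) (hε1 : ε ≤ 1) {F : Phase → ENNReal}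
    (hF : Measurable F) (hper : ∀ p z, F (shift (site ε p) z) = F z) {B : ENNReal}
    (hB : ∫⁻ z in cell ε, F z ∂𝔪 ≤ 𝔪 (cell ε) * B) (ρ) :
    ∫⁻ z in slab ρ, F z ∂𝔪 ≤ 𝔪 (slab (ρ + 2)) * B := by
  rw [← ENNReal.mul_le_mul_iff_right (phaseMeasure_cell_ne_zero hε) (phaseMeasure_cell_ne_top hε)]
  refine (setLIntegral_slab_le hε hε1 hF hper ρ).trans ?_
  rw [mul_left_comm]
  exact mul_le_mul_right hB _

lemma volume_inter_Ioo_le (I : Set ℝ) : volume (I ∩ Ioo (-1) 1) ≤ ofReal 2 := by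
  refine (measure_mono Set.inter_subset_right).trans ?_
  rw [volume_Ioo]
  norm_num

section SecondMoment

variable {φ : Plane → ℝ}

lemma eventually_setLIntegral_strikeCount_sq_le (hν : ν ∈ Ioo (1 / 2 : ℝ) 1)
    (hφ : IsProbDensity volume φ) (hμ : ∀ᵐ x ∂obstacleLaw φ, ‖x‖ < 1) {I : Set ℝ}
    (hI : MeasurableSet I) (hh : 0 ≤ h) {η : ℝ} (hη : 0 < η) :
    ∀ᶠ ε in 𝓝[>] (0 : ℝ), ∫⁻ z in cell ε, strikeCount (obstacleLaw φ) ε ν I 0 h z ^ 2 ∂𝔪 ≤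
      𝔪 (cell ε) * ((volume (I ∩ Ioo (-1) 1) * ofReal h) ^ 2 + ofReal η) := by
  classical
  have := isProbabilityMeasure_obstacleLaw hφ
  obtain ⟨w, hw, hstrip⟩ := exists_strip_le hφ hμ (η := ofReal (η / (4 * (h + 1))))
    (by simpa using (by positivity))
  set c := ofReal (2 * π) ^ 2 with hc
  have hc0 : c ≠ 0 := by rw [hc]; exact pow_ne_zero _ (by simpa using Real.pi_pos)
  have hct : c ≠ ⊤ := ENNReal.pow_ne_top ofReal_ne_top
  have hlt : c * ofReal h ^ 2 < c * (ofReal h ^ 2 + ofReal (η / 8)) := by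
    rw [ENNReal.mul_lt_mul_iff_right hc0 hct]
    exact ENNReal.lt_add_right (ENNReal.pow_ne_top ofReal_ne_top) (by simpa using by positivity)
  have hgap : ∀ᶠ ε in 𝓝[>] (0 : ℝ), 0 < gap ε ν := by
    filter_upwards [eventually_rangeRadius_le hν.2 (show (0 : ℝ) < 1 / 4 by norm_num),
      self_mem_nhdsWithin] with ε h1 hε
    have := sqrt_pos.2 hε
    unfold gap
    linarith
  filter_upwards [(tendsto_cell_mul_tsum hν.2 hh).eventually (gt_mem_nhds hlt),
    eventually_le_mul_patchRadius hν.1 hw, hgap, self_mem_nhdsWithin] with ε h1 h2 hg hε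
  have hε0 : (0 : ℝ) < ε := hε
  refine (setLIntegral_cell_strikeCount_sq_le hμ hε0 hg hI hstrip h2).trans ?_
  set ℓ := volume (I ∩ Ioo (-1) 1)
  have hℓ2 : ℓ ≤ ofReal 2 := volume_inter_Ioo_le I
  set T := ∑' d : ℤ × ℤ, (if d = 0 then 0 else
    pairWeight ε h (‖site ε d‖ - 2 * patchRadius ε ν)) with hT
  have hQ : 𝔪 (cell ε) = ofReal (2 * π) * ofReal ε := by
    rw [phaseMeasure_cell hε0, ofReal_mul (by positivity)]
  -- pairs in the same range
  have h3 : ℓ * ofReal h * ofReal (η / (4 * (h + 1))) ≤ ofReal (η / 2) := by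
    calc ℓ * ofReal h * ofReal (η / (4 * (h + 1)))
        ≤ ofReal 2 * ofReal h * ofReal (η / (4 * (h + 1))) := by gcongr
      _ = ofReal (2 * h * (η / (4 * (h + 1)))) := by
          rw [← ofReal_mul zero_le_two, ← ofReal_mul (by positivity)]
      _ ≤ _ := by
          refine ofReal_le_ofReal ?_
          rw [mul_div_assoc', div_le_iff₀ (by positivity)]
          nlinarith
  -- pairs in different ranges
  have h4 : (ofReal ε * ℓ) ^ 2 * T ≤ 𝔪 (cell ε) * (ℓ ^ 2 * (ofReal h ^ 2 + ofReal (η / 8))) := by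
    rw [← ENNReal.mul_le_mul_iff_right hc0 hct]
    calc c * ((ofReal ε * ℓ) ^ 2 * T) = 𝔪 (cell ε) * ℓ ^ 2 * (𝔪 (cell ε) * T) := by
          rw [hQ, hc]; ring
      _ ≤ 𝔪 (cell ε) * ℓ ^ 2 * (c * (ofReal h ^ 2 + ofReal (η / 8))) := mul_le_mul_right h1.le _
      _ = _ := by ring
  have h5 : ℓ ^ 2 * ofReal (η / 8) ≤ ofReal (η / 2) := by
    calc ℓ ^ 2 * ofReal (η / 8) ≤ ofReal 2 ^ 2 * ofReal (η / 8) := by gcongr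
      _ = ofReal (2 ^ 2 * (η / 8)) := by
          rw [← ENNReal.ofReal_pow zero_le_two, ← ofReal_mul (by positivity)]
      _ = _ := by congr 1; ring
  calc 𝔪 (cell ε) * (ℓ * ofReal h) * ofReal (η / (4 * (h + 1))) + (ofReal ε * ℓ) ^ 2 * T
      ≤ 𝔪 (cell ε) * ofReal (η / 2) + 𝔪 (cell ε) * (ℓ ^ 2 * ofReal h ^ 2 + ofReal (η / 2)) := by
        refine add_le_add ?_ (h4.trans ?_)
        · rw [mul_assoc]; exact mul_le_mul_right h3 _
        · rw [mul_add (ℓ ^ 2)]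
          exact mul_le_mul_right (add_le_add_right h5 _) _
    _ = _ := by
        rw [← mul_add]
        congr 1
        have : ofReal η = ofReal (η / 2) + ofReal (η / 2) := by
          rw [← ofReal_add (by positivity) (by positivity), add_halves]
        rw [this]
        ring

variable {μ : Measure Plane} [IsProbabilityMeasure μ] {I : Set ℝ}

/-- Within a time shorter than the gap no more than one obstacle is struck. -/
lemma ofReal_integral_hitI_eq (hμ : ∀ᵐ x ∂μ, ‖x‖ < 1) (hε : 0 < ε) (hδ : δ ≤ gap ε ν)
    (hg : 0 < gap ε ν) (hI : MeasurableSet I) (z) :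
    ofReal (∫ y, hitI ε ν I δ z y ∂μ) = strikeCount μ ε ν I 0 δ z := by
  rw [ofReal_integral_eq_lintegral_ofReal ((isTame_hitI ε ν hI δ).integrable z)
    (ae_of_all _ fun y => hitI_nonneg ε ν I δ z y), strikeCount]
  refine lintegral_congr_ae ?_
  filter_upwards [hμ] with y hy
  by_cases h : ∃ p, z ∈ 𝔰 ε ν p y I 0 δ
  · obtain ⟨p, hp⟩ := h
    have hu : ∀ q, q ≠ p → z ∉ 𝔰 ε ν q y I 0 δ := by
      intro q hq hqz
      refine hq (strikes_unique hε hδ hg hy (z := z) ?_ ?_)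
      · exact (strikes_iff _ _ _ _).2 (strikeSet_subset_univ _ _ _ _ _ hqz)
      · exact (strikes_iff _ _ _ _).2 (strikeSet_subset_univ _ _ _ _ _ hp)
    rw [tsum_eq_single p fun q hq => indicator_of_notMem (hu q hq) _,
      indicator_of_mem hp, hitI, if_pos ⟨p, hp⟩]
    simp
  · rw [hitI, if_neg h]
    push Not at h
    simp only [indicator_of_notMem (h _)]
    simp

lemma ofReal_hitSum_eq (hμ : ∀ᵐ x ∂μ, ‖x‖ < 1) (hε : 0 < ε) (hδ : δ ≤ gap ε ν)
    (hg : 0 < gap ε ν) (hI : MeasurableSet I) (n z) : ofReal (hitSum μ ε ν I δ n z) =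
      ∑ i ∈ Finset.range n, strikeCount μ ε ν I (i * δ) ((i + 1) * δ) z := by
  rw [hitSum, ENNReal.ofReal_sum_of_nonneg
    fun i _ => integral_nonneg fun y => hitI_nonneg _ _ _ _ _ _]
  refine Finset.sum_congr rfl fun i _ => ?_
  rw [ofReal_integral_hitI_eq hμ hε hδ hg hI, strikeCount_freeFlight, zero_add]
  congr 1
  ring

lemma strikeCount_le_sum (μ : Measure Plane) [SFinite μ] (ε ν : ℝ) (hI : MeasurableSet I) (n : ℕ)
    (z : Phase) : strikeCount μ ε ν I 0 ((n + 1) * δ) z ≤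
      ∑ i ∈ Finset.range (n + 1), strikeCount μ ε ν I (i * δ) ((i + 1) * δ) z := by
  induction n with
  | zero => simp
  | succ n ih =>
    rw [Finset.sum_range_succ]
    push_cast
    exact (strikeCount_add_le μ ε ν hI 0 ((n + 1) * δ) _ z).trans (add_le_add_left ih _)

lemma hitSum_shift (μ : Measure Plane) [IsProbabilityMeasure μ] (hμ : ∀ᵐ x ∂μ, ‖x‖ < 1)
    (hε : 0 < ε) (hδ : δ ≤ gap ε ν) (hg : 0 < gap ε ν) (hI : MeasurableSet I) (n p z) :
    hitSum μ ε ν I δ n (shift (site ε p) z) = hitSum μ ε ν I δ n z := by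
  rw [← ENNReal.ofReal_eq_ofReal_iff (hitSum_nonneg _ _ _ _ _ _ _) (hitSum_nonneg _ _ _ _ _ _ _),
    ofReal_hitSum_eq hμ hε hδ hg hI, ofReal_hitSum_eq hμ hε hδ hg hI]
  simp only [strikeCount_shift]

lemma setLIntegral_cell_hitSum (hμ : ∀ᵐ x ∂μ, ‖x‖ < 1) (hε : 0 < ε)
    (hδ : δ ≤ gap ε ν) (hg : 0 < gap ε ν) (hI : MeasurableSet I) (n) :
    ∫⁻ z in cell ε, ofReal (hitSum μ ε ν I δ n z) ∂𝔪 =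
      𝔪 (cell ε) * (volume (I ∩ Ioo (-1) 1) * ofReal (n * δ)) := by
  simp only [ofReal_hitSum_eq hμ hε hδ hg hI]
  rw [lintegral_finsetSum _ fun i _ => measurable_strikeCount μ ε ν hI _ _]
  have : ∀ i : ℕ, ((i : ℝ) + 1) * δ - i * δ = δ := fun i => by ring
  simp only [setLIntegral_cell_strikeCount hε hI, this]
  rw [Finset.sum_const, Finset.card_range, nsmul_eq_mul, ofReal_mul (by positivity),
    ENNReal.ofReal_natCast]
  ring

/-- Up to a null set, subdividing the time interval does not change the number of strikes. -/
lemma ofReal_hitSum_ae_eq (hμ : ∀ᵐ x ∂μ, ‖x‖ < 1) (hε : 0 < ε)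
    (hδ : δ ≤ gap ε ν) (hg : 0 < gap ε ν) (hI : MeasurableSet I) (n) :
    ∀ᵐ z ∂phaseMeasure.restrict (cell ε), strikeCount μ ε ν I 0 ((n + 1 : ℕ) * δ) z =
      ofReal (hitSum μ ε ν I δ (n + 1) z) := by
  refine ae_eq_of_ae_le_of_lintegral_le (ae_of_all _ fun z => ?_) ?_ ?_ ?_
  · beta_reduce
    rw [ofReal_hitSum_eq hμ hε hδ hg hI]
    push_cast
    exact strikeCount_le_sum μ ε ν hI n z
  · rw [setLIntegral_cell_strikeCount hε hI]
    exact mul_ne_top (phaseMeasure_cell_ne_top hε) (mul_ne_top (ne_top_of_le_ne_top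
      ofReal_ne_top (volume_inter_Ioo_le I)) ofReal_ne_top)
  · fun_prop
  · rw [setLIntegral_cell_strikeCount hε hI, setLIntegral_cell_hitSum hμ hε hδ hg hI, sub_zero]

lemma setLIntegral_cell_hitSum_sub_le (hμ : ∀ᵐ x ∂μ, ‖x‖ < 1) (hε : 0 < ε)
    (hδ0 : 0 ≤ δ) (hδ : δ ≤ gap ε ν) (hg : 0 < gap ε ν) (hI : MeasurableSet I) {n : ℕ}
    (hn : n ≠ 0) {κ : ℝ} (hnh : n * δ = h) (hκ : 0 < κ)
    (hsq : ∫⁻ z in cell ε, strikeCount μ ε ν I 0 h z ^ 2 ∂𝔪 ≤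
      𝔪 (cell ε) * ((volume (I ∩ Ioo (-1) 1) * ofReal h) ^ 2 + ofReal (κ ^ 2))) :
    ∫⁻ z in cell ε, ofReal
        |hitSum μ ε ν I δ n z - h * (volume (I ∩ Ioo (-1) 1)).toReal| ∂𝔪 ≤
      𝔪 (cell ε) * ofReal κ := by
  set ℓ := volume (I ∩ Ioo (-1) 1)
  have hh : 0 ≤ h := by rw [← hnh]; positivity
  have hℓt : ℓ ≠ ⊤ := ne_top_of_le_ne_top ofReal_ne_top (volume_inter_Ioo_le I)
  set m := h * ℓ.toReal with hm
  have hm0 : 0 ≤ m := by positivity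
  have hmE : ofReal m = ℓ * ofReal h := by
    rw [hm, ofReal_mul hh, ENNReal.ofReal_toReal hℓt, mul_comm]
  set u := hitSum μ ε ν I δ n with hu
  have hu0 : ∀ z, 0 ≤ u z := fun z => hitSum_nonneg _ _ _ _ _ _ _
  have hum : Measurable u := by fun_prop
  set Q := 𝔪 (cell ε)
  have hQt : Q ≠ ⊤ := phaseMeasure_cell_ne_top hε
  -- variance identity
  have h1 : ∫⁻ z in cell ε, ofReal ((u z - m) ^ 2) ∂𝔪 ≤ Q * ofReal (κ ^ 2) := by
    have e : ∀ z, ofReal ((u z - m) ^ 2) + 2 * ofReal m * ofReal (u z) =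
        ofReal (u z) ^ 2 + ofReal m ^ 2 := by
      intro z
      rw [← ENNReal.ofReal_ofNat, ← ENNReal.ofReal_pow (hu0 z), ← ENNReal.ofReal_pow hm0,
        ← ofReal_mul zero_le_two, ← ofReal_mul (by positivity),
        ← ofReal_add (by positivity) (by have := hu0 z; positivity),
        ← ofReal_add (by positivity) (by positivity)]
      congr 1
      ring
    have hmu : ∫⁻ z in cell ε, 2 * ofReal m * ofReal (u z) ∂𝔪 = 2 * (Q * ofReal m ^ 2) := by
      rw [lintegral_const_mul _ hum.ennreal_ofReal,
        setLIntegral_cell_hitSum hμ hε hδ hg hI, hnh, ← hmE]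
      ring
    have hs : ∫⁻ z in cell ε, ofReal (u z) ^ 2 ∂𝔪 ≤ Q * (ofReal m ^ 2 + ofReal (κ ^ 2)) := by
      obtain ⟨k, rfl⟩ := Nat.exists_eq_succ_of_ne_zero hn
      have hae := ofReal_hitSum_ae_eq hμ hε hδ hg hI k
      rw [lintegral_congr_ae, hmE]
      · exact hsq
      · filter_upwards [hae] with z hz
        rw [hu, ← hnh, hz]
    have h2 : ∫⁻ z in cell ε, ofReal ((u z - m) ^ 2) ∂𝔪 + 2 * (Q * ofReal m ^ 2) ≤
        Q * ofReal (κ ^ 2) + 2 * (Q * ofReal m ^ 2) := by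
      calc ∫⁻ z in cell ε, ofReal ((u z - m) ^ 2) ∂𝔪 + 2 * (Q * ofReal m ^ 2)
          = ∫⁻ z in cell ε, (ofReal ((u z - m) ^ 2) + 2 * ofReal m * ofReal (u z)) ∂𝔪 := by
            rw [← hmu]
            exact (lintegral_add_left (by fun_prop) _).symm
        _ = ∫⁻ z in cell ε, ofReal (u z) ^ 2 ∂𝔪 + Q * ofReal m ^ 2 := by
            rw [lintegral_congr e, lintegral_add_right _ measurable_const, setLIntegral_const,
              mul_comm Q]
        _ ≤ Q * (ofReal m ^ 2 + ofReal (κ ^ 2)) + Q * ofReal m ^ 2 := add_le_add_left hs _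
        _ = _ := by ring
    exact (ENNReal.add_le_add_iff_right (mul_ne_top (by simp)
      (mul_ne_top hQt (ENNReal.pow_ne_top ofReal_ne_top)))).1 h2
  have h2 : ∀ z, ofReal |u z - m| ≤ ofReal (1 / (2 * κ)) *
      ofReal ((u z - m) ^ 2) + ofReal (κ / 2) := by
    intro z
    rw [← ofReal_mul (by positivity), ← ofReal_add (by positivity) (by positivity)]
    refine ofReal_le_ofReal ?_
    have h3 : 1 / (2 * κ) * (u z - m) ^ 2 + κ / 2 - |u z - m| =
        1 / (2 * κ) * (|u z - m| - κ) ^ 2 := by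
      rw [← sq_abs (u z - m)]
      field_simp
      ring
    have h4 : 0 ≤ 1 / (2 * κ) * (|u z - m| - κ) ^ 2 := by positivity
    linarith
  calc ∫⁻ z in cell ε, ofReal |u z - m| ∂𝔪 ≤ ∫⁻ z in cell ε, (ofReal (1 / (2 * κ)) *
      ofReal ((u z - m) ^ 2) + ofReal (κ / 2)) ∂𝔪 := lintegral_mono h2
    _ = ofReal (1 / (2 * κ)) * ∫⁻ z in cell ε, ofReal ((u z - m) ^ 2) ∂𝔪 + ofReal (κ / 2) * Q := by
        rw [lintegral_add_right _ measurable_const, setLIntegral_const,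
          lintegral_const_mul _ (by fun_prop)]
    _ ≤ ofReal (1 / (2 * κ)) * (Q * ofReal (κ ^ 2)) + ofReal (κ / 2) * Q :=
        add_le_add_left (mul_le_mul_right h1 _) _
    _ = Q * (ofReal (1 / (2 * κ)) * ofReal (κ ^ 2) + ofReal (κ / 2)) := by ring
    _ = Q * ofReal κ := by
        rw [← ofReal_mul (by positivity), ← ofReal_add (by positivity) (by positivity)]
        congr 2
        field_simp
        norm_num

/-- The ranges cover only a small part of the plane. -/
lemma phaseMeasure_slab_ranges_le (hε : 0 < ε) (hε1 : ε ≤ 1) (ρ) :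
    𝔪 (slab ρ ∩ {z | z.1 ∈ obstacleRanges ε ν}) ≤
      𝔪 (slab (ρ + 2)) * ofReal (π * (rangeRadius ε ν / √ε) ^ 2) := by
  have hR := rangeRadius_pos hε ν
  set F : Phase → ENNReal := fun z =>
    ∑' p, ((fun z => z.1) ⁻¹' Metric.ball 0 (rangeRadius ε ν)).indicator
      (1 : Phase → ENNReal) (shift (-site ε p) z) with hF
  have hb : MeasurableSet ((fun z : Phase => z.1) ⁻¹' Metric.ball (0 : Plane) (rangeRadius ε ν)) :=
    measurable_fst Metric.isOpen_ball.measurableSet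
  have hFm : Measurable F := Measurable.tsum fun p =>
    (measurable_one.indicator hb).comp (measurePreserving_shift _).measurable
  have h1 : ∀ z : Phase, z.1 ∈ obstacleRanges ε ν → 1 ≤ F z := by
    intro z hz
    obtain ⟨p, hp⟩ := mem_obstacleRanges.1 hz
    refine le_trans ?_ (ENNReal.le_tsum p)
    rw [indicator_of_mem]
    · rfl
    · rw [Metric.mem_ball, dist_eq_norm] at hp
      simpa [shift, ← sub_eq_add_neg] using hp
  have hm : MeasurableSet {z : Phase | z.1 ∈ obstacleRanges ε ν} :=
    measurable_fst (isOpen_obstacleRanges ε ν).measurableSet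
  calc 𝔪 (slab ρ ∩ {z | z.1 ∈ obstacleRanges ε ν})
      = ∫⁻ z in slab ρ ∩ {z | z.1 ∈ obstacleRanges ε ν}, 1 ∂𝔪 := by simp
    _ ≤ ∫⁻ z in slab ρ ∩ {z | z.1 ∈ obstacleRanges ε ν}, F z ∂𝔪 :=
        setLIntegral_mono' ((measurableSet_slab ρ).inter hm) fun z hz => h1 z hz.2
    _ ≤ ∫⁻ z in slab ρ, F z ∂𝔪 := lintegral_mono_set Set.inter_subset_left
    _ ≤ _ := by
        refine setLIntegral_slab_le_of_cell hε hε1 hFm ?_ ?_ ρ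
        · intro q z
          rw [hF]
          simp only
          rw [← (Equiv.addLeft q).tsum_eq]
          refine tsum_congr fun p => ?_
          congr 1
          rw [Equiv.coe_addLeft, site_add]
          simp only [shift, Prod.mk.injEq, and_true]
          abel
        · rw [hF, setLIntegral_cell_tsum hε (by fun_prop), lintegral_indicator_one hb]
          have e : (fun z => z.1) ⁻¹' Metric.ball (0 : Plane) (rangeRadius ε ν) =
              Metric.ball (0 : Plane) (rangeRadius ε ν) ×ˢ (univ : Set Velocity) := by ext z; simp
          rw [e, phaseMeasure, Measure.prod_prod, arcLength_univ, ← phaseMeasure,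
            phaseMeasure_cell hε, EuclideanSpace.volume_ball_fin_two, ← ENNReal.ofReal_pow hR.le,
            ← NNReal.coe_real_pi, ← ofReal_mul (by positivity), ← ofReal_mul (by positivity),
            ← ofReal_mul (by positivity)]
          refine ofReal_le_ofReal (le_of_eq ?_)
          have := Real.sq_sqrt hε.le
          have hs := sqrt_pos.2 hε
          rw [div_pow, this]
          field_simp

end SecondMoment

/-! ### The process during a short time -/

/-- Bounded Lipschitz functions with bounded support, with explicit constants. -/
structure IsTest (C A L : ℝ) (ψ : Phase → ℝ) : Prop where
  bound : ∀ z, |ψ z| ≤ C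
  support : ∀ z : Phase, A < ‖z.1‖ → ψ z = 0
  lipschitz : ∀ z z', |ψ z - ψ z'| ≤ L * dist z z'
  nonneg : 0 ≤ L

/-- The effect of the collisions on a test function: the mean over the impact parameter of the
change at a collision, times the rate `2` of the collisions. -/
def scatter (ψ : Phase → ℝ) (z : Phase) : ℝ :=
  ∫ σ in Ioo (-1 : ℝ) 1, (ψ (z.1, rotVel (turn σ) z.2) - ψ z)

/-- First order approximation of the evolution of `ψ` during the time `h`. -/
def shortTime (h : ℝ) (ψ : Phase → ℝ) (z : Phase) : ℝ :=
  ψ (freeFlight h z) + h * scatter ψ z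

lemma dist_freeFlight_le (hh : 0 ≤ h) (z z') :
    dist (freeFlight h z) (freeFlight h z') ≤ (1 + h) * dist z z' := by
  have h1 : dist z.1 z'.1 ≤ dist z z' := le_max_left _ _
  have h2 : dist z.2 z'.2 ≤ dist z z' := le_max_right _ _
  have h0 : 0 ≤ dist z z' := dist_nonneg
  rw [Prod.dist_eq]
  refine max_le ?_ ?_
  · rw [freeFlight_fst, freeFlight_fst]
    refine (dist_add_add_le _ _ _ _).trans ?_
    rw [dist_smul₀, Real.norm_of_nonneg hh]
    have h3 : dist (z.2 : Plane) (z'.2 : Plane) ≤ dist z z' := h2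
    nlinarith
  · change dist z.2 z'.2 ≤ _
    nlinarith

lemma turn_mem {σ : ℝ} : turn σ ∈ Icc 0 (2 * π) := by
  have h1 := Real.neg_pi_div_two_le_arcsin σ
  have h2 := Real.arcsin_le_pi_div_two σ
  unfold turn
  constructor <;> linarith

instance : IsFiniteMeasure ((volume : Measure ℝ).restrict (Ioo (-1 : ℝ) 1)) :=
  isFiniteMeasure_restrict.2 (by rw [volume_Ioo]; exact ofReal_ne_top)

lemma continuous_turned (z : Phase) : Continuous fun σ => (z.1, rotVel (turn σ) z.2) := by fun_prop

lemma abs_integral_Ioo_le {f : ℝ → ℝ} {K : ℝ} (h : ∀ σ, |f σ| ≤ K) :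
    |∫ σ in Ioo (-1 : ℝ) 1, f σ| ≤ 2 * K := by
  have := norm_setIntegral_le_of_norm_le_const (μ := volume) (s := Ioo (-1 : ℝ) 1) (f := f)
    measure_Ioo_lt_top (fun σ _ => h σ)
  rw [Measure.real, volume_Ioo, toReal_ofReal (by norm_num)] at this
  rw [norm_eq_abs] at this
  linarith

namespace IsTest

variable {ψ : Phase → ℝ}

lemma continuous (h : IsTest C A L ψ) : Continuous ψ := by
  have : LipschitzWith ⟨L, h.nonneg⟩ ψ := LipschitzWith.of_dist_le_mul fun z z' => by
    rw [Real.dist_eq]; exact h.lipschitz z z'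
  exact this.continuous

lemma measurable (h : IsTest C A L ψ) : Measurable ψ := h.continuous.measurable

lemma bound_nonneg (h : IsTest C A L ψ) : 0 ≤ C := (abs_nonneg _).trans (h.bound (0, unitVector 0))

lemma mono (h : IsTest C A L ψ) {C' A' L' : ℝ} (hC : C ≤ C') (hA : A ≤ A') (hL : L ≤ L') :
    IsTest C' A' L' ψ where
  bound z := (h.bound z).trans hC
  support z hz := h.support z (hA.trans_lt hz)
  lipschitz z z' := (h.lipschitz z z').trans (mul_le_mul_of_nonneg_right hL dist_nonneg)
  nonneg := h.nonneg.trans hL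

lemma abs_change_le (h : IsTest C A L ψ) (α z) :
    |ψ (z.1, rotVel α z.2) - ψ z| ≤ 2 * C := by
  have h1 := h.bound (z.1, rotVel α z.2)
  have h2 := h.bound z
  have h3 := abs_sub (ψ (z.1, rotVel α z.2)) (ψ z)
  linarith

lemma integrableOn_change (h : IsTest C A L ψ) (z : Phase) :
    IntegrableOn (fun σ => ψ (z.1, rotVel (turn σ) z.2) - ψ z) (Ioo (-1) 1) :=
  Integrable.of_bound ((h.continuous.comp (continuous_turned z)).sub
    continuous_const).aestronglyMeasurable (2 * C) (ae_of_all _ fun σ => h.abs_change_le (turn σ) z)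

lemma abs_scatter_le (h : IsTest C A L ψ) (z) : |scatter ψ z| ≤ 4 * C := by
  have := abs_integral_Ioo_le fun σ => h.abs_change_le (turn σ) z
  unfold scatter
  linarith

lemma abs_scatter_sub_le (h : IsTest C A L ψ) (z z') :
    |scatter ψ z - scatter ψ z'| ≤ 4 * L * dist z z' := by
  unfold scatter
  rw [← integral_sub (h.integrableOn_change z) (h.integrableOn_change z')]
  refine (abs_integral_Ioo_le (K := 2 * L * dist z z') fun σ => ?_).trans (le_of_eq ?_)
  · have h1 := h.lipschitz (z.1, rotVel (turn σ) z.2) (z'.1, rotVel (turn σ) z'.2)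
    have h2 := h.lipschitz z z'
    have e : dist (z.1, rotVel (turn σ) z.2) (z'.1, rotVel (turn σ) z'.2) = dist z z' := by
      rw [Prod.dist_eq, Prod.dist_eq, dist_rotVel]
    rw [e] at h1
    rw [sub_sub_sub_comm]
    exact (abs_sub _ _).trans (by linarith)
  · ring

lemma shortTime (h : IsTest C A L ψ) (hs : 0 ≤ s) :
    IsTest (C * (1 + 5 * s)) (A + s) (L * (1 + 5 * s)) (shortTime s ψ) where
  bound z := by
    have h1 := h.bound (freeFlight s z)
    have h3 := h.bound_nonneg
    unfold LorentzGas.shortTime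
    refine (abs_add_le _ _).trans ?_
    rw [abs_mul, abs_of_nonneg hs]
    nlinarith [mul_le_mul_of_nonneg_left (h.abs_scatter_le z) hs, mul_nonneg h3 hs]
  support z hz := by
    have h1 := norm_freeFlight_fst_le s z
    rw [abs_of_nonneg hs] at h1
    have h2 : ∀ α, ψ (z.1, rotVel α z.2) = 0 := fun α => h.support _ (by change A < ‖z.1‖; linarith)
    rw [LorentzGas.shortTime, scatter, h.support (freeFlight s z) (by linarith), (h.support z (by
      linarith))]
    simp [h2]
  lipschitz z z' := by
    have h1 := h.lipschitz (freeFlight s z) (freeFlight s z')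
    have h3 := dist_freeFlight_le hs z z'
    have h4 : 0 ≤ dist z z' := dist_nonneg
    have h5 := h.nonneg
    unfold LorentzGas.shortTime
    rw [add_sub_add_comm, ← mul_sub]
    refine (abs_add_le _ _).trans ?_
    rw [abs_mul, abs_of_nonneg hs]
    have h6 := mul_le_mul_of_nonneg_left h3 h5
    have h7 := mul_le_mul_of_nonneg_left (h.abs_scatter_sub_le z z') hs
    nlinarith [mul_nonneg (mul_nonneg h5 h4) hs]
  nonneg := mul_nonneg h.nonneg (by linarith)

lemma iterate_shortTime (h : IsTest C A L ψ) (hs : 0 ≤ s) (n : ℕ) :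
    IsTest (C * (1 + 5 * s) ^ n) (A + n * s) (L * (1 + 5 * s) ^ n)
      ((LorentzGas.shortTime s)^[n] ψ) := by
  induction n with
  | zero => simpa using h
  | succ n ih =>
    rw [iterate_succ_apply', pow_succ, ← mul_assoc, ← mul_assoc]
    exact (ih.shortTime hs).mono le_rfl (by push_cast; linarith) le_rfl

end IsTest

/-- The impact parameters for which the deflection angle is in `[k h, (k+1) h)`. -/
def turnCell (h : ℝ) (k : ℕ) : Set ℝ := {σ | ⌊turn σ / h⌋₊ = k}

lemma measurableSet_turnCell (h k) : MeasurableSet (turnCell h k) :=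
  (Nat.measurable_floor.comp (by fun_prop)) (measurableSet_singleton k)

lemma abs_turn_sub_le (hh : 0 < h) {k : ℕ} {σ : ℝ} (hσ : σ ∈ turnCell h k) :
    |turn σ - k * h| ≤ h := by
  have h0 : 0 ≤ turn σ / h := div_nonneg turn_mem.1 hh.le
  have hσ' : ⌊turn σ / h⌋₊ = k := hσ
  have h1 := Nat.floor_le h0
  have h2 := Nat.lt_floor_add_one (turn σ / h)
  rw [hσ', le_div_iff₀ hh] at h1
  rw [hσ', div_lt_iff₀ hh] at h2
  rw [abs_le]
  constructor <;> linarith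

/-- Number of sets `turnCell h k` that suffice to cover `[-1, 1]`. -/
def turnCount (h : ℝ) : ℕ := ⌊2 * π / h⌋₊ + 1

lemma turn_lt_count (hh : 0 < h) (σ) : ⌊turn σ / h⌋₊ < turnCount h :=
  Nat.lt_succ_of_le (Nat.floor_le_floor (div_le_div_of_nonneg_right turn_mem.2 hh.le))

lemma exists_unique_turnCell (hh : 0 < h) (σ) :
    ∃ k : Fin (turnCount h), σ ∈ turnCell h k ∧ ∀ k' : Fin (turnCount h),
      σ ∈ turnCell h k' → k' = k :=
  ⟨⟨_, turn_lt_count hh σ⟩, rfl, fun _ hk' => Fin.ext hk'.symm⟩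

/-- The collision integral as a sum over small intervals of the deflection angle. -/
lemma abs_sum_sub_scatter_le {ψ : Phase → ℝ} (hψ : IsTest C A L ψ) (hh : 0 < h) (z) :
    |∑ k : Fin (turnCount h), (ψ (z.1, rotVel (k * h) z.2) - ψ z) *
        (volume (turnCell h k ∩ Ioo (-1) 1)).toReal - scatter ψ z| ≤ 2 * L * h := by
  classical
  set a : ℕ → ℝ := fun k => ψ (z.1, rotVel (k * h) z.2) - ψ z with ha
  have h1 : ∑ k : Fin (turnCount h), a k * (volume (turnCell h k ∩ Ioo (-1) 1)).toReal =
      ∫ σ in Ioo (-1 : ℝ) 1, a ⌊turn σ / h⌋₊ := by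
    have e : ∀ σ, a ⌊turn σ / h⌋₊ =
        ∑ k : Fin (turnCount h), (turnCell h k).indicator (fun _ => a k) σ := by
      intro σ
      obtain ⟨k, hk, hu⟩ := exists_unique_turnCell hh σ
      rw [Finset.sum_eq_single k, indicator_of_mem hk]
      · rw [show ⌊turn σ / h⌋₊ = k from hk]
      · intro k' _ hk'
        exact indicator_of_notMem (fun hc => hk' (hu k' hc)) _
      · simp
    simp only [e]
    rw [integral_finsetSum _ fun (k : Fin (turnCount h)) _ =>
      (integrable_const (a k)).indicator (measurableSet_turnCell h k)]
    refine Finset.sum_congr rfl fun k _ => ?_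
    rw [integral_indicator_const _ (measurableSet_turnCell h k), smul_eq_mul, mul_comm,
      Measure.real,
      Measure.restrict_apply (measurableSet_turnCell h k)]
  have hm :=
    (measurable_of_countable a).comp (Nat.measurable_floor.comp (measurable_turn.div_const h))
  change |∑ k : Fin (turnCount h), a k * (volume (turnCell h k ∩ Ioo (-1) 1)).toReal - _| ≤ _
  rw [h1, scatter, ← integral_sub _ (hψ.integrableOn_change z)]
  · refine (abs_integral_Ioo_le (K := L * h) fun σ => ?_).trans (le_of_eq ?_)
    · rw [ha]
      simp only [sub_sub_sub_cancel_right]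
      refine (hψ.lipschitz _ _).trans (mul_le_mul_of_nonneg_left ?_ hψ.nonneg)
      rw [Prod.dist_eq, dist_self, max_eq_right dist_nonneg]
      refine (dist_rotVel_le _ _ _).trans ?_
      rw [abs_sub_comm]
      exact abs_turn_sub_le hh (k := ⌊turn σ / h⌋₊) rfl
    · ring
  · exact Integrable.of_bound hm.aestronglyMeasurable (2 * C)
      (ae_of_all _ fun σ => hψ.abs_change_le _ z)

section Block

variable {μ : Measure Plane} [IsProbabilityMeasure μ] {ψ : Phase → ℝ}

/-- The outcome of a single collision during the time `h`. -/
lemma abs_collision_outcome_le (hψ : IsTest C A L ψ) (hε : 0 < ε) (hh : 0 < h) (hεh : 2 * ε ≤ h)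
    {k : ℕ} (ha : 0 ≤ a) (hb : b ≤ h) (hz : z ∈ strikeSet ε c (turnCell h k) a b) :
    |ψ (freeFlight h (deflect ε c z)) - ψ (freeFlight h z) -
      (ψ (z.1, rotVel (k * h) z.2) - ψ z)| ≤ 4 * L * h := by
  obtain ⟨h1, h2, h3, h4⟩ := hz
  set τ := entryTime ε c z
  have hτ0 : 0 ≤ τ := ha.trans h3
  have hτh : τ ≤ h := h4.trans hb
  have d1 := dist_freeFlight_entryTime hε h1.le
  have d2 := dist_deflect hε h1.le
  have d3 : dist (freeFlight h (deflect ε c z)).1 z.1 ≤ 2 * h := by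
    have e1 := dist_freeFlight h τ (deflect ε c z)
    have e2 := dist_freeFlight τ 0 z
    rw [abs_of_nonneg (by linarith)] at e1 e2
    have e3 : (freeFlight 0 z).1 = z.1 := by simp [freeFlight]
    rw [e3] at e2
    have e4 := dist_triangle (freeFlight h (deflect ε c z)).1 (freeFlight τ (deflect ε c z)).1 z.1
    have e5 := dist_triangle (freeFlight τ (deflect ε c z)).1 c z.1
    have e6 := dist_triangle_left c z.1 (freeFlight τ z).1
    linarith
  have d4 : dist (freeFlight h (deflect ε c z)) (z.1, rotVel (k * h) z.2) ≤ 2 * h := by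
    rw [Prod.dist_eq]
    refine max_le d3 ?_
    change dist (rotVel (turn (tra c z / ε)) z.2) (rotVel (k * h) z.2) ≤ _
    have := (dist_rotVel_le (turn (tra c z / ε)) (k * h) z.2).trans (abs_turn_sub_le hh h2)
    linarith
  have d5 : dist (freeFlight h z) z ≤ h := by
    rw [Prod.dist_eq]
    refine max_le ?_ ?_
    · have e2 := dist_freeFlight h 0 z
      rw [abs_of_nonneg (by linarith)] at e2
      have e3 : (freeFlight 0 z).1 = z.1 := by simp [freeFlight]
      rw [e3] at e2
      linarith
    · change dist z.2 z.2 ≤ h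
      rw [dist_self]; exact hh.le
  have l1 := (hψ.lipschitz _ _).trans (mul_le_mul_of_nonneg_left d4 hψ.nonneg)
  have l2 := (hψ.lipschitz _ _).trans (mul_le_mul_of_nonneg_left d5 hψ.nonneg)
  rw [sub_sub_sub_comm]
  exact (abs_sub _ _).trans (by nlinarith [mul_nonneg hψ.nonneg hh.le])

lemma adv_iterate_eq_zero (hμ : ∀ᵐ x ∂μ, ‖x‖ < 1) (hε : 0 < ε) (hδ0 : 0 ≤ δ)
    (hδ : δ ≤ gap ε ν) (hg : 0 < gap ε ν) (hεδ : 2 * ε ≤ δ) (hA : ∀ z : Phase, A < ‖z.1‖ → ψ z = 0)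
    (n : ℕ) (hz : A + 2 * (n * δ) < ‖z.1‖) (hx : ‖x‖ < 1) :
    (adv μ ε ν δ)^[n] (fun z _ => ψ z) z x = 0 := by
  have h1 := collisionEffect_eq_zero hμ hε hδ0 hδ hg hεδ hA n hz hx
  rw [collisionEffect, hA, sub_zero] at h1
  · exact h1
  · have h1 := norm_freeFlight_fst_le (n * δ) z
    have h2 : 0 ≤ n * δ := by positivity
    rw [abs_of_nonneg h2] at h1
    linarith

/-- Away from the ranges, the error of the short time approximation is controlled by the
fluctuations of the number of strikes. -/
lemma abs_adv_iterate_sub_shortTime_le (hμ : ∀ᵐ x ∂μ, ‖x‖ < 1) (hψ : IsTest C A L ψ) (hε : 0 < ε)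
    (hδ : δ ≤ gap ε ν) (hg : 0 < gap ε ν) (hδ0 : 0 ≤ δ) (hh : 0 < h) (hεh : 2 * ε ≤ h) {n : ℕ}
    (hn : n * δ = h) (hz : z.1 ∉ obstacleRanges ε ν) (x) :
    |(adv μ ε ν δ)^[n] (fun z _ => ψ z) z x - shortTime h ψ z| ≤
      |moreCollisions μ ε ν δ ψ n z x| +
      (4 * L * h * hitSum μ ε ν univ δ n z +
      (2 * C * ∑ k : Fin (turnCount h), |hitSum μ ε ν (turnCell h k) δ n z -
        h * (volume (turnCell h k ∩ Ioo (-1) 1)).toReal| + 2 * L * h ^ 2)) := by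
  have hn0 : n ≠ 0 := by
    rintro rfl
    simp at hn
    linarith
  set a : ℕ → ℝ := fun k => ψ (z.1, rotVel (k * h) z.2) - ψ z
  have h1 := abs_integral_oneCollision_sub_le (κ := Fin (turnCount h))
    (I := fun k => turnCell h k) (fun k => measurableSet_turnCell h k)
    (fun σ _ => exists_unique_turnCell hh σ) hμ hε hδ hg hψ.measurable hψ.bound
    (a := fun k => a k) (η := 4 * L * h) n (z := z) ?_
  swap
  · intro i hi p k y _ hs
    rw [freeFlight_mem_strikeSet] at hs
    rw [hn]
    refine abs_collision_outcome_le hψ hε hh hεh ?_ ?_ hs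
    · positivity
    · have : (i : ℝ) + 1 ≤ n := by exact_mod_cast hi
      nlinarith
  rw [← oneCollision_eq_integral hn0 hz x] at h1
  set v : Fin (turnCount h) → ℝ := fun k => (volume (turnCell h k ∩ Ioo (-1) 1)).toReal
  have h3 : |∑ k : Fin (turnCount h), a k * hitSum μ ε ν (turnCell h k) δ n z -
      h * ∑ k : Fin (turnCount h), a k * v k| ≤
      2 * C * ∑ k : Fin (turnCount h), |hitSum μ ε ν (turnCell h k) δ n z - h * v k| := by
    rw [Finset.mul_sum, ← Finset.sum_sub_distrib, Finset.mul_sum]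
    refine (Finset.abs_sum_le_sum_abs _ _).trans (Finset.sum_le_sum fun k _ => ?_)
    have e : a k * hitSum μ ε ν (turnCell h k) δ n z - h * (a k * v k) =
        a k * (hitSum μ ε ν (turnCell h k) δ n z - h * v k) := by ring
    rw [e, abs_mul]
    exact mul_le_mul_of_nonneg_right (hψ.abs_change_le _ z) (abs_nonneg _)
  have h4 : |h * ∑ k : Fin (turnCount h), a k * v k - h * scatter ψ z| ≤ 2 * L * h ^ 2 := by
    rw [← mul_sub, abs_mul, abs_of_pos hh]
    nlinarith [mul_le_mul_of_nonneg_left (abs_sum_sub_scatter_le hψ hh z) hh.le]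
  have e : (adv μ ε ν δ)^[n] (fun z _ => ψ z) z x - shortTime h ψ z =
      moreCollisions μ ε ν δ ψ n z x + ((oneCollision μ ε ν δ ψ n z x -
        ∑ k : Fin (turnCount h), a k * hitSum μ ε ν (turnCell h k) δ n z) +
      ((∑ k : Fin (turnCount h), a k * hitSum μ ε ν (turnCell h k) δ n z -
      h * ∑ k : Fin (turnCount h), a k * v k) + (h * ∑ k : Fin (turnCount h), a k * v k -
        h * scatter ψ z))) := by
    rw [moreCollisions, shortTime, hn]
    ring
  rw [e]
  refine (abs_add_le _ _).trans (add_le_add_right ((abs_add_le _ _).trans (add_le_add h1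
    ((abs_add_le _ _).trans (add_le_add h3 h4)))) _)

end Block

/-! ### Iteration of the short time approximation -/

/-- Number of time steps during the time `h`. -/
def stepCount (ε ν h : ℝ) : ℕ := ⌈2 * h / gap ε ν⌉₊

/-- Length of the time steps: of the order of the gap and no more than half of it. -/
def stepSize (ε ν h : ℝ) : ℝ := h / stepCount ε ν h

/-- What has to hold for the decomposition of the time `h` into time steps. -/
structure IsFine (ε ν h : ℝ) : Prop where
  pos : 0 < ε
  le_one : ε ≤ 1
  gap_pos : 0 < gap ε ν
  count_ne : stepCount ε ν h ≠ 0
  count_mul : stepCount ε ν h * stepSize ε ν h = h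
  size_pos : 0 < stepSize ε ν h
  size_lt : stepSize ε ν h < gap ε ν
  size_add_le : stepSize ε ν h + 2 * ε ≤ gap ε ν
  le_size : 2 * ε ≤ stepSize ε ν h
  size_le : stepSize ε ν h ≤ h

lemma eventually_isFine (hν : ν < 1) (hh : 0 < h) : ∀ᶠ ε in 𝓝[>] (0 : ℝ), IsFine ε ν h := by
  filter_upwards [eventually_rangeRadius_le hν (show (0 : ℝ) < 1 / 4 by norm_num),
    eventually_sqrt_lt hh, eventually_sqrt_lt (show (0 : ℝ) < 1 / 12 by norm_num),
    self_mem_nhdsWithin] with ε h1 h2 h3 hε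
  have hε0 : (0 : ℝ) < ε := hε
  have hs := sqrt_pos.2 hε0
  have hss := Real.mul_self_sqrt hε0.le
  have hR := rangeRadius_pos hε0 ν
  have hg1 : √ε / 2 ≤ gap ε ν := by unfold gap; linarith
  have hg2 : gap ε ν ≤ √ε := by unfold gap; linarith
  have hg : 0 < gap ε ν := by linarith
  have hε12 : 12 * ε ≤ √ε := by nlinarith
  have hM1 : 2 * h / gap ε ν ≤ stepCount ε ν h := Nat.le_ceil _
  have hM0 : (0 : ℝ) < stepCount ε ν h := lt_of_lt_of_le (by positivity) hM1
  have hMn : stepCount ε ν h ≠ 0 := by intro h0; rw [h0] at hM0; simp at hM0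
  have hm : stepCount ε ν h * stepSize ε ν h = h := mul_div_cancel₀ _ hM0.ne'
  have hδ : 0 < stepSize ε ν h := div_pos hh hM0
  have hδ1 : stepSize ε ν h ≤ gap ε ν / 2 := by
    rw [div_le_iff₀ hg] at hM1
    rw [stepSize, div_le_iff₀ hM0]
    linarith
  have hδ2 : gap ε ν / 3 ≤ stepSize ε ν h := by
    rw [stepSize, le_div_iff₀ hM0]
    have : (stepCount ε ν h : ℝ) * gap ε ν < (2 * h / gap ε ν + 1) * gap ε ν :=
      mul_lt_mul_of_pos_right (Nat.ceil_lt_add_one (by positivity)) hg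
    rw [add_mul, div_mul_cancel₀ _ hg.ne'] at this
    linarith
  exact ⟨hε0, by nlinarith, hg, hMn, hm, hδ, by linarith, by linarith, by linarith, by linarith⟩

/-- The constant in the error of the short time approximation. -/
def blockConst (C A L : ℝ) : ℝ := (10 * L + 2080 * C) * (𝔪 (slab (A + 9))).toReal + 2

lemma phaseMeasure_slab_le (h : ρ ≤ A + 9) : 𝔪 (slab ρ) ≤ ofReal (𝔪 (slab (A + 9))).toReal := by
  rw [ENNReal.ofReal_toReal (phaseMeasure_slab_ne_top _)]
  exact measure_mono fun z hz => le_trans (show ‖z.1‖ ≤ ρ from hz) h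

lemma lintegral_fst_prod {X Y : Type*} [MeasurableSpace X] [MeasurableSpace Y] {m : Measure X}
    {n : Measure Y} [SFinite m] [IsProbabilityMeasure n] {F : X → ENNReal} (hF : Measurable F) :
    ∫⁻ p, F p.1 ∂m.prod n = ∫⁻ x, F x ∂m := measurePreserving_fst.lintegral_comp hF

section Block

variable {φ : Plane → ℝ} {ψ : Phase → ℝ}

lemma ae_prod_norm_lt {μ : Measure Plane} [IsProbabilityMeasure μ] (hμ : ∀ᵐ x ∂μ, ‖x‖ < 1) :
    ∀ᵐ p ∂𝔪× μ, ‖p.2‖ < 1 := Measure.quasiMeasurePreserving_snd.ae hμ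

lemma exists_mul_le {X : ℝ} (hX : 0 ≤ X) (hh : 0 < h) : ∃ b > 0, X * b ≤ h := by
  refine ⟨h / (X + 1), by positivity, ?_⟩
  rw [mul_div_assoc', div_le_iff₀ (by positivity)]
  nlinarith

/-- During a short time the process is described by the short time approximation, up to an error
that is quadratic in the time. -/
theorem eventually_lintegral_adv_sub_shortTime_le (hν : ν ∈ Ioo (1 / 2 : ℝ) 1)
    (hφ : IsProbDensity volume φ) (hμ : ∀ᵐ x ∂obstacleLaw φ, ‖x‖ < 1) (hψ : IsTest C A L ψ)
    (hh : 0 < h) (hh1 : h ≤ 1) :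
    ∀ᶠ ε in 𝓝[>] (0 : ℝ), ∫⁻ p, ‖(adv (obstacleLaw φ) ε ν (stepSize ε ν h))^[stepCount ε ν h]
        (fun z _ => ψ z) p.1 p.2 - shortTime h ψ p.1‖ₑ ∂𝔪× (obstacleLaw φ) ≤
      ofReal (blockConst C A L * h ^ 2) := by
  have := isProbabilityMeasure_obstacleLaw hφ
  have hC := hψ.bound_nonneg
  have hL := hψ.nonneg
  set μ := obstacleLaw φ
  set V := (𝔪 (slab (A + 9))).toReal with hV
  have hV0 : 0 ≤ V := toReal_nonneg
  set N := turnCount h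
  have hh2 : 0 < h ^ 2 := by positivity
  obtain ⟨κ, hκ, hκ1⟩ := exists_mul_le (X := 2 * C * (N * V)) (by positivity) hh2
  obtain ⟨b, hb, hb1⟩ := exists_mul_le (X := 7 * C * (V * π)) (by positivity) hh2
  have hsq : ∀ᶠ ε in 𝓝[>] (0 : ℝ), ∀ k : Fin N, ∫⁻ z in cell ε,
      strikeCount μ ε ν (turnCell h k) 0 h z ^ 2 ∂𝔪 ≤
      𝔪 (cell ε) * ((volume (turnCell h k ∩ Ioo (-1) 1) * ofReal h) ^ 2 + ofReal (κ ^ 2)) :=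
    eventually_all.2 fun k => eventually_setLIntegral_strikeCount_sq_le hν hφ hμ
      (measurableSet_turnCell h k) hh.le (by positivity)
  filter_upwards [eventually_isFine hν.2 hh, hsq,
    eventually_setLIntegral_strikeCount_sq_le hν hφ hμ MeasurableSet.univ
      (show 0 ≤ 4 * h by positivity) hh2, eventually_rangeRadius_le hν.2 (lt_min hb one_pos)] with ε
        hf hsq hsq' hR
  have hε := hf.pos
  have hg := hf.gap_pos
  set δ := stepSize ε ν h
  set n := stepCount ε ν h
  have hδg : δ ≤ gap ε ν := hf.size_lt.le
  have hδ0 : 0 ≤ δ := hf.size_pos.le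
  -- the three contributions to the error
  set R : Set Phase := slab (A + 2) ∩ {z | z.1 ∈ obstacleRanges ε ν}
  have hRm : MeasurableSet R := (measurableSet_slab _).inter
    (measurable_fst (isOpen_obstacleRanges ε ν).measurableSet)
  set E : Phase → ENNReal := fun z => ofReal (4 * L * h) *
    ofReal (hitSum μ ε ν univ δ n z) + (ofReal (2 * C) *
      ∑ k : Fin N, ofReal |hitSum μ ε ν (turnCell h k) δ n z -
        h * (volume (turnCell h k ∩ Ioo (-1) 1)).toReal| + ofReal (2 * L * h ^ 2)) with hE
  have hm1 : Measurable (hitSum μ ε ν univ δ n) := measurable_hitSum μ ε ν MeasurableSet.univ δ n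
  have hm2 : ∀ k : Fin N, Measurable fun z => ofReal |hitSum μ ε ν (turnCell h k) δ n z -
        h * (volume (turnCell h k ∩ Ioo (-1) 1)).toReal| := fun k =>
    ((measurable_hitSum μ ε ν (measurableSet_turnCell h k) δ n).sub_const _).abs.ennreal_ofReal
  have hEm : Measurable E := by fun_prop
  have hpt : ∀ᵐ p ∂𝔪× μ, ‖(adv μ ε ν δ)^[n] (fun z _ => ψ z) p.1 p.2 -
      shortTime h ψ p.1‖ₑ ≤ (R.indicator (fun _ => ofReal (7 * C)) p.1 +
        (slab (A + 2)).indicator E p.1) + ‖moreCollisions μ ε ν δ ψ n p.1 p.2‖ₑ := by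
    filter_upwards [ae_prod_norm_lt hμ] with p hp
    rw [Real.enorm_eq_ofReal_abs, Real.enorm_eq_ofReal_abs]
    by_cases hs : p.1 ∈ slab (A + 2)
    · by_cases hr : p.1.1 ∈ obstacleRanges ε ν
      · rw [indicator_of_mem (show p.1 ∈ R from ⟨hs, hr⟩), add_assoc]
        refine le_trans (ofReal_le_ofReal ?_) le_self_add
        refine (abs_sub _ _).trans ?_
        have h1 := ((IsTame.of_left hψ.measurable hψ.bound).adv_iterate (μ := μ) (ε := ε) (ν := ν)
          (δ := δ) n).bound p.1 p.2
        have h2 := (hψ.shortTime hh.le).bound p.1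
        nlinarith
      · rw [indicator_of_notMem (fun hc : p.1 ∈ R => hr hc.2), zero_add,
          indicator_of_mem hs, add_comm, hE]
        refine (ofReal_le_ofReal (abs_adv_iterate_sub_shortTime_le hμ hψ hε hδg hg hδ0 hh
          (hf.le_size.trans hf.size_le) hf.count_mul hr p.2)).trans (ENNReal.ofReal_add_le.trans ?_)
        refine add_le_add_right (ENNReal.ofReal_add_le.trans ?_) _
        rw [ofReal_mul (by positivity)]
        refine add_le_add_right (ENNReal.ofReal_add_le.trans ?_) _
        rw [ofReal_mul (by positivity), ENNReal.ofReal_sum_of_nonneg fun k _ => abs_nonneg _]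
    · have hs' : A + 2 < ‖p.1.1‖ := not_le.1 hs
      have h1 : (adv μ ε ν δ)^[n] (fun z _ => ψ z) p.1 p.2 = 0 :=
        adv_iterate_eq_zero hμ hε hδ0 hδg hg hf.le_size hψ.support n
          (by rw [hf.count_mul]; linarith) hp
      rw [h1, ((hψ.shortTime hh.le).support p.1 (by linarith))]
      simp
  have i1 : ∫⁻ z, R.indicator (fun _ => ofReal (7 * C)) z ∂𝔪 ≤ ofReal (h ^ 2) := by
    rw [lintegral_indicator_const hRm]
    calc ofReal (7 * C) * 𝔪 R ≤ ofReal (7 * C) * (ofReal V * ofReal (π * b)) := by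
          refine mul_le_mul_right ((phaseMeasure_slab_ranges_le hε hf.le_one _).trans
            (mul_le_mul' (phaseMeasure_slab_le (A := A) (by linarith)) (ofReal_le_ofReal ?_))) _
          refine mul_le_mul_of_nonneg_left ?_ Real.pi_pos.le
          have hs := sqrt_pos.2 hε
          have h3 : rangeRadius ε ν / √ε ≤ min b 1 := (div_le_iff₀ hs).2 hR
          have h4 : 0 ≤ rangeRadius ε ν / √ε := div_nonneg (rangeRadius_pos hε ν).le hs.le
          have h5 := min_le_left b 1
          have h6 := min_le_right b 1
          nlinarith
      _ ≤ _ := by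
          rw [← ofReal_mul hV0, ← ofReal_mul (by positivity)]
          exact ofReal_le_ofReal (by linarith)
  have i2 : ∫⁻ z, (slab (A + 2)).indicator E z ∂𝔪 ≤
      ofReal (8 * L * V * h ^ 2 + (h ^ 2 + 2 * L * V * h ^ 2)) := by
    have j1 : ∫⁻ z in slab (A + 2), ofReal (hitSum μ ε ν univ δ n z) ∂𝔪 ≤ ofReal (V * (2 * h)) := by
      refine (setLIntegral_slab_le_of_cell hε hf.le_one hm1.ennreal_ofReal
        (fun p z => by rw [hitSum_shift μ hμ hε hδg hg MeasurableSet.univ])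
        (B := ofReal (2 * h)) ?_ _).trans ?_
      · rw [setLIntegral_cell_hitSum hμ hε hδg hg MeasurableSet.univ, hf.count_mul,
          ofReal_mul zero_le_two]
        exact mul_le_mul_right (mul_le_mul_left (volume_inter_Ioo_le _) _) _
      · rw [ofReal_mul hV0]
        exact mul_le_mul_left (phaseMeasure_slab_le (A := A) (by linarith)) _
    have j2 : ∀ k : Fin N, ∫⁻ z in slab (A + 2), ofReal
        |hitSum μ ε ν (turnCell h k) δ n z -
        h * (volume (turnCell h k ∩ Ioo (-1) 1)).toReal| ∂𝔪 ≤
        ofReal (V * κ) := by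
      intro k
      refine (setLIntegral_slab_le_of_cell hε hf.le_one (hm2 k)
        (fun p z => by rw [hitSum_shift μ hμ hε hδg hg (measurableSet_turnCell h k)])
        (setLIntegral_cell_hitSum_sub_le hμ hε hδ0 hδg hg (measurableSet_turnCell h k)
          hf.count_ne hf.count_mul hκ (hsq k)) _).trans ?_
      rw [ofReal_mul hV0]
      exact mul_le_mul_left (phaseMeasure_slab_le (A := A) (by linarith)) _
    rw [lintegral_indicator (measurableSet_slab _), hE,
      lintegral_add_left (hm1.ennreal_ofReal.const_mul _), lintegral_const_mul _ hm1.ennreal_ofReal,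
      lintegral_add_right _ measurable_const,
      lintegral_const_mul _ (Finset.measurable_fun_sum _ fun k _ => hm2 k),
      lintegral_finsetSum _ fun k _ => hm2 k, setLIntegral_const,
      ofReal_add (by positivity) (by positivity), ofReal_add (by positivity) (by positivity)]
    refine add_le_add ?_ (add_le_add ?_ ?_)
    · refine (mul_le_mul_right j1 _).trans ?_
      rw [← ofReal_mul (by positivity)]
      exact ofReal_le_ofReal (le_of_eq (by ring))
    · refine (mul_le_mul_right (Finset.sum_le_sum fun k _ => j2 k) _).trans ?_
      rw [Finset.sum_const, Finset.card_univ, Fintype.card_fin, nsmul_eq_mul,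
        ← ENNReal.ofReal_natCast, ← ofReal_mul (by positivity), ← ofReal_mul (by positivity)]
      exact ofReal_le_ofReal (by linarith)
    · refine (mul_le_mul_right (phaseMeasure_slab_le (A := A) (by linarith)) _).trans ?_
      rw [← ofReal_mul (by positivity)]
      exact ofReal_le_ofReal (le_of_eq (by ring))
  have i3 : ∫⁻ p, ‖moreCollisions μ ε ν δ ψ n p.1 p.2‖ₑ ∂𝔪× μ ≤ ofReal (2080 * C * V * h ^ 2) := by
    refine (lintegral_moreCollisions_le hμ hε hf.size_add_le hf.le_size hψ.measurable hψ.bound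
      hψ.support n hf.count_mul hf.size_le).trans ?_
    have j1 := setLIntegral_slab_le_of_cell hε hf.le_one
      ((measurable_strikeCount μ ε ν MeasurableSet.univ 0 (4 * h)).pow_const 2)
      (fun p z => by rw [strikeCount_shift]) hsq' (A + 5 * h)
    refine (mul_le_mul_right (j1.trans (mul_le_mul' (phaseMeasure_slab_le (A := A) (by linarith))
      (add_le_add_left (pow_le_pow_left₀ zero_le
        (mul_le_mul_left (volume_inter_Ioo_le _) _) 2) _))) _).trans ?_
    rw [← ofReal_mul zero_le_two, ← ENNReal.ofReal_pow (by positivity),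
      ← ofReal_add (by positivity) (by positivity), ← ofReal_mul hV0, ← ofReal_mul (by positivity)]
    exact ofReal_le_ofReal (le_of_eq (by ring))
  have hRi : Measurable fun z : Phase => R.indicator (fun _ => ofReal (7 * C)) z := by fun_prop
  have hEi : Measurable fun z : Phase => (slab (A + 2)).indicator E z :=
    hEm.indicator (measurableSet_slab _)
  have hRp : Measurable fun p : Phase × Plane =>
      R.indicator (fun _ => ofReal (7 * C)) p.1 := by fun_prop
  have hREp : Measurable fun p : Phase × Plane =>
      R.indicator (fun _ => ofReal (7 * C)) p.1 + (slab (A + 2)).indicator E p.1 := by fun_prop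
  refine (lintegral_mono_ae hpt).trans ?_
  rw [lintegral_add_left hREp, lintegral_add_left hRp, lintegral_fst_prod hRi,
    lintegral_fst_prod hEi]
  refine (add_le_add (add_le_add i1 i2) i3).trans ?_
  rw [← ofReal_add (by positivity) (by positivity), ← ofReal_add (by positivity) (by positivity)]
  refine ofReal_le_ofReal (le_of_eq ?_)
  rw [blockConst, ← hV]
  ring

end Block

section Iteration

variable {μ : Measure Plane} [IsProbabilityMeasure μ] {C' : ℝ} {H K : Phase → Plane → ℝ}

lemma adv_sub (hH : IsTame C H) (hK : IsTame C' K) : adv μ ε ν δ (fun z x => H z x - K z x) =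
      fun z x => adv μ ε ν δ H z x - adv μ ε ν δ K z x := by
  funext z x
  exact refresh_sub hH.comp_step hK.comp_step z x

lemma adv_iterate_sub (hH : IsTame C H) (hK : IsTame C' K) (n) :
    (adv μ ε ν δ)^[n] (fun z x => H z x - K z x) =
      fun z x => (adv μ ε ν δ)^[n] H z x - (adv μ ε ν δ)^[n] K z x := by
  induction n with
  | zero => rfl
  | succ n ih =>
    rw [iterate_succ_apply', ih, adv_sub (hH.adv_iterate n) (hK.adv_iterate n)]
    simp only [iterate_succ_apply']

lemma setLIntegral_adv_iterate_le (hμ : ∀ᵐ x ∂μ, ‖x‖ < 1) (hε : 0 < ε) (hδ0 : 0 ≤ δ)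
    (hδ : δ ≤ gap ε ν) (hg : 0 < gap ε ν) (hH : IsTame C H) (n) :
    ∫⁻ p in {p : Phase × Plane | p.1 ∈ outside ε ν p.2}, ‖(adv μ ε ν δ)^[n] H p.1 p.2‖ₑ ∂𝔪× μ ≤
      ∫⁻ p in {p : Phase × Plane | p.1 ∈ outside ε ν p.2}, ‖H p.1 p.2‖ₑ ∂𝔪× μ := by
  induction n with
  | zero => exact le_rfl
  | succ n ih =>
    rw [iterate_succ_apply']
    exact (setLIntegral_adv_le hμ hε hδ0 hδ hg (hH.adv_iterate n)).trans ih

end Iteration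

section Block

variable {φ : Plane → ℝ} {ψ : Phase → ℝ}

/-- Comparison of the process with the iterated short time approximation. The transfer operator
does not increase the `L¹` norm outside of the obstacles, so that the errors add up. -/
theorem eventually_setLIntegral_adv_sub_iterate_le (hν : ν ∈ Ioo (1 / 2 : ℝ) 1)
    (hφ : IsProbDensity volume φ) (hμ : ∀ᵐ x ∂obstacleLaw φ, ‖x‖ < 1)
    (hh : 0 < h) (hh1 : h ≤ 1) (n) (hψ : ∀ k < n, IsTest C A L ((shortTime h)^[k] ψ)) :
    ∀ᶠ ε in 𝓝[>] (0 : ℝ), ∫⁻ p in {p : Phase × Plane | p.1 ∈ outside ε ν p.2},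
        ‖(adv (obstacleLaw φ) ε ν (stepSize ε ν h))^[stepCount ε ν h * n]
        (fun z _ => ψ z) p.1 p.2 - (shortTime h)^[n] ψ p.1‖ₑ ∂𝔪× (obstacleLaw φ) ≤
      ofReal (n * (blockConst C A L * h ^ 2)) := by
  have := isProbabilityMeasure_obstacleLaw hφ
  induction n with
  | zero => exact Eventually.of_forall fun ε => by simp
  | succ n ih =>
    have hψ0 : IsTest C A L ψ := hψ 0 (Nat.succ_pos n)
    have hψn := hψ n (Nat.lt_succ_self n)
    filter_upwards [ih fun k hk => hψ k (hk.trans (Nat.lt_succ_self n)),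
      eventually_lintegral_adv_sub_shortTime_le hν hφ hμ hψn hh hh1,
      eventually_isFine hν.2 hh] with ε h1 h2 hf
    set μ := obstacleLaw φ
    set T := adv μ ε ν (stepSize ε ν h)
    set m := stepCount ε ν h
    have t2 := IsTame.of_left hψn.measurable hψn.bound
    have t3 : IsTame C (T^[m * n] fun z _ => ψ z) := (IsTame.of_left hψ0.measurable
      hψ0.bound).adv_iterate _
    have hK : 0 ≤ blockConst C A L := by
      have := hψ0.bound_nonneg
      have := hψ0.nonneg
      have : 0 ≤ (𝔪 (slab (A + 9))).toReal := toReal_nonneg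
      unfold blockConst
      positivity
    have e : ∀ p : Phase × Plane, T^[m * (n + 1)] (fun z _ => ψ z) p.1 p.2 -
        (shortTime h)^[n + 1] ψ p.1 =
        T^[m] (fun z x => T^[m * n] (fun z _ => ψ z) z x - (shortTime h)^[n] ψ z) p.1 p.2 +
        (T^[m] (fun z _ => (shortTime h)^[n] ψ z) p.1 p.2 -
          shortTime h ((shortTime h)^[n] ψ) p.1) := by
      intro p
      rw [mul_add, mul_one, add_comm (m * n), Function.iterate_add_apply, adv_iterate_sub t3 t2,
        iterate_succ_apply']
      ring
    have hm : Measurable fun p : Phase × Plane => ‖T^[m] (fun z x =>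
        T^[m * n] (fun z _ => ψ z) z x - (shortTime h)^[n] ψ z) p.1 p.2‖ₑ :=
      ((t3.sub t2).adv_iterate m).measurable_prod.enorm
    calc ∫⁻ p in {p : Phase × Plane | p.1 ∈ outside ε ν p.2}, ‖T^[m * (n + 1)]
          (fun z _ => ψ z) p.1 p.2 - (shortTime h)^[n + 1] ψ p.1‖ₑ ∂𝔪× μ
        ≤ ∫⁻ p in {p : Phase × Plane | p.1 ∈ outside ε ν p.2}, (‖T^[m] (fun z x =>
            T^[m * n] (fun z _ => ψ z) z x - (shortTime h)^[n] ψ z) p.1 p.2‖ₑ +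
          ‖T^[m] (fun z _ => (shortTime h)^[n] ψ z) p.1 p.2 -
          shortTime h ((shortTime h)^[n] ψ) p.1‖ₑ) ∂𝔪× μ := by
          refine lintegral_mono fun p => ?_
          rw [e]
          exact enorm_add_le _ _
      _ ≤ ofReal (n * (blockConst C A L * h ^ 2)) + ofReal (blockConst C A L * h ^ 2) := by
          rw [lintegral_add_left hm]
          exact add_le_add ((setLIntegral_adv_iterate_le hμ hf.pos hf.size_pos.le hf.size_lt.le
            hf.gap_pos (t3.sub t2) m).trans h1) ((setLIntegral_le_lintegral _ _).trans h2)
      _ = _ := by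
          rw [← ofReal_add (by positivity) (by positivity)]
          congr 1
          push_cast
          ring

lemma compl_outside_subset (hε : 0 < ε) (hx : ‖x‖ < 1)
    (hz : z ∉ outside ε ν x) : z.1 ∈ obstacleRanges ε ν := by
  unfold outside at hz
  simp only [mem_ofPred_eq, not_forall, not_le] at hz
  obtain ⟨p, hp⟩ := hz
  exact mem_obstacleRanges.2 ⟨p, mem_range_of_dist_centre hε hx hp.le⟩

/-- Comparison of the process with the iterated short time approximation, for a bounded initial
density with bounded support. -/
theorem eventually_abs_integral_sub_iterate_le (hν : ν ∈ Ioo (1 / 2 : ℝ) 1)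
    (hφ : IsProbDensity volume φ) (hμ : ∀ᵐ x ∂obstacleLaw φ, ‖x‖ < 1)
    (hh : 0 < h) (hh1 : h ≤ 1) {n : ℕ} (hn : n ≠ 0)
    (hψ : ∀ k ≤ n, IsTest C A L ((shortTime h)^[k] ψ)) {f : Phase → ℝ} (hf : Integrable f 𝔪) {R : ℝ}
    (hfR : ∀ z, |f z| ≤ R) (hfs : ∀ z, z ∉ slab R → f z = 0) {κ : ℝ} (hκ : 0 < κ) :
    ∀ᶠ ε in 𝓝[>] (0 : ℝ),
      |∫ z, f z * (∫ ξ, ψ (markovLorentz ε ν ξ (n * h) z)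
          ∂(Measure.infinitePi fun _ : ℕ => obstacleLaw φ)) ∂𝔪 -
        ∫ z, f z * (shortTime h)^[n] ψ z ∂𝔪| ≤
      R * (n * (blockConst C A L * h ^ 2) + κ) := by
  have := isProbabilityMeasure_obstacleLaw hφ
  have hψ0 : IsTest C A L ψ := hψ 0 (Nat.zero_le n)
  have hψn := hψ n le_rfl
  have hC := hψ0.bound_nonneg
  have hR0 : 0 ≤ R := (abs_nonneg _).trans (hfR (0, unitVector 0))
  set V := (𝔪 (slab (R + 2))).toReal with hV
  have hV0 : 0 ≤ V := toReal_nonneg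
  obtain ⟨b, hb, hb1⟩ := exists_mul_le (X := 2 * C * (V * π)) (by positivity) hκ
  filter_upwards [eventually_setLIntegral_adv_sub_iterate_le hν hφ hμ hh hh1 n
    fun k hk => hψ k hk.le, eventually_isFine hν.2 hh, eventually_rangeRadius_le hν.2 (lt_min hb
      one_pos)] with ε h1 hfine hRR
  set μ := obstacleLaw φ
  set T := adv μ ε ν (stepSize ε ν h)
  set m := stepCount ε ν h
  have hε := hfine.pos
  have t2 := IsTame.of_left hψn.measurable hψn.bound
  have t3 : IsTame C (T^[m * n] fun z _ => ψ z) := (IsTame.of_left hψ0.measurable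
    hψ0.bound).adv_iterate _
  have hK : 0 ≤ blockConst C A L := by
    have := hψ0.nonneg
    have : 0 ≤ (𝔪 (slab (A + 9))).toReal := toReal_nonneg
    unfold blockConst
    positivity
  set D : Phase → Plane → ℝ := fun z x =>
    T^[m * n] (fun z _ => ψ z) z x - (shortTime h)^[n] ψ z with hD
  have tD : IsTame (C + C) D := t3.sub t2
  have hDm : Measurable fun p : Phase × Plane => ‖D p.1 p.2‖ₑ := tD.measurable_prod.enorm
  -- the expectation in terms of the transfer operator
  have e1 : ∀ z, ∫ ξ, ψ (markovLorentz ε ν ξ (n * h) z)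
      ∂(𝔭 μ) = ∫ x, T^[m * n] (fun z _ => ψ z) z x ∂μ := by
    intro z
    obtain ⟨k, hk⟩ := Nat.exists_eq_succ_of_ne_zero (mul_ne_zero hfine.count_ne hn)
    have e2 : (n : ℝ) * h = (k + 1 : ℕ) * stepSize ε ν h := by
      rw [← Nat.succ_eq_add_one, ← hk]
      push_cast
      rw [mul_comm (m : ℝ), mul_assoc, hfine.count_mul]
    rw [e2, integral_markovLorentz_eq hμ hε hfine.size_pos hfine.size_lt hψ0.measurable hψ0.bound,
      show m * n = k + 1 from hk]
  have e3 : ∀ z, ∫ x, T^[m * n] (fun z _ => ψ z) z x ∂μ - (shortTime h)^[n] ψ z =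
      ∫ x, D z x ∂μ := by
    intro z
    rw [hD, integral_sub (t3.integrable z) (integrable_const _), integral_const]
    simp
  have hDi : Measurable fun z => ∫ x, D z x ∂μ :=
    (tD.measurable.stronglyMeasurable.integral_prod_right).measurable
  have i1 : Integrable (fun z => f z * ∫ x, T^[m * n] (fun z _ => ψ z) z x ∂μ) 𝔪 := by
    refine hf.mul_bdd (c := C)
      (t3.measurable.stronglyMeasurable.integral_prod_right).aestronglyMeasurable
      (ae_of_all _ fun z => ?_)
    exact (norm_integral_le_of_norm_le_const (ae_of_all _ fun x => t3.bound z x)).trans (by simp)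
  have i2 := hf.mul_bdd (c := C) hψn.measurable.aestronglyMeasurable (ae_of_all _ hψn.bound)
  simp only [e1]
  rw [← integral_sub i1 i2]
  simp only [← mul_sub, e3]
  set O : Set (Phase × Plane) := {p | p.1 ∈ outside ε ν p.2}
  have hO : MeasurableSet O := measurableSet_outside ε ν
  set S : Set Phase := slab R ∩ {z | z.1 ∈ obstacleRanges ε ν}
  have hS : MeasurableSet S := (measurableSet_slab _).inter
    (measurable_fst (isOpen_obstacleRanges ε ν).measurableSet)
  have hSle : 𝔪 S ≤ ofReal (V * (π * b)) := by
    refine (phaseMeasure_slab_ranges_le hε hfine.le_one R).trans ?_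
    rw [ofReal_mul hV0]
    refine mul_le_mul' (by rw [hV, ENNReal.ofReal_toReal (phaseMeasure_slab_ne_top _)])
      (ofReal_le_ofReal (mul_le_mul_of_nonneg_left ?_ Real.pi_pos.le))
    have hs := sqrt_pos.2 hε
    have h3 : rangeRadius ε ν / √ε ≤ min b 1 := (div_le_iff₀ hs).2 hRR
    have h4 : 0 ≤ rangeRadius ε ν / √ε := div_nonneg (rangeRadius_pos hε ν).le hs.le
    have h5 := min_le_left b 1
    have h6 := min_le_right b 1
    nlinarith
  have key : ∫⁻ z, ‖f z * ∫ x, D z x ∂μ‖ₑ ∂𝔪 ≤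
      ofReal (R * (n * (blockConst C A L * h ^ 2) + κ)) := by
    have hSm : Measurable fun p : Phase × Plane => S.indicator (fun _ => ofReal (2 * C)) p.1 := by
      fun_prop
    calc ∫⁻ z, ‖f z * ∫ x, D z x ∂μ‖ₑ ∂𝔪 ≤ ∫⁻ z, ∫⁻ x, ‖f z‖ₑ * ‖D z x‖ₑ ∂μ ∂𝔪 := by
          refine lintegral_mono fun z => ?_
          have hz : Measurable fun x => ‖D z x‖ₑ := hDm.comp measurable_prodMk_left
          rw [lintegral_const_mul _ hz, enorm_mul]
          exact mul_le_mul_right (enorm_integral_le_lintegral_enorm _) _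
      _ = ∫⁻ p, ‖f p.1‖ₑ * ‖D p.1 p.2‖ₑ ∂𝔪× μ := by
          rw [lintegral_prod]
          exact (hf.aestronglyMeasurable.enorm.comp_quasiMeasurePreserving
            Measure.quasiMeasurePreserving_fst).mul hDm.aemeasurable
      _ ≤ ∫⁻ p, ofReal R * (O.indicator (fun p => ‖D p.1 p.2‖ₑ) p +
            S.indicator (fun _ => ofReal (2 * C)) p.1) ∂𝔪× μ := by
          refine lintegral_mono_ae ?_
          filter_upwards [ae_prod_norm_lt hμ] with p hp
          by_cases hs : p.1 ∈ slab R
          · refine mul_le_mul' ?_ ?_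
            · rw [Real.enorm_eq_ofReal_abs]
              exact ofReal_le_ofReal (hfR _)
            · by_cases ho : p ∈ O
              · rw [indicator_of_mem ho]
                exact le_self_add
              · rw [indicator_of_mem (show p.1 ∈ S from ⟨hs, compl_outside_subset hε hp ho⟩)]
                refine le_trans ?_ le_add_self
                rw [Real.enorm_eq_ofReal_abs]
                exact ofReal_le_ofReal ((tD.bound _ _).trans (by linarith))
          · rw [hfs _ hs]
            simp
      _ = ofReal R * (∫⁻ p in O, ‖D p.1 p.2‖ₑ ∂𝔪× μ + ofReal (2 * C) * 𝔪 S) := by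
          rw [lintegral_const_mul' _ _ ofReal_ne_top, lintegral_add_right _ hSm,
            lintegral_indicator hO, lintegral_fst_prod (by fun_prop), lintegral_indicator_const hS]
      _ ≤ ofReal R * (ofReal (n * (blockConst C A L * h ^ 2)) + ofReal κ) := by
          refine mul_le_mul_right (add_le_add h1 ((mul_le_mul_right hSle _).trans ?_)) _
          rw [← ofReal_mul (by positivity)]
          exact ofReal_le_ofReal (by linarith)
      _ = _ := by rw [← ofReal_add (by positivity) hκ.le, ← ofReal_mul hR0]
  rw [← ENNReal.ofReal_le_ofReal_iff (by positivity), ← Real.enorm_eq_ofReal_abs]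
  exact (enorm_integral_le_lintegral_enorm _).trans key

end Block

/-! ### The series of the numbers of collisions -/

/-- The change of velocity in a collision with impact parameter `σ`. -/
def spin (σ : ℝ) (z : Phase) : Phase := (z.1, rotVel (turn σ) z.2)

/-- The gain term of the linear Boltzmann equation, for nonnegative functions. -/
def gain (F : Phase → ENNReal) (z : Phase) : ENNReal :=
  ∫⁻ σ in Ioo (-1 : ℝ) 1, F (spin σ z)

/-- The contribution of the paths with `n` collisions to `exp (2 t)` times the solution of the
linear Boltzmann equation. -/
def dyson (F : Phase → ENNReal) : ℕ → ℝ → Phase → ENNReal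
  | 0, t, z => F (freeFlight (-t) z)
  | n + 1, t, z => ∫⁻ s in Ioc 0 t, gain (dyson F n s) (freeFlight (s - t) z)

/-- The solution of the linear Boltzmann equation with initial value `F`, times `exp (2 t)`. -/
def dysonSum (F : Phase → ENNReal) (t : ℝ) (z : Phase) : ENNReal :=
  ∑' n, dyson F n t z

lemma measurePreserving_spin (σ) : MeasurePreserving (spin σ) 𝔪 𝔪 :=
  (MeasurePreserving.id volume).prod (measurePreserving_rotVel (turn σ))

@[fun_prop] lemma continuous_spin : Continuous fun p : ℝ × Phase => spin p.1 p.2 :=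
  continuous_snd.fst.prodMk (Continuous.comp (g := fun p : ℝ × Velocity => rotVel p.1 p.2)
    (f := fun p : ℝ × Phase => (turn p.1, p.2.2)) continuous_rotVel (by fun_prop))

lemma turn_neg (σ) : turn (-σ) = 2 * π - turn σ := by unfold turn; rw [Real.arcsin_neg]; ring

lemma spin_neg_spin (σ z) : spin (-σ) (spin σ z) = z := by
  unfold spin
  refine Prod.ext rfl ?_
  change rotVel (turn (-σ)) (rotVel (turn σ) z.2) = z.2
  rw [rotVel_rotVel, turn_neg, sub_add_cancel, rotVel_two_pi]

lemma lintegral_Ioo_neg {F : ℝ → ENNReal} (hF : Measurable F) :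
    ∫⁻ σ in Ioo (-1 : ℝ) 1, F (-σ) = ∫⁻ σ in Ioo (-1 : ℝ) 1, F σ := by
  rw [← ((Measure.measurePreserving_neg (volume : Measure ℝ)).setLIntegral_comp_preimage
    (measurableSet_Ioo (a := (-1 : ℝ)) (b := 1)) hF)]
  congr 2
  ext σ
  simp only [mem_preimage, Set.mem_Ioo]
  constructor <;> rintro ⟨h1, h2⟩ <;> constructor <;> linarith

section Gain

variable {F G : Phase → ENNReal}

lemma measurable_gain_uncurry {X : Type*} [MeasurableSpace X] {F : X → Phase → ENNReal}
    (hF : Measurable fun p : X × Phase => F p.1 p.2) :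
    Measurable fun p : X × Phase => gain (F p.1) p.2 := by
  have h := hF.comp (f := fun q : (X × Phase) × ℝ => (q.1.1, spin q.2 q.1.2))
      (measurable_fst.fst.prodMk (continuous_spin.measurable.comp
        (f := fun q : (X × Phase) × ℝ => (q.2, q.1.2)) (by fun_prop)))
  exact h.lintegral_prod_right'

@[fun_prop] lemma measurable_gain (hF : Measurable F) : Measurable (gain F) :=
  (measurable_gain_uncurry (X := Unit) (F := fun _ => F) (hF.comp measurable_snd)).comp
    (f := fun z => ((), z)) measurable_prodMk_left

lemma measurable_spin_prod (hF : Measurable F) :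
    Measurable fun p : Phase × ℝ => F (spin p.2 p.1) := by
  fun_prop

/-- The gain operator is symmetric. -/
lemma lintegral_gain_mul (hF : Measurable F) (hG : Measurable G) :
    ∫⁻ z, gain F z * G z ∂𝔪 = ∫⁻ z, F z * gain G z ∂𝔪 := by
  have h1 : ∀ z, gain F z * G z = ∫⁻ σ in Ioo (-1 : ℝ) 1, F (spin σ z) * G z := fun z => by
    have : Measurable fun σ => F (spin σ z) := by fun_prop
    rw [lintegral_mul_const _ this]
    rfl
  have h2 : ∀ z, F z * gain G z = ∫⁻ σ in Ioo (-1 : ℝ) 1, F z * G (spin σ z) := fun z => by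
    have : Measurable fun σ => G (spin σ z) := by fun_prop
    rw [lintegral_const_mul _ this]
    rfl
  have m1 : Measurable fun p : Phase × ℝ => F (spin p.2 p.1) * G p.1 := by fun_prop
  have m2 : Measurable fun p : Phase × ℝ => F p.1 * G (spin p.2 p.1) := by fun_prop
  rw [lintegral_congr h1, lintegral_congr h2, lintegral_lintegral_swap m1.aemeasurable,
    lintegral_lintegral_swap (f := fun z σ => F z * G (spin σ z)) m2.aemeasurable]
  rw [← lintegral_Ioo_neg m2.lintegral_prod_left']
  refine lintegral_congr fun σ => ?_
  have m4 : Measurable fun z => F z * G (spin (-σ) z) := by fun_prop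
  exact Eq.trans (by simp only [spin_neg_spin]) ((measurePreserving_spin σ).lintegral_comp m4)

lemma gain_const (c : ENNReal) (z) : gain (fun _ => c) z = 2 * c := by
  rw [gain, setLIntegral_const, volume_Ioo, mul_comm]
  norm_num

lemma lintegral_gain (hF : Measurable F) : ∫⁻ z, gain F z ∂𝔪 = 2 * ∫𝔪 F := by
  have h := lintegral_gain_mul hF (G := fun _ => 1) measurable_const
  simp only [gain_const, mul_one] at h
  rw [h, lintegral_mul_const _ hF, mul_comm]

lemma gain_tsum {F : ℕ → Phase → ENNReal} (hF : ∀ n, Measurable (F n)) (z) :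
    gain (fun z => ∑' n, F n z) z = ∑' n, gain (F n) z := lintegral_tsum fun n =>
    ((measurable_spin_prod (hF n)).comp measurable_prodMk_left).aemeasurable

@[fun_prop] lemma measurable_dyson (hF : Measurable F) (n) :
    Measurable fun p : ℝ × Phase => dyson F n p.1 p.2 := by
  induction n with
  | zero =>
    exact hF.comp (continuous_freeFlight.measurable.comp (measurable_fst.neg.prodMk measurable_snd))
  | succ n ih =>
    have h2 : Measurable fun q : (ℝ × Phase) × ℝ =>
        {q : (ℝ × Phase) × ℝ | 0 < q.2 ∧ q.2 ≤ q.1.1}.indicator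
          (fun q => gain (dyson F n q.2) (freeFlight (q.2 - q.1.1) q.1.2)) q := by
      refine Measurable.indicator ?_ ?_
      · exact (measurable_gain_uncurry ih).comp (f := fun q : (ℝ × Phase) × ℝ => (q.2, freeFlight
          (q.2 - q.1.1) q.1.2)) (by fun_prop)
      · exact (measurableSet_lt measurable_const measurable_snd).inter
          (measurableSet_le measurable_snd measurable_fst.fst)
    convert (h2.lintegral_prod_right' (ν := volume)) using 2 with p
    rw [dyson, ← lintegral_indicator measurableSet_Ioc]
    rfl

lemma measurable_dyson_right (hF : Measurable F) (n t) : Measurable (dyson F n t) := by fun_prop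

@[fun_prop] lemma measurable_dysonSum_uncurry (hF : Measurable F) :
    Measurable fun p : ℝ × Phase => dysonSum F p.1 p.2 :=
  Measurable.tsum fun n => measurable_dyson hF n

@[fun_prop]
lemma measurable_dysonSum (hF : Measurable F) (t) : Measurable (dysonSum F t) := by fun_prop

lemma measurable_gain_time {H : ℝ → Phase → ENNReal}
    (hH : Measurable fun p : ℝ × Phase => H p.1 p.2) (t) :
    Measurable fun p : Phase × ℝ => gain (H p.2) (freeFlight (p.2 - t) p.1) :=
  (measurable_gain_uncurry hH).comp
    (f := fun p : Phase × ℝ => (p.2, freeFlight (p.2 - t) p.1)) (by fun_prop)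

lemma lintegral_freeFlight (hF : Measurable F) (s) : ∫⁻ z, F (freeFlight s z) ∂𝔪 = ∫𝔪 F :=
  (measurePreserving_freeFlight s).lintegral_comp hF

lemma lintegral_pow_Ioc (ht : 0 ≤ t) (n) :
    ∫⁻ s in Ioc 0 t, ofReal (2 * ((2 * s) ^ n / n.factorial)) =
      ofReal ((2 * t) ^ (n + 1) / (n + 1).factorial) := by
  rw [← ofReal_integral_eq_lintegral_ofReal]
  · congr 1
    rw [← intervalIntegral.integral_of_le ht]
    have e : ∀ s : ℝ, 2 * ((2 * s) ^ n / n.factorial) = 2 ^ (n + 1) / n.factorial * s ^ n := by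
      intro s; rw [mul_pow, pow_succ]; ring
    simp only [e]
    rw [intervalIntegral.integral_const_mul, integral_pow, Nat.factorial_succ]
    push_cast
    have : (n.factorial : ℝ) ≠ 0 := by positivity
    field_simp
    ring
  · exact (Continuous.integrableOn_Icc (by fun_prop)).mono_set Set.Ioc_subset_Icc_self
  · refine (ae_restrict_iff' measurableSet_Ioc).2 (ae_of_all _ fun s hs => ?_)
    have : 0 ≤ s := hs.1.le
    change 0 ≤ 2 * ((2 * s) ^ n / n.factorial)
    positivity

lemma lintegral_dyson (hF : Measurable F) (n) (ht : 0 ≤ t) : ∫⁻ z, dyson F n t z ∂𝔪 =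
      ofReal ((2 * t) ^ n / n.factorial) * ∫𝔪 F := by
  induction n generalizing t with
  | zero =>
    simp only [dyson]
    rw [lintegral_freeFlight hF]
    simp
  | succ n ih =>
    simp only [dyson]
    rw [lintegral_lintegral_swap (measurable_gain_time (measurable_dyson hF n) t).aemeasurable]
    have : ∀ s ∈ Ioc 0 t, ∫⁻ z, gain (dyson F n s) (freeFlight (s - t) z) ∂𝔪 =
        ofReal (2 * ((2 * s) ^ n / n.factorial)) * ∫𝔪 F := by
      intro s hs
      rw [lintegral_freeFlight (by fun_prop), lintegral_gain (by fun_prop), ih hs.1.le, ← mul_assoc,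
        ofReal_mul zero_le_two]
      norm_num
    rw [setLIntegral_congr_fun measurableSet_Ioc this, lintegral_mul_const _ (by fun_prop),
      lintegral_pow_Ioc ht]

/-- The total mass grows exponentially, at the collision rate `2`. -/
lemma lintegral_dysonSum (hF : Measurable F) (ht : 0 ≤ t) : ∫⁻ z, dysonSum F t z ∂𝔪 =
      ofReal (exp (2 * t)) * ∫𝔪 F := by
  unfold dysonSum
  rw [lintegral_tsum fun n => (measurable_dyson_right hF n t).aemeasurable]
  simp only [lintegral_dyson hF _ ht]
  rw [ENNReal.tsum_mul_right, ← ENNReal.ofReal_tsum_of_nonneg]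
  · rw [Real.exp_eq_exp_ℝ, NormedSpace.exp_eq_tsum_div]
  · intro n; positivity
  · exact Real.summable_pow_div_factorial _

lemma dysonSum_eq (hF : Measurable F) (t z) : dysonSum F t z = F (freeFlight (-t) z) +
      ∫⁻ s in Ioc 0 t, gain (dysonSum F s) (freeFlight (s - t) z) := by
  have h : ∀ s z, gain (dysonSum F s) z = ∑' n, gain (dyson F n s) z := fun s z =>
    gain_tsum (fun n => measurable_dyson_right hF n s) z
  have m : ∀ n, Measurable fun s => gain (dyson F n s) (freeFlight (s - t) z) := fun n =>
    (measurable_gain_time (measurable_dyson hF n) t).comp measurable_prodMk_left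
  have e : ∀ n, ∫⁻ s in Ioc 0 t, gain (dyson F n s) (freeFlight (s - t) z) =
      dyson F (n + 1) t z := fun n => by rw [dyson]
  simp only [h]
  rw [lintegral_tsum fun n => (m n).aemeasurable, tsum_congr e,
    show F (freeFlight (-t) z) = dyson F 0 t z by rw [dyson]]
  exact tsum_eq_zero_add' ENNReal.summable

/-- Duhamel's formula, started at time `t`. -/
lemma dysonSum_add (hF : Measurable F) (ht : 0 ≤ t) (hh : 0 ≤ h) (z) :
    dysonSum F (t + h) z = dysonSum F t (freeFlight (-h) z) +
      ∫⁻ s in Ioc t (t + h), gain (dysonSum F s) (freeFlight (s - (t + h)) z) := by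
  rw [dysonSum_eq hF (t + h), dysonSum_eq hF t, ← Set.Ioc_union_Ioc_eq_Ioc ht (by linarith :
    t ≤ t + h), lintegral_union measurableSet_Ioc (Set.Ioc_disjoint_Ioc_of_le le_rfl), ← add_assoc,
    freeFlight_add, show -h + -t = -(t + h) by ring]
  congr 2
  refine lintegral_congr fun s => ?_
  rw [freeFlight_add, show -h + (s - t) = s - (t + h) by ring]

/-- Duhamel's formula, tested against a function. -/
lemma lintegral_dysonSum_add_mul (hF : Measurable F) (hG : Measurable G) (ht : 0 ≤ t)
    (hh : 0 ≤ h) : ∫⁻ z, dysonSum F (t + h) z * G z ∂𝔪 =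
      ∫⁻ z, dysonSum F t z * G (freeFlight h z) ∂𝔪 + ∫⁻ s in Ioc t (t + h), ∫⁻ z, dysonSum F s z *
        gain (fun z => G (freeFlight (t + h - s) z)) z ∂𝔪 := by
  have hD : ∀ s, Measurable (dysonSum F s) := by fun_prop
  have hGf : ∀ s, Measurable fun z => G (freeFlight s z) := by fun_prop
  have hDf : Measurable fun z => dysonSum F t (freeFlight (-h) z) := by fun_prop
  simp only [dysonSum_add hF ht hh, add_mul]
  have m1 : Measurable fun z => dysonSum F t (freeFlight (-h) z) * G z := hDf.mul hG
  rw [lintegral_add_left m1]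
  congr 1
  · have m2 : Measurable fun z => dysonSum F t z * G (freeFlight h z) := by fun_prop
    rw [← lintegral_freeFlight m2 (-h)]
    refine lintegral_congr fun z => ?_
    rw [freeFlight_add, neg_add_cancel]
    congr 2
    simp [freeFlight]
  · have m3 : ∀ z, Measurable fun s => gain (dysonSum F s) (freeFlight (s - (t + h)) z) := fun z =>
      (measurable_gain_time (measurable_dysonSum_uncurry hF) (t + h)).comp measurable_prodMk_left
    have m4 : Measurable fun p : Phase × ℝ =>
        gain (dysonSum F p.2) (freeFlight (p.2 - (t + h)) p.1) * G p.1 :=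
      (measurable_gain_time (measurable_dysonSum_uncurry hF) (t + h)).mul (hG.comp measurable_fst)
    rw [lintegral_congr fun z => (lintegral_mul_const (G z) (m3 z)).symm,
      lintegral_lintegral_swap m4.aemeasurable]
    refine lintegral_congr fun s => ?_
    rw [← lintegral_gain_mul (hD s) (hGf _)]
    have m5 : Measurable fun z => gain (dysonSum F s) z * G (freeFlight (t + h - s) z) := by
      fun_prop
    rw [← lintegral_freeFlight m5 (s - (t + h))]
    refine lintegral_congr fun z => ?_
    rw [freeFlight_add, show s - (t + h) + (t + h - s) = 0 by ring]
    congr 2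
    simp [freeFlight]

end Gain

/-! ### The solution of the linear Boltzmann equation -/

/-- The solution of the linear Boltzmann equation with initial value `F`. -/
def boltzmann (F : Phase → ENNReal) (t : ℝ) (z : Phase) : ℝ :=
  exp (-(2 * t)) * (dysonSum F t z).toReal

section Density

variable {F : Phase → ENNReal}

@[fun_prop] lemma measurable_boltzmann (hF : Measurable F) (t) : Measurable (boltzmann F t) :=
  (measurable_dysonSum hF t).ennreal_toReal.const_mul _

lemma boltzmann_nonneg (F : Phase → ENNReal) (t z) : 0 ≤ boltzmann F t z :=
  mul_nonneg (Real.exp_pos _).le toReal_nonneg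

lemma lintegral_dysonSum_ne_top (hF : Measurable F) (hm : ∫𝔪 F ≠ ⊤)
    (ht : 0 ≤ t) : ∫⁻ z, dysonSum F t z ∂𝔪 ≠ ⊤ := by
  rw [lintegral_dysonSum hF ht]
  exact mul_ne_top ofReal_ne_top hm

lemma dysonSum_lt_top (hF : Measurable F) (hm : ∫𝔪 F ≠ ⊤)
    (ht : 0 ≤ t) : ∀ᵐ z ∂𝔪, dysonSum F t z < ⊤ :=
  ae_lt_top (by fun_prop) (lintegral_dysonSum_ne_top hF hm ht)

lemma integrable_dysonSum (hF : Measurable F) (hm : ∫𝔪 F ≠ ⊤)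
    (ht : 0 ≤ t) : Integrable (fun z => (dysonSum F t z).toReal) 𝔪 :=
  integrable_toReal_of_lintegral_ne_top (measurable_dysonSum hF t).aemeasurable
    (lintegral_dysonSum_ne_top hF hm ht)

lemma integrable_boltzmann (hF : Measurable F) (hm : ∫𝔪 F ≠ ⊤)
    (ht : 0 ≤ t) : Integrable (boltzmann F t) 𝔪 := (integrable_dysonSum hF hm ht).const_mul _

lemma integral_dysonSum (hF : Measurable F) (hm : ∫𝔪 F ≠ ⊤)
    (ht : 0 ≤ t) : ∫ z, (dysonSum F t z).toReal ∂𝔪 = exp (2 * t) * (∫𝔪 F).toReal := by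
  rw [integral_toReal (measurable_dysonSum hF t).aemeasurable (dysonSum_lt_top hF hm ht),
    lintegral_dysonSum hF ht, ENNReal.toReal_mul, toReal_ofReal (Real.exp_pos _).le]

lemma integral_boltzmann (hF : Measurable F) (hm : ∫𝔪 F ≠ ⊤)
    (ht : 0 ≤ t) : ∫ z, boltzmann F t z ∂𝔪 = (∫𝔪 F).toReal := by
  unfold boltzmann
  rw [integral_const_mul, integral_dysonSum hF hm ht, ← mul_assoc, ← Real.exp_add]
  simp

lemma boltzmann_zero (hF : Measurable F) (z) : boltzmann F 0 z = (F z).toReal := by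
  rw [boltzmann, dysonSum_eq hF]
  simp [freeFlight]

lemma integral_boltzmann_mul (hF : Measurable F) (hm : ∫𝔪 F ≠ ⊤)
    (ht : 0 ≤ t) {χ : Phase → ℝ} (hχ : Measurable χ) (h0 : ∀ z, 0 ≤ χ z) :
    ∫ z, boltzmann F t z * χ z ∂𝔪 = exp (-(2 * t)) *
      (∫⁻ z, dysonSum F t z * ofReal (χ z) ∂𝔪).toReal := by
  have e : ∀ z, boltzmann F t z * χ z =
      exp (-(2 * t)) * (dysonSum F t z * ofReal (χ z)).toReal := fun z => by
    rw [boltzmann, ENNReal.toReal_mul, toReal_ofReal (h0 z), mul_assoc]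
  simp only [e]
  rw [integral_const_mul, integral_toReal]
  · fun_prop
  · filter_upwards [dysonSum_lt_top hF hm ht] with z hz
    exact ENNReal.mul_lt_top hz ENNReal.ofReal_lt_top

lemma dist_freeFlight_self_le (hr : 0 ≤ r) (z) : dist (freeFlight r z) z ≤ r := by
  rw [Prod.dist_eq]
  refine max_le ?_ ?_
  · have e2 := dist_freeFlight r 0 z
    rw [sub_zero, abs_of_nonneg hr] at e2
    have e3 : (freeFlight 0 z).1 = z.1 := by simp [freeFlight]
    rw [e3] at e2
    exact e2.le
  · change dist z.2 z.2 ≤ r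
    rw [dist_self]; exact hr

lemma dist_spin (σ z z') : dist (spin σ z) (spin σ z') = dist z z' := by
  unfold spin
  rw [Prod.dist_eq, Prod.dist_eq, dist_rotVel]

lemma gain_le_gain_add {G G' : Phase → ENNReal} (hG : Measurable G) {c : ENNReal} (z z')
    (h : ∀ σ, G' (spin σ z') ≤ G (spin σ z) + c) : gain G' z' ≤ gain G z + 2 * c := by
  unfold gain
  refine (lintegral_mono h).trans ?_
  have : Measurable fun σ => G (spin σ z) := by fun_prop
  rw [lintegral_add_left this, setLIntegral_const, volume_Ioo, mul_comm c]
  norm_num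

/-- Expansion of the solution for a short time, in a weak sense. -/
lemma lintegral_dysonSum_add_mul_le (hF : Measurable F) (ht : 0 ≤ t) (hh : 0 ≤ h)
    {χ : Phase → ℝ} (hχ : Measurable χ) (hC0 : 0 ≤ C) (hC : ∀ z, χ z ≤ C) (hL : 0 ≤ L)
    (hlip : ∀ z z', |χ z - χ z'| ≤ L * dist z z') : ∫⁻ z, dysonSum F (t + h) z * ofReal (χ z) ∂𝔪 ≤
      ∫⁻ z, dysonSum F t z * ofReal (χ (freeFlight h z)) ∂𝔪 +
      (ofReal h * ∫⁻ z, dysonSum F t z * gain (fun z => ofReal (χ z)) z ∂𝔪 +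
        ofReal (h ^ 2 * (4 * L + 4 * C) * exp (2 * (t + h))) * ∫𝔪 F) := by
  set G : Phase → ENNReal := fun z => ofReal (χ z)
  have hGm : Measurable G := by fun_prop
  set m := ∫𝔪 F
  set M := ofReal (exp (2 * (t + h))) * m with hM
  have hD := measurable_dysonSum hF
  have hmul : ∀ s, 0 ≤ s → s ≤ t + h → ∀ {K K' : Phase → ENNReal} {c}, Measurable K' →
      (∀ z, K z ≤ K' z + c) →
      ∫⁻ z, dysonSum F s z * K z ∂𝔪 ≤ ∫⁻ z, dysonSum F s z * K' z ∂𝔪 + c * M := by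
    intro s hs hs' K K' c hK' hle
    refine (lintegral_mono fun z => mul_le_mul_right (hle z) _).trans ?_
    simp only [mul_add]
    have hm : Measurable fun z => dysonSum F s z * K' z := (hD s).mul hK'
    rw [lintegral_add_left hm, lintegral_mul_const _ (hD s), mul_comm _ c, lintegral_dysonSum hF hs]
    exact add_le_add_right (mul_le_mul_right (mul_le_mul_left (ofReal_le_ofReal
      (Real.exp_le_exp.2 (by linarith))) _) _) _
  -- the test function hardly changes along a short path
  have hclose : ∀ z z' : Phase, dist z' z ≤ h → G z' ≤ G z + ofReal (L * h) := by
    intro z z' hd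
    refine le_trans (ofReal_le_ofReal ?_) ENNReal.ofReal_add_le
    have h1 := (le_abs_self _).trans (hlip z' z)
    have h2 := mul_le_mul_of_nonneg_left hd hL
    linarith
  have hg1 : ∀ r z, 0 ≤ r → r ≤ h → gain (fun z => G (freeFlight r z)) z ≤
      gain G z + 2 * ofReal (L * h) := fun r z hr hrh =>
    gain_le_gain_add hGm z z fun σ => hclose _ _ ((dist_freeFlight_self_le hr _).trans hrh)
  have hg2 : ∀ r z, 0 ≤ r → r ≤ h → gain G (freeFlight r z) ≤
      gain G z + 2 * ofReal (L * h) := fun r z hr hrh =>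
    gain_le_gain_add hGm z _ fun σ => hclose _ _ (by
      rw [dist_spin]; exact (dist_freeFlight_self_le hr _).trans hrh)
  have hgC : ∀ K : Phase → ENNReal, ∀ c, (∀ z, K z ≤ c) → ∀ z, gain K z ≤ 2 * c :=
    fun K c hK z => by rw [← gain_const _ z]; exact lintegral_mono fun σ => hK _
  have hGg := measurable_gain hGm
  have step1 : ∀ s ∈ Ioc t (t + h), ∫⁻ z, dysonSum F s z * gain G z ∂𝔪 ≤
      ∫⁻ z, dysonSum F t z * gain G z ∂𝔪 + 2 * ofReal (L * h) * M +
        ofReal h * (2 * (2 * ofReal C) * M) := by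
    intro s hs
    have hst : 0 ≤ s - t := by linarith [hs.1]
    have hsh : s - t ≤ h := by linarith [hs.2]
    have := lintegral_dysonSum_add_mul hF hGg ht hst
    rw [add_sub_cancel] at this
    rw [this]
    refine add_le_add (hmul t ht (by linarith) hGg fun z => hg2 _ z hst hsh) ?_
    refine (setLIntegral_mono' measurableSet_Ioc fun r hr => hmul r (by linarith [hr.1])
      (by linarith [hr.2, hs.2]) (K' := fun _ => 0) measurable_const fun z =>
      (hgC _ _ (fun z => hgC G _ (fun z => ofReal_le_ofReal (hC z)) _) z).trans
          le_add_self).trans ?_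
    simp only [mul_zero, lintegral_zero, zero_add]
    rw [setLIntegral_const, Real.volume_Ioc, mul_comm]
    exact mul_le_mul_left (ofReal_le_ofReal hsh) _
  rw [lintegral_dysonSum_add_mul hF hGm ht hh]
  refine add_le_add_right ?_ _
  refine (setLIntegral_mono' measurableSet_Ioc fun s hs => (hmul s (by linarith [hs.1]) hs.2 hGg
    fun z => hg1 _ z (by linarith [hs.2]) (by linarith [hs.1])).trans
      (add_le_add_left (step1 s hs) _)).trans (le_of_eq ?_)
  rw [setLIntegral_const, Real.volume_Ioc, add_sub_cancel_left, mul_comm]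
  have e1 : ofReal (h ^ 2 * (4 * L + 4 * C) * exp (2 * (t + h))) =
      (ofReal h * (4 * ofReal (L * h)) + ofReal h * (ofReal h * (4 * ofReal C))) *
        ofReal (exp (2 * (t + h))) := by
    have h4 : (4 : ENNReal) = ofReal 4 := by simp
    have e : h ^ 2 * (4 * L + 4 * C) * exp (2 * (t + h)) =
        (h * (4 * (L * h)) + h * (h * (4 * C))) * exp (2 * (t + h)) := by ring
    rw [e, ofReal_mul (by positivity), ofReal_add (by positivity)
      (by positivity), ofReal_mul hh, ofReal_mul hh, ofReal_mul hh,
      ofReal_mul zero_le_four, ofReal_mul zero_le_four, h4]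
  rw [e1, hM]
  ring

lemma scatter_add_two_mul {χ : Phase → ℝ} (hχ : Continuous χ) (hC : ∀ z, |χ z| ≤ C)
    (z) : scatter χ z + 2 * χ z = ∫ σ in Ioo (-1 : ℝ) 1, χ (spin σ z) := by
  have hi : IntegrableOn (fun σ => χ (spin σ z)) (Ioo (-1) 1) :=
    Integrable.of_bound (hχ.comp (continuous_turned z)).aestronglyMeasurable C
      (ae_of_all _ fun σ => hC _)
  have e : scatter χ z = ∫ σ in Ioo (-1 : ℝ) 1, (χ (spin σ z) - χ z) := rfl
  rw [e, integral_sub hi (integrable_const _), integral_const]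
  simp only [Measure.real, Measure.restrict_apply MeasurableSet.univ, Set.univ_inter,
    volume_Ioo, smul_eq_mul]
  rw [toReal_ofReal (by norm_num)]
  ring

lemma gain_ofReal {χ : Phase → ℝ} (hχ : Continuous χ) (hC : ∀ z, χ z ≤ C) (h0 : ∀ z, 0 ≤ χ z) (z) :
    gain (fun z => ofReal (χ z)) z = ofReal (scatter χ z + 2 * χ z) := by
  have habs : ∀ z, |χ z| ≤ C := fun z => by rw [abs_of_nonneg (h0 z)]; exact hC z
  have hi : IntegrableOn (fun σ => χ (spin σ z)) (Ioo (-1) 1) :=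
    Integrable.of_bound (hχ.comp (continuous_turned z)).aestronglyMeasurable C
      (ae_of_all _ fun σ => habs _)
  rw [scatter_add_two_mul hχ habs, ofReal_integral_eq_lintegral_ofReal hi
    (ae_of_all _ fun σ => h0 _), gain]

end Density

section ShortTime

variable {F : Phase → ENNReal} {ψ χ : Phase → ℝ}

lemma integrable_boltzmann_mul (hF : Measurable F) (hm : ∫𝔪 F ≠ ⊤)
    (ht : 0 ≤ t) (hχ : Measurable χ) (hC : ∀ z, |χ z| ≤ C) :
    Integrable (fun z => boltzmann F t z * χ z) 𝔪 :=
  (integrable_boltzmann hF hm ht).mul_bdd hχ.aestronglyMeasurable (ae_of_all _ hC)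

lemma integral_boltzmann_mul_mono (hF : Measurable F) (hm : ∫𝔪 F ≠ ⊤)
    (ht : 0 ≤ t) {χ' : Phase → ℝ} (hχ : Measurable χ) (hC : ∀ z, |χ z| ≤ C)
    (hχ' : Measurable χ') {C' : ℝ} (hC' : ∀ z, |χ' z| ≤ C') {c : ℝ} (h : ∀ z, χ z ≤ χ' z + c) :
    ∫ z, boltzmann F t z * χ z ∂𝔪 ≤ ∫ z, boltzmann F t z * χ' z ∂𝔪 + c * (∫𝔪 F).toReal := by
  rw [← integral_boltzmann hF hm ht, ← integral_const_mul,
    ← integral_add (integrable_boltzmann_mul hF hm ht hχ' hC')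
      ((integrable_boltzmann hF hm ht).const_mul c)]
  refine integral_mono (integrable_boltzmann_mul hF hm ht hχ hC)
    ((integrable_boltzmann_mul hF hm ht hχ' hC').add
      ((integrable_boltzmann hF hm ht).const_mul c)) fun z => ?_
  have := mul_le_mul_of_nonneg_left (h z) (boltzmann_nonneg F t z)
  change _ ≤ boltzmann F t z * χ' z + c * boltzmann F t z
  linarith

lemma continuous_of_abs_le (hL : 0 ≤ L) (hlip : ∀ z z', |χ z - χ z'| ≤ L * dist z z') :
    Continuous χ := (LipschitzWith.of_dist_le_mul (K := ⟨L, hL⟩) fun z z' => by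
    rw [Real.dist_eq]; exact hlip z z').continuous

/-- A one-sided weak form of the equation for a short time, for nonnegative test functions. -/
lemma integral_boltzmann_add_le (hF : Measurable F) (hm : ∫𝔪 F ≠ ⊤)
    (ht : 0 ≤ t) (hh : 0 ≤ h) (hh2 : h ≤ 1 / 2) (h0 : ∀ z, 0 ≤ χ z) (hC : ∀ z, χ z ≤ C)
    (hL : 0 ≤ L) (hlip : ∀ z z', |χ z - χ z'| ≤ L * dist z z') :
    ∫ z, boltzmann F (t + h) z * χ z ∂𝔪 ≤ ∫ z, boltzmann F t z * shortTime h χ z ∂𝔪 +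
        h ^ 2 * (6 * L + 8 * C) * (∫𝔪 F).toReal := by
  set m := (∫𝔪 F).toReal
  have hm0 : 0 ≤ m := toReal_nonneg
  have hC0 : 0 ≤ C := (h0 (0, unitVector 0)).trans (hC _)
  have hcont := continuous_of_abs_le hL hlip
  have hχ := hcont.measurable
  have habs : ∀ z, |χ z| ≤ C := fun z => by rw [abs_of_nonneg (h0 z)]; exact hC z
  set B : Phase → ℝ := fun z => scatter χ z + 2 * χ z
  have hsf : ∀ z, gain (fun z => ofReal (χ z)) z = ofReal (B z) := gain_ofReal hcont hC h0
  have hgC : ∀ z, gain (fun z => ofReal (χ z)) z ≤ ofReal (2 * C) := fun z => by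
    rw [ofReal_mul zero_le_two, ENNReal.ofReal_ofNat, ← gain_const _ z]
    exact lintegral_mono fun σ => ofReal_le_ofReal (hC _)
  have hB0 : ∀ z, 0 ≤ B z := fun z =>
    (integral_nonneg fun σ => h0 _).trans_eq (scatter_add_two_mul hcont habs z).symm
  have hBC : ∀ z, B z ≤ 2 * C := fun z =>
    (ENNReal.ofReal_le_ofReal_iff (by positivity)).1 (hsf z ▸ hgC z)
  have hBm : Measurable B := by
    simpa only [hsf, toReal_ofReal (hB0 _)] using
      (measurable_gain hχ.ennreal_ofReal).ennreal_toReal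
  have hχf : Measurable fun z => χ (freeFlight h z) := by fun_prop
  have hth : 0 ≤ t + h := by linarith
  set X := ∫⁻ z, dysonSum F t z * ofReal (χ (freeFlight h z)) ∂𝔪
  set Y := ∫⁻ z, dysonSum F t z * gain (fun z => ofReal (χ z)) z ∂𝔪 with hY
  have hne : ∀ {K : Phase → ENNReal} {c}, (∀ z, K z ≤ ofReal c) →
      ∫⁻ z, dysonSum F t z * K z ∂𝔪 ≠ ⊤ := by
    intro K c hK
    refine ne_top_of_le_ne_top (mul_ne_top (lintegral_dysonSum_ne_top hF hm ht)
      (ofReal_ne_top (r := c))) ?_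
    rw [← lintegral_mul_const _ (by fun_prop)]
    exact lintegral_mono fun z => mul_le_mul_right (hK _) _
  have hXt : X ≠ ⊤ := hne fun z => ofReal_le_ofReal (hC _)
  have hYt : Y ≠ ⊤ := hne hgC
  set a := ∫ z, boltzmann F t z * χ (freeFlight h z) ∂𝔪
  set b := ∫ z, boltzmann F t z * B z ∂𝔪 with hb
  set c := ∫ z, boltzmann F t z * χ z ∂𝔪
  have ea : a = exp (-(2 * t)) * X.toReal := integral_boltzmann_mul hF hm ht hχf fun z => h0 _
  have eb : b = exp (-(2 * t)) * Y.toReal := by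
    rw [hb, integral_boltzmann_mul hF hm ht hBm hB0, hY]
    simp only [hsf]
  have key : ∫ z, boltzmann F (t + h) z * χ z ∂𝔪 ≤
      exp (-(2 * h)) * (a + h * b) + h ^ 2 * (4 * L + 4 * C) * m := by
    have h1 := lintegral_dysonSum_add_mul_le hF ht hh hχ hC0 hC hL hlip
    rw [integral_boltzmann_mul hF hm hth hχ h0]
    have hYt' := mul_ne_top (ofReal_ne_top (r := h)) hYt
    have hZt := mul_ne_top
      (ofReal_ne_top (r := h ^ 2 * (4 * L + 4 * C) * exp (2 * (t + h)))) hm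
    have h2 := ENNReal.toReal_mono (ENNReal.add_ne_top.2 ⟨hXt, ENNReal.add_ne_top.2 ⟨hYt', hZt⟩⟩) h1
    rw [ENNReal.toReal_add hXt (ENNReal.add_ne_top.2 ⟨hYt', hZt⟩), ENNReal.toReal_add hYt' hZt,
      ENNReal.toReal_mul, ENNReal.toReal_mul, toReal_ofReal hh,
      toReal_ofReal (by positivity)] at h2
    have h3 := mul_le_mul_of_nonneg_left h2 (Real.exp_pos (-(2 * (t + h)))).le
    refine h3.trans (le_of_eq ?_)
    have e1 : exp (-(2 * (t + h))) * exp (2 * (t + h)) = 1 := by rw [← Real.exp_add]; simp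
    have e2 : exp (-(2 * (t + h))) = exp (-(2 * h)) * exp (-(2 * t)) := by
      rw [← Real.exp_add]; congr 1; ring
    rw [ea, eb]
    have e3 : exp (-(2 * (t + h))) * (h ^ 2 * (4 * L + 4 * C) * exp (2 * (t + h)) * m) =
        h ^ 2 * (4 * L + 4 * C) * m := by linear_combination (h ^ 2 * (4 * L + 4 * C) * m) * e1
    rw [e2] at e3 ⊢
    linear_combination e3
  -- the decay factor
  have hexp1 : exp (-(2 * h)) ≤ 1 - 2 * h + 4 * h ^ 2 := by
    have h1 := Real.abs_exp_sub_one_sub_id_le (x := -(2 * h)) (by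
      rw [abs_neg, abs_of_nonneg (by positivity)]; linarith)
    have h2 := (abs_le.1 h1).2
    nlinarith
  have hexp2 : exp (-(2 * h)) ≤ 1 := Real.exp_le_one_iff.2 (by linarith)
  have hlow : c ≤ a + L * h * m := by
    refine integral_boltzmann_mul_mono hF hm ht hχ habs hχf (fun z => habs _) fun z => ?_
    have h1 := (le_abs_self _).trans (hlip z (freeFlight h z))
    rw [dist_comm] at h1
    have h2 := mul_le_mul_of_nonneg_left (dist_freeFlight_self_le hh z) hL
    linarith
  have ha0 : 0 ≤ a := integral_nonneg fun z => mul_nonneg (boltzmann_nonneg _ _ _) (h0 _)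
  have hb0 : 0 ≤ b := integral_nonneg fun z => mul_nonneg (boltzmann_nonneg _ _ _) (hB0 _)
  have haC : a ≤ C * m := by
    have := integral_boltzmann_mul_mono hF hm ht hχf (fun z => habs _) (χ' := fun _ => 0)
      measurable_const (C' := 0) (by simp) (c := C) (fun z => by linarith [hC (freeFlight h z)])
    simpa using this
  have hW : ∫ z, boltzmann F t z * shortTime h χ z ∂𝔪 = a + h * (b - 2 * c) := by
    have e : ∀ z, boltzmann F t z * shortTime h χ z = boltzmann F t z * χ (freeFlight h z) +
        h * (boltzmann F t z * B z - 2 * (boltzmann F t z * χ z)) := fun z => by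
      rw [shortTime]; ring
    simp only [e]
    have i1 := integrable_boltzmann_mul hF hm ht hχf fun z => habs _
    have i2 := integrable_boltzmann_mul hF hm ht hBm (C := 2 * C)
      fun z => by rw [abs_of_nonneg (hB0 z)]; exact hBC z
    have i3 := integrable_boltzmann_mul hF hm ht hχ habs
    have i4 : Integrable (fun z => boltzmann F t z * B z - 2 * (boltzmann F t z * χ z))
        𝔪 := i2.sub (i3.const_mul 2)
    rw [integral_add i1 (i4.const_mul h), integral_const_mul, integral_sub i2 (i3.const_mul 2),
      integral_const_mul]
  rw [hW]
  have f1 := mul_le_mul_of_nonneg_right hexp1 ha0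
  have f2 := mul_le_mul_of_nonneg_right hexp2 (mul_nonneg hh hb0)
  have f3 := mul_le_mul_of_nonneg_left hlow (by positivity : 0 ≤ 2 * h)
  have f4 := mul_le_mul_of_nonneg_left haC (by positivity : 0 ≤ 4 * h ^ 2)
  nlinarith

lemma scatter_add_const (c z) : scatter (fun z => ψ z + c) z = scatter ψ z := by
  unfold scatter
  simp only [add_sub_add_right_eq_sub]

lemma scatter_const_sub (c z) : scatter (fun z => c - ψ z) z = -scatter ψ z := by
  unfold scatter
  rw [← integral_neg]
  congr 1
  funext σ
  ring

/-- The solution of the linear Boltzmann equation satisfies the short time approximation up to an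
error that is quadratic in the time. -/
lemma abs_integral_boltzmann_add_sub_le (hF : Measurable F)
    (hm : ∫𝔪 F ≠ ⊤) (ht : 0 ≤ t) (hh : 0 ≤ h) (hh2 : h ≤ 1 / 2) (hψ : IsTest C A L ψ) :
    |∫ z, boltzmann F (t + h) z * ψ z ∂𝔪 - ∫ z, boltzmann F t z * shortTime h ψ z ∂𝔪| ≤
        h ^ 2 * (6 * L + 16 * C) * (∫𝔪 F).toReal := by
  have hth : 0 ≤ t + h := by linarith
  have hW := hψ.shortTime hh
  have hb : ∀ z, -C ≤ ψ z ∧ ψ z ≤ C := fun z => abs_le.1 (hψ.bound z)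
  have i1 := integrable_boltzmann_mul hF hm hth hψ.measurable hψ.bound
  have i2 := integrable_boltzmann_mul hF hm ht hW.measurable hW.bound
  have j1 := (integrable_boltzmann hF hm hth).const_mul C
  have j2 := (integrable_boltzmann hF hm ht).const_mul C
  have u := integral_boltzmann_add_le hF hm ht hh hh2 (χ := fun z => ψ z + C) (C := 2 * C)
    (fun z => by linarith [(hb z).1]) (fun z => by linarith [(hb z).2]) hψ.nonneg
    (fun z z' => by rw [add_sub_add_right_eq_sub]; exact hψ.lipschitz z z')
  have l := integral_boltzmann_add_le hF hm ht hh hh2 (χ := fun z => C - ψ z) (C := 2 * C)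
    (fun z => by linarith [(hb z).2]) (fun z => by linarith [(hb z).1]) hψ.nonneg
    (fun z z' => by rw [sub_sub_sub_cancel_left, abs_sub_comm]; exact hψ.lipschitz z z')
  have e1 : ∀ z, boltzmann F (t + h) z * (ψ z + C) =
      boltzmann F (t + h) z * ψ z + C * boltzmann F (t + h) z := fun z => by ring
  have e2 : ∀ z, boltzmann F (t + h) z * (C - ψ z) =
      C * boltzmann F (t + h) z - boltzmann F (t + h) z * ψ z := fun z => by ring
  have e3 : ∀ z, boltzmann F t z * shortTime h (fun z => ψ z + C) z =
      boltzmann F t z * shortTime h ψ z + C * boltzmann F t z := fun z => by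
    rw [shortTime, scatter_add_const, shortTime]; ring
  have e4 : ∀ z, boltzmann F t z * shortTime h (fun z => C - ψ z) z =
      C * boltzmann F t z - boltzmann F t z * shortTime h ψ z := fun z => by
    rw [shortTime, scatter_const_sub, shortTime]; ring
  simp only [e1, e3] at u
  simp only [e2, e4] at l
  rw [integral_add i1 j1, integral_add i2 j2, integral_const_mul, integral_const_mul,
    integral_boltzmann hF hm ht, integral_boltzmann hF hm hth] at u
  rw [integral_sub j1 i1, integral_sub j2 i2, integral_const_mul, integral_const_mul,
    integral_boltzmann hF hm ht, integral_boltzmann hF hm hth] at l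
  rw [abs_le]
  constructor <;> linarith

/-- Comparison of the solution with the iterated short time approximation. -/
theorem abs_integral_boltzmann_sub_iterate_le (hF : Measurable F)
    (hm : ∫𝔪 F ≠ ⊤) (hh : 0 ≤ h) (hh2 : h ≤ 1 / 2) (n)
    (hψ : ∀ k < n, IsTest C A L ((shortTime h)^[k] ψ)) :
    |∫ z, boltzmann F (n * h) z * ψ z ∂𝔪 - ∫ z, (F z).toReal * (shortTime h)^[n] ψ z ∂𝔪| ≤
        n * (h ^ 2 * (6 * L + 16 * C) * (∫𝔪 F).toReal) := by
  induction n generalizing ψ with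
  | zero =>
    simp only [Nat.cast_zero, zero_mul, Function.iterate_zero, id_eq, boltzmann_zero hF]
    simp
  | succ n ih =>
    have h1 := ih fun k hk => by
      rw [← Function.iterate_succ_apply]
      exact hψ (k + 1) (by omega)
    have hψ0 : IsTest C A L ψ := hψ 0 (Nat.succ_pos n)
    have h2 := abs_integral_boltzmann_add_sub_le hF hm (t := n * h) (by positivity) hh hh2 hψ0
    rw [← Function.iterate_succ_apply] at h1
    have e : ((n + 1 : ℕ) : ℝ) * h = n * h + h := by push_cast; ring
    rw [e]
    refine (abs_sub_le _ (∫ z, boltzmann F (n * h) z * shortTime h ψ z ∂𝔪) _).trans ?_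
    push_cast
    linarith

end ShortTime

/-! ### Continuity in time of the solution -/

instance : IsLocallyFiniteMeasure 𝔪 := by unfold phaseMeasure; infer_instance

lemma tendsto_integral_abs_freeFlight_sub {u : Phase → ℝ} (hu : Integrable u 𝔪) :
    Tendsto (fun r => ∫ z, |u (freeFlight r z) - u z| ∂𝔪) (𝓝 0) (𝓝 0) := by
  let S : C(ℝ, C(Phase, Phase)) := ContinuousMap.curry ⟨_, continuous_freeFlight⟩
  have hS := measurePreserving_freeFlight
  have h2 := (tendsto_iff_norm_sub_tendsto_zero.1 (Filter.Tendsto.compMeasurePreservingLp (p := 1)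
    (f := fun _ => hu.toL1 u) (tendsto_const_nhds) (S.continuous.tendsto 0) hS (hS 0)
    ENNReal.one_ne_top))
  refine h2.congr fun r => ?_
  rw [L1.norm_eq_integral_norm]
  have e : ∀ r, Lp.compMeasurePreserving (S r) (hS r) (hu.toL1 u) =ᵐ[𝔪]
      fun z => u (freeFlight r z) := fun r => (Lp.coeFn_compMeasurePreserving _ (hS r)).trans
      ((hS r).quasiMeasurePreserving.ae_eq_comp hu.coeFn_toL1)
  refine integral_congr_ae ?_
  filter_upwards [Lp.coeFn_sub (Lp.compMeasurePreserving (S r) (hS r) (hu.toL1 u))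
    (Lp.compMeasurePreserving (S 0) (hS 0) (hu.toL1 u)), e r, e 0] with z h1 h2 h3
  rw [h1, Pi.sub_apply, h2, h3, norm_eq_abs]
  simp [freeFlight]

lemma integral_freeFlight {u : Phase → ℝ} (hu : Measurable u) (s) :
    ∫ z, u (freeFlight s z) ∂𝔪 = ∫ z, u z ∂𝔪 := by
  rw [← integral_map (measurePreserving_freeFlight s).measurable.aemeasurable
    hu.aestronglyMeasurable, (measurePreserving_freeFlight s).map_eq]

section Continuity

variable {F : Phase → ENNReal} {T : ℝ}

/-- The gain of the sum along the free motion has the mass that is missing. -/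
lemma integral_abs_dysonSum_add_sub (hF : Measurable F) (hm : ∫𝔪 F ≠ ⊤) (ht : 0 ≤ t) (hh : 0 ≤ h) :
    ∫ z, |(dysonSum F (t + h) z).toReal - (dysonSum F t (freeFlight (-h) z)).toReal| ∂𝔪 =
      (exp (2 * (t + h)) - exp (2 * t)) * (∫𝔪 F).toReal := by
  have hth : 0 ≤ t + h := by linarith
  have h1 : ∀ᵐ z ∂𝔪,
      |(dysonSum F (t + h) z).toReal - (dysonSum F t (freeFlight (-h) z)).toReal| =
        (dysonSum F (t + h) z).toReal - (dysonSum F t (freeFlight (-h) z)).toReal := by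
    filter_upwards [dysonSum_lt_top hF hm hth] with z hz
    refine abs_of_nonneg (sub_nonneg.2 (ENNReal.toReal_mono hz.ne ?_))
    rw [dysonSum_add hF ht hh]
    exact le_self_add
  have h3 : Integrable (fun z => (dysonSum F t (freeFlight (-h) z)).toReal) 𝔪 :=
    (measurePreserving_freeFlight (-h)).integrable_comp_of_integrable (integrable_dysonSum hF hm ht)
  rw [integral_congr_ae h1, integral_sub (integrable_dysonSum hF hm hth) h3,
    integral_dysonSum hF hm hth, integral_freeFlight
      (measurable_dysonSum hF t).ennreal_toReal, integral_dysonSum hF hm ht]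
  ring

lemma integral_abs_dysonSum_sub_le (hF : Measurable F) (hm : ∫𝔪 F ≠ ⊤)
    (ht : 0 ≤ t) (hs : 0 ≤ s) : ∫ z, |(dysonSum F s z).toReal - (dysonSum F t z).toReal| ∂𝔪 ≤
      |exp (2 * s) - exp (2 * t)| * (∫𝔪 F).toReal +
        ∫ z, |(dysonSum F t (freeFlight (t - s) z)).toReal - (dysonSum F t z).toReal| ∂𝔪 := by
  have is := integrable_dysonSum hF hm hs
  have it := integrable_dysonSum hF hm ht
  have itr := (measurePreserving_freeFlight (t - s)).integrable_comp_of_integrable it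
  have key : ∫ z, |(dysonSum F s z).toReal - (dysonSum F t (freeFlight (t - s) z)).toReal| ∂𝔪 =
      |exp (2 * s) - exp (2 * t)| * (∫𝔪 F).toReal := by
    rcases le_total t s with hts | hst
    · have := integral_abs_dysonSum_add_sub hF hm ht (sub_nonneg.2 hts)
      rw [neg_sub, add_sub_cancel] at this
      rw [this, abs_of_nonneg]
      exact sub_nonneg.2 (Real.exp_le_exp.2 (by linarith))
    · have h1 := integral_abs_dysonSum_add_sub hF hm hs (sub_nonneg.2 hst)
      rw [neg_sub, add_sub_cancel] at h1
      rw [abs_sub_comm, abs_of_nonneg (sub_nonneg.2 (Real.exp_le_exp.2 (by linarith))), ← h1]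
      have hmeas : Measurable fun z =>
          |(dysonSum F s z).toReal - (dysonSum F t (freeFlight (t - s) z)).toReal| := by fun_prop
      rw [← integral_freeFlight hmeas (s - t)]
      refine integral_congr_ae (ae_of_all _ fun z => ?_)
      have e : freeFlight (t - s) (freeFlight (s - t) z) = z := by
        simp [freeFlight, add_assoc, ← add_smul]
      simp only [e]
      rw [abs_sub_comm]
  have i1 : Integrable (fun z => |(dysonSum F s z).toReal -
      (dysonSum F t (freeFlight (t - s) z)).toReal|) 𝔪 := (is.sub itr).abs
  have i2 : Integrable (fun z => |(dysonSum F t (freeFlight (t - s) z)).toReal -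
      (dysonSum F t z).toReal|) 𝔪 := (itr.sub it).abs
  rw [← key, ← integral_add i1 i2]
  exact integral_mono (is.sub it).abs ((is.sub itr).abs.add (itr.sub it).abs) fun z =>
    abs_sub_le _ _ _

/-- The solution is continuous in time, as a function with values in `L¹`. -/
lemma tendsto_integral_abs_boltzmann_sub (hF : Measurable F) (hm : ∫𝔪 F ≠ ⊤) (ht : 0 ≤ t) :
    Tendsto (fun s => ∫ z, |boltzmann F s z - boltzmann F t z| ∂𝔪) (𝓝[Set.Ici 0] t) (𝓝 0) := by
  set m := (∫𝔪 F).toReal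
  set N : ℝ → ℝ := fun r =>
    ∫ z, |(dysonSum F t (freeFlight r z)).toReal - (dysonSum F t z).toReal| ∂𝔪 with hN
  have hN0 := tendsto_integral_abs_freeFlight_sub (integrable_dysonSum hF hm ht)
  have hb : Tendsto (fun s => |exp (2 * s) - exp (2 * t)| * m + N (t - s) +
      |exp (-(2 * s)) - exp (-(2 * t))| * (exp (2 * t) * m)) (𝓝 t) (𝓝 0) := by
    have h1 : Tendsto (fun s => |exp (2 * s) - exp (2 * t)| * m) (𝓝 t) (𝓝 0) := by
      have : Continuous fun s => |exp (2 * s) - exp (2 * t)| * m := by fun_prop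
      simpa using this.tendsto t
    have h2 : Tendsto (fun s => |exp (-(2 * s)) - exp (-(2 * t))| *
        (exp (2 * t) * m)) (𝓝 t) (𝓝 0) := by
      have : Continuous fun s => |exp (-(2 * s)) - exp (-(2 * t))| *
        (exp (2 * t) * m) := by fun_prop
      simpa using this.tendsto t
    have h3 :=
      hN0.comp (by simpa using (continuous_const.sub continuous_id).tendsto t (f := fun s => t - s))
    simpa using (h1.add h3).add h2
  refine tendsto_of_tendsto_of_tendsto_of_le_of_le' tendsto_const_nhds
    (hb.mono_left nhdsWithin_le_nhds) (.of_forall fun s => by positivity) ?_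
  filter_upwards [self_mem_nhdsWithin] with s hs
  have hs : 0 ≤ s := hs
  have is := integrable_dysonSum hF hm hs
  have it := integrable_dysonSum hF hm ht
  refine le_trans ?_ (add_le_add_left (integral_abs_dysonSum_sub_le hF hm ht hs) _)
  have i1 : Integrable (fun z => |(dysonSum F s z).toReal - (dysonSum F t z).toReal|)
    𝔪 := (is.sub it).abs
  rw [← integral_dysonSum hF hm ht, ← integral_const_mul, ← integral_add i1 (it.const_mul _)]
  refine integral_mono ((integrable_boltzmann hF hm hs).sub (integrable_boltzmann hF hm ht)).abs
    ((is.sub it).abs.add (it.const_mul _)) fun z => ?_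
  simp only [boltzmann]
  set a := (dysonSum F s z).toReal
  set b := (dysonSum F t z).toReal
  have e : exp (-(2 * s)) * a - exp (-(2 * t)) * b =
      exp (-(2 * s)) * (a - b) + (exp (-(2 * s)) - exp (-(2 * t))) * b := by ring
  rw [e]
  refine (abs_add_le _ _).trans ?_
  rw [abs_mul, abs_mul, abs_of_pos (Real.exp_pos _), abs_of_nonneg toReal_nonneg]
  have : exp (-(2 * s)) ≤ 1 := Real.exp_le_one_iff.2 (by linarith)
  nlinarith [abs_nonneg (a - b)]

end Continuity

/-! ### The collision term of the equation -/

lemma exists_eq_unitVector (v) : ∃ θ, v = unitVector θ := by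
  set w : ℂ := ⟨(v : Plane) 0, (v : Plane) 1⟩
  have hn : ‖w‖ = 1 := by
    have h : ‖w‖ ^ 2 = 1 := by
      rw [Complex.sq_norm, Complex.normSq_apply, ← (velocity_sq v)]
      ring
    nlinarith [norm_nonneg w]
  refine ⟨w.arg, Subtype.ext (plane_ext ?_ ?_)⟩
  · have := Complex.norm_mul_cos_arg w
    rw [hn, one_mul] at this
    simpa [unitVector] using this.symm
  · have := Complex.norm_mul_sin_arg w
    rw [hn, one_mul] at this
    simpa [unitVector] using this.symm

lemma arcLength_eq_map (a) :
    arcLength = ((volume : Measure ℝ).restrict (Ioc a (a + 2 * π))).map unitVector := by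
  refine Measure.ext_of_lintegral _ fun F hF => ?_
  rw [lintegral_arcLength_Ioc hF a, lintegral_map hF continuous_unitVector.measurable]

lemma sin_image_Ioo : sin '' Ioo (π / 2) (π / 2 + π) = Ioo (-1) 1 := by
  ext σ
  constructor
  · rintro ⟨α, hα, rfl⟩
    have hc : cos α < 0 := Real.cos_neg_of_pi_div_two_lt_of_lt hα.1 (by linarith [hα.2])
    have := Real.sin_sq_add_cos_sq α
    constructor <;> nlinarith
  · rintro ⟨h1, h2⟩
    refine ⟨π - Real.arcsin σ, ⟨?_, ?_⟩, ?_⟩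
    · linarith [Real.arcsin_lt_pi_div_two.2 h2]
    · linarith [Real.neg_pi_div_two_lt_arcsin.2 h1]
    · rw [Real.sin_pi_sub, Real.sin_arcsin h1.le h2.le]

lemma cos_neg_iff {α : ℝ} (hα : α ∈ Ioc (π / 2) (π / 2 + 2 * π)) :
    cos α < 0 ↔ α ∈ Ioo (π / 2) (π / 2 + π) := by
  constructor
  · refine fun h => ⟨hα.1, ?_⟩
    by_contra! hle
    have : 0 ≤ cos (α - 2 * π) := Real.cos_nonneg_of_mem_Icc ⟨by linarith, by linarith [hα.2]⟩
    rw [Real.cos_sub_two_pi] at this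
    linarith
  · exact fun h => Real.cos_neg_of_pi_div_two_lt_of_lt h.1 (by linarith [h.2])

lemma sin_injOn : Set.InjOn sin (Ioo (π / 2) (π / 2 + π)) := by
  intro α hα β hβ h
  have h' : sin (π - α) = sin (π - β) := by rw [Real.sin_pi_sub, Real.sin_pi_sub, h]
  have := Real.injOn_sin ⟨by linarith [hα.2], by linarith [hα.1]⟩
    ⟨by linarith [hβ.2], by linarith [hβ.1]⟩ h'
  linarith

lemma unitVector_add_eq (θ α) : (unitVector (θ + α) : Plane) =
    cos α • (unitVector θ : Plane) + sin α • perp (unitVector θ) := by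
  apply plane_ext <;> simp [unitVector, Real.cos_add, Real.sin_add] <;> ring

lemma inner_unitVector_add (θ α) :
    ⟪(unitVector θ : Plane), (unitVector (θ + α) : Plane)⟫ = cos α := by
  rw [inner_eq]
  simp only [unitVector, PiLp.toLp_apply, Matrix.cons_val_zero, Matrix.cons_val_one]
  rw [← Real.cos_sub, ← Real.cos_neg]
  congr 1
  ring

/-- The average over the directions of collision, in terms of the impact parameter. -/
lemma integral_specular {F : Velocity → ℝ} (hF : Measurable F) (v : Velocity) :
    ∫ ω in {ω : Velocity | ⟪(v : Plane), (ω : Plane)⟫ < 0},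
      F (specular (ω : Plane) v) * |⟪(v : Plane), (ω : Plane)⟫| ∂arcLength =
      ∫ σ in Ioo (-1 : ℝ) 1, F (rotVel (turn σ) v) := by
  obtain ⟨θ, rfl⟩ := exists_eq_unitVector v
  set I := Ioo (π / 2) (π / 2 + π) with hI
  set S := {ω : Velocity | ⟪(unitVector θ : Plane), (ω : Plane)⟫ < 0} with hS
  have hin : Measurable fun ω : Velocity => ⟪(unitVector θ : Plane), (ω : Plane)⟫ := by fun_prop
  have hSm : MeasurableSet S := measurableSet_lt hin measurable_const
  set G : Velocity → ℝ := fun ω => F (specular (ω : Plane) (unitVector θ)) *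
    |⟪(unitVector θ : Plane), (ω : Plane)⟫| with hG
  have hGm : Measurable G := by fun_prop
  have e0 : ∀ α ∈ I, G (unitVector (θ + α)) =
      |cos α| • F (rotVel (turn (sin α)) (unitVector θ)) := by
    intro α hα
    have hsp : specular (unitVector (θ + α) : Plane) (unitVector θ) =
        rotVel (turn (sin α)) (unitVector θ) := by
      have h := specular_eq_rotVel one_pos (Real.abs_sin_le_one α) (unitVector θ)
      have hq : -√(1 ^ 2 - sin α ^ 2) = cos α := by
        rw [one_pow, ← Real.abs_cos_eq_sqrt_one_sub_sin_sq, abs_of_neg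
          (Real.cos_neg_of_pi_div_two_lt_of_lt hα.1 (by linarith [hα.2])), neg_neg]
      rw [hq, ← unitVector_add_eq, div_one] at h
      exact h
    simp only [hG]
    rw [hsp, inner_unitVector_add, smul_eq_mul, mul_comm]
  rw [← integral_indicator hSm, arcLength_eq_map (θ + π / 2),
    integral_map continuous_unitVector.measurable.aemeasurable
      ((hGm.indicator hSm).aestronglyMeasurable)]
  have hshift : ∫ x in Ioc (θ + π / 2) (θ + π / 2 + 2 * π), S.indicator G (unitVector x) =
      ∫ α in Ioc (π / 2) (π / 2 + 2 * π), S.indicator G (unitVector (θ + α)) := by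
    have h := (measurePreserving_add_left (volume : Measure ℝ) θ).setIntegral_preimage_emb
      (measurableEmbedding_addLeft θ) (fun x => S.indicator G (unitVector x))
      (Ioc (θ + π / 2) (θ + π / 2 + 2 * π))
    rw [← h]
    congr 2
    ext x; simp [add_assoc]
  rw [hshift]
  have hind : ∀ α ∈ Ioc (π / 2) (π / 2 + 2 * π),
      S.indicator G (unitVector (θ + α)) = I.indicator (fun α => G (unitVector (θ + α))) α := by
    intro α hα
    have hiff : unitVector (θ + α) ∈ S ↔ α ∈ I := by
      rw [hS, mem_ofPred_eq, inner_unitVector_add, cos_neg_iff hα]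
    by_cases h : α ∈ I
    · rw [indicator_of_mem h, indicator_of_mem (hiff.2 h)]
    · rw [indicator_of_notMem h, indicator_of_notMem (mt hiff.1 h)]
  rw [setIntegral_congr_fun measurableSet_Ioc hind, setIntegral_indicator measurableSet_Ioo]
  have hsub : Ioc (π / 2) (π / 2 + 2 * π) ∩ I = I :=
    Set.inter_eq_right.2 fun x hx => ⟨hx.1, by linarith [hx.2, Real.pi_pos]⟩
  rw [hsub, setIntegral_congr_fun measurableSet_Ioo e0, ← sin_image_Ioo,
    integral_image_eq_integral_abs_deriv_smul measurableSet_Ioo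
      (fun x _ => (Real.hasDerivAt_sin x).hasDerivWithinAt) sin_injOn
      fun σ => F (rotVel (turn σ) (unitVector θ))]

lemma collisionOperator_eq {f : Phase → ℝ} (hf : Measurable f) (z) :
    collisionOperator f z = -2 * f z + ∫ σ in Ioo (-1 : ℝ) 1, f (spin σ z) := by
  rw [collisionOperator, integral_specular (F := fun v => f (z.1, v)) (hf.comp (by fun_prop))]
  rfl

/-- The collision term is symmetric, since the collisions with impact parameters `σ` and `-σ` are
inverse to each other. -/
lemma integral_collisionOperator_mul {f ψ : Phase → ℝ} (hfm : Measurable f)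
    (hf : Integrable f 𝔪) (hψ : Continuous ψ) (hC : ∀ z, |ψ z| ≤ C) :
    Integrable (fun z => collisionOperator f z * ψ z) 𝔪 ∧
      ∫ z, collisionOperator f z * ψ z ∂𝔪 = ∫ z, f z * scatter ψ z ∂𝔪 := by
  set μ := (volume : Measure ℝ).restrict (Ioo (-1) 1)
  set H : ℝ × Phase → ℝ := fun p => f (spin p.1 p.2) * ψ p.2 with hH
  have hHm : Measurable H := by fun_prop
  have hneg : MeasurePreserving (Neg.neg : ℝ → ℝ) μ μ := by
    have h := (Measure.measurePreserving_neg (volume : Measure ℝ)).restrict_preimage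
      (measurableSet_Ioo (a := (-1 : ℝ)) (b := 1))
    have e : (Neg.neg : ℝ → ℝ) ⁻¹' Ioo (-1) 1 = Ioo (-1) 1 := by ext x; simp [and_comm, neg_lt]
    rwa [e] at h
  have hΨ : MeasurePreserving (fun p : ℝ × Phase => (-p.1, spin p.1 p.2)) (μ.prod 𝔪) (μ.prod 𝔪) :=
    hneg.skew_product (g := spin) continuous_spin.measurable
      (ae_of_all _ fun σ => (measurePreserving_spin σ).map_eq)
  have hK : ∀ p : ℝ × Phase, H (-p.1, spin p.1 p.2) = f p.2 * ψ (spin p.1 p.2) := fun p => by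
    simp only [hH, spin_neg_spin]
  have hKi : Integrable (fun p : ℝ × Phase => f p.2 * ψ (spin p.1 p.2)) (μ.prod 𝔪) :=
    (hf.comp_snd μ).mul_bdd (c := C) (hψ.comp continuous_spin).aestronglyMeasurable
      (ae_of_all _ fun p => hC _)
  have hHi : Integrable H (μ.prod 𝔪) := by
    rw [← hΨ.integrable_comp hHm.aestronglyMeasurable]
    exact hKi.congr (ae_of_all _ fun p => (hK p).symm)
  have hHK : ∫ p, H p ∂μ.prod 𝔪 = ∫ p, f p.2 * ψ (spin p.1 p.2) ∂μ.prod 𝔪 := by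
    conv_lhs => rw [← hΨ.map_eq]
    rw [integral_map hΨ.measurable.aemeasurable]
    · simp only [hK]
    · rw [hΨ.map_eq]
      fun_prop
  have e1 : ∀ z, collisionOperator f z * ψ z = -2 * (f z * ψ z) + ∫ σ, H (σ, z) ∂μ := fun z => by
    rw [collisionOperator_eq hfm]
    simp only [hH]
    rw [integral_mul_const]
    ring
  have e2 : ∀ z, f z * scatter ψ z = -2 * (f z * ψ z) + ∫ σ, f z * ψ (spin σ z) ∂μ := fun z => by
    rw [integral_const_mul, ← scatter_add_two_mul hψ hC]
    ring
  have i1 : Integrable (fun z => -2 * (f z * ψ z)) 𝔪 :=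
    (hf.mul_bdd (c := C) hψ.aestronglyMeasurable (ae_of_all _ hC)).const_mul _
  have i2 : Integrable (fun z => ∫ σ, H (σ, z) ∂μ) 𝔪 := hHi.integral_prod_right
  simp only [e1, e2]
  refine ⟨i1.add i2, ?_⟩
  rw [integral_add i1 i2, integral_add i1 hKi.integral_prod_right]
  congr 1
  rw [← integral_prod_symm H hHi, hHK, integral_prod_symm _ hKi]

/-! ### The weak form of the equation -/

lemma exists_isTest {ψ : Plane × Plane → ℝ} (hψ : ContDiff ℝ 1 ψ) (hs : HasCompactSupport ψ) :
    ∃ C A L, IsTest C A L fun z => ψ (z.1, z.2) := by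
  obtain ⟨C, hC⟩ := hψ.continuous.bounded_above_of_compact_support hs
  obtain ⟨K, hK⟩ := ContDiff.lipschitzWith_of_hasCompactSupport hs hψ one_ne_zero
  obtain ⟨A, hA⟩ := hs.isBounded.exists_norm_le
  refine ⟨C, A, K, fun z => hC _, fun z hz => ?_, fun z z' => ?_, K.2⟩
  · by_contra hne
    have := norm_fst_le (z.1, (z.2 : Plane))
    exact absurd (this.trans (hA _ (subset_tsupport _ (Function.mem_support.2 hne)))) (not_le.2 hz)
  · rw [← Real.dist_eq]
    exact hK.dist_le_mul _ _

lemma abs_integral_mul_sub_le {u v χ : Phase → ℝ} (hu : Integrable u 𝔪)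
    (hv : Integrable v 𝔪) (hχ : Measurable χ) (hC : ∀ z, |χ z| ≤ C) :
    |∫ z, u z * χ z ∂𝔪 - ∫ z, v z * χ z ∂𝔪| ≤ C * ∫ z, |u z - v z| ∂𝔪 := by
  rw [← integral_sub (hu.mul_bdd hχ.aestronglyMeasurable (ae_of_all _ hC))
    (hv.mul_bdd hχ.aestronglyMeasurable (ae_of_all _ hC)), ← integral_const_mul]
  refine (abs_integral_le_integral_abs).trans (integral_mono_of_nonneg
    (ae_of_all _ fun z => abs_nonneg _) (by fun_prop) (ae_of_all _ fun z => ?_))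
  change |u z * χ z - v z * χ z| ≤ C * |u z - v z|
  rw [← sub_mul, abs_mul, mul_comm]
  exact mul_le_mul_of_nonneg_right (hC z) (abs_nonneg _)

section Weak

variable {F : Phase → ENNReal} {T : ℝ}

lemma IsTest.measurable_scatter {ψ : Phase → ℝ} (hψ : IsTest C A L ψ) : Measurable (scatter ψ) := by
  have h : scatter ψ = fun z => LorentzGas.shortTime 1 ψ z - ψ (freeFlight 1 z) := by
    funext z
    rw [LorentzGas.shortTime]
    ring
  rw [h]
  exact (hψ.shortTime zero_le_one).measurable.sub
    (hψ.measurable.comp (measurePreserving_freeFlight 1).measurable)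

lemma continuousOn_integral_boltzmann_mul (hF : Measurable F)
    (hm : ∫𝔪 F ≠ ⊤) {χ : Phase → ℝ} (hχ : Measurable χ) (hC : ∀ z, |χ z| ≤ C) :
    ContinuousOn (fun s => ∫ z, boltzmann F s z * χ z ∂𝔪) (Set.Ici 0) := by
  intro t ht
  have ht : 0 ≤ t := ht
  rw [ContinuousWithinAt, tendsto_iff_dist_tendsto_zero]
  have h := (tendsto_integral_abs_boltzmann_sub hF hm ht).const_mul C
  rw [mul_zero] at h
  refine squeeze_zero' (.of_forall fun s => dist_nonneg) ?_ h
  filter_upwards [self_mem_nhdsWithin] with s hs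
  rw [Real.dist_eq]
  exact abs_integral_mul_sub_le (integrable_boltzmann hF hm hs) (integrable_boltzmann hF hm ht)
    hχ hC

lemma hasDerivAt_comp_freeFlight {ψ : Plane × Plane → ℝ} (hψ : ContDiff ℝ 1 ψ) (z) :
    HasDerivAt (fun s => ψ ((freeFlight s z).1, (freeFlight s z).2))
      (fderiv ℝ ψ (z.1, z.2) ((z.2 : Plane), 0)) 0 := by
  have h1 : HasDerivAt (fun s => ((freeFlight s z).1, ((freeFlight s z).2 : Plane)))
      ((z.2 : Plane), (0 : Plane)) 0 := by
    refine HasDerivAt.prodMk ?_ (hasDerivAt_const 0 (z.2 : Plane))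
    have := ((hasDerivAt_id (0 : ℝ)).smul_const (z.2 : Plane)).const_add z.1
    simpa [freeFlight] using this
  have h2 : HasFDerivAt ψ (fderiv ℝ ψ (z.1, z.2))
      ((freeFlight 0 z).1, ((freeFlight 0 z).2 : Plane)) := by
    have := (hψ.differentiable one_ne_zero (z.1, (z.2 : Plane))).hasFDerivAt
    simpa [freeFlight] using this
  exact h2.comp_hasDerivAt 0 h1

/-- The transport and scattering operator applied to the test function `ψ`. -/
def generator (ψ : Plane × Plane → ℝ) (z : Phase) : ℝ :=
  fderiv ℝ ψ (z.1, z.2) ((z.2 : Plane), 0) + scatter (fun z => ψ (z.1, z.2)) z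

lemma abs_fderiv_velocity_le {ψ : Plane × Plane → ℝ} (hψ : ContDiff ℝ 1 ψ)
    (ht : IsTest C A L fun z => ψ (z.1, z.2)) (z : Phase) :
    |fderiv ℝ ψ (z.1, z.2) ((z.2 : Plane), 0)| ≤ L := by
  rw [← norm_eq_abs]
  refine (hasDerivAt_comp_freeFlight hψ z).le_of_lip' ht.nonneg (Eventually.of_forall fun s => ?_)
  have h1 := ht.lipschitz (freeFlight s z) (freeFlight 0 z)
  have h2 : dist (freeFlight s z) (freeFlight 0 z) = |s| := by
    rw [Prod.dist_eq]
    simp [freeFlight, dist_eq_norm, norm_smul]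
  rw [h2] at h1
  rw [norm_eq_abs, norm_eq_abs, sub_zero]
  exact h1

@[fun_prop] lemma measurable_fderiv_velocity {ψ : Plane × Plane → ℝ} (hψ : ContDiff ℝ 1 ψ) :
    Measurable fun z : Phase => fderiv ℝ ψ (z.1, z.2) ((z.2 : Plane), 0) := by
  have h : Continuous fun z : Phase => fderiv ℝ ψ (z.1, z.2) ((z.2 : Plane), 0) := by fun_prop
  fun_prop

lemma measurable_generator {ψ : Plane × Plane → ℝ} (hψ : ContDiff ℝ 1 ψ)
    (ht : IsTest C A L fun z => ψ (z.1, z.2)) : Measurable (generator ψ) :=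
  (measurable_fderiv_velocity hψ).add ht.measurable_scatter

lemma abs_generator_le {ψ : Plane × Plane → ℝ} (hψ : ContDiff ℝ 1 ψ)
    (ht : IsTest C A L fun z => ψ (z.1, z.2)) (z) : |generator ψ z| ≤ L + 4 * C :=
  (abs_add_le _ _).trans (add_le_add (abs_fderiv_velocity_le hψ ht z) (ht.abs_scatter_le z))

lemma hasDerivAt_integral_freeFlight {f : Phase → ℝ} (hfm : Measurable f)
    (hf : Integrable f 𝔪) {ψ : Plane × Plane → ℝ}
    (hψ : ContDiff ℝ 1 ψ) (ht : IsTest C A L fun z => ψ (z.1, z.2)) :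
    HasDerivAt (fun s => ∫ z, f z * ψ ((freeFlight s z).1, (freeFlight s z).2) ∂𝔪)
      (∫ z, f z * fderiv ℝ ψ (z.1, z.2) ((z.2 : Plane), 0) ∂𝔪) 0 := by
  have hm : ∀ s, Measurable fun z => f z * ψ ((freeFlight s z).1, (freeFlight s z).2) := fun s =>
    hfm.mul (ht.measurable.comp (measurePreserving_freeFlight s).measurable)
  refine (hasDerivAt_integral_of_dominated_loc_of_lip
    (F' := fun z => f z * fderiv ℝ ψ (z.1, z.2) ((z.2 : Plane), 0)) univ_mem
    (.of_forall fun s => (hm s).aestronglyMeasurable) ?_ ?_ ?_ (hf.abs.mul_const L) ?_).2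
  · exact hf.mul_bdd (ht.measurable.comp
      (measurePreserving_freeFlight 0).measurable).aestronglyMeasurable
      (ae_of_all _ fun z => ht.bound (freeFlight 0 z))
  · fun_prop
  · refine ae_of_all _ fun z => LipschitzOnWith.of_dist_le_mul fun s _ s' _ => ?_
    have h1 := ht.lipschitz (freeFlight s z) (freeFlight s' z)
    have h2 : dist (freeFlight s z) (freeFlight s' z) = dist s s' := by
      rw [Prod.dist_eq]
      simp [freeFlight, dist_eq_norm, ← sub_smul, norm_smul]
    rw [h2] at h1
    rw [Real.coe_nnabs, abs_of_nonneg (mul_nonneg (abs_nonneg _) ht.nonneg), Real.dist_eq,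
      ← mul_sub, abs_mul, mul_assoc]
    exact mul_le_mul_of_nonneg_left h1 (abs_nonneg _)
  · exact ae_of_all _ fun z => (hasDerivAt_comp_freeFlight hψ z).const_mul _

/-- The differential form of the equation. -/
lemma hasDerivWithinAt_integral_boltzmann (hF : Measurable F)
    (hm : ∫𝔪 F ≠ ⊤) (ht : 0 ≤ t) {ψ : Plane × Plane → ℝ}
    (hψ : ContDiff ℝ 1 ψ) (hψt : IsTest C A L fun z => ψ (z.1, z.2)) :
    HasDerivWithinAt (fun s => ∫ z, boltzmann F s z * ψ (z.1, z.2) ∂𝔪)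
      (∫ z, boltzmann F t z * generator ψ z ∂𝔪) (Set.Ici t) t := by
  set m := (∫𝔪 F).toReal
  set f := boltzmann F t
  set Ψ : Phase → ℝ := fun z => ψ (z.1, z.2)
  have hfi := integrable_boltzmann hF hm ht
  have hC0 := hψt.bound_nonneg
  have hm0 : 0 ≤ m := toReal_nonneg
  have hL0 := hψt.nonneg
  set b := ∫ z, f z * scatter Ψ z ∂𝔪 with hb
  set k : ℝ → ℝ := fun s => ∫ z, f z * Ψ (freeFlight (s - t) z) ∂𝔪 + (s - t) * b with hk
  have ib := hfi.mul_bdd hψt.measurable_scatter.aestronglyMeasurable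
      (ae_of_all _ hψt.abs_scatter_le)
  have hkd : HasDerivAt k (∫ z, f z * generator ψ z ∂𝔪) t := by
    have hsub := (hasDerivAt_id t).sub_const t
    have h1 : HasDerivAt (fun s => ∫ z, f z * Ψ (freeFlight (s - t) z) ∂𝔪)
        (∫ z, f z * fderiv ℝ ψ (z.1, z.2) ((z.2 : Plane), 0) ∂𝔪) t := by
      refine HasDerivAt.comp_sub_const (f := fun s => ∫ z, f z * Ψ (freeFlight s z) ∂𝔪) t t ?_
      rw [sub_self]
      exact hasDerivAt_integral_freeFlight (by fun_prop) hfi hψ hψt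
    have e : ∫ z, f z * generator ψ z ∂𝔪 =
        ∫ z, f z * fderiv ℝ ψ (z.1, z.2) ((z.2 : Plane), 0) ∂𝔪 + 1 * b := by
      rw [one_mul, hb, ← integral_add _ ib]
      · simp only [generator, mul_add]
        rfl
      · exact hfi.mul_bdd (measurable_fderiv_velocity hψ).aestronglyMeasurable
          (ae_of_all _ (abs_fderiv_velocity_le hψ hψt))
    rw [e]
    exact h1.add (hsub.mul_const b)
  have hrem : HasDerivWithinAt (fun s => ∫ z, boltzmann F s z * Ψ z ∂𝔪 - k s) 0 (Set.Ici t) t := by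
    have hO : (fun s => ∫ z, boltzmann F s z * Ψ z ∂𝔪 - k s) =O[𝓝[Set.Ici t] t]
        fun s => ‖s - t‖ ^ 2 := by
      refine Asymptotics.IsBigO.of_bound ((6 * L + 16 * C) * m) ?_
      have hnear : ∀ᶠ s in 𝓝[Set.Ici t] t, s < t + 1 / 2 :=
        nhdsWithin_le_nhds (Iio_mem_nhds (by linarith))
      filter_upwards [self_mem_nhdsWithin, hnear] with s hs hs2
      have h := abs_integral_boltzmann_add_sub_le hF hm ht (sub_nonneg.2 hs) (by linarith) hψt
      rw [add_sub_cancel] at h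
      have e : ∫ z, f z * shortTime (s - t) Ψ z ∂𝔪 = k s := by
        simp only [shortTime, mul_add, hk]
        have e2 : ∀ z, f z * ((s - t) * scatter Ψ z) = (s - t) * (f z * scatter Ψ z) :=
          fun z => by ring
        simp only [e2]
        rw [integral_add _ (ib.const_mul _), integral_const_mul]
        exact hfi.mul_bdd (hψt.measurable.comp
          (measurePreserving_freeFlight (s - t)).measurable).aestronglyMeasurable
          (ae_of_all _ fun z => hψt.bound _)
      rw [e] at h
      rw [norm_eq_abs, Real.norm_of_nonneg (by positivity : 0 ≤ ‖s - t‖ ^ 2),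
        norm_eq_abs, sq_abs]
      linarith
    have := (hO.hasFDerivWithinAt Set.self_mem_Ici (by norm_num)).hasDerivWithinAt
    simpa using this
  have := hkd.hasDerivWithinAt.add hrem
  rw [add_zero] at this
  refine this.congr_of_mem (fun s _ => ?_) Set.self_mem_Ici
  simp only [Pi.add_apply]
  ring

lemma integral_boltzmann_mul_sub (hF : Measurable F)
    (hm : ∫𝔪 F ≠ ⊤) (ht : 0 ≤ t) {ψ : Plane × Plane → ℝ}
    (hψ : ContDiff ℝ 1 ψ) (hψt : IsTest C A L fun z => ψ (z.1, z.2)) :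
    ∫ s in (0 : ℝ)..t, ∫ z, boltzmann F s z * generator ψ z ∂𝔪 =
      ∫ z, boltzmann F t z * ψ (z.1, z.2) ∂𝔪 - ∫ z, boltzmann F 0 z * ψ (z.1, z.2) ∂𝔪 := by
  have hsub : Set.uIcc 0 t ⊆ Set.Ici 0 := by
    rw [Set.uIcc_of_le ht]
    exact Set.Icc_subset_Ici_self
  refine intervalIntegral.integral_eq_sub_of_hasDeriv_right
    (f := fun s => ∫ z, boltzmann F s z * ψ (z.1, z.2) ∂𝔪)
    ((continuousOn_integral_boltzmann_mul hF hm hψt.measurable hψt.bound).mono hsub)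
    (fun s hs => ?_) ?_
  · rw [min_eq_left ht] at hs
    exact (hasDerivWithinAt_integral_boltzmann hF hm hs.1.le hψ hψt).mono Set.Ioi_subset_Ici_self
  · exact ((continuousOn_integral_boltzmann_mul hF hm (measurable_generator hψ hψt)
      (abs_generator_le hψ hψt)).mono hsub).intervalIntegrable

/-- The sum over the numbers of collisions solves the linear Boltzmann equation. -/
theorem isBoltzmannSolution_boltzmann {f₀ : Phase → ℝ} (hF : Measurable F)
    (h : (fun z => (F z).toReal) =ᵐ[𝔪] f₀)
    (hm : ∫𝔪 F = 1) (T) : IsBoltzmannSolution f₀ T (boltzmann F) := by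
  have hm' : ∫𝔪 F ≠ ⊤ := by rw [hm]; exact ENNReal.one_ne_top
  have h0 : boltzmann F 0 =ᵐ[𝔪] f₀ := by
    filter_upwards [h] with z hz
    rw [boltzmann_zero hF, hz]
  refine ⟨fun t ht => ⟨integrable_boltzmann hF hm' ht.1,
    ae_of_all _ (boltzmann_nonneg F t), ?_⟩, fun t ht => ?_, h0, fun ψ hψ hs t ht => ?_⟩
  · rw [integral_boltzmann hF hm' ht.1, hm, ENNReal.toReal_one]
  · exact (tendsto_integral_abs_boltzmann_sub hF hm' ht.1).mono_left
      (nhdsWithin_mono _ Set.Icc_subset_Ici_self)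
  · obtain ⟨C, A, L, hψt⟩ := exists_isTest hψ hs
    have e0 : ∫ z, f₀ z * ψ (z.1, z.2) ∂𝔪 = ∫ z, boltzmann F 0 z * ψ (z.1, z.2) ∂𝔪 := by
      refine integral_congr_ae ?_
      filter_upwards [h0] with z hz
      rw [hz]
    have e1 : ∀ s ∈ Set.uIcc 0 t, ∫ z, (boltzmann F s z * fderiv ℝ ψ (z.1, z.2) ((z.2 : Plane), 0) +
        collisionOperator (boltzmann F s) z * ψ (z.1, z.2)) ∂𝔪 =
        ∫ z, boltzmann F s z * generator ψ z ∂𝔪 := by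
      intro s hs
      rw [Set.uIcc_of_le ht.1] at hs
      have hfi := integrable_boltzmann hF hm' hs.1
      have i1 := hfi.mul_bdd (measurable_fderiv_velocity hψ).aestronglyMeasurable
          (ae_of_all _ (abs_fderiv_velocity_le hψ hψt))
      have i2 := hfi.mul_bdd hψt.measurable_scatter.aestronglyMeasurable
          (ae_of_all _ hψt.abs_scatter_le)
      obtain ⟨i3, e⟩ := integral_collisionOperator_mul (by fun_prop) hfi hψt.continuous hψt.bound
      rw [integral_add i1 i3, e, ← integral_add i1 i2]
      simp only [generator, mul_add]
    rw [intervalIntegral.integral_congr e1, integral_boltzmann_mul_sub hF hm' ht.1 hψ hψt, e0]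
    ring

end Weak

/-! ### Convergence for test functions -/

section Monotone

variable {F F₁ : Phase → ENNReal}

lemma dyson_mono (h : ∀ z, F₁ z ≤ F z) (n t z) : dyson F₁ n t z ≤ dyson F n t z := by
  induction n generalizing t z with
  | zero => exact h _
  | succ n ih => exact lintegral_mono fun s => lintegral_mono fun σ => ih _ _

lemma dysonSum_mono (h : ∀ z, F₁ z ≤ F z) (t z) : dysonSum F₁ t z ≤ dysonSum F t z :=
  tsum_le_tsum fun n => dyson_mono h n t z

lemma integral_abs_boltzmann_sub_of_le (hF : Measurable F) (hF₁ : Measurable F₁)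
    (hm : ∫𝔪 F ≠ ⊤) (h : ∀ z, F₁ z ≤ F z) (ht : 0 ≤ t) :
    ∫ z, |boltzmann F t z - boltzmann F₁ t z| ∂𝔪 = (∫𝔪 F).toReal - (∫𝔪 F₁).toReal := by
  have hm1 := ne_top_of_le_ne_top hm (lintegral_mono h)
  rw [← integral_boltzmann hF hm ht, ← integral_boltzmann hF₁ hm1 ht,
    ← integral_sub (integrable_boltzmann hF hm ht) (integrable_boltzmann hF₁ hm1 ht)]
  refine integral_congr_ae ?_
  filter_upwards [dysonSum_lt_top hF hm ht] with z hz
  exact abs_of_nonneg (sub_nonneg.2 (mul_le_mul_of_nonneg_left (ENNReal.toReal_mono hz.ne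
    (dysonSum_mono h t z)) (Real.exp_pos _).le))

/-- Approximation of an initial density by bounded densities with bounded support. -/
lemma exists_bounded_le (hF : Measurable F) (hm : ∫𝔪 F ≠ ⊤) (hδ : 0 < δ) :
    ∃ (R : ℝ) (F₁ : Phase → ENNReal), 0 < R ∧ Measurable F₁ ∧ (∀ z, F₁ z ≤ F z) ∧
      (∀ z, (F₁ z).toReal ≤ R) ∧ (∀ z, z ∉ slab R → F₁ z = 0) ∧
      (∫𝔪 F).toReal - (∫𝔪 F₁).toReal ≤ δ := by
  set S : ℕ → Set Phase := fun n => {z | F z ≤ n} ∩ slab n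
  have hSm : ∀ n, MeasurableSet (S n) := fun n =>
    (measurableSet_le hF measurable_const).inter (measurableSet_slab _)
  have hmono : ∀ n k, n ≤ k → S n ⊆ S k := fun n k hnk z hz =>
    ⟨show F z ≤ (k : ENNReal) from le_trans hz.1 (by exact_mod_cast hnk),
      show ‖z.1‖ ≤ (k : ℝ) from le_trans hz.2 (by exact_mod_cast hnk)⟩
  have hlim : Tendsto (fun n => ∫⁻ z, (S n).indicator F z ∂𝔪) atTop (𝓝 ∫𝔪 F) := by
    refine lintegral_tendsto_of_tendsto_of_monotone (fun n => (hF.indicator (hSm n)).aemeasurable)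
      (ae_of_all _ fun z n k hnk => Set.indicator_le_indicator_of_subset (hmono n k hnk)
        (fun _ => zero_le) z) ?_
    filter_upwards [ae_lt_top hF hm] with z hz
    refine tendsto_const_nhds.congr' ?_
    obtain ⟨n₁, h1⟩ := ENNReal.exists_nat_gt hz.ne
    obtain ⟨n₂, h2⟩ := exists_nat_gt ‖z.1‖
    filter_upwards [eventually_ge_atTop (max n₁ n₂)] with n hn
    refine (indicator_of_mem (hmono _ _ hn ⟨h1.le.trans ?_, h2.le.trans ?_⟩) _).symm
    · exact_mod_cast le_max_left _ _
    · exact_mod_cast le_max_right _ _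
  obtain ⟨n, hn, hn1⟩ := ((((ENNReal.tendsto_toReal hm).comp hlim).eventually_const_lt
    (sub_lt_self _ hδ)).and (eventually_ge_atTop 1)).exists
  refine ⟨n, (S n).indicator F, by exact_mod_cast hn1, hF.indicator (hSm n),
    fun z => Set.indicator_le_self _ _ _, fun z => ?_, fun z hz => ?_, ?_⟩
  · by_cases hz : z ∈ S n
    · rw [indicator_of_mem hz]
      exact ENNReal.toReal_le_of_le_ofReal (by positivity) (hz.1.trans (by simp))
    · rw [indicator_of_notMem hz]
      simp
  · exact indicator_of_notMem (fun h => hz h.2) _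
  · simp only [Function.comp_apply] at hn
    linarith

end Monotone

section Mean

variable {φ : Plane → ℝ} {ψ : Phase → ℝ} {F : Phase → ENNReal}

@[fun_prop] lemma measurable_meanAt (hφ : IsProbDensity volume φ) (ε ν t) (hψ : Measurable ψ) :
    Measurable (meanAt φ ε ν t ψ) := by
  have := isProbabilityMeasure_obstacleLaw hφ
  exact (hψ.comp (measurable_markovLorentz ε ν t)).stronglyMeasurable.integral_prod_left'.measurable

lemma abs_meanAt_le (hφ : IsProbDensity volume φ) (ε ν t) (hC : ∀ z, |ψ z| ≤ C) (z) :
    |meanAt φ ε ν t ψ z| ≤ C := by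
  have := isProbabilityMeasure_obstacleLaw hφ
  simpa [meanAt] using (norm_integral_le_of_norm_le_const (μ := 𝔭 (obstacleLaw φ))
    (f := fun ξ => ψ (markovLorentz ε ν ξ t z)) (ae_of_all _ fun ξ => hC _))

/-- The Markovian Lorentz process is approximated by the linear Boltzmann equation. -/
theorem tendsto_integral_mul_meanAt (hν : ν ∈ Ioo (1 / 2 : ℝ) 1)
    (hφ : IsProbDensity volume φ) (hμ : ∀ᵐ x ∂obstacleLaw φ, ‖x‖ < 1) (hF : Measurable F)
    (hm : ∫𝔪 F ≠ ⊤) (ht : 0 < t) (hψ : IsTest C A L ψ) :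
    Tendsto (fun ε => ∫ z, (F z).toReal * meanAt φ ε ν t ψ z ∂𝔪) (𝓝[>] 0)
      (𝓝 (∫ z, boltzmann F t z * ψ z ∂𝔪)) := by
  have hC0 := hψ.bound_nonneg
  have hL0 := hψ.nonneg
  rw [Metric.tendsto_nhds]
  intro e he
  obtain ⟨R, F₁, hR, hF₁, hle, hbd, hsupp, hδ⟩ := exists_bounded_le hF hm
    (δ := e / (4 * (C + 1))) (by positivity)
  have hm1 := ne_top_of_le_ne_top hm (lintegral_mono hle)
  set m₀ := (∫𝔪 F).toReal
  set m₁ := (∫𝔪 F₁).toReal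
  have hm₁0 : 0 ≤ m₁ := toReal_nonneg
  have i0 := integrable_toReal_of_lintegral_ne_top hF.aemeasurable hm
  have i1 := integrable_toReal_of_lintegral_ne_top hF₁.aemeasurable hm1
  -- constants that control the iterates of the short time approximation up to the time `t`
  set C' := C * exp (5 * t) with hC'
  set L' := L * exp (5 * t) with hL'
  set K := |blockConst C' (A + t) L'|
  set M := (6 * L' + 16 * C') * m₁ with hM
  have hM0 : 0 ≤ M := by positivity
  have htest : ∀ n : ℕ, 0 < n → ∀ k ≤ n, IsTest C' (A + t) L' ((shortTime (t / n))^[k] ψ) := by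
    intro n hn k hk
    have hn' : (0 : ℝ) < n := by exact_mod_cast hn
    have hk' : (k : ℝ) ≤ n := by exact_mod_cast hk
    have hkt : k * (t / n) ≤ t := by
      rw [← mul_div_assoc, div_le_iff₀ hn']
      nlinarith
    have hpow : (1 + 5 * (t / n)) ^ k ≤ exp (5 * t) := by
      calc (1 + 5 * (t / n)) ^ k ≤ (exp (5 * (t / n))) ^ k := by
            refine pow_le_pow_left₀ (by positivity) ?_ k
            rw [add_comm]
            exact Real.add_one_le_exp _
        _ = exp (5 * (k * (t / n))) := by
            rw [← Real.exp_nat_mul]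
            congr 1
            ring
        _ ≤ _ := Real.exp_le_exp.2 (by linarith)
    exact (hψ.iterate_shortTime (by positivity) k).mono (mul_le_mul_of_nonneg_left hpow hC0)
      (by linarith) (mul_le_mul_of_nonneg_left hpow hL0)
  obtain ⟨n, hn⟩ := exists_nat_gt (max (t / (1 / 2)) (t / (e / (8 * (R * t * K + t * M + 1)))))
  have hn0 : (0 : ℝ) < n := lt_of_le_of_lt (le_max_of_le_left (by positivity)) hn
  have hnpos : 0 < n := by exact_mod_cast hn0
  set h := t / n with hh
  have hh0 : 0 < h := div_pos ht hn0
  have hh2 : h ≤ 1 / 2 := by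
    have := (le_max_left _ _).trans_lt hn
    rw [div_lt_comm₀ (by norm_num) hn0] at this
    exact this.le
  have hhe : h ≤ e / (8 * (R * t * K + t * M + 1)) := by
    have := (le_max_right _ _).trans_lt hn
    rw [div_lt_comm₀ (by positivity) hn0] at this
    exact this.le
  have hnh : n * h = t := by rw [hh]; field_simp
  have hsmall : (R * t * K + t * M) * h ≤ e / 8 := by
    rw [le_div_iff₀ (by positivity)] at hhe
    nlinarith
  have hev := eventually_abs_integral_sub_iterate_le hν hφ hμ hh0 (by linarith) hnpos.ne'
    (htest n hnpos) i1 (fun z => by rw [abs_of_nonneg toReal_nonneg]; exact hbd z)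
    (fun z hz => by rw [hsupp z hz, ENNReal.toReal_zero]) (κ := e / (8 * R)) (by positivity)
  rw [hnh] at hev
  have hB := abs_integral_boltzmann_sub_iterate_le hF₁ hm1
    hh0.le hh2 n fun k hk => htest n hnpos k hk.le
  rw [hnh] at hB
  have h01 : ∫ z, |(F z).toReal - (F₁ z).toReal| ∂𝔪 = m₀ - m₁ := by
    have := integral_abs_boltzmann_sub_of_le hF hF₁ hm hle le_rfl
    simpa only [boltzmann_zero hF, boltzmann_zero hF₁] using this
  have h4 : C * (m₀ - m₁) ≤ e / 4 := by
    calc C * (m₀ - m₁) ≤ C * (e / (4 * (C + 1))) := mul_le_mul_of_nonneg_left hδ hC0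
      _ ≤ e / 4 := by
        rw [← mul_div_assoc, div_le_div_iff₀ (by positivity) (by positivity)]
        nlinarith
  have hT := abs_integral_mul_sub_le (integrable_boltzmann hF hm ht.le)
    (integrable_boltzmann hF₁ hm1 ht.le) hψ.measurable hψ.bound
  rw [integral_abs_boltzmann_sub_of_le hF hF₁ hm hle ht.le] at hT
  filter_upwards [hev] with ε hε
  have hS := abs_integral_mul_sub_le i0 i1 (measurable_meanAt hφ ε ν t hψ.measurable)
    (abs_meanAt_le hφ ε ν t hψ.bound)
  rw [h01] at hS
  have hε' : |∫ z, (F₁ z).toReal * meanAt φ ε ν t ψ z ∂𝔪 -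
      ∫ z, (F₁ z).toReal * (shortTime h)^[n] ψ z ∂𝔪| ≤ R * t * K * h + e / 8 := by
    refine hε.trans ?_
    have e1 : R * (n * (blockConst C' (A + t) L' * h ^ 2) + e / (8 * R)) =
        R * t * blockConst C' (A + t) L' * h + e / 8 := by
      rw [← hnh]
      field_simp
    rw [e1]
    have := le_abs_self (blockConst C' (A + t) L')
    gcongr
  have hB' : |∫ z, boltzmann F₁ t z * ψ z ∂𝔪 -
      ∫ z, (F₁ z).toReal * (shortTime h)^[n] ψ z ∂𝔪| ≤ t * M * h := by
    refine hB.trans (le_of_eq ?_)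
    rw [← hnh, hM]
    ring
  rw [Real.dist_eq]
  rw [abs_le] at hS hε' hB' hT
  rw [abs_lt]
  constructor <;> linarith [hS.1, hS.2, hε'.1, hε'.2, hB'.1, hB'.2, hT.1, hT.2]

end Mean

/-! ### Convergence for bounded continuous functions -/

/-- A Lipschitz continuous cutoff function that is `1` for `‖x‖ ≤ A` and `0` for `‖x‖ ≥ A + 1`. -/
def cutoff (A : ℝ) (z : Phase) : ℝ := max 0 (min 1 (A + 1 - ‖z.1‖))

lemma cutoff_nonneg (A z) : 0 ≤ cutoff A z := le_max_left _ _

lemma cutoff_le_one (A z) : cutoff A z ≤ 1 := max_le zero_le_one (min_le_left _ _)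

lemma isTest_mul_cutoff {g : Phase → ℝ} {M : ℝ} (hM : ∀ z, |g z| ≤ M) (hL0 : 0 ≤ L)
    (hL : ∀ z z', |g z - g z'| ≤ L * dist z z') (A) :
    IsTest M (A + 1) (L + M) fun z => g z * cutoff A z := by
  have hM0 : 0 ≤ M := (abs_nonneg _).trans (hM (0, unitVector 0))
  have hlip : ∀ z z', |cutoff A z - cutoff A z'| ≤ dist z z' := fun z z' => by
    calc |cutoff A z - cutoff A z'| ≤ |min 1 (A + 1 - ‖z.1‖) - min 1 (A + 1 - ‖z'.1‖)| := by
          unfold cutoff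
          simpa using (abs_max_sub_max_le_max (0 : ℝ) (min 1 (A + 1 - ‖z.1‖)) 0 (min 1 (A + 1 -
            ‖z'.1‖)))
      _ ≤ |(A + 1 - ‖z.1‖) - (A + 1 - ‖z'.1‖)| := by
          simpa using (abs_min_sub_min_le_max (1 : ℝ) (A + 1 - ‖z.1‖) 1 (A + 1 - ‖z'.1‖))
      _ = |‖z'.1‖ - ‖z.1‖| := by congr 1; ring
      _ ≤ ‖z'.1 - z.1‖ := abs_norm_sub_norm_le _ _
      _ ≤ dist z z' := by
          rw [← dist_eq_norm, dist_comm, Prod.dist_eq]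
          exact le_max_left _ _
  refine ⟨fun z => ?_, fun z hz => ?_, fun z z' => ?_, by positivity⟩
  · rw [abs_mul, abs_of_nonneg (cutoff_nonneg A z)]
    have := mul_le_mul (hM z) (cutoff_le_one A z) (cutoff_nonneg A z) hM0
    linarith
  · have : cutoff A z = 0 := max_eq_left ((min_le_right _ _).trans (by linarith))
    rw [this, mul_zero]
  · have e : g z * cutoff A z - g z' * cutoff A z' =
        (g z - g z') * cutoff A z + g z' * (cutoff A z - cutoff A z') := by ring
    rw [e]
    refine (abs_add_le _ _).trans ?_
    rw [abs_mul, abs_mul, abs_of_nonneg (cutoff_nonneg A z), add_mul]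
    refine add_le_add ?_ (mul_le_mul (hM z') (hlip z z') (abs_nonneg _) hM0)
    exact (mul_le_of_le_one_right (abs_nonneg _) (cutoff_le_one A z)).trans (hL z z')

lemma isTest_cutoff (A) : IsTest 1 (A + 1) 1 (cutoff A) := by
  have := isTest_mul_cutoff (g := fun _ => 1) (M := 1) (L := 0) (by simp) le_rfl (by simp) A
  simpa using this

lemma tendsto_cutoff (z) : Tendsto (fun n : ℕ => cutoff n z) atTop (𝓝 1) := by
  obtain ⟨k, hk⟩ := exists_nat_gt ‖z.1‖
  refine tendsto_const_nhds.congr' ?_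
  filter_upwards [eventually_ge_atTop k] with n hn
  have : (k : ℝ) ≤ n := by exact_mod_cast hn
  rw [cutoff, min_eq_left (by linarith), max_eq_right zero_le_one]

/-- If the limit is a probability measure, it is enough to consider Lipschitz continuous test
functions with bounded support, since no mass can escape to infinity. -/
lemma tendsto_of_forall_isTest {γ : Type*} {l : Filter γ} [l.IsCountablyGenerated]
    {μs : γ → ProbabilityMeasure Phase} {μ : ProbabilityMeasure Phase}
    (h : ∀ C A L ψ, IsTest C A L ψ →
      Tendsto (fun i => ∫ z, ψ z ∂(μs i : Measure Phase)) l (𝓝 (∫ z, ψ z ∂(μ : Measure Phase)))) :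
    Tendsto μs l (𝓝 μ) := by
  rw [tendsto_iff_forall_lipschitz_integral_tendsto]
  rintro g ⟨D, hD⟩ ⟨L, hL⟩
  set z₀ : Phase := (0, unitVector 0)
  set M := |g z₀| + D
  have hM : ∀ z, |g z| ≤ M := fun z => by
    have h1 := hD z z₀
    rw [Real.dist_eq] at h1
    have h2 := abs_sub_abs_le_abs_sub (g z) (g z₀)
    linarith
  have hM0 : 0 ≤ M := (abs_nonneg _).trans (hM z₀)
  have hgm : Measurable g := hL.continuous.measurable
  have hlip : ∀ z z', |g z - g z'| ≤ L * dist z z' := fun z z' => by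
    rw [← Real.dist_eq]; exact hL.dist_le_mul z z'
  -- the cutoff changes integrals by the mass that it removes
  have hcut : ∀ (ρ : ProbabilityMeasure Phase) (n : ℕ),
      |∫ z, g z ∂(ρ : Measure Phase) - ∫ z, g z * cutoff n z ∂(ρ : Measure Phase)| ≤
        M * (1 - ∫ z, cutoff n z ∂(ρ : Measure Phase)) := by
    intro ρ n
    have hcm := (isTest_cutoff n).measurable
    have ig : Integrable g (ρ : Measure Phase) :=
      Integrable.of_bound hgm.aestronglyMeasurable M (ae_of_all _ hM)
    have ic : Integrable (cutoff n) (ρ : Measure Phase) :=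
      Integrable.of_bound hcm.aestronglyMeasurable 1 (ae_of_all _ (isTest_cutoff n).bound)
    have igc : Integrable (fun z => g z * cutoff n z) (ρ : Measure Phase) :=
      Integrable.of_bound (hgm.mul hcm).aestronglyMeasurable M
        (ae_of_all _ (isTest_mul_cutoff hM L.2 hlip n).bound)
    have e1 : 1 - ∫ z, cutoff n z ∂(ρ : Measure Phase) =
        ∫ z, (1 - cutoff n z) ∂(ρ : Measure Phase) := by
      rw [integral_sub (integrable_const _) ic]
      simp
    have i1 : Integrable (fun z => 1 - cutoff n z) (ρ : Measure Phase) :=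
      (integrable_const _).sub ic
    rw [← integral_sub ig igc, e1, ← integral_const_mul]
    refine abs_integral_le_integral_abs.trans (integral_mono_of_nonneg
      (ae_of_all _ fun z => abs_nonneg _) (i1.const_mul M) (ae_of_all _ fun z => ?_))
    change |g z - g z * cutoff n z| ≤ M * (1 - cutoff n z)
    have h1 : 0 ≤ 1 - cutoff n z := sub_nonneg.2 (cutoff_le_one _ z)
    have e : g z - g z * cutoff n z = g z * (1 - cutoff n z) := by ring
    rw [e, abs_mul, abs_of_nonneg h1]
    exact mul_le_mul_of_nonneg_right (hM z) h1
  have hmass : Tendsto (fun n : ℕ => ∫ z, cutoff n z ∂(μ : Measure Phase)) atTop (𝓝 1) := by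
    have := tendsto_integral_of_dominated_convergence (μ := (μ : Measure Phase))
      (F := fun (n : ℕ) z => cutoff n z) (f := fun _ => 1) (fun _ => 1)
      (fun n => (isTest_cutoff n).measurable.aestronglyMeasurable) (integrable_const _)
      (fun n => ae_of_all _ (isTest_cutoff n).bound) (ae_of_all _ tendsto_cutoff)
    simpa using this
  rw [Metric.tendsto_nhds]
  intro e he
  obtain ⟨n, hn⟩ := (hmass.eventually_const_lt
    (show 1 - e / (4 * (M + 1)) < 1 by linarith [show 0 < e / (4 * (M + 1)) by positivity])).exists
  have h2 := Metric.tendsto_nhds.1 (h _ _ _ _ (isTest_mul_cutoff hM L.2 hlip n)) (e / 4)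
    (by positivity)
  have hMe : M * (e / (4 * (M + 1))) ≤ e / 4 := by
    rw [← mul_div_assoc, div_le_div_iff₀ (by positivity) (by positivity)]
    nlinarith
  filter_upwards [(h _ _ _ _ (isTest_cutoff n)).eventually_const_lt hn, h2] with i hi1 hi2
  have c1 := (hcut (μs i) n).trans (mul_le_mul_of_nonneg_left
    (show _ ≤ e / (4 * (M + 1)) by linarith) hM0)
  have c2 := (hcut μ n).trans (mul_le_mul_of_nonneg_left
    (show _ ≤ e / (4 * (M + 1)) by linarith) hM0)
  rw [Real.dist_eq] at hi2 ⊢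
  rw [abs_le] at c1 c2
  rw [abs_lt] at hi2 ⊢
  constructor <;> linarith [c1.1, c1.2, c2.1, c2.2, hi2.1, hi2.2]

section Limit

variable {φ : Plane → ℝ} {F : Phase → ENNReal}

lemma integral_mul_meanAt_zero (hφ : IsProbDensity volume φ) (hμ : ∀ᵐ x ∂obstacleLaw φ, ‖x‖ < 1)
    (hε : 0 < ε) (hg : 0 < gap ε ν) (u g : Phase → ℝ) :
    ∫ z, u z * meanAt φ ε ν 0 g z ∂𝔪 = ∫ z, u z * g z ∂𝔪 := by
  have := isProbabilityMeasure_obstacleLaw hφ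
  refine integral_congr_ae ?_
  filter_upwards [markovLorentz_zero_ae hμ hε hg] with z hz
  have e : meanAt φ ε ν 0 g z = g z := by
    rw [meanAt, integral_congr_ae (by filter_upwards [hz] with ξ hξ; rw [hξ])]
    simp
  rw [e]

theorem tendsto_integral_mul_meanAt_of_continuous (hν : ν ∈ Ioo (1 / 2 : ℝ) 1)
    (hφ : IsProbDensity volume φ) (hμ : ∀ᵐ x ∂obstacleLaw φ, ‖x‖ < 1) (hF : Measurable F)
    (hm : ∫𝔪 F = 1) (ht : 0 < t) (g : Phase →ᵇ ℝ) :
    Tendsto (fun ε => ∫ z, (F z).toReal * meanAt φ ε ν t g z ∂𝔪) (𝓝[>] 0)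
      (𝓝 (∫ z, boltzmann F t z * g z ∂𝔪)) := by
  have hm' : ∫𝔪 F ≠ ⊤ := by rw [hm]; exact ENNReal.one_ne_top
  have hbm := (measurable_boltzmann hF t).ennreal_ofReal
  have hb1 : ∫⁻ z, ofReal (boltzmann F t z) ∂𝔪 = 1 := by
    rw [← ofReal_integral_eq_lintegral_ofReal (integrable_boltzmann hF hm' ht.le)
      (ae_of_all _ (boltzmann_nonneg F t)), integral_boltzmann hF hm' ht.le, hm]
    simp
  set β := phaseMeasure.withDensity fun z => ofReal (boltzmann F t z)
  have hlim : ∀ g : Phase → ℝ, ∫ z, g z ∂β = ∫ z, boltzmann F t z * g z ∂𝔪 := fun g => by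
    rw [integral_withDensity_mul hbm (by rw [hb1]; exact ENNReal.one_ne_top)]
    simp only [toReal_ofReal (boltzmann_nonneg F t _)]
  let μs : ℝ → ProbabilityMeasure Phase := fun ε =>
    ⟨processLaw φ F ε ν t, isProbabilityMeasure_processLaw hφ hm ε ν t⟩
  let μ : ProbabilityMeasure Phase := ⟨β, isProbabilityMeasure_withDensity hb1⟩
  have hconv : Tendsto μs (𝓝[>] 0) (𝓝 μ) := by
    refine tendsto_of_forall_isTest fun C A L ψ hψ => ?_
    change Tendsto (fun ε => ∫ z, ψ z ∂(processLaw φ F ε ν t)) _ (𝓝 (∫ z, ψ z ∂β))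
    rw [hlim]
    simp only [integral_processLaw hφ hF hm _ ν t hψ.measurable hψ.bound]
    exact tendsto_integral_mul_meanAt hν hφ hμ hF hm' ht hψ
  have h := ProbabilityMeasure.tendsto_iff_forall_integral_tendsto.1 hconv g
  change Tendsto (fun ε => ∫ z, g z ∂(processLaw φ F ε ν t)) _ (𝓝 (∫ z, g z ∂β)) at h
  rw [hlim] at h
  simpa only [integral_processLaw hφ hF hm _ ν t g.continuous.measurable g.norm_coe_le_norm] using h

end Limit

end LorentzGas

end

theorem theorem2
    -- the law of the obstacle positions
    (ν : ℝ) (hν : ν ∈ Set.Ioo (1 / 2 : ℝ) 1)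
    (φ : LorentzGas.Plane → ℝ) (hφ : LorentzGas.IsProbDensity volume φ)
    (hφ_radial : ∀ x y : LorentzGas.Plane, ‖x‖ = ‖y‖ → φ x = φ y)
    (hφ_supp : ∀ x : LorentzGas.Plane, 1 ≤ ‖x‖ → φ x = 0)
    -- independent obstacle positions with density `φ`, one for each visit to an obstacle range
    {Ω : Type*} [MeasurableSpace Ω] (P : Measure Ω) [IsProbabilityMeasure P]
    (ξ : ℕ → Ω → LorentzGas.Plane) (hξ_meas : ∀ k, Measurable (ξ k))
    (hξ_law : ∀ k, P.map (ξ k) = volume.withDensity (fun x => ENNReal.ofReal (φ x)))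
    (hξ_indep : iIndepFun ξ P)
    (T : ℝ) (hT : 0 < T)
    (f₀ : LorentzGas.Phase → ℝ) (hf₀ : LorentzGas.IsProbDensity LorentzGas.phaseMeasure f₀) :
    -- as soon as the obstacle ranges are disjoint, the transported density exists and is unique
    (∀ ε : ℝ, 0 < ε → 2 * LorentzGas.rangeRadius ε ν < Real.sqrt ε → ∀ t ∈ Set.Icc 0 T,
      ∃ F : LorentzGas.Phase → ℝ, LorentzGas.IsTransported P ξ ε ν f₀ t F ∧
        ∀ G : LorentzGas.Phase → ℝ, LorentzGas.IsTransported P ξ ε ν f₀ t G →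
          G =ᵐ[LorentzGas.phaseMeasure] F) ∧
    -- and it converges to the solution of the linear Boltzmann equation
    ∃ f : ℝ → LorentzGas.Phase → ℝ, LorentzGas.IsBoltzmannSolution f₀ T f ∧
      ∀ t ∈ Set.Icc 0 T, ∀ F : ℝ → LorentzGas.Phase → ℝ,
        (∀ᶠ ε in 𝓝[>] 0, LorentzGas.IsTransported P ξ ε ν f₀ t (F ε)) →
          ∀ g : LorentzGas.Phase →ᵇ ℝ,
            Tendsto (fun ε => ∫ z, F ε z * g z ∂LorentzGas.phaseMeasure) (𝓝[>] 0)
              (𝓝 (∫ z, f t z * g z ∂LorentzGas.phaseMeasure)) := by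
  have hμ := LorentzGas.obstacleLaw_norm_lt hφ hφ_supp
  refine ⟨fun ε hε hg t ht => ?_, ?_⟩
  · obtain ⟨F, hF⟩ := LorentzGas.exists_isTransported hφ hφ_supp hξ_meas hξ_law hξ_indep hf₀ hε
      (sub_pos.2 hg) ht.1
    exact ⟨F, hF, fun G hG => LorentzGas.isTransported_unique hF hG⟩
  obtain ⟨F₀, hF₀, hF₀f, hm⟩ := LorentzGas.exists_measurable_density hf₀
  have hsol := LorentzGas.isBoltzmannSolution_boltzmann hF₀ hF₀f hm T
  refine ⟨LorentzGas.boltzmann F₀, hsol, fun t ht F hF g => ?_⟩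
  -- the transported density is an expectation that only involves the law of the obstacles
  have hmean : ∀ᶠ ε in 𝓝[>] (0 : ℝ),
      ∫ z, (F₀ z).toReal * LorentzGas.meanAt φ ε ν t g z ∂LorentzGas.phaseMeasure =
        ∫ z, F ε z * g z ∂LorentzGas.phaseMeasure := by
    filter_upwards [hF] with ε h
    rw [h.2 g]
    refine integral_congr_ae ?_
    filter_upwards [hF₀f] with z hz
    rw [← hz, LorentzGas.integral_comp_obstacles hφ hξ_meas hξ_law hξ_indep
      (LorentzGas.measurable_comp_markovLorentz ε ν t z g.continuous.measurable)]
    rfl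
  refine Tendsto.congr' hmean ?_
  rcases ht.1.eq_or_lt with rfl | ht0
  · refine tendsto_const_nhds.congr' ?_
    filter_upwards [LorentzGas.eventually_rangeRadius_le hν.2 (show (0 : ℝ) < 1 / 4 by norm_num),
      self_mem_nhdsWithin] with ε hε hε0
    have hs := Real.sqrt_pos.2 hε0
    rw [LorentzGas.integral_mul_meanAt_zero hφ hμ hε0 (by rw [LorentzGas.gap]; linarith)]
    simp only [LorentzGas.boltzmann_zero hF₀]
  · exact LorentzGas.tendsto_integral_mul_meanAt_of_continuous hν hφ hμ hF₀ hm ht0 g
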